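/- Proposition 5.1. Let $\mathbb T=\mathbb R/2\pi\mathbb Z$. Fix the gravity $g>0$ and the depth $b>0$ (both finite), let $G(0)=|D_x|\tanh(b|D_x|)$, and let $L=\big((g-\partial_x^2)G(0)\big)^{1/2}$, that is, the Fourier multiplier with symbol $\ell(k)=\big((g+k^2)\,|k|\tanh(b|k|)\big)^{1/2}$. For a space $X$ of functions or of operators, $\|\cdot\|_{T,X}$ is the norm $\sup_{t\in[0,T]}\|\cdot\|_X$ of $C^0([0,T];X)$ (and $\|f\|_{T,X}=\infty$ if $f(t)\notin X$ for some $t$). $L^2(\mathbb T)$ consists of complex-valued functions and $\mathcal L(L^2)$ of bounded real-linear operators on it. A time-dependent operator $R$ with $R(t)\in\mathcal L(L^2)$ is said to map $C^0([0,T];L^2)$ into itself if $t\mapsto R(t)u(t)$ is in $C^0([0,T];L^2)$ for all $u\in C^0([0,T];L^2)$. There exist constants $\delta_0\in(0,1)$, $r\ge 2$, $C>0$ (depending only on $g,b$) such that the following holds for every $T>0$. Let $c,V$ be real-valued functions on $[0,T]\times\mathbb T$ with $c-1\in C^0([0,T];H^r)$ and $\partial_t c,\ V\in C^0([0,T];H^1)$,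 let $R_2(t)\in\mathcal L(L^2)$ map $C^0([0,T];L^2)$ into itself, and assume $$\|c-1\|_{T,L^\infty}<\delta_0,\qquad \mathcal N_0:=\|c-1\|_{T,H^r}+\|V\|_{T,H^1}+\|\partial_t c\|_{T,H^1}+\|R_2\|_{T,\mathcal L(L^2)}\le 1 .$$ Let $\widetilde P=\partial_t+V\partial_x+iL^{1/2}(cL^{1/2}\,\cdot)+R_2$. Then there exist $T_1>0$, a bounded invertible complex-linear map $\Phi:C^0([0,T];L^2)\to C^0([0,T_1];L^2)$ with bounded inverse, a function $m(t)$ on $[0,T]$, a real-valued function $W(t,x)$ on $[0,T_1]\times\mathbb T$ and operators $R_3(t)\in\mathcal L(L^2)$, $t\in[0,T_1]$, such that, with $\widetilde P_3=\partial_t+W\partial_x+iL+R_3$, $$\widetilde P u=m\,\Phi^{-1}\big(\widetilde P_3(\Phi u)\big),$$ in the following sense: for all $u\in C^0([0,T];L^2)$ and $h\in C^0([0,T_1];L^2)$, one has $\widetilde P_3(\Phi u)=h$ in the sense of distributions if and only if $\widetilde P u=m\,\Phi^{-1}h$ in the sense of distributions. Moreover: 1. $W\in C^0([0,T_1];H^1)$,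 $\int_{\mathbb T}W(t,x)\,dx=0$ for all $t$, $W\in C^0([0,T_1];H^2)$ if $V\in C^0([0,T];H^2)$, and $$\|W\|_{T_1,H^2}\le C\big(\|c-1\|_{T,H^2}+\|V\|_{T,H^2}+\|\partial_t c\|_{T,H^1}\big).$$ 2. $R_3$ maps $C^0([0,T_1];L^2)$ into itself and $\|R_3\|_{T_1,\mathcal L(L^2)}\le C\,\mathcal N_0$; if $R_2(t)$ is complex-linear for all $t$, so is $R_3(t)$ for all $t$. 3. $\big|\tfrac{T_1}{T}-1\big|+\|m-1\|_{C^0([0,T])}\le C\,\|c-1\|_{T,L^\infty}$. 4. $\Phi=\varphi_*^{-1}\psi_*^{-1}\Psi_1$, where $$(\Psi_1h)(t,x)=(1+\partial_x\tilde\beta_1(t,x))^{1/2}\,h(t,x+\tilde\beta_1(t,x)),\quad (\psi_*^{-1}h)(t,x)=h(\psi^{-1}(t),x),\quad (\varphi_*^{-1}h)(t,x)=h(t,x-p(t)).$$ Here $\tilde\beta_1$ is real-valued, $\tilde\beta_1$ and $\partial_x\tilde\beta_1$ are continuous on $[0,T]\times\mathbb T$ and $|\partial_x\tilde\beta_1|\le\frac12$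 (so that $x\mapsto x+\tilde\beta_1(t,x)$ is a diffeomorphism of $\mathbb T$); $\psi:[0,T]\to[0,T_1]$ is a $C^1$ diffeomorphism with $\psi(0)=0$, $\psi(T)=T_1$, $\psi'=m>0$; and $p\in C^1([0,T_1];\mathbb R)$. These transformations preserve the $L^2(dx)$ scalar product: $\langle(\Phi u)(t),(\Phi v)(t)\rangle=\langle u(\psi^{-1}(t)),v(\psi^{-1}(t))\rangle$ for $t\in[0,T_1]$. -/

import Mathlib

open MeasureTheory Set Filter Topology
open scoped ENNReal

noncomputable section

namespace WaterWave

instance instFactTwoPiPos : Fact (0 < 2 * Real.pi) := ⟨Real.two_pi_pos⟩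

/-- The torus `ℝ / 2πℤ`. -/
abbrev Torus : Type := AddCircle (2 * Real.pi)

/-- The normalized Lebesgue measure `dx / 2π` on the torus. -/
abbrev dx : Measure Torus := AddCircle.haarAddCircle

/-- The space `L²` of complex valued functions on the torus. -/
abbrev L2 : Type := Lp ℂ 2 dx

/-- The space `C⁰([0,T]; L²)` with the sup norm. -/
abbrev C0L2 (T : ℝ) : Type := C(Icc (0 : ℝ) T, L2)

/-- An element of `C⁰([0,T]; L²)` as a function of real time; only its values on `[0,T]` matter. -/
def atTime {T : ℝ} (u : C0L2 T) (t : ℝ) : L2 :=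
  if h : t ∈ Icc (0 : ℝ) T then u ⟨t, h⟩ else 0

/-! ### Sobolev spaces of real valued functions of `x`, depending on time -/

/-- Fourier coefficients `(2π)⁻¹ ∫ f(x) e^{-ikx} dx` of a real valued function. -/
def realCoeff (f : Torus → ℝ) (k : ℤ) : ℂ := fourierCoeff (fun x => (f x : ℂ)) k

/-- Fourier coefficients of an element of `L²`. -/
def coeff (u : L2) (k : ℤ) : ℂ := fourierCoeff (u : Torus → ℂ) k

/-- `‖f‖_{H^s} = (∑ₖ (1 + k²)^s |f̂(k)|²)^{1/2}`, possibly infinite (for `f` in `L²`). -/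
def sobolevNorm (s : ℝ) (f : Torus → ℝ) : ℝ≥0∞ :=
  (∑' k : ℤ, ENNReal.ofReal ((1 + (k : ℝ) ^ 2) ^ s) * ‖realCoeff f k‖ₑ ^ 2) ^ (1 / 2 : ℝ)

/-- `f ∈ C⁰([0,T]; H^s)`, for `s ≥ 0`. -/
def ContH (T s : ℝ) (f : ℝ → Torus → ℝ) : Prop :=
  (∀ t ∈ Icc 0 T, MemLp (f t) 2 dx ∧ sobolevNorm s (f t) < ⊤) ∧
  ∀ t ∈ Icc 0 T, Tendsto (fun τ => sobolevNorm s (fun x => f τ x - f t x))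
    (𝓝[Icc 0 T] t) (𝓝 0)

/-- The norm of `C⁰([0,T]; H^s)`. -/
def normH (T s : ℝ) (f : ℝ → Torus → ℝ) : ℝ≥0∞ := ⨆ t ∈ Icc 0 T, sobolevNorm s (f t)

/-- The norm of `C⁰([0,T]; L^∞)`. -/
def normLinfty (T : ℝ) (f : ℝ → Torus → ℝ) : ℝ≥0∞ := ⨆ t ∈ Icc 0 T, eLpNorm (f t) ⊤ dx

/-- The norm of `C⁰([0,T])`. -/
def normC0 (T : ℝ) (m : ℝ → ℝ) : ℝ≥0∞ := ⨆ t ∈ Icc 0 T, ‖m t‖ₑ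

/-- `f' = ∂_t f` on `[0,T]`, in the sense of distributions in `x`. -/
def IsTimeDeriv (T : ℝ) (f f' : ℝ → Torus → ℝ) : Prop :=
  ∀ t ∈ Icc 0 T, ∀ k : ℤ,
    HasDerivWithinAt (fun τ => realCoeff (f τ) k) (realCoeff (f' t) k) (Icc 0 T) t

/-! ### Time dependent operators of order zero -/

/-- The family `R(t)` of bounded operators maps `C⁰([0,T]; L²)` into itself,
by `(R u)(t) = R(t) u(t)`. -/
def MapsC0L2 (T : ℝ) (R : ℝ → L2 →L[ℝ] L2) : Prop :=
  ∀ u : ℝ → L2, ContinuousOn u (Icc 0 T) → ContinuousOn (fun t => R t (u t)) (Icc 0 T)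

/-- `sup_{t ∈ [0,T]} ‖R(t)‖_{𝓛(L²)}`. -/
def normOp (T : ℝ) (R : ℝ → L2 →L[ℝ] L2) : ℝ≥0∞ := ⨆ t ∈ Icc 0 T, ‖R t‖ₑ

/-- `R(t)` commutes with the multiplication by `i`, that is, is complex linear. -/
def IsComplexLinear (T : ℝ) (R : ℝ → L2 →L[ℝ] L2) : Prop :=
  ∀ t ∈ Icc 0 T, ∀ v : L2, R t (Complex.I • v) = Complex.I • R t v

/-! ### The equations

A periodic distribution is represented by the sequence of its Fourier coefficients. -/

/-- The symbol `ℓ(k) = ((g + k²) |k| tanh (b |k|))^{1/2}` of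
`L = ((g - ∂ₓ²) G(0))^{1/2}`, where `G(0) = |Dₓ| tanh (b |Dₓ|)`. -/
def symbolL (g b : ℝ) (k : ℤ) : ℝ :=
  Real.sqrt ((g + (k : ℝ) ^ 2) * (|(k : ℝ)| * Real.tanh (b * |(k : ℝ)|)))

/-- The operator `L`. -/
def opL (g b : ℝ) (v : ℤ → ℂ) : ℤ → ℂ := fun k => (symbolL g b k : ℂ) * v k

/-- The operator `L^{1/2}`. -/
def opLhalf (g b : ℝ) (v : ℤ → ℂ) : ℤ → ℂ := fun k => (Real.sqrt (symbolL g b k) : ℂ) * v k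

/-- The operator `∂ₓ`. -/
def opDx (v : ℤ → ℂ) : ℤ → ℂ := fun k => Complex.I * (k : ℂ) * v k

/-- Multiplication of a distribution by a function `a`. The series converges absolutely
for `v` in `H^{-s}` and `a` in `H^s`, in particular in all the uses below. -/
def opMul (a : Torus → ℝ) (v : ℤ → ℂ) : ℤ → ℂ := fun k => ∑' j : ℤ, realCoeff a (k - j) * v j

/-- `∂_t u + A = f` on `[0,T]`, in the sense of distributions in `x`, where
`A t` is the sequence of Fourier coefficients of a distribution. -/
def TimeEq {T : ℝ} (u : C0L2 T) (A : ℝ → ℤ → ℂ) (f : C0L2 T) : Prop :=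
  ∀ t ∈ Icc 0 T, ∀ k : ℤ,
    HasDerivWithinAt (fun τ => coeff (atTime u τ) k) (coeff (atTime f t) k - A t k) (Icc 0 T) t

/-- `P̃ u = f`, where `P̃ = ∂_t + V ∂ₓ + i L^{1/2} (c L^{1/2} ·) + R₂`. -/
def EqP (g b : ℝ) {T : ℝ} (c V : ℝ → Torus → ℝ) (R₂ : ℝ → L2 →L[ℝ] L2) (u f : C0L2 T) : Prop :=
  TimeEq u (fun t k =>
    opMul (V t) (opDx (coeff (atTime u t))) k
      + Complex.I * opLhalf g b (opMul (c t) (opLhalf g b (coeff (atTime u t)))) k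
      + coeff (R₂ t (atTime u t)) k) f

/-- `P̃₃ u = f`, where `P̃₃ = ∂_t + W ∂ₓ + i L + R₃`. -/
def EqP3 (g b : ℝ) {T : ℝ} (W : ℝ → Torus → ℝ) (R₃ : ℝ → L2 →L[ℝ] L2) (u f : C0L2 T) : Prop :=
  TimeEq u (fun t k =>
    opMul (W t) (opDx (coeff (atTime u t))) k
      + Complex.I * opL g b (coeff (atTime u t)) k
      + coeff (R₃ t (atTime u t)) k) f

/-! ### The changes of variables -/

/-- `∂ₓ β`, for a function on the torus. -/
def dX (β : Torus → ℝ) (x : Torus) : ℝ := deriv (fun s : ℝ => β (x + (s : Torus))) 0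

/-- For every `t` in `[0,T]`, `x ↦ x + β(t,x)` is a `C¹` change of variables of the torus, with
`|∂ₓ β| ≤ 1/2`, depending continuously on time. -/
def IsSpaceDiffeo (T : ℝ) (β : ℝ → Torus → ℝ) : Prop :=
  ContinuousOn (fun q : ℝ × Torus => β q.1 q.2) (Icc 0 T ×ˢ univ) ∧
  ContinuousOn (fun q : ℝ × Torus => dX (β q.1) q.2) (Icc 0 T ×ˢ univ) ∧
  ∀ t ∈ Icc 0 T, ∀ x : Torus,
    DifferentiableAt ℝ (fun s : ℝ => β t (x + (s : Torus))) 0 ∧ |dX (β t) x| ≤ 1 / 2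

/-- `(Ψ₁ h)(t,x) = (1 + ∂ₓ β(t,x))^{1/2} h(t, x + β(t,x))`. -/
def spaceChange (β : ℝ → Torus → ℝ) (h : ℝ → Torus → ℂ) : ℝ → Torus → ℂ :=
  fun t x => (Real.sqrt (1 + dX (β t) x) : ℂ) * h t (x + (β t x : Torus))

/-- `(ψ_*⁻¹ h)(t,x) = h(ψ⁻¹(t), x)`. -/
def timeChange (ψinv : ℝ → ℝ) (h : ℝ → Torus → ℂ) : ℝ → Torus → ℂ := fun t x => h (ψinv t) x

/-- `(φ_*⁻¹ h)(t,x) = h(t, x - p(t))`. -/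
def translation (p : ℝ → ℝ) (h : ℝ → Torus → ℂ) : ℝ → Torus → ℂ :=
  fun t x => h t (x - (p t : Torus))

/-- `ψ : [0,T] → [0,T₁]` is an increasing `C¹` diffeomorphism with inverse `ψinv` and
derivative `m > 0`. -/
def IsTimeDiffeo (T T₁ : ℝ) (ψ ψinv m : ℝ → ℝ) : Prop :=
  ψ 0 = 0 ∧ ψ T = T₁ ∧
  MapsTo ψ (Icc 0 T) (Icc 0 T₁) ∧ MapsTo ψinv (Icc 0 T₁) (Icc 0 T) ∧
  InvOn ψinv ψ (Icc 0 T) (Icc 0 T₁) ∧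
  ContinuousOn m (Icc 0 T) ∧
  ∀ t ∈ Icc 0 T, 0 < m t ∧ HasDerivWithinAt ψ (m t) (Icc 0 T) t

/-- The quantity
`𝒩₀ = ‖c - 1‖_{T,H^r} + ‖V‖_{T,H¹} + ‖∂_t c‖_{T,H¹} + ‖R₂‖_{T,𝓛(L²)}`; here `ct = ∂_t c`. -/
def sizeN0 (T r : ℝ) (c ct V : ℝ → Torus → ℝ) (R₂ : ℝ → L2 →L[ℝ] L2) : ℝ≥0∞ :=
  normH T r (fun t x => c t x - 1) + normH T 1 V + normH T 1 ct + normOp T R₂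

end WaterWave

end

open WaterWave

/-!
The equation is conjugated to one with constant principal part by unitary changes of variables, and
the point is that the error is of order zero, with a bound that needs no regularity of `u`.

*The change of variables.* Let `σ = ∫ c^{-2/3} dx` and `d = σ⁻¹ c^{-2/3}`, a positive function of
mean one, so that `G(t, y) = y + β(t, y)` with `∂_y β = d - 1` is a diffeomorphism of the torus.
The operator `U h = d^{1/2} h ∘ G` is unitary on `L²`, and `L^{1/2} c L^{1/2}` acts on `U h` to
leading order as `c d^{3/2} = σ^{-3/2} = m(t)` times `U L h`, because `L` has order `3/2`. The change
of time `ψ' = m` (`Speed`) removes `m`. The free constant `q(t)` in `β` is chosen such that the new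
transport coefficient `W = m⁻¹ (V d + ∂_t β) ∘ G⁻¹` has mean zero; thus the translation is part of
`β`, and `p = 0`. With `m` taken out, it remains to see that `U⁻¹ L^{1/2} d^{-3/2} L^{1/2} U = L + K`
with `K` bounded on `L²`, and small if `d - 1` is.

*The operator `K`.* Join the translation `y ↦ y + q` to `G` by the path `y ↦ y + q + θ β₀(y)`, where
`β₀` has mean zero, and let `d_θ` and `U_θ` be the corresponding objects. The form
`⟨L^{1/2} d_θ^{-3/2} L^{1/2} U_θ f, U_θ h⟩` is that of `L` at `θ = 0`, and its derivative in `θ` is a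
triple Fourier series (`hasSum_form_deriv`) in the generator `v_θ` of the path, in `d_θ^{-3/2}`, and
in `U_θ f` and `U_θ h`, with the explicit commutator symbol `symS`. In
the frequency `n` of `U_θ f`, the terms of `symS` grow like `|n|^{5/2}`. That it is a commutator
leaves `|n|^{3/2}`, the exponent `-3/2` removes this principal part, and the symmetry of the form,
due to the factor `d^{1/2}`, removes the subprincipal part `|n|^{1/2}`; so the symbol is bounded by
a power of the other two frequencies, uniformly in `n` (`exists_abs_symS_le`). Since those two
frequencies belong to smooth functions, the series is bounded by `L²` norms
(`norm_tsum_symS_le`), hence so is the difference of the forms (`SDiffeo.exists_form_bound`), which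
defines `K` (`SDiffeo.exists_conj_operator`, `exists_conj_curve`). Regularity is measured in the
weighted Wiener norms `wn N a = ∑ (1 + |k|)^N |a k|`, which give algebras and control the
off-diagonal decay of the matrix of `U` (`SDiffeo.norm_M_le_left`, `SDiffeo.norm_M_le_right`).

*The equation.* The function `u` is only continuous with values in `L²`, and the equation holds in
the sense of distributions, so it cannot be differentiated along the flow. It is tested instead on
the moving orthonormal basis `U(t) e^{ikx}`, which is smooth: `UCurve.hasDerivWithinAt_iff`
shows that the weak equations in the fixed and in the moving basis are equivalent. The terms of first
order are matched by `Flow.transport_identity`, all terms by `Flow.pairing_identity`, and the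
equivalence follows, first in the original time (`Flow.equation_iff`) and then in the new time
(`Coefs.eqP_iff`).

*The smallness.* The Wiener norm of `c - 1` has to be small, whereas only its `L^∞` norm is assumed
to be so. As the norm of `c - 1` in a space `H^r` with large `r` is at most one, the interpolation
inequality `wn_le_of_interpolation` gives it (`exists_coefs`).
-/


noncomputable section

namespace WaterWave

open scoped ComplexConjugate

/-! ### Fourier coefficients and multiplication operators on `L²` -/

/-- The continuous function `f` as an element of `L²`. -/
def cl : C(Torus, ℂ) →L[ℂ] L2 := ContinuousMap.toLp 2 dx ℂ

/-- The exponential `e^{ikx}` as an element of `L²`. -/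
def eb (k : ℤ) : L2 := cl (fourier k)

theorem coeFn_cl (f : C(Torus, ℂ)) : (cl f : Torus → ℂ) =ᵐ[dx] f :=
  ContinuousMap.coeFn_toLp (𝕜 := ℂ) dx f

theorem coeff_cl (f : C(Torus, ℂ)) (k : ℤ) : coeff (cl f) k = fourierCoeff f k :=
  fourierCoeff_toLp f k

theorem fourierBasis_eq_eb (k : ℤ) : (fourierBasis (T := 2 * Real.pi)) k = eb k := by
  rw [coe_fourierBasis]; rfl

theorem coeff_eq_inner (u : L2) (k : ℤ) : coeff u k = inner ℂ (eb k) u := by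
  rw [← fourierBasis_eq_eb, ← HilbertBasis.repr_apply_apply, fourierBasis_repr]; rfl

theorem coeff_add (u v : L2) (k : ℤ) : coeff (u + v) k = coeff u k + coeff v k := by
  simp [coeff_eq_inner, inner_add_right]

theorem coeff_sub (u v : L2) (k : ℤ) : coeff (u - v) k = coeff u k - coeff v k := by
  simp [coeff_eq_inner, inner_sub_right]

theorem coeff_smul (c : ℂ) (u : L2) (k : ℤ) : coeff (c • u) k = c * coeff u k := by
  simp [coeff_eq_inner, inner_smul_right]

theorem coeff_real_smul (c : ℝ) (u : L2) (k : ℤ) : coeff (c • u) k = c * coeff u k := by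
  rw [← coeff_smul]; congr 1

theorem norm_eb (k : ℤ) : ‖eb k‖ = 1 := by
  rw [← fourierBasis_eq_eb]; exact (fourierBasis (T := 2 * Real.pi)).orthonormal.1 k

theorem inner_eb_eb (k l : ℤ) : inner ℂ (eb k) (eb l) = if k = l then 1 else 0 := by
  rw [← fourierBasis_eq_eb, ← fourierBasis_eq_eb]
  exact orthonormal_iff_ite.1 (fourierBasis (T := 2 * Real.pi)).orthonormal k l

theorem coeff_eb (k l : ℤ) : coeff (eb k) l = if l = k then 1 else 0 := by
  rw [coeff_eq_inner, inner_eb_eb]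

theorem norm_coeff_le (u : L2) (k : ℤ) : ‖coeff u k‖ ≤ ‖u‖ := by
  rw [coeff_eq_inner]
  calc _ ≤ ‖eb k‖ * ‖u‖ := norm_inner_le_norm _ _
    _ = ‖u‖ := by rw [norm_eb, one_mul]

theorem L2_ext {u v : L2} (h : ∀ k, coeff u k = coeff v k) : u = v := by
  apply (fourierBasis (T := 2 * Real.pi)).repr.injective
  ext k
  rw [fourierBasis_repr, fourierBasis_repr]
  exact h k

/-- Parseval's identity. -/
theorem hasSum_inner (u v : L2) :
    HasSum (fun k => conj (coeff u k) * coeff v k) (inner ℂ u v) := by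
  have := (fourierBasis (T := 2 * Real.pi)).hasSum_inner_mul_inner u v
  simpa only [fourierBasis_eq_eb, coeff_eq_inner, inner_conj_symm] using this

theorem hasSum_norm_sq (u : L2) : HasSum (fun k => ‖coeff u k‖ ^ 2) (‖u‖ ^ 2) := by
  have h := hasSum_inner u u
  have h2 := (Complex.hasSum_iff _ _).1 h
  have h3 := h2.1
  rw [inner_self_eq_norm_sq_to_K] at h3
  convert h3 using 1
  · ext k; rw [← Complex.normSq_eq_conj_mul_self, Complex.ofReal_re, Complex.normSq_eq_norm_sq]
  · norm_cast

theorem hasSum_eb (u : L2) : HasSum (fun k => coeff u k • eb k) u := by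
  have := (fourierBasis (T := 2 * Real.pi)).hasSum_repr u
  simp only [fourierBasis_eq_eb, fourierBasis_repr] at this
  exact this

/-- The element of `L²` with given square summable Fourier coefficients. -/
def ofCoeff (a : ℤ → ℂ) (h : Summable fun k => ‖a k‖ ^ 2) : L2 :=
  (fourierBasis (T := 2 * Real.pi)).repr.symm
    ⟨a, memℓp_gen (by simpa using h)⟩

theorem coeff_ofCoeff (a : ℤ → ℂ) (h : Summable fun k => ‖a k‖ ^ 2) (k : ℤ) :
    coeff (ofCoeff a h) k = a k := by
  have := fourierBasis_repr (T := 2 * Real.pi) (ofCoeff a h) k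
  rw [ofCoeff, LinearIsometryEquiv.apply_symm_apply] at this
  exact this.symm

theorem norm_cl_le (f : C(Torus, ℂ)) : ‖cl f‖ ≤ ‖f‖ := by
  have h := ContinuousMap.toLp_norm_le (p := 2) (𝕜 := ℂ) (E := ℂ) dx
  calc ‖cl f‖ ≤ ‖ContinuousMap.toLp (E := ℂ) 2 dx ℂ‖ * ‖f‖ := ContinuousLinearMap.le_opNorm _ _
    _ ≤ 1 * ‖f‖ := by
      gcongr
      refine h.trans ?_
      simp [measureUnivNNReal]
    _ = ‖f‖ := one_mul _

theorem memLp_mul (a : C(Torus, ℂ)) (u : L2) : MemLp (fun x => a x * u x) 2 dx := by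
  refine MemLp.of_le_mul (c := ‖a‖) (Lp.memLp u)
    (a.continuous.aestronglyMeasurable.mul (Lp.aestronglyMeasurable u)) (ae_of_all _ fun x => ?_)
  rw [norm_mul]
  gcongr
  exact a.norm_coe_le_norm x

/-- Multiplication of an element of `L²` by a continuous function. -/
def mulL : C(Torus, ℂ) →L[ℂ] L2 →L[ℂ] L2 :=
  LinearMap.mkContinuous₂
    (LinearMap.mk₂ ℂ (fun a u => (memLp_mul a u).toLp)
      (fun a b u => by
        rw [← MemLp.toLp_add]; congr 1; ext x; simp [add_mul])
      (fun c a u => by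
        rw [← MemLp.toLp_const_smul]; congr 1; ext x; simp [mul_assoc])
      (fun a u v => by
        rw [← MemLp.toLp_add]
        refine MemLp.toLp_congr _ _ ?_
        filter_upwards [Lp.coeFn_add u v] with x hx
        rw [Pi.add_apply] at hx
        rw [hx]; exact mul_add _ _ _)
      (fun c a u => by
        rw [← MemLp.toLp_const_smul]
        refine MemLp.toLp_congr _ _ ?_
        filter_upwards [Lp.coeFn_smul c u] with x hx
        rw [Pi.smul_apply] at hx
        rw [hx]; simp only [Pi.smul_apply, smul_eq_mul]; ring))
    1 (fun a u => by
      simp only [LinearMap.mk₂_apply, one_mul]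
      refine Lp.norm_le_mul_norm_of_ae_le_mul ?_
      filter_upwards [(memLp_mul a u).coeFn_toLp] with x hx
      rw [hx, norm_mul]
      gcongr
      exact a.norm_coe_le_norm x)

theorem coeFn_mulL (a : C(Torus, ℂ)) (u : L2) :
    (mulL a u : Torus → ℂ) =ᵐ[dx] fun x => a x * u x :=
  (memLp_mul a u).coeFn_toLp

theorem norm_mulL_le (a : C(Torus, ℂ)) (u : L2) : ‖mulL a u‖ ≤ ‖a‖ * ‖u‖ := by
  refine Lp.norm_le_mul_norm_of_ae_le_mul ?_
  filter_upwards [coeFn_mulL a u] with x hx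
  rw [hx, norm_mul]
  gcongr
  exact a.norm_coe_le_norm x

theorem norm_mulL_le_of_le {a : C(Torus, ℂ)} {A : ℝ} (hA : ∀ x, ‖a x‖ ≤ A) (u : L2) :
    ‖mulL a u‖ ≤ A * ‖u‖ := by
  refine Lp.norm_le_mul_norm_of_ae_le_mul ?_
  filter_upwards [coeFn_mulL a u] with x hx
  rw [hx, norm_mul]
  gcongr
  exact hA x

theorem mulL_mulL (a b : C(Torus, ℂ)) (u : L2) : mulL a (mulL b u) = mulL (a * b) u := by
  apply Lp.ext
  filter_upwards [coeFn_mulL a (mulL b u), coeFn_mulL b u, coeFn_mulL (a * b) u] with x h1 h2 h3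
  rw [h1, h2, h3, ContinuousMap.mul_apply, mul_assoc]

theorem mulL_cl (a f : C(Torus, ℂ)) : mulL a (cl f) = cl (a * f) := by
  apply Lp.ext
  filter_upwards [coeFn_mulL a (cl f), coeFn_cl f, coeFn_cl (a * f)] with x h1 h2 h3
  rw [h1, h2, h3, ContinuousMap.mul_apply]

theorem mulL_one (u : L2) : mulL 1 u = u := by
  apply Lp.ext
  filter_upwards [coeFn_mulL 1 u] with x h1
  rw [h1]; simp

theorem inner_mulL_left (a : C(Torus, ℂ)) (u v : L2) :
    inner ℂ (mulL a u) v = inner ℂ u (mulL (star a) v) := by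
  rw [L2.inner_def, L2.inner_def]
  apply integral_congr_ae
  filter_upwards [coeFn_mulL a u, coeFn_mulL (star a) v] with x h1 h2
  rw [h1, h2]
  simp; ring

theorem inner_cl_left (f : C(Torus, ℂ)) (v : L2) :
    inner ℂ (cl f) v = ∫ x, conj (f x) * v x ∂dx := by
  rw [L2.inner_def]
  apply integral_congr_ae
  filter_upwards [coeFn_cl f] with x h1
  rw [h1]; simp [mul_comm]

theorem inner_cl_cl (f g : C(Torus, ℂ)) :
    inner ℂ (cl f) (cl g) = ∫ x, conj (f x) * g x ∂dx := by
  rw [inner_cl_left]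
  apply integral_congr_ae
  filter_upwards [coeFn_cl g] with x h1
  rw [h1]

theorem fourier_mul (k l : ℤ) : (fourier k * fourier l : C(Torus, ℂ)) = fourier (k + l) := by
  ext x; rw [ContinuousMap.mul_apply, fourier_add]

theorem star_fourier (k : ℤ) : star (fourier k : C(Torus, ℂ)) = fourier (-k) := by
  ext x; rw [ContinuousMap.star_apply, fourier_neg]; rfl

theorem coeff_mulL_fourier (k : ℤ) (u : L2) (j : ℤ) :
    coeff (mulL (fourier k) u) j = coeff u (j - k) := by
  have := inner_mulL_left (star (fourier k)) (eb j) u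
  rw [star_star] at this
  rw [coeff_eq_inner, ← this, eb, mulL_cl, star_fourier, fourier_mul, coeff_eq_inner, eb,
    neg_add_eq_sub]

/-- `v` is real valued, in terms of its Fourier coefficients. -/
def Herm (v : L2) : Prop := ∀ k, coeff v (-k) = conj (coeff v k)

/-- The coefficients of the product of a real valued `v` and of `u`. -/
theorem hasSum_conv_of_herm {v : L2} (hv : Herm v) (u : L2) (k : ℤ) :
    HasSum (fun j => coeff v (k - j) * coeff u j) (inner ℂ (mulL (fourier k) v) u) := by
  have := hasSum_inner (mulL (fourier k) v) u
  convert this using 2 with j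
  rw [coeff_mulL_fourier, ← hv, neg_sub]

theorem hasSum_coeff_mul (f g : C(Torus, ℂ)) (k : ℤ) :
    HasSum (fun j => fourierCoeff f (k - j) * fourierCoeff g j) (fourierCoeff (f * g) k) := by
  have := hasSum_inner (cl (fourier k * star f)) (cl g)
  have h2 : inner ℂ (cl (fourier k * star f)) (cl g) = fourierCoeff (f * g) k := by
    rw [← coeff_cl, coeff_eq_inner, eb, ← mulL_cl f g, ← mulL_cl]
    have h3 := inner_mulL_left (star f) (eb k) (cl g)
    rw [star_star] at h3
    rw [← eb, ← h3, mulL_cl, eb, mulL_cl, mul_comm (star f)]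
  rw [h2] at this
  convert this using 2 with j
  rw [← mulL_cl, coeff_mulL_fourier, coeff_cl, coeff_cl]
  congr 1
  simp only [fourierCoeff, ← integral_conj]
  congr 1; ext x
  simp only [ContinuousMap.star_apply, smul_eq_mul, map_mul, ← fourier_neg, RCLike.star_def,
    Complex.conj_conj, neg_sub]

/-! ### Weighted absolutely convergent Fourier series -/

/-- The weight `1 + |k|`. -/
def jp (k : ℤ) : ℝ := 1 + |(k : ℝ)|

theorem one_le_jp (k : ℤ) : 1 ≤ jp k := by simp [jp]

theorem jp_pos (k : ℤ) : 0 < jp k := zero_lt_one.trans_le (one_le_jp k)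

theorem jp_add_le (j k : ℤ) : jp (j + k) ≤ jp j * jp k := by
  simp only [jp, Int.cast_add]
  nlinarith [abs_add_le (j : ℝ) k, mul_nonneg (abs_nonneg (j : ℝ)) (abs_nonneg (k : ℝ))]

theorem jp_neg (k : ℤ) : jp (-k) = jp k := by simp [jp]

theorem abs_le_jp (k : ℤ) : |(k : ℝ)| ≤ jp k := by simp [jp]

theorem jp_le_mul_sub (j k : ℤ) : jp k ≤ jp j * jp (j - k) := by
  have := jp_add_le j (k - j)
  rwa [add_sub_cancel, ← jp_neg (k - j), neg_sub] at this

theorem jp_sq_le (k : ℤ) : jp k ^ 2 ≤ 2 * (1 + (k : ℝ) ^ 2) := by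
  simp only [jp]
  nlinarith [sq_nonneg (1 - |(k : ℝ)|), sq_abs (k : ℝ)]

theorem summable_jp_inv_sq : Summable fun k : ℤ => (jp k ^ 2)⁻¹ := by
  have h : Summable fun k : ℤ => ((k : ℝ) ^ 2)⁻¹ := by
    simpa using Real.summable_one_div_int_pow (p := 2) |>.2 one_lt_two
  have h2 : Summable fun k : ℤ => ((k : ℝ) ^ 2)⁻¹ + if k = 0 then (1 : ℝ) else 0 :=
    h.add (summable_of_ne_finset_zero (s := {0}) (by intro b hb; simp_all))
  refine h2.of_nonneg_of_le (fun k => by positivity) fun k => ?_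
  by_cases hk : k = 0
  · simp [hk, jp]
  · have hk' : 0 < |(k : ℝ)| := abs_pos.2 (by exact_mod_cast hk)
    rw [if_neg hk, add_zero, ← sq_abs (k : ℝ)]
    gcongr
    exact abs_le_jp k

theorem summable_jp_inv_pow {n : ℕ} (hn : 2 ≤ n) : Summable fun k : ℤ => (jp k ^ n)⁻¹ := by
  refine summable_jp_inv_sq.of_nonneg_of_le (fun k => by have := jp_pos k; positivity) fun k => ?_
  have := jp_pos k
  gcongr
  exact one_le_jp k

/-- The weighted `ℓ¹` norm `∑ (1 + |k|)^N |a_k|`. -/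
def wn (N : ℕ) (a : ℤ → ℂ) : ℝ≥0∞ := ∑' k, ENNReal.ofReal (jp k ^ N) * ‖a k‖ₑ

theorem summable_of_wn {N : ℕ} {a : ℤ → ℂ} (h : wn N a ≠ ⊤) :
    Summable fun k => jp k ^ N * ‖a k‖ := by
  have h2 := ENNReal.summable_toReal h
  refine h2.congr fun k => ?_
  rw [ENNReal.toReal_mul, ENNReal.toReal_ofReal (pow_nonneg (jp_pos k).le N), toReal_enorm]

theorem wn_eq_ofReal {N : ℕ} {a : ℤ → ℂ} (h : Summable fun k => jp k ^ N * ‖a k‖) :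
    wn N a = ENNReal.ofReal (∑' k, jp k ^ N * ‖a k‖) := by
  rw [ENNReal.ofReal_tsum_of_nonneg
    (fun k => mul_nonneg (pow_nonneg (jp_pos k).le N) (norm_nonneg _)) h]
  simp only [wn]
  congr 1; ext k
  rw [ENNReal.ofReal_mul (pow_nonneg (jp_pos k).le N), ofReal_norm]

theorem tsum_le_of_wn {N : ℕ} {a : ℤ → ℂ} {A : ℝ} (hA : 0 ≤ A) (h : wn N a ≤ ENNReal.ofReal A) :
    ∑' k, jp k ^ N * ‖a k‖ ≤ A := by
  have h1 := wn_eq_ofReal (summable_of_wn (h.trans_lt ENNReal.ofReal_lt_top).ne)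
  rw [h1, ENNReal.ofReal_le_ofReal_iff hA] at h
  exact h

theorem wn_mono {M N : ℕ} (h : M ≤ N) (a : ℤ → ℂ) : wn M a ≤ wn N a := by
  refine ENNReal.tsum_le_tsum fun k => ?_
  gcongr
  exact one_le_jp k

theorem wn_le_of_le {N : ℕ} {a b : ℤ → ℂ} (h : ∀ k, ‖a k‖ ≤ ‖b k‖) : wn N a ≤ wn N b := by
  refine ENNReal.tsum_le_tsum fun k => ?_
  gcongr
  rw [← ofReal_norm, ← ofReal_norm]
  exact ENNReal.ofReal_le_ofReal (h k)

theorem wn_add_le (N : ℕ) (a b : ℤ → ℂ) : wn N (fun k => a k + b k) ≤ wn N a + wn N b := by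
  rw [wn, wn, wn, ← ENNReal.tsum_add]
  refine ENNReal.tsum_le_tsum fun k => ?_
  rw [← mul_add]
  gcongr
  exact enorm_add_le _ _

theorem wn_smul (N : ℕ) (c : ℂ) (a : ℤ → ℂ) : wn N (fun k => c * a k) = ‖c‖ₑ * wn N a := by
  rw [wn, wn, ← ENNReal.tsum_mul_left]
  congr 1; ext k
  rw [enorm_mul]; ring

/-- A complex valued version of a real valued function. -/
def ofR (f : C(Torus, ℝ)) : C(Torus, ℂ) := ⟨fun x => (f x : ℂ), by fun_prop⟩

@[simp] theorem ofR_apply (f : C(Torus, ℝ)) (x : Torus) : ofR f x = (f x : ℂ) := rfl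

theorem ofR_mul (f g : C(Torus, ℝ)) : ofR (f * g) = ofR f * ofR g := by
  ext x; simp

theorem ofR_add (f g : C(Torus, ℝ)) : ofR (f + g) = ofR f + ofR g := by
  ext x; simp

theorem star_ofR (f : C(Torus, ℝ)) : star (ofR f) = ofR f := by
  ext x; simp

theorem fourierCoeff_ofR (f : C(Torus, ℝ)) : fourierCoeff (ofR f) = realCoeff f := rfl

theorem fourierCoeff_add' (f g : C(Torus, ℂ)) (k : ℤ) :
    fourierCoeff (f + g) k = fourierCoeff f k + fourierCoeff g k := by
  rw [← coeff_cl, ← coeff_cl, ← coeff_cl, map_add, coeff_add]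

theorem fourierCoeff_one (k : ℤ) : fourierCoeff (1 : C(Torus, ℂ)) k = if k = 0 then 1 else 0 := by
  have : (1 : C(Torus, ℂ)) = fourier 0 := by ext x; simp
  rw [this, ← coeff_cl]
  exact coeff_eb 0 k

theorem realCoeff_neg (f : Torus → ℝ) (k : ℤ) : realCoeff f (-k) = conj (realCoeff f k) := by
  simp only [realCoeff, fourierCoeff, ← integral_conj]
  congr 1; ext x
  simp only [smul_eq_mul, map_mul, ← fourier_neg, Complex.conj_ofReal]

theorem wn_one (N : ℕ) : wn N (fourierCoeff (1 : C(Torus, ℂ))) = 1 := by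
  rw [wn, tsum_eq_single 0]
  · rw [fourierCoeff_one]; simp [jp]
  · intro k hk; rw [fourierCoeff_one]; simp [hk]

/-- The weighted Wiener space is an algebra, with constant one. -/
theorem wn_mul_le (N : ℕ) (f g : C(Torus, ℂ)) :
    wn N (fourierCoeff (f * g)) ≤ wn N (fourierCoeff f) * wn N (fourierCoeff g) := by
  have h1 : ∀ k, ENNReal.ofReal (jp k ^ N) * ‖fourierCoeff (f * g) k‖ₑ ≤
      ∑' j, (ENNReal.ofReal (jp (k - j) ^ N) * ‖fourierCoeff f (k - j)‖ₑ) *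
        (ENNReal.ofReal (jp j ^ N) * ‖fourierCoeff g j‖ₑ) := by
    intro k
    have h2 : ‖fourierCoeff (f * g) k‖ₑ ≤
        ∑' j, ‖fourierCoeff f (k - j) * fourierCoeff g j‖ₑ := by
      rw [← (hasSum_coeff_mul f g k).tsum_eq]
      exact enorm_tsum_le_tsum_enorm
    calc _ ≤ ENNReal.ofReal (jp k ^ N) * ∑' j, ‖fourierCoeff f (k - j) * fourierCoeff g j‖ₑ := by
          gcongr
      _ ≤ _ := by
          rw [← ENNReal.tsum_mul_left]
          refine ENNReal.tsum_le_tsum fun j => ?_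
          have h3 : ENNReal.ofReal (jp k ^ N) ≤
              ENNReal.ofReal (jp (k - j) ^ N) * ENNReal.ofReal (jp j ^ N) := by
            rw [← ENNReal.ofReal_mul (pow_nonneg (jp_pos _).le N), ← mul_pow]
            apply ENNReal.ofReal_le_ofReal
            have := jp_add_le (k - j) j
            rw [sub_add_cancel] at this
            gcongr
            exact (jp_pos k).le
          rw [enorm_mul]
          calc _ ≤ _ := mul_le_mul_left h3 _
            _ = _ := by ring
  calc wn N (fourierCoeff (f * g)) ≤ _ := ENNReal.tsum_le_tsum h1
    _ = ∑' j, ∑' k, (ENNReal.ofReal (jp (k - j) ^ N) * ‖fourierCoeff f (k - j)‖ₑ) *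
        (ENNReal.ofReal (jp j ^ N) * ‖fourierCoeff g j‖ₑ) := ENNReal.tsum_comm
    _ = _ := by
      simp_rw [ENNReal.tsum_mul_right]
      have : ∀ j : ℤ, ∑' k, (ENNReal.ofReal (jp (k - j) ^ N) * ‖fourierCoeff f (k - j)‖ₑ) =
          wn N (fourierCoeff f) := fun j =>
        (Equiv.subRight j).tsum_eq
          (fun k => ENNReal.ofReal (jp k ^ N) * ‖fourierCoeff f k‖ₑ)
      simp_rw [this, ENNReal.tsum_mul_left]
      rfl

theorem wn_pow_le (N : ℕ) (f : C(Torus, ℂ)) (n : ℕ) :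
    wn N (fourierCoeff (f ^ n)) ≤ wn N (fourierCoeff f) ^ n := by
  induction n with
  | zero => simp only [pow_zero]; exact (wn_one N).le
  | succ n ih =>
    rw [pow_succ, pow_succ]
    exact (wn_mul_le N _ _).trans (by gcongr)

theorem hasSum_fourier_of_wn {f : C(Torus, ℂ)} (h : wn 0 (fourierCoeff f) ≠ ⊤) :
    HasSum (fun k => fourierCoeff f k • (fourier k : C(Torus, ℂ))) f := by
  apply hasSum_fourier_series_of_summable
  apply Summable.of_norm
  simpa using summable_of_wn h

theorem enorm_le_wn (f : C(Torus, ℂ)) (x : Torus) : ‖f x‖ₑ ≤ wn 0 (fourierCoeff f) := by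
  by_cases h : wn 0 (fourierCoeff f) = ⊤
  · simp [h]
  have h1 := has_pointwise_sum_fourier_series_of_summable
    (Summable.of_norm (by simpa using summable_of_wn h)) x
  rw [← h1.tsum_eq]
  refine enorm_tsum_le_tsum_enorm.trans (ENNReal.tsum_le_tsum fun k => ?_)
  rw [enorm_smul]
  have : ‖fourier k x‖ₑ ≤ 1 := by
    rw [← ofReal_norm, ENNReal.ofReal_le_one, fourier_apply, Circle.norm_coe]
  calc _ ≤ ‖fourierCoeff f k‖ₑ * 1 := by gcongr
    _ = _ := by simp

theorem norm_le_of_wn {f : C(Torus, ℂ)} {N : ℕ} {A : ℝ} (hA : 0 ≤ A)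
    (h : wn N (fourierCoeff f) ≤ ENNReal.ofReal A) (x : Torus) : ‖f x‖ ≤ A := by
  have := (enorm_le_wn f x).trans ((wn_mono (Nat.zero_le N) _).trans h)
  rwa [← ofReal_norm, ENNReal.ofReal_le_ofReal_iff hA] at this

theorem wn_tsum_le (N : ℕ) {f : ℕ → C(Torus, ℂ)} {g : C(Torus, ℂ)} (h : HasSum f g) :
    wn N (fourierCoeff g) ≤ ∑' n, wn N (fourierCoeff (f n)) := by
  have h1 : ∀ k, HasSum (fun n => fourierCoeff (f n) k) (fourierCoeff g k) := by
    intro k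
    have h2 := (h.mapL cl).mapL (innerSL ℂ (eb k))
    simpa only [innerSL_apply_apply, ← coeff_eq_inner, coeff_cl] using h2
  calc wn N (fourierCoeff g)
      ≤ ∑' k, ∑' n, ENNReal.ofReal (jp k ^ N) * ‖fourierCoeff (f n) k‖ₑ := by
        refine ENNReal.tsum_le_tsum fun k => ?_
        rw [ENNReal.tsum_mul_left, ← (h1 k).tsum_eq]
        gcongr
        exact enorm_tsum_le_tsum_enorm
    _ = _ := ENNReal.tsum_comm

/-- The coefficients of `(1 + z)^s - 1 = ∑ n, a n * z^(n+1)`, and their summability. -/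
theorem exists_series_one_add_rpow (s : ℝ) : ∃ a : ℕ → ℝ,
    (Summable fun n => |a n| * (1 / 2 : ℝ) ^ n) ∧
    ∀ z : ℝ, |z| ≤ 1 / 2 → HasSum (fun n : ℕ => a n * z ^ (n + 1)) ((1 + z) ^ s - 1) := by
  have hps := Real.one_add_rpow_hasFPowerSeriesOnBall_zero (a := s)
  have hnorm : ∀ n, ‖binomialSeries ℝ s n‖ = |Ring.choose s n| := by
    intro n
    rw [binomialSeries, FormalMultilinearSeries.ofScalars_norm, Real.norm_eq_abs]
  have hsum : Summable fun n : ℕ => |Ring.choose s n| * (1 / 2 : ℝ) ^ n := by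
    have := (binomialSeries ℝ s).summable_norm_mul_pow (r := (1 / 2 : NNReal))
      (lt_of_lt_of_le (by
        rw [← ENNReal.coe_one, ENNReal.coe_lt_coe]; exact NNReal.half_lt_self one_ne_zero) hps.r_le)
    simpa [hnorm] using this
  have hval : ∀ z : ℝ, |z| ≤ 1 / 2 →
      HasSum (fun n : ℕ => Ring.choose s n * z ^ n) ((1 + z) ^ s) := by
    intro z hz
    have := hps.hasSum (y := z) (by
      rw [Metric.mem_eball, edist_zero_right, ← ofReal_norm, ENNReal.ofReal_lt_one,
        Real.norm_eq_abs]; linarith)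
    simpa [binomialSeries, FormalMultilinearSeries.coeff_ofScalars, mul_comm] using this
  refine ⟨fun n => Ring.choose s (n + 1), ?_, fun z hz => ?_⟩
  · refine (((summable_nat_add_iff 1).2 hsum).mul_left 2).congr fun n => ?_
    rw [pow_succ]; ring
  · simpa using (hasSum_nat_add_iff' 1).2 (hval z hz)

/-- The function `(1 + f)^s - 1` is controlled by `f`, for `f` of size at most `1/2`. -/
theorem wn_one_add_rpow (s : ℝ) : ∃ C : ℝ, 0 < C ∧ ∀ (N : ℕ) (f g : C(Torus, ℝ)),
    wn N (realCoeff f) ≤ ENNReal.ofReal (1 / 2) → (∀ x, g x = (1 + f x) ^ s - 1) →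
    wn N (realCoeff g) ≤ ENNReal.ofReal C * wn N (realCoeff f) := by
  obtain ⟨a, hsum, hval⟩ := exists_series_one_add_rpow s
  set A := ∑' n : ℕ, |a n| * (1 / 2 : ℝ) ^ n with hA
  have hA0 : 0 ≤ A := tsum_nonneg fun n => by positivity
  refine ⟨A + 1, by positivity, fun N f g hf hg => ?_⟩
  have hfx : ∀ x, |f x| ≤ 1 / 2 := by
    intro x
    have := norm_le_of_wn (f := ofR f) (by norm_num) hf x
    simpa using this
  have hs1 : Summable fun n : ℕ => ‖((a n : ℝ) : ℂ) • ofR f ^ (n + 1)‖ := by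
    refine (hsum.mul_left (1 / 2)).of_nonneg_of_le (fun n => norm_nonneg _) fun n => ?_
    rw [norm_smul, Complex.norm_real, Real.norm_eq_abs, mul_left_comm, ← pow_succ']
    gcongr
    refine (norm_pow_le _ _).trans ?_
    gcongr
    rw [ContinuousMap.norm_le _ (by norm_num)]
    intro x
    simpa using hfx x
  have hs2 : HasSum (fun n : ℕ => ((a n : ℝ) : ℂ) • ofR f ^ (n + 1)) (ofR g) := by
    have h3 := hs1.of_norm.hasSum
    have h6 : ∑' n : ℕ, ((a n : ℝ) : ℂ) • ofR f ^ (n + 1) = ofR g := by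
      refine ContinuousMap.ext fun x => ?_
      have h4 := ContinuousMap.hasSum_apply h3 x
      have h7 := Complex.hasSum_ofReal.2 (hval (f x) (hfx x))
      rw [← hg] at h7
      refine h4.unique ?_
      simpa using h7
    rw [← h6]
    exact h3
  have h8 : ∀ n, wn N (fourierCoeff (((a n : ℝ) : ℂ) • ofR f ^ (n + 1) : C(Torus, ℂ))) ≤
      ENNReal.ofReal (|a n| * (1 / 2 : ℝ) ^ n) * wn N (realCoeff f) := by
    intro n
    have h8 : fourierCoeff (((a n : ℝ) : ℂ) • ofR f ^ (n + 1) : C(Torus, ℂ)) =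
        fun k => ((a n : ℝ) : ℂ) * fourierCoeff (ofR f ^ (n + 1) : C(Torus, ℂ)) k := by
      ext k
      rw [← coeff_cl, map_smul, coeff_smul, coeff_cl]
    have h9 : ‖((a n : ℝ) : ℂ)‖ₑ = ENNReal.ofReal |a n| := by
      rw [← ofReal_norm, Complex.norm_real, Real.norm_eq_abs]
    rw [h8, wn_smul, ENNReal.ofReal_mul (abs_nonneg _), mul_assoc, h9]
    gcongr
    calc _ ≤ wn N (fourierCoeff (ofR f)) ^ (n + 1) := wn_pow_le N (ofR f) (n + 1)
      _ = wn N (fourierCoeff (ofR f)) ^ n * wn N (fourierCoeff (ofR f)) := pow_succ _ _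
      _ ≤ _ := by
        rw [ENNReal.ofReal_pow (by norm_num)]
        exact mul_le_mul_left (pow_le_pow_left₀ (zero_le) hf n) _
  have h10 := wn_tsum_le N hs2
  rw [fourierCoeff_ofR] at h10
  calc wn N (realCoeff g)
      ≤ ∑' n : ℕ, wn N (fourierCoeff (((a n : ℝ) : ℂ) • ofR f ^ (n + 1) : C(Torus, ℂ))) :=
        h10
    _ ≤ ∑' n : ℕ, ENNReal.ofReal (|a n| * (1 / 2 : ℝ) ^ n) * wn N (realCoeff f) :=
        ENNReal.tsum_le_tsum h8
    _ = ENNReal.ofReal A * wn N (realCoeff f) := by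
        rw [ENNReal.tsum_mul_right, ← ENNReal.ofReal_tsum_of_nonneg (fun n => by positivity) hsum]
    _ ≤ ENNReal.ofReal (A + 1) * wn N (realCoeff f) :=
        mul_le_mul_left (ENNReal.ofReal_le_ofReal (by linarith)) _

/-! ### Derivatives on the torus, classical and in `L²` -/

/-- `f'` is the derivative of the function `f` on the torus. -/
def HasTDeriv {E : Type*} [NormedAddCommGroup E] [NormedSpace ℝ E] (f f' : Torus → E) : Prop :=
  ∀ x, HasDerivAt (fun s : ℝ => f (x + (s : Torus))) (f' x) 0

namespace HasTDeriv

variable {E : Type*} [NormedAddCommGroup E] [NormedSpace ℝ E]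

theorem hasDerivAt {f f' : Torus → E} (h : HasTDeriv f f') (x : Torus) (s : ℝ) :
    HasDerivAt (fun s : ℝ => f (x + (s : Torus))) (f' (x + (s : Torus))) s := by
  have h1 := h (x + (s : Torus))
  have h2 : HasDerivAt (fun r : ℝ => r - s) 1 s := (hasDerivAt_id s).sub_const s
  rw [← sub_self s] at h1
  have h3 := HasDerivAt.scomp (h := fun r : ℝ => r - s) s h1 h2
  simp only [one_smul] at h3
  refine h3.congr_of_eventuallyEq (Eventually.of_forall fun r => ?_)
  simp [add_assoc]

theorem hasDerivAt_coe {f f' : Torus → E} (h : HasTDeriv f f') (s : ℝ) :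
    HasDerivAt (fun s : ℝ => f (s : Torus)) (f' (s : Torus)) s := by
  simpa using h.hasDerivAt 0 s

theorem mul {𝔸 : Type*} [NormedRing 𝔸] [NormedAlgebra ℝ 𝔸] {f f' g g' : Torus → 𝔸}
    (h : HasTDeriv f f') (h' : HasTDeriv g g') :
    HasTDeriv (fun x => f x * g x) (fun x => f' x * g x + f x * g' x) := fun x => by
  have := (h x).mul (h' x)
  simp only [QuotientAddGroup.mk_zero, add_zero] at this
  exact this

theorem comp_real {f f' : Torus → ℝ} {F : ℝ → E} {F' : ℝ → E} (h : HasTDeriv f f')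
    (hF : ∀ x, HasDerivAt F (F' (f x)) (f x)) :
    HasTDeriv (fun x => F (f x)) (fun x => f' x • F' (f x)) := fun x => by
  have h1 : HasDerivAt F (F' (f x)) (f (x + ((0 : ℝ) : Torus))) := by simpa using hF x
  exact h1.scomp 0 (h x)

theorem ofReal {f f' : Torus → ℝ} (h : HasTDeriv f f') :
    HasTDeriv (fun x => (f x : ℂ)) (fun x => (f' x : ℂ)) := fun x => (h x).ofReal_comp

theorem conjugate {f f' : Torus → ℂ} (h : HasTDeriv f f') :
    HasTDeriv (fun x => conj (f x)) (fun x => conj (f' x)) := fun x => by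
  have := (Complex.conjCLE.toContinuousLinearMap.hasFDerivAt
    (x := f (x + ((0 : ℝ) : Torus)))).comp_hasDerivAt 0 (h x)
  exact this

theorem re {f f' : Torus → ℂ} (h : HasTDeriv f f') :
    HasTDeriv (fun x => (f x).re) (fun x => (f' x).re) := fun x => by
  have := (Complex.reCLM.hasFDerivAt (x := f (x + ((0 : ℝ) : Torus)))).comp_hasDerivAt 0 (h x)
  exact this

theorem dX_eq {f f' : Torus → ℝ} (h : HasTDeriv f f') : dX f = f' := funext fun x => (h x).deriv

end HasTDeriv

theorem hasTDeriv_fourier (k : ℤ) :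
    HasTDeriv (fourier k : C(Torus, ℂ)) (fun x => Complex.I * k * fourier k x) := by
  intro x
  obtain ⟨r, rfl⟩ := QuotientAddGroup.mk_surjective x
  have h := hasDerivAt_fourier (2 * Real.pi) k r
  have h1 : HasDerivAt (fun s : ℝ => r + s) 1 0 := (hasDerivAt_id 0).const_add r
  rw [← add_zero r] at h
  have h2 := h.scomp 0 h1
  rw [one_smul, add_zero] at h2
  have hpi : ((2 * Real.pi : ℝ) : ℂ) ≠ 0 := by exact_mod_cast Real.two_pi_pos.ne'
  refine (h2.congr_deriv ?_).congr_of_eventuallyEq (Eventually.of_forall fun s => ?_)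
  · have : (2 * Real.pi * Complex.I * k / (2 * Real.pi : ℝ) : ℂ) = Complex.I * k := by
      field_simp
      push_cast
      ring
    rw [this]
  · simp only [Function.comp_apply]
    congr 1

theorem integral_hasTDeriv {f f' : Torus → ℂ} (h : HasTDeriv f f') (hf' : Continuous f') :
    ∫ x, f' x ∂dx = 0 := by
  have h1 := fourierCoeff_eq_intervalIntegral (T := 2 * Real.pi) f' 0 0
  have h2 : ∫ x, f' x ∂dx = fourierCoeff f' 0 := by simp [fourierCoeff]
  rw [h2, h1]
  have h3 : ∫ s in (0 : ℝ)..0 + 2 * Real.pi, f' (s : Torus) =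
      f ((0 + 2 * Real.pi : ℝ) : Torus) - f ((0 : ℝ) : Torus) := by
    apply intervalIntegral.integral_eq_sub_of_hasDerivAt (f := fun s : ℝ => f (s : Torus))
    · exact fun s _ => h.hasDerivAt_coe s
    · exact (hf'.comp (AddCircle.continuous_mk' _)).intervalIntegrable _ _
  have h4 : ((0 + 2 * Real.pi : ℝ) : Torus) = ((0 : ℝ) : Torus) := by
    simp
  simp only [neg_zero, fourier_zero, one_smul]
  rw [h3, h4, sub_self, smul_zero]

theorem fourierCoeff_deriv {f f' : C(Torus, ℂ)} (h : HasTDeriv f f') (k : ℤ) :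
    fourierCoeff f' k = Complex.I * k * fourierCoeff f k := by
  have h1 := (hasTDeriv_fourier (-k)).mul h
  have h2 := integral_hasTDeriv h1 (by fun_prop)
  rw [integral_add (Continuous.integrable_of_hasCompactSupport (by fun_prop)
      (HasCompactSupport.of_compactSpace _))
    (Continuous.integrable_of_hasCompactSupport (by fun_prop)
      (HasCompactSupport.of_compactSpace _))] at h2
  simp_rw [mul_assoc] at h2
  rw [integral_const_mul, integral_const_mul] at h2
  simp only [fourierCoeff, smul_eq_mul]
  push_cast at h2
  linear_combination h2

/-- `g` is the derivative of `f` in `L²`, in the sense of distributions. -/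
def WD (f g : L2) : Prop := ∀ k, coeff g k = Complex.I * k * coeff f k

theorem WD.of_hasTDeriv {f f' : C(Torus, ℂ)} (h : HasTDeriv f f') : WD (cl f) (cl f') := by
  intro k
  rw [coeff_cl, coeff_cl, fourierCoeff_deriv h]

theorem WD.add {f g f' g' : L2} (h : WD f g) (h' : WD f' g') : WD (f + f') (g + g') := by
  intro k
  rw [coeff_add, coeff_add, h, h', mul_add]

theorem WD.smul {f g : L2} (h : WD f g) (c : ℂ) : WD (c • f) (c • g) := by
  intro k
  rw [coeff_smul, coeff_smul, h]; ring

theorem WD.sub {f g f' g' : L2} (h : WD f g) (h' : WD f' g') : WD (f - f') (g - g') := by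
  intro k
  rw [coeff_sub, coeff_sub, h, h', mul_sub]

theorem Herm.of_WD {f g : L2} (hf : Herm f) (h : WD f g) : Herm g := by
  intro k
  rw [h, h, hf]
  simp

/-- Integration by parts. -/
theorem WD.inner {b b' f f' : L2} (hb : WD b b') (hf : WD f f') :
    inner ℂ b f' = - inner ℂ b' f := by
  refine (hasSum_inner b f').unique ?_
  refine (hasSum_inner b' f).neg.congr_fun fun k => ?_
  rw [hb, hf]
  simp; ring

theorem WD.mulL {a a' : C(Torus, ℂ)} (ha : HasTDeriv a a') {f g : L2} (h : WD f g) :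
    WD (mulL a f) (mulL a' f + mulL a g) := by
  intro k
  have h1 : ∀ (a : C(Torus, ℂ)) (f : L2),
      coeff (WaterWave.mulL a f) k = Inner.inner ℂ (cl (star a * fourier k)) f := by
    intro a f
    rw [coeff_eq_inner, ← mulL_cl, inner_mulL_left, star_star, eb]
  have h2 : HasTDeriv (star a * fourier k : C(Torus, ℂ))
      (star a' * fourier k + (Complex.I * k) • (star a * fourier k) : C(Torus, ℂ)) := by
    have := HasTDeriv.conjugate ha |>.mul (hasTDeriv_fourier k)
    intro x
    refine (this x).congr_deriv ?_
    simp only [ContinuousMap.add_apply, ContinuousMap.mul_apply, ContinuousMap.smul_apply,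
      ContinuousMap.star_apply, smul_eq_mul, RCLike.star_def]
    ring
  have h3 := (WD.of_hasTDeriv h2).inner h
  rw [coeff_add, h1, h1, h1, h3, map_add, map_smul, inner_add_left, inner_smul_left]
  simp

theorem cl_injective : Function.Injective cl := ContinuousMap.toLp_injective (𝕜 := ℂ) dx

theorem continuousMap_ext_coeff {f g : C(Torus, ℂ)}
    (h : ∀ k, fourierCoeff f k = fourierCoeff g k) : f = g :=
  cl_injective (L2_ext fun k => by rw [coeff_cl, coeff_cl, h])

/-- The Cauchy-Schwarz inequality for series. -/
theorem summable_mul_and_tsum_le {ι : Type*} {f g : ι → ℝ} (hf0 : ∀ i, 0 ≤ f i)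
    (hg0 : ∀ i, 0 ≤ g i) (hf : Summable fun i => f i ^ 2) (hg : Summable fun i => g i ^ 2) :
    (Summable fun i => f i * g i) ∧
      ∑' i, f i * g i ≤ Real.sqrt (∑' i, f i ^ 2) * Real.sqrt (∑' i, g i ^ 2) := by
  have := Real.summable_and_inner_le_Lp_mul_Lq_tsum_of_nonneg (p := 2) (q := 2)
    Real.HolderConjugate.two_two hf0 hg0 (by simpa using hf) (by simpa using hg)
  simpa [Real.sqrt_eq_rpow] using this

/-- A constant for the embedding of `H¹` in the continuous functions. -/
def embC : ℝ := Real.sqrt (∑' k : ℤ, (jp k ^ 2)⁻¹)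

theorem embC_nonneg : 0 ≤ embC := Real.sqrt_nonneg _

theorem summable_mul_inv_jp {a : ℤ → ℂ} (ha : Summable fun k => ‖a k‖ ^ 2) :
    (Summable fun k => ‖a k‖ * (jp k)⁻¹) ∧
      ∑' k, ‖a k‖ * (jp k)⁻¹ ≤ Real.sqrt (∑' k, ‖a k‖ ^ 2) * embC := by
  have := summable_mul_and_tsum_le (f := fun k => ‖a k‖) (g := fun k => (jp k)⁻¹)
    (fun k => norm_nonneg _) (fun k => (inv_pos.2 (jp_pos k)).le) ha
    (by simpa using summable_jp_inv_sq)
  simpa [embC] using this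

theorem norm_inv_int_le (k : ℤ) : ‖(Complex.I * k)⁻¹‖ ≤ 2 * (jp k)⁻¹ := by
  by_cases hk : k = 0
  · simp [hk, jp]
  · have hk1 : (1 : ℝ) ≤ |(k : ℝ)| := by
      have := Int.one_le_abs hk
      exact_mod_cast this
    have h0 : 0 < |(k : ℝ)| := by linarith
    rw [norm_inv, norm_mul, Complex.norm_I, one_mul, Complex.norm_intCast]
    rw [← div_eq_mul_inv, inv_le_comm₀ h0 (div_pos two_pos (jp_pos k)), inv_div]
    simp only [jp]
    linarith

theorem norm_fourier (k : ℤ) : ‖(fourier k : C(Torus, ℂ))‖ = 1 := fourier_norm k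

theorem summable_antideriv (f : L2) :
    Summable fun k : ℤ => ‖((Complex.I * k)⁻¹ * coeff f k) • (fourier k : C(Torus, ℂ))‖ := by
  refine ((summable_mul_inv_jp (hasSum_norm_sq f).summable).1.mul_left 2).of_nonneg_of_le
    (fun k => norm_nonneg _) fun k => ?_
  rw [norm_smul, norm_fourier, mul_one, norm_mul]
  calc _ ≤ (2 * (jp k)⁻¹) * ‖coeff f k‖ := by gcongr; exact norm_inv_int_le k
    _ = _ := by ring

/-- The antiderivative of mean zero of (the mean zero part of) an element of `L²`. -/
def antideriv : L2 →L[ℂ] C(Torus, ℂ) :=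
  LinearMap.mkContinuous
    { toFun := fun f => ∑' k : ℤ, ((Complex.I * k)⁻¹ * coeff f k) • (fourier k : C(Torus, ℂ))
      map_add' := fun f g => by
        rw [← (summable_antideriv f).of_norm.tsum_add (summable_antideriv g).of_norm]
        congr 1; ext1 k
        rw [coeff_add, mul_add, add_smul]
      map_smul' := fun c f => by
        rw [RingHom.id_apply, ← (summable_antideriv f).of_norm.tsum_const_smul]
        congr 1; ext1 k
        rw [coeff_smul, smul_smul]; congr 1; ring }
    (2 * embC) (fun f => by
      refine (norm_tsum_le_tsum_norm (summable_antideriv f)).trans ?_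
      have h1 := summable_mul_inv_jp (hasSum_norm_sq f).summable
      calc _ ≤ ∑' k, 2 * (‖coeff f k‖ * (jp k)⁻¹) := by
            refine (summable_antideriv f).tsum_le_tsum (fun k => ?_) (h1.1.mul_left 2)
            rw [norm_smul, norm_fourier, mul_one, norm_mul]
            calc _ ≤ (2 * (jp k)⁻¹) * ‖coeff f k‖ := by gcongr; exact norm_inv_int_le k
              _ = _ := by ring
        _ ≤ 2 * (Real.sqrt (‖f‖ ^ 2) * embC) := by
            rw [tsum_mul_left]
            have h2 := h1.2
            rw [(hasSum_norm_sq f).tsum_eq] at h2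
            linarith
        _ = 2 * embC * ‖f‖ := by
            rw [Real.sqrt_sq (norm_nonneg _)]; ring)

theorem norm_antideriv_le (f : L2) : ‖antideriv f‖ ≤ 2 * embC * ‖f‖ :=
  (LinearMap.mkContinuous_norm_le _ (mul_nonneg two_pos.le embC_nonneg) _ |> fun h =>
    (ContinuousLinearMap.le_opNorm antideriv f).trans (by gcongr; exact h))

theorem fourierCoeff_antideriv (f : L2) (k : ℤ) :
    fourierCoeff (antideriv f) k = (Complex.I * k)⁻¹ * coeff f k := by
  have h1 : HasSum (fun k : ℤ => ((Complex.I * k)⁻¹ * coeff f k) • (fourier k : C(Torus, ℂ)))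
      (antideriv f) := (summable_antideriv f).of_norm.hasSum
  have h2 := (h1.mapL cl).mapL (innerSL ℂ (eb k))
  simp only [innerSL_apply_apply, map_smul, ← coeff_eq_inner, coeff_cl] at h2
  refine h2.unique ?_
  refine (hasSum_ite_eq k ((Complex.I * k)⁻¹ * coeff f k)).congr_fun fun j => ?_
  rw [← coeff_cl, ← eb, coeff_eb]
  by_cases h : j = k
  · subst h; simp
  · rw [if_neg h, if_neg (Ne.symm h), smul_zero]

/-- The continuous representative of an element of `H¹`. -/
theorem WD.eq_cl {f g : L2} (h : WD f g) : f = cl (coeff f 0 • 1 + antideriv g) := by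
  refine L2_ext fun k => ?_
  rw [coeff_cl, fourierCoeff_add', fourierCoeff_antideriv, h]
  have : fourierCoeff (coeff f 0 • 1 : C(Torus, ℂ)) k = coeff f 0 * if k = 0 then 1 else 0 := by
    rw [← coeff_cl, map_smul, coeff_smul, coeff_cl, fourierCoeff_one]
  rw [this]
  by_cases hk : k = 0
  · simp [hk]
  · have : (k : ℂ) ≠ 0 := by exact_mod_cast hk
    rw [if_neg hk]
    field_simp
    simp

/-- A function with summable `(1 + |k|) |a k|` is continuously differentiable. -/
theorem exists_hasTDeriv {f : C(Torus, ℂ)} (h : wn 1 (fourierCoeff f) ≠ ⊤) :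
    ∃ f' : C(Torus, ℂ), HasTDeriv f f' := by
  have h0 : wn 0 (fourierCoeff f) ≠ ⊤ := ((wn_mono zero_le_one _).trans_lt h.lt_top).ne
  have hs : Summable fun k : ℤ => ‖Complex.I * k * fourierCoeff f k‖ := by
    refine (summable_of_wn h).of_nonneg_of_le (fun k => norm_nonneg _) fun k => ?_
    rw [norm_mul, norm_mul, Complex.norm_I, one_mul, Complex.norm_intCast, pow_one]
    gcongr
    exact abs_le_jp k
  have hs2 : Summable fun k : ℤ =>
      ‖(Complex.I * k * fourierCoeff f k) • (fourier k : C(Torus, ℂ))‖ := by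
    simpa only [norm_smul, norm_fourier, mul_one] using hs
  refine ⟨∑' k : ℤ, (Complex.I * k * fourierCoeff f k) • (fourier k : C(Torus, ℂ)), fun x => ?_⟩
  have h1 := hasSum_fourier_of_wn h0
  have h2 := hasDerivAt_tsum (u := fun k : ℤ => ‖Complex.I * k * fourierCoeff f k‖) hs
    (g := fun (k : ℤ) (s : ℝ) => fourierCoeff f k * fourier k (x + (s : Torus)))
    (g' := fun (k : ℤ) (s : ℝ) =>
      fourierCoeff f k * (Complex.I * k * fourier k (x + (s : Torus))))
    (fun k s => ((hasTDeriv_fourier k).hasDerivAt x s).const_mul _)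
    (fun k s => by
      have h4 : ‖fourier k (x + (s : Torus))‖ = 1 := by rw [fourier_apply, Circle.norm_coe]
      rw [norm_mul, norm_mul, h4, norm_mul (Complex.I * k), mul_one, mul_comm])
    (y₀ := 0) (by
      have := (ContinuousMap.hasSum_apply h1 (x + ((0 : ℝ) : Torus))).summable
      simpa using this) 0
  refine (h2.congr_deriv ?_).congr_of_eventuallyEq (Eventually.of_forall fun s => ?_)
  · have h3 := ContinuousMap.hasSum_apply hs2.of_norm.hasSum x
    rw [← h3.tsum_eq]
    congr 1; ext k
    simp only [QuotientAddGroup.mk_zero, add_zero, ContinuousMap.smul_apply, smul_eq_mul]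
    ring
  · have h3 := ContinuousMap.hasSum_apply h1 (x + (s : Torus))
    simp only [← h3.tsum_eq, ContinuousMap.smul_apply, smul_eq_mul]

theorem exists_hasTDeriv_real {f : C(Torus, ℝ)} (h : wn 1 (realCoeff f) ≠ ⊤) :
    ∃ f' : C(Torus, ℝ), HasTDeriv f f' := by
  obtain ⟨F, hF⟩ := exists_hasTDeriv (f := ofR f) h
  exact ⟨⟨fun x => (F x).re, by fun_prop⟩, hF.re⟩

theorem realCoeff_deriv {f f' : C(Torus, ℝ)} (h : HasTDeriv f f') (k : ℤ) :
    realCoeff f' k = Complex.I * k * realCoeff f k :=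
  fourierCoeff_deriv (f := ofR f) (f' := ofR f') h.ofReal k

theorem wn_deriv_le (N : ℕ) {f f' : C(Torus, ℝ)} (h : HasTDeriv f f') :
    wn N (realCoeff f') ≤ wn (N + 1) (realCoeff f) := by
  refine ENNReal.tsum_le_tsum fun k => ?_
  rw [realCoeff_deriv h, enorm_mul, ← mul_assoc, pow_succ,
    ENNReal.ofReal_mul (pow_nonneg (jp_pos k).le N)]
  gcongr
  rw [← ofReal_norm, norm_mul, Complex.norm_I, one_mul, Complex.norm_intCast]
  exact ENNReal.ofReal_le_ofReal (abs_le_jp k)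

/-- The mean zero antiderivative of a real valued function. -/
theorem exists_antideriv_real {e : C(Torus, ℝ)} (h : wn 0 (realCoeff e) ≠ ⊤)
    (h0 : realCoeff e 0 = 0) :
    ∃ β : C(Torus, ℝ), HasTDeriv β e ∧ ofR β = antideriv (cl (ofR e)) := by
  set F := antideriv (cl (ofR e)) with hF
  have hc : ∀ k, fourierCoeff F k = (Complex.I * k)⁻¹ * realCoeff e k := by
    intro k
    rw [hF, fourierCoeff_antideriv, coeff_cl]; rfl
  have hreal : star F = F := by
    refine continuousMap_ext_coeff fun k => ?_
    have h1 : fourierCoeff (star F : C(Torus, ℂ)) k = conj (fourierCoeff F (-k)) := by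
      simp only [fourierCoeff, ← integral_conj]
      congr 1; ext x
      simp only [ContinuousMap.star_apply, smul_eq_mul, map_mul, ← fourier_neg, RCLike.star_def, neg_neg]
    rw [h1, hc, hc, realCoeff_neg]
    simp
  have hre : ∀ x, ((F x).re : ℂ) = F x := by
    intro x
    have := DFunLike.congr_fun hreal x
    exact Complex.conj_eq_iff_re.1 this
  have hβ : ofR ⟨fun x => (F x).re, by fun_prop⟩ = F := by
    ext x; simp [hre]
  refine ⟨⟨fun x => (F x).re, by fun_prop⟩, ?_, hβ⟩
  have hw : wn 1 (fourierCoeff F) ≠ ⊤ := by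
    refine ((?_ : wn 1 (fourierCoeff F) ≤ ENNReal.ofReal 2 * wn 0 (realCoeff e)).trans_lt
      (ENNReal.mul_lt_top ENNReal.ofReal_lt_top h.lt_top)).ne
    rw [wn, wn, ← ENNReal.tsum_mul_left]
    refine ENNReal.tsum_le_tsum fun k => ?_
    rw [hc, enorm_mul, ← mul_assoc, pow_zero, ENNReal.ofReal_one, one_mul, pow_one, ← ofReal_norm,
      ← ENNReal.ofReal_mul (jp_pos k).le]
    gcongr
    calc _ ≤ jp k * (2 * (jp k)⁻¹) :=
          mul_le_mul_of_nonneg_left (norm_inv_int_le k) (jp_pos k).le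
      _ = 2 := by field_simp [(jp_pos k).ne']
  obtain ⟨F', hF'⟩ := exists_hasTDeriv hw
  have hF'e : F' = ofR e := by
    refine continuousMap_ext_coeff fun k => ?_
    rw [fourierCoeff_deriv hF', hc, fourierCoeff_ofR]
    by_cases hk : k = 0
    · simp [hk, h0]
    · have : (k : ℂ) ≠ 0 := by exact_mod_cast hk
      field_simp
  rw [hF'e] at hF'
  exact hF'.re

/-! ### Sobolev norms in terms of derivatives in `L²` -/

theorem sobolevNorm_eq {s : ℝ} {f : Torus → ℝ}
    (h : Summable fun k : ℤ => (1 + (k : ℝ) ^ 2) ^ s * ‖realCoeff f k‖ ^ 2) :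
    sobolevNorm s f =
      ENNReal.ofReal (Real.sqrt (∑' k : ℤ, (1 + (k : ℝ) ^ 2) ^ s * ‖realCoeff f k‖ ^ 2)) := by
  have hnn : ∀ k : ℤ, 0 ≤ (1 + (k : ℝ) ^ 2) ^ s * ‖realCoeff f k‖ ^ 2 := fun k => by positivity
  rw [sobolevNorm, Real.sqrt_eq_rpow,
    ← ENNReal.ofReal_rpow_of_nonneg (tsum_nonneg hnn) (by norm_num),
    ENNReal.ofReal_tsum_of_nonneg hnn h]
  congr 2; ext1 k
  rw [ENNReal.ofReal_mul (by positivity), ENNReal.ofReal_pow (norm_nonneg _), ofReal_norm]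

theorem summable_of_sobolevNorm {s : ℝ} {f : Torus → ℝ} (h : sobolevNorm s f < ⊤) :
    Summable fun k : ℤ => (1 + (k : ℝ) ^ 2) ^ s * ‖realCoeff f k‖ ^ 2 := by
  have h1 : ∑' k : ℤ, ENNReal.ofReal ((1 + (k : ℝ) ^ 2) ^ s) * ‖realCoeff f k‖ₑ ^ 2 ≠ ⊤ := by
    intro h2
    rw [sobolevNorm, h2, ENNReal.top_rpow_of_pos (by norm_num)] at h
    exact lt_irrefl _ h
  refine (ENNReal.summable_toReal h1).congr fun k => ?_
  rw [ENNReal.toReal_mul, ENNReal.toReal_ofReal (by positivity), ENNReal.toReal_pow, toReal_enorm]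

theorem sobolevNorm_mono {s t : ℝ} (h : s ≤ t) (f : Torus → ℝ) :
    sobolevNorm s f ≤ sobolevNorm t f := by
  rw [sobolevNorm, sobolevNorm]
  gcongr with k
  nlinarith [sq_nonneg (k : ℝ)]

theorem norm_sq_eq_tsum (u : L2) : ‖u‖ ^ 2 = ∑' k, ‖coeff u k‖ ^ 2 := (hasSum_norm_sq u).tsum_eq.symm

theorem WD.norm_coeff_sq {u u' : L2} (h : WD u u') (k : ℤ) :
    ‖coeff u' k‖ ^ 2 = (k : ℝ) ^ 2 * ‖coeff u k‖ ^ 2 := by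
  rw [h, norm_mul, norm_mul, Complex.norm_I, one_mul, Complex.norm_intCast, mul_pow, sq_abs]

theorem sobolevNorm_one_eq {f : Torus → ℝ} {u u' : L2} (hf : ∀ k, coeff u k = realCoeff f k)
    (h : WD u u') : sobolevNorm 1 f = ENNReal.ofReal (Real.sqrt (‖u‖ ^ 2 + ‖u'‖ ^ 2)) := by
  have h1 : HasSum (fun k : ℤ => (1 + (k : ℝ) ^ 2) ^ (1 : ℝ) * ‖realCoeff f k‖ ^ 2)
      (‖u‖ ^ 2 + ‖u'‖ ^ 2) := by
    refine ((hasSum_norm_sq u).add (hasSum_norm_sq u')).congr_fun fun k => ?_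
    rw [h.norm_coeff_sq, Real.rpow_one, ← hf]; ring
  rw [sobolevNorm_eq h1.summable, h1.tsum_eq]

theorem sobolevNorm_two_eq {f : Torus → ℝ} {u u' u'' : L2} (hf : ∀ k, coeff u k = realCoeff f k)
    (h : WD u u') (h' : WD u' u'') :
    sobolevNorm 2 f = ENNReal.ofReal (Real.sqrt (‖u‖ ^ 2 + 2 * ‖u'‖ ^ 2 + ‖u''‖ ^ 2)) := by
  have h1 : HasSum (fun k : ℤ => (1 + (k : ℝ) ^ 2) ^ (2 : ℝ) * ‖realCoeff f k‖ ^ 2)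
      (‖u‖ ^ 2 + 2 * ‖u'‖ ^ 2 + ‖u''‖ ^ 2) := by
    refine (((hasSum_norm_sq u).add ((hasSum_norm_sq u').mul_left 2)).add
      (hasSum_norm_sq u'')).congr_fun fun k => ?_
    have h3 : (2 : ℝ) = (2 : ℕ) := by norm_num
    rw [h'.norm_coeff_sq, h.norm_coeff_sq, h3, Real.rpow_natCast, ← hf]; push_cast; ring
  rw [sobolevNorm_eq h1.summable, h1.tsum_eq]

theorem sobolevNorm_one_le {f : Torus → ℝ} {u u' : L2} (hf : ∀ k, coeff u k = realCoeff f k)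
    (h : WD u u') : sobolevNorm 1 f ≤ ENNReal.ofReal (‖u‖ + ‖u'‖) := by
  rw [sobolevNorm_one_eq hf h]
  refine ENNReal.ofReal_le_ofReal (Real.sqrt_le_iff.2 ⟨by positivity, ?_⟩)
  nlinarith [norm_nonneg u, norm_nonneg u', mul_nonneg (norm_nonneg u) (norm_nonneg u')]

theorem sobolevNorm_two_le {f : Torus → ℝ} {u u' u'' : L2} (hf : ∀ k, coeff u k = realCoeff f k)
    (h : WD u u') (h' : WD u' u'') :
    sobolevNorm 2 f ≤ ENNReal.ofReal (2 * (‖u‖ + ‖u'‖ + ‖u''‖)) := by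
  rw [sobolevNorm_two_eq hf h h']
  refine ENNReal.ofReal_le_ofReal (Real.sqrt_le_iff.2 ⟨by positivity, ?_⟩)
  nlinarith [norm_nonneg u, norm_nonneg u', norm_nonneg u'',
    mul_nonneg (norm_nonneg u) (norm_nonneg u'), mul_nonneg (norm_nonneg u) (norm_nonneg u''),
    mul_nonneg (norm_nonneg u') (norm_nonneg u'')]

theorem le_sobolevNorm_one {f : Torus → ℝ} {u u' : L2} (hf : ∀ k, coeff u k = realCoeff f k)
    (h : WD u u') : ENNReal.ofReal ‖u‖ ≤ sobolevNorm 1 f ∧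
      ENNReal.ofReal ‖u'‖ ≤ sobolevNorm 1 f := by
  rw [sobolevNorm_one_eq hf h]
  exact ⟨ENNReal.ofReal_le_ofReal (Real.le_sqrt_of_sq_le (by nlinarith [sq_nonneg ‖u'‖])),
    ENNReal.ofReal_le_ofReal (Real.le_sqrt_of_sq_le (by nlinarith [sq_nonneg ‖u‖]))⟩

theorem le_sobolevNorm_two {f : Torus → ℝ} {u u' u'' : L2} (hf : ∀ k, coeff u k = realCoeff f k)
    (h : WD u u') (h' : WD u' u'') : ENNReal.ofReal ‖u''‖ ≤ sobolevNorm 2 f := by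
  rw [sobolevNorm_two_eq hf h h']
  exact ENNReal.ofReal_le_ofReal
    (Real.le_sqrt_of_sq_le (by nlinarith [sq_nonneg ‖u‖, sq_nonneg ‖u'‖]))

theorem summable_coeff_sq_of_sobolevNorm {s : ℝ} (hs : 0 ≤ s) {f : Torus → ℝ}
    (h : sobolevNorm s f < ⊤) : Summable fun k => ‖realCoeff f k‖ ^ 2 := by
  refine (summable_of_sobolevNorm h).of_nonneg_of_le (fun k => by positivity) fun k => ?_
  have : 1 ≤ (1 + (k : ℝ) ^ 2) ^ s := Real.one_le_rpow (by nlinarith [sq_nonneg (k : ℝ)]) hs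
  nlinarith [sq_nonneg ‖realCoeff f k‖]

/-- A function in `H¹` has a derivative in `L²`. -/
theorem exists_WD_one {f : Torus → ℝ} (h : sobolevNorm 1 f < ⊤) :
    ∃ u u' : L2, (∀ k, coeff u k = realCoeff f k) ∧ WD u u' := by
  have h1 := summable_coeff_sq_of_sobolevNorm zero_le_one h
  have h2 : Summable fun k : ℤ => ‖Complex.I * k * realCoeff f k‖ ^ 2 := by
    refine (summable_of_sobolevNorm h).of_nonneg_of_le (fun k => by positivity) fun k => ?_
    rw [norm_mul, norm_mul, Complex.norm_I, one_mul, Complex.norm_intCast, mul_pow, sq_abs,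
      Real.rpow_one]
    nlinarith [sq_nonneg ‖realCoeff f k‖]
  refine ⟨ofCoeff _ h1, ofCoeff _ h2, fun k => coeff_ofCoeff _ _ _, fun k => ?_⟩
  rw [coeff_ofCoeff, coeff_ofCoeff]

theorem exists_WD_two {f : Torus → ℝ} (h : sobolevNorm 2 f < ⊤) {u u' : L2}
    (hf : ∀ k, coeff u k = realCoeff f k) (hu : WD u u') : ∃ u'' : L2, WD u' u'' := by
  have h2 : Summable fun k : ℤ => ‖Complex.I * k * coeff u' k‖ ^ 2 := by
    refine (summable_of_sobolevNorm h).of_nonneg_of_le (fun k => by positivity) fun k => ?_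
    have h3 : (2 : ℝ) = (2 : ℕ) := by norm_num
    rw [norm_mul, norm_mul, Complex.norm_I, one_mul, Complex.norm_intCast, mul_pow, sq_abs,
      hu.norm_coeff_sq, h3, Real.rpow_natCast, hf, ← mul_assoc]
    gcongr
    nlinarith [sq_nonneg (k : ℝ)]
  exact ⟨ofCoeff _ h2, fun k => coeff_ofCoeff _ _ _⟩

theorem coeff_toLp {f : Torus → ℂ} (h : MemLp f 2 dx) (k : ℤ) :
    coeff h.toLp k = fourierCoeff f k := by
  have h1 := h.coeFn_toLp
  exact congrFun (fourierCoeff_congr_ae h1) k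

theorem realCoeff_sub_of_memLp {f g : Torus → ℝ} (hf : MemLp f 2 dx) (hg : MemLp g 2 dx) (k : ℤ) :
    realCoeff (fun x => f x - g x) k = realCoeff f k - realCoeff g k := by
  have h1 : MemLp (fun x => (f x : ℂ)) 2 dx := hf.ofReal
  have h2 : MemLp (fun x => (g x : ℂ)) 2 dx := hg.ofReal
  have h3 : MemLp (fun x => ((f x - g x : ℝ) : ℂ)) 2 dx := (hf.sub hg).ofReal
  rw [realCoeff, realCoeff, realCoeff, ← coeff_toLp h1, ← coeff_toLp h2, ← coeff_toLp h3,
    ← coeff_sub, ← MemLp.toLp_sub]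
  congr 1
  refine MemLp.toLp_congr _ _ (ae_of_all _ fun x => ?_)
  simp

theorem ae_eq_of_realCoeff {f : Torus → ℝ} (hf : MemLp f 2 dx) {F : C(Torus, ℝ)}
    (h : ∀ k, realCoeff f k = realCoeff F k) : f =ᵐ[dx] F := by
  have h1 : MemLp (fun x => (f x : ℂ)) 2 dx := hf.ofReal
  have h2 : h1.toLp = cl (ofR F) := L2_ext fun k => by
    rw [coeff_toLp, coeff_cl]; exact h k
  have h3 := h1.coeFn_toLp
  rw [h2] at h3
  filter_upwards [h3, coeFn_cl (ofR F)] with x hx hx2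
  rw [hx2, ofR_apply] at hx
  exact_mod_cast hx.symm

/-! ### The Wiener norm is controlled by Sobolev norms -/

theorem wn_le_sqrt {N : ℕ} {a : ℤ → ℂ} (h : Summable fun k => (jp k ^ (N + 1) * ‖a k‖) ^ 2) :
    wn N a ≤ ENNReal.ofReal (embC * Real.sqrt (∑' k, (jp k ^ (N + 1) * ‖a k‖) ^ 2)) := by
  have h1 := summable_mul_and_tsum_le (f := fun k => jp k ^ (N + 1) * ‖a k‖)
    (g := fun k => (jp k)⁻¹) (fun k => mul_nonneg (pow_nonneg (jp_pos k).le _) (norm_nonneg _))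
    (fun k => (inv_pos.2 (jp_pos k)).le) h (by simpa using summable_jp_inv_sq)
  have h2 : ∀ k, jp k ^ (N + 1) * ‖a k‖ * (jp k)⁻¹ = jp k ^ N * ‖a k‖ := by
    intro k
    have := (jp_pos k).ne'
    field_simp
    ring
  simp only [h2] at h1
  rw [wn_eq_ofReal h1.1]
  refine ENNReal.ofReal_le_ofReal (h1.2.trans (le_of_eq ?_))
  simp [embC, mul_comm]

theorem jp_pow_sq_le (N : ℕ) (k : ℤ) :
    (jp k ^ (N + 1)) ^ 2 ≤ 2 ^ (N + 1) * (1 + (k : ℝ) ^ 2) ^ (N + 1) := by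
  rw [← pow_mul, mul_comm (N + 1), pow_mul, ← mul_pow]
  have := jp_pos k
  gcongr
  exact jp_sq_le k

/-- The constant in `wn_le_sobolevNorm` and `wn_le_of_interpolation`. -/
def wienerC (N : ℕ) : ℝ := embC * 2 ^ (N + 1)

/-- The Cauchy–Schwarz inequality costs one power of the weight. -/
theorem wn_le_sobolevNorm (N : ℕ) {f : Torus → ℝ} {s : ℝ} (hs : (N + 1 : ℕ) ≤ s)
    (h : sobolevNorm s f < ⊤) :
    wn N (realCoeff f) ≤ ENNReal.ofReal (wienerC N) * sobolevNorm s f := by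
  have h0 := (sobolevNorm_mono hs f).trans_lt h
  have h1 := summable_of_sobolevNorm h0
  refine le_trans ?_ (mul_le_mul_right (sobolevNorm_mono hs f) _)
  rw [sobolevNorm_eq h1]
  simp only [Real.rpow_natCast] at h1 ⊢
  have hle : ∀ k : ℤ, (jp k ^ (N + 1) * ‖realCoeff f k‖) ^ 2 ≤
      2 ^ (N + 1) * ((1 + (k : ℝ) ^ 2) ^ (N + 1) * ‖realCoeff f k‖ ^ 2) := by
    intro k
    rw [mul_pow, ← mul_assoc]
    gcongr
    exact jp_pow_sq_le N k
  have h2 : Summable fun k => (jp k ^ (N + 1) * ‖realCoeff f k‖) ^ 2 :=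
    (h1.mul_left (2 ^ (N + 1))).of_nonneg_of_le (fun k => by positivity) hle
  refine (wn_le_sqrt h2).trans ?_
  rw [wienerC, ← ENNReal.ofReal_mul (mul_nonneg embC_nonneg (by positivity)), mul_assoc]
  refine ENNReal.ofReal_le_ofReal (mul_le_mul_of_nonneg_left ?_ embC_nonneg)
  have h3 := h2.tsum_le_tsum hle (h1.mul_left (2 ^ (N + 1)))
  rw [tsum_mul_left] at h3
  refine (Real.sqrt_le_sqrt h3).trans ?_
  rw [Real.sqrt_mul (by positivity)]
  gcongr
  rw [Real.sqrt_le_left (by positivity)]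
  have : (1 : ℝ) ≤ 2 ^ (N + 1) := one_le_pow₀ (by norm_num)
  nlinarith

/-- Interpolation between `L²` and a Sobolev space of high order. -/
theorem wn_le_of_interpolation (N : ℕ) {f : Torus → ℝ} {δ : ℝ} (hδ : 0 ≤ δ)
    (h : sobolevNorm (2 * (N + 1) : ℕ) f ≤ 1) (h2 : ∑' k, ‖realCoeff f k‖ ^ 2 ≤ δ ^ 2) :
    wn N (realCoeff f) ≤ ENNReal.ofReal (wienerC N * Real.sqrt δ) := by
  have h1 := summable_of_sobolevNorm (h.trans_lt ENNReal.one_lt_top)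
  have hs := summable_coeff_sq_of_sobolevNorm (Nat.cast_nonneg _) (h.trans_lt ENNReal.one_lt_top)
  rw [sobolevNorm_eq h1, ENNReal.ofReal_le_one, Real.sqrt_le_one] at h
  simp only [Real.rpow_natCast] at h h1
  have hsq : ∀ k : ℤ, (1 + (k : ℝ) ^ 2) ^ (2 * (N + 1)) * ‖realCoeff f k‖ ^ 2 =
      ((1 + (k : ℝ) ^ 2) ^ (N + 1) * ‖realCoeff f k‖) ^ 2 := by
    intro k; rw [mul_pow, ← pow_mul, mul_comm (N + 1)]
  simp only [hsq] at h h1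
  have h3 := summable_mul_and_tsum_le
    (f := fun k : ℤ => (1 + (k : ℝ) ^ 2) ^ (N + 1) * ‖realCoeff f k‖)
    (g := fun k => ‖realCoeff f k‖) (fun k => by positivity) (fun k => by positivity) h1 hs
  have h4 : ∑' k : ℤ, (1 + (k : ℝ) ^ 2) ^ (N + 1) * ‖realCoeff f k‖ * ‖realCoeff f k‖ ≤ δ := by
    refine h3.2.trans ?_
    calc _ ≤ 1 * Real.sqrt (δ ^ 2) := by
          gcongr
          rwa [Real.sqrt_le_one]
      _ = δ := by rw [one_mul, Real.sqrt_sq hδ]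
  have hle : ∀ k : ℤ, (jp k ^ (N + 1) * ‖realCoeff f k‖) ^ 2 ≤
      2 ^ (N + 1) * ((1 + (k : ℝ) ^ 2) ^ (N + 1) * ‖realCoeff f k‖ * ‖realCoeff f k‖) := by
    intro k
    rw [mul_pow, mul_assoc, ← sq, ← mul_assoc]
    gcongr
    exact jp_pow_sq_le N k
  have h5 : Summable fun k => (jp k ^ (N + 1) * ‖realCoeff f k‖) ^ 2 :=
    (h3.1.mul_left (2 ^ (N + 1))).of_nonneg_of_le (fun k => by positivity) hle
  refine (wn_le_sqrt h5).trans (ENNReal.ofReal_le_ofReal ?_)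
  rw [wienerC, mul_assoc]
  refine mul_le_mul_of_nonneg_left ?_ embC_nonneg
  have h6 := h5.tsum_le_tsum hle (h3.1.mul_left (2 ^ (N + 1)))
  rw [tsum_mul_left] at h6
  refine (Real.sqrt_le_sqrt (h6.trans (mul_le_mul_of_nonneg_left h4 (by positivity)))).trans ?_
  rw [Real.sqrt_mul (by positivity)]
  gcongr
  rw [Real.sqrt_le_left (by positivity)]
  have : (1 : ℝ) ≤ 2 ^ (N + 1) := one_le_pow₀ (by norm_num)
  nlinarith

/-! ### Changes of variables of the torus acting on `L²` -/

theorem measurePreserving_of_integral {G : Torus → Torus} (hG : Continuous G) {w : C(Torus, ℝ)}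
    (hw : ∀ x, 0 < w x) (h : ∀ f : C(Torus, ℂ), ∫ x, (w x : ℂ) * f (G x) ∂dx = ∫ x, f x ∂dx) :
    MeasurePreserving G (dx.withDensity fun x => ENNReal.ofReal (w x)) dx := by
  have hm : Measurable fun x => (w x).toNNReal := w.continuous.measurable.real_toNNReal
  have hfin : IsFiniteMeasure (dx.withDensity fun x => ENNReal.ofReal (w x)) :=
    isFiniteMeasure_withDensity_ofReal
      ((w.continuous.integrable_of_hasCompactSupport (HasCompactSupport.of_compactSpace _)).2)
  refine ⟨hG.measurable, ?_⟩
  refine ext_of_forall_integral_eq_of_IsFiniteMeasure fun f => ?_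
  rw [integral_map hG.aemeasurable f.continuous.aestronglyMeasurable]
  change ∫ x, f (G x) ∂(dx.withDensity fun x => ((w x).toNNReal : ℝ≥0∞)) = _
  rw [integral_withDensity_eq_integral_smul hm]
  have h1 := h ⟨fun x => (f x : ℂ), by fun_prop⟩
  simp only [ContinuousMap.coe_mk, ← Complex.ofReal_mul] at h1
  rw [integral_complex_ofReal, integral_complex_ofReal] at h1
  rw [← Complex.ofReal_injective h1]
  congr 1; ext x
  simp [NNReal.smul_def, (hw x).le]

/-- A continuous map of the torus that carries the measure of density `w` to `dx`. -/
structure WMap where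
  /-- the map -/
  G : C(Torus, Torus)
  /-- the density -/
  w : C(Torus, ℝ)
  pos : ∀ x, 0 < w x
  integral_eq : ∀ f : C(Torus, ℂ), ∫ x, (w x : ℂ) * f (G x) ∂dx = ∫ x, f x ∂dx

namespace WMap

variable (M : WMap)

theorem measurePreserving :
    MeasurePreserving M.G (dx.withDensity fun x => ENNReal.ofReal (M.w x)) dx :=
  measurePreserving_of_integral M.G.continuous M.pos M.integral_eq

theorem quasiMeasurePreserving : Measure.QuasiMeasurePreserving M.G dx dx := by
  refine M.measurePreserving.quasiMeasurePreserving.mono_left ?_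
  refine withDensity_absolutelyContinuous' ?_ (ae_of_all _ fun x => ?_)
  · exact (M.w.continuous.measurable.ennreal_ofReal).aemeasurable
  · exact (ENNReal.ofReal_pos.2 (M.pos x)).ne'

/-- The function `√w (h ∘ G)`. -/
def fn (h : Torus → ℂ) (x : Torus) : ℂ := (Real.sqrt (M.w x) : ℂ) * h (M.G x)

theorem eLpNorm_fn (h : L2) : eLpNorm (M.fn h) 2 dx = eLpNorm h 2 dx := by
  have hh : Measurable h := (Lp.stronglyMeasurable h).measurable
  have h2 : ∀ x, ‖M.fn h x‖ₑ ^ (2 : ℝ) =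
      ENNReal.ofReal (M.w x) * (‖h (M.G x)‖ₑ ^ (2 : ℝ)) := by
    intro x
    rw [fn, enorm_mul, ENNReal.mul_rpow_of_nonneg _ _ (by norm_num)]
    congr 1
    rw [← ofReal_norm, Complex.norm_real, Real.norm_of_nonneg (Real.sqrt_nonneg _),
      ENNReal.ofReal_rpow_of_nonneg (Real.sqrt_nonneg _) (by norm_num), Real.rpow_two,
      Real.sq_sqrt (M.pos x).le]
  rw [eLpNorm_eq_lintegral_rpow_enorm_toReal (by norm_num) (by norm_num),
    eLpNorm_eq_lintegral_rpow_enorm_toReal (by norm_num) (by norm_num)]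
  simp only [ENNReal.toReal_ofNat, h2]
  congr 1
  have h3 : Measurable fun x => ‖h (M.G x)‖ₑ ^ (2 : ℝ) :=
    (hh.comp M.G.continuous.measurable).enorm.pow_const _
  rw [← M.measurePreserving.lintegral_comp (hh.enorm.pow_const _)]
  exact (lintegral_withDensity_eq_lintegral_mul _
    M.w.continuous.measurable.ennreal_ofReal h3).symm

theorem memLp_fn (h : L2) : MemLp (M.fn h) 2 dx := by
  refine ⟨?_, ?_⟩
  · refine AEStronglyMeasurable.mul ?_
      ((Lp.stronglyMeasurable h).aestronglyMeasurable.comp_quasiMeasurePreserving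
        M.quasiMeasurePreserving)
    exact (by fun_prop : Continuous fun x => (Real.sqrt (M.w x) : ℂ)).aestronglyMeasurable
  · rw [M.eLpNorm_fn]; exact (Lp.memLp h).2

/-- The isometry `h ↦ √w (h ∘ G)` of `L²`. -/
def iso : L2 →ₗᵢ[ℂ] L2 where
  toFun h := (M.memLp_fn h).toLp
  map_add' h h' := by
    rw [← MemLp.toLp_add]
    refine MemLp.toLp_congr _ _ ?_
    filter_upwards [M.quasiMeasurePreserving.ae_eq_comp (Lp.coeFn_add h h')] with x hx
    simp only [fn, Function.comp_apply, Pi.add_apply] at hx ⊢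
    rw [hx, mul_add]
  map_smul' c h := by
    rw [RingHom.id_apply, ← MemLp.toLp_const_smul]
    refine MemLp.toLp_congr _ _ ?_
    filter_upwards [M.quasiMeasurePreserving.ae_eq_comp (Lp.coeFn_smul c h)] with x hx
    simp only [fn, Function.comp_apply, Pi.smul_apply, smul_eq_mul] at hx ⊢
    rw [hx]; ring
  norm_map' h := by
    change ‖(M.memLp_fn h).toLp‖ = ‖h‖
    rw [Lp.norm_toLp, M.eLpNorm_fn, Lp.norm_def]

theorem coeFn_iso (h : L2) : (M.iso h : Torus → ℂ) =ᵐ[dx] M.fn h := (M.memLp_fn h).coeFn_toLp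

theorem iso_mulL (f : C(Torus, ℂ)) (h : L2) :
    M.iso (mulL f h) = mulL (f.comp M.G) (M.iso h) := by
  apply Lp.ext
  filter_upwards [M.coeFn_iso (mulL f h), M.coeFn_iso h, coeFn_mulL (f.comp M.G) (M.iso h),
    M.quasiMeasurePreserving.ae_eq_comp (coeFn_mulL f h)] with x h1 h2 h3 h4
  simp only [fn, Function.comp_apply] at h1 h2 h3 h4
  rw [h1, h3, h2, h4, ContinuousMap.comp_apply]; ring

theorem iso_cl (f : C(Torus, ℂ)) : M.iso (cl f) =
    cl ⟨fun x => (Real.sqrt (M.w x) : ℂ) * f (M.G x), by fun_prop⟩ := by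
  apply Lp.ext
  filter_upwards [M.coeFn_iso (cl f), coeFn_cl ⟨fun x => (Real.sqrt (M.w x) : ℂ) * f (M.G x), by fun_prop⟩,
    M.quasiMeasurePreserving.ae_eq_comp (coeFn_cl f)] with x h1 h2 h3
  simp only [fn, Function.comp_apply, ContinuousMap.coe_mk] at h1 h2 h3
  rw [h1, h2, h3]

end WMap

/-- The change of variables `y ↦ y + β(y)` of the torus, of derivative `d`. -/
structure Diffeo where
  /-- the displacement -/
  β : C(Torus, ℝ)
  /-- the derivative of the change of variables -/
  d : C(Torus, ℝ)
  hasTDeriv : HasTDeriv β (fun x => d x - 1)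
  abs_sub_le : ∀ x, |d x - 1| ≤ 1 / 4

namespace Diffeo

variable (D : Diffeo)

theorem d_ge (x : Torus) : 3 / 4 ≤ D.d x := by linarith [(abs_le.1 (D.abs_sub_le x)).1]

theorem d_le (x : Torus) : D.d x ≤ 5 / 4 := by linarith [(abs_le.1 (D.abs_sub_le x)).2]

theorem d_pos (x : Torus) : 0 < D.d x := by linarith [D.d_ge x]

/-- The change of variables. -/
def G : C(Torus, Torus) :=
  ⟨fun y => y + (D.β y : Torus),
    continuous_id.add ((AddCircle.continuous_mk' _).comp D.β.continuous)⟩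

theorem G_apply (y : Torus) : D.G y = y + (D.β y : Torus) := rfl

/-- The lift `s ↦ s + β(y + s) - β(y)` of the change of variables near `y`. -/
def lift (y : Torus) (s : ℝ) : ℝ := s + (D.β (y + (s : Torus)) - D.β y)

theorem G_add (y : Torus) (s : ℝ) : D.G (y + (s : Torus)) = D.G y + (D.lift y s : Torus) := by
  simp only [G_apply, lift, AddCircle.coe_add, AddCircle.coe_sub]
  abel

theorem lift_zero (y : Torus) : D.lift y 0 = 0 := by simp [lift]

theorem lift_two_pi (y : Torus) : D.lift y (2 * Real.pi) = 2 * Real.pi := by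
  simp [lift, AddCircle.coe_period (2 * Real.pi)]

theorem hasDerivAt_lift (y : Torus) (s : ℝ) :
    HasDerivAt (D.lift y) (D.d (y + (s : Torus))) s := by
  have := (hasDerivAt_id s).add ((D.hasTDeriv.hasDerivAt y s).sub_const (D.β y))
  refine this.congr_deriv (by ring)

theorem lift_strictMono (y : Torus) : StrictMono (D.lift y) :=
  strictMono_of_hasDerivAt_pos (D.hasDerivAt_lift y) fun _ => D.d_pos _

theorem exists_coe_eq (x : Torus) : ∃ s ∈ Ico (0 : ℝ) (2 * Real.pi), (s : Torus) = x := by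
  have h := (AddCircle.equivIco (2 * Real.pi) 0 x).2
  refine ⟨_, by simpa using h, AddCircle.coe_equivIco⟩

/-- The lift increases by `2π` on an interval of length `2π`. -/
theorem G_bijective : Function.Bijective D.G := by
  constructor
  · intro y₁ y₂ h
    obtain ⟨s, hs, hs'⟩ := exists_coe_eq (y₁ - y₂)
    have h1 : y₁ = y₂ + (s : Torus) := by rw [hs']; abel
    rw [h1, G_add, add_eq_left, AddCircle.coe_eq_zero_iff] at h
    obtain ⟨n, hn⟩ := h
    have h2 : 0 ≤ D.lift y₂ s := by
      rw [← D.lift_zero y₂]; exact (D.lift_strictMono y₂).monotone hs.1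
    have h3 : D.lift y₂ s < 2 * Real.pi := by
      have := D.lift_strictMono y₂ hs.2
      rwa [lift_two_pi] at this
    have hn0 : n = 0 := by
      rw [← hn, zsmul_eq_mul] at h2 h3
      have hpi := Real.two_pi_pos
      have h4 : (n : ℝ) < 1 := by nlinarith
      have h5 : (-1 : ℝ) < n := by nlinarith
      have h6 : n < 1 := by exact_mod_cast h4
      have h7 : -1 < n := by exact_mod_cast h5
      omega
    rw [hn0, zero_smul] at hn
    have h8 : s = 0 := (D.lift_strictMono y₂).injective (by rw [← hn, lift_zero])
    rw [h1, h8]; simp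
  · intro x
    obtain ⟨t, ht, ht'⟩ := exists_coe_eq (x - D.G 0)
    have hc : ContinuousOn (D.lift 0) (Icc 0 (2 * Real.pi)) :=
      fun s _ => (D.hasDerivAt_lift 0 s).continuousAt.continuousWithinAt
    have h1 := intermediate_value_Icc Real.two_pi_pos.le hc
    rw [lift_zero, lift_two_pi] at h1
    obtain ⟨s, -, hs⟩ := h1 ⟨ht.1, ht.2.le⟩
    exact ⟨0 + (s : Torus), by rw [G_add, hs, ht']; abel⟩

/-- The change of variables, as a homeomorphism. -/
def homeo : Torus ≃ₜ Torus :=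
  Continuous.homeoOfEquivCompactToT2 (f := Equiv.ofBijective D.G D.G_bijective) D.G.continuous

/-- The inverse change of variables. -/
def φ : C(Torus, Torus) := ⟨D.homeo.symm, D.homeo.symm.continuous⟩

theorem φ_G (y : Torus) : D.φ (D.G y) = y := D.homeo.symm_apply_apply y

theorem G_φ (x : Torus) : D.G (D.φ x) = x := D.homeo.apply_symm_apply x

theorem hasTDeriv_comp {E : Type*} [NormedAddCommGroup E] [NormedSpace ℝ E] {f f' : Torus → E}
    (h : HasTDeriv f f') : HasTDeriv (fun y => f (D.G y)) (fun y => D.d y • f' (D.G y)) := by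
  intro y
  have h1 := D.hasDerivAt_lift y 0
  have h2 := h.hasDerivAt (D.G y) (D.lift y 0)
  have h3 := HasDerivAt.scomp 0 h2 h1
  rw [lift_zero] at h3
  simp only [QuotientAddGroup.mk_zero, add_zero] at h3
  refine h3.congr_of_eventuallyEq (Eventually.of_forall fun s => ?_)
  simp only [Function.comp_apply, G_add]

/-- The displacement of the inverse change of variables. -/
def βinv : C(Torus, ℝ) := ⟨fun x => - D.β (D.φ x), by fun_prop⟩

theorem φ_eq (x : Torus) : D.φ x = x + (D.βinv x : Torus) := by
  have h := D.G_φ x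
  rw [G_apply] at h
  simp only [βinv, ContinuousMap.coe_mk, AddCircle.coe_neg]
  nth_rewrite 2 [← h]
  abel

/-- The inverse function theorem in one variable. -/
theorem hasTDeriv_βinv : HasTDeriv D.βinv (fun x => (D.d (D.φ x))⁻¹ - 1) := by
  intro x
  have key : ∀ s : ℝ, D.φ (x + (s : Torus)) =
      D.φ x + ((s + (D.βinv (x + (s : Torus)) - D.βinv x) : ℝ) : Torus) := by
    intro s
    rw [φ_eq, φ_eq, AddCircle.coe_add, AddCircle.coe_sub]; abel
  set h : ℝ → ℝ := fun s => s + (D.βinv (x + (s : Torus)) - D.βinv x) with hh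
  have hinv : ∀ s, D.lift (D.φ x) (h s) = s := by
    intro s
    rw [lift, ← key]
    simp only [hh, βinv, ContinuousMap.coe_mk]
    ring
  have h0 : h 0 = 0 := by simp [hh]
  have hcont : ContinuousAt h 0 := by
    have h1 : Continuous h := by
      have h2 : Continuous fun s : ℝ => x + (s : Torus) :=
        continuous_const.add (AddCircle.continuous_mk' _)
      have h3 := D.βinv.continuous.comp h2
      exact continuous_id.add (h3.sub continuous_const)
    exact h1.continuousAt
  have hd : HasDerivAt (D.lift (D.φ x)) (D.d (D.φ x)) (h 0) := by
    have := D.hasDerivAt_lift (D.φ x) (h 0)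
    rw [h0] at this ⊢
    simpa using this
  have h1 := HasDerivAt.of_local_left_inverse hcont hd (D.d_pos _).ne'
    (Eventually.of_forall hinv)
  have h2 := (h1.sub (hasDerivAt_id 0)).add_const (D.βinv x)
  refine h2.congr_of_eventuallyEq (Eventually.of_forall fun s => ?_)
  simp [hh]

/-- The change of variables in the integral, done on an interval of length `2π`. -/
theorem integral_G (f : C(Torus, ℂ)) : ∫ x, (D.d x : ℂ) * f (D.G x) ∂dx = ∫ x, f x ∂dx := by
  have key : ∀ (F : Torus → ℂ) (a : ℝ), ∫ x, F x ∂dx =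
      (1 / (2 * Real.pi)) • ∫ s in a..a + 2 * Real.pi, F (s : Torus) := by
    intro F a
    have := fourierCoeff_eq_intervalIntegral (T := 2 * Real.pi) F 0 a
    simpa [fourierCoeff] using this
  rw [key _ 0, key f (D.β 0)]
  congr 1
  set r : ℝ → ℝ := fun s => s + D.β (s : Torus)
  have hr : ∀ s : ℝ, HasDerivAt r (D.d (s : Torus)) s := by
    intro s
    refine ((hasDerivAt_id s).add (D.hasTDeriv.hasDerivAt_coe s)).congr_deriv (by ring)
  have hc : Continuous fun s : ℝ => f (s : Torus) :=
    f.continuous.comp (AddCircle.continuous_mk' _)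
  have hdc : Continuous fun s : ℝ => D.d (s : Torus) :=
    D.d.continuous.comp (AddCircle.continuous_mk' _)
  have h1 := intervalIntegral.integral_deriv_smul_comp (a := 0) (b := 0 + 2 * Real.pi)
    (f := r) (f' := fun s => D.d (s : Torus)) (g := fun s : ℝ => f (s : Torus))
    (fun s _ => hr s) hdc.continuousOn hc
  have h2 : r 0 = D.β 0 := by simp [r]
  have h3 : r (0 + 2 * Real.pi) = D.β 0 + 2 * Real.pi := by
    simp [r, AddCircle.coe_period (2 * Real.pi), add_comm]
  rw [h2, h3] at h1
  rw [← h1]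
  simp only [Function.comp_apply, Complex.real_smul, r, G_apply, AddCircle.coe_add]

/-- The change of variables with its Jacobian. -/
def wmap : WMap := ⟨D.G, D.d, D.d_pos, D.integral_G⟩

/-- The Jacobian of the inverse. -/
def J : C(Torus, ℝ) :=
  ⟨fun x => (D.d (D.φ x))⁻¹, Continuous.inv₀ (by fun_prop) fun x => (D.d_pos _).ne'⟩

/-- The inverse change of variables with its Jacobian. -/
def wmapInv : WMap := ⟨D.φ, D.J, fun x => inv_pos.2 (D.d_pos _), fun f => by
  have h1 := D.integral_G ⟨fun x => (D.J x : ℂ) * f (D.φ x), by fun_prop⟩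
  simp only [ContinuousMap.coe_mk] at h1
  rw [← h1]
  congr 1; ext y
  have := (D.d_pos y).ne'
  have h : (D.d y : ℂ) ≠ 0 := by exact_mod_cast this
  simp only [ContinuousMap.coe_mk, J, φ_G]
  push_cast
  field_simp⟩

/-- The function `√d`. -/
def sq : C(Torus, ℝ) := ⟨fun x => Real.sqrt (D.d x), by fun_prop⟩

theorem sq_apply (x : Torus) : D.sq x = Real.sqrt (D.d x) := rfl

theorem sq_pos (x : Torus) : 0 < D.sq x := Real.sqrt_pos.2 (D.d_pos x)

theorem sq_mul_self (x : Torus) : D.sq x * D.sq x = D.d x := Real.mul_self_sqrt (D.d_pos x).le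

theorem sq_le (x : Torus) : D.sq x ≤ 2 := by
  rw [sq_apply, Real.sqrt_le_left (by norm_num)]; linarith [D.d_le x]

theorem wmap_fn (h : Torus → ℂ) (x : Torus) : D.wmap.fn h x = (D.sq x : ℂ) * h (D.G x) := rfl

theorem wmap_G : D.wmap.G = D.G := rfl

theorem wmapInv_G : D.wmapInv.G = D.φ := rfl

theorem wmapInv_fn (h : Torus → ℂ) (x : Torus) :
    D.wmapInv.fn h x = ((D.sq (D.φ x))⁻¹ : ℂ) * h (D.φ x) := by
  have : Real.sqrt (D.wmapInv.w x) = (D.sq (D.φ x))⁻¹ := Real.sqrt_inv _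
  rw [WMap.fn, this]; push_cast; rfl

theorem ofReal_sq_ne (x : Torus) : (D.sq x : ℂ) ≠ 0 := by exact_mod_cast (D.sq_pos x).ne'

theorem iso_iso (h : L2) : D.wmap.iso (D.wmapInv.iso h) = h := by
  apply Lp.ext
  filter_upwards [D.wmap.coeFn_iso (D.wmapInv.iso h),
    D.wmap.quasiMeasurePreserving.ae_eq_comp (D.wmapInv.coeFn_iso h)] with x h1 h2
  simp only [wmap_fn, wmap_G, wmapInv_fn, Function.comp_apply, φ_G] at h1 h2
  rw [h1, h2, mul_inv_cancel_left₀ (D.ofReal_sq_ne x)]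

/-- The unitary operator `h ↦ √d (h ∘ G)`. -/
def U : L2 ≃ₗᵢ[ℂ] L2 :=
  LinearIsometryEquiv.ofSurjective D.wmap.iso fun h => ⟨D.wmapInv.iso h, D.iso_iso h⟩

theorem U_apply (h : L2) : D.U h = D.wmap.iso h := rfl

theorem U_symm_apply (h : L2) : D.U.symm h = D.wmapInv.iso h := by
  rw [LinearIsometryEquiv.symm_apply_eq, U_apply, iso_iso]

/-- The image `√d e^{ikG}` of the exponential `e^{ikx}`. -/
def a (k : ℤ) : C(Torus, ℂ) := ⟨fun x => (D.sq x : ℂ) * fourier k (D.G x), by fun_prop⟩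

theorem a_apply (k : ℤ) (x : Torus) : D.a k x = (D.sq x : ℂ) * fourier k (D.G x) := rfl

theorem U_eb (k : ℤ) : D.U (eb k) = cl (D.a k) := D.wmap.iso_cl (fourier k)

theorem U_mulL (f : C(Torus, ℂ)) (h : L2) : D.U (mulL f h) = mulL (f.comp D.G) (D.U h) :=
  D.wmap.iso_mulL f h

theorem inner_U_left (f h : L2) : inner ℂ (D.U f) h = inner ℂ f (D.U.symm h) := by
  rw [← D.U.inner_map_map f, LinearIsometryEquiv.apply_symm_apply]

theorem inner_a_left (k : ℤ) (h : L2) : inner ℂ (cl (D.a k)) h = coeff (D.U.symm h) k := by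
  rw [← U_eb, inner_U_left, coeff_eq_inner]

theorem norm_a_le (k : ℤ) (x : Torus) : ‖D.a k x‖ ≤ 2 := by
  rw [a_apply, norm_mul, fourier_apply, Circle.norm_coe, mul_one, Complex.norm_real,
    Real.norm_of_nonneg (D.sq_pos x).le]
  exact D.sq_le x

/-- The composition `f ↦ f ∘ φ` with the inverse change of variables. -/
def comp (f : L2) : L2 := D.U.symm (mulL (ofR D.sq) f)

theorem coeFn_comp (f : L2) : (D.comp f : Torus → ℂ) =ᵐ[dx] fun x => f (D.φ x) := by
  rw [comp, U_symm_apply]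
  filter_upwards [D.wmapInv.coeFn_iso (mulL (ofR D.sq) f),
    D.wmapInv.quasiMeasurePreserving.ae_eq_comp (coeFn_mulL (ofR D.sq) f)] with x h1 h2
  simp only [wmapInv_G, wmapInv_fn, Function.comp_apply, ofR_apply] at h1 h2
  rw [h1, h2, inv_mul_cancel_left₀ (D.ofReal_sq_ne _)]

theorem norm_comp_le (f : L2) : ‖D.comp f‖ ≤ 2 * ‖f‖ := by
  rw [comp, LinearIsometryEquiv.norm_map]
  refine norm_mulL_le_of_le (fun x => ?_) f
  rw [ofR_apply, Complex.norm_real, Real.norm_of_nonneg (D.sq_pos x).le]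
  exact D.sq_le x

/-- The function `1 / d`. -/
def dInv : C(Torus, ℝ) :=
  ⟨fun x => (D.d x)⁻¹, Continuous.inv₀ (by fun_prop) fun x => (D.d_pos x).ne'⟩

theorem dInv_apply (x : Torus) : D.dInv x = (D.d x)⁻¹ := rfl

theorem dInv_le (x : Torus) : D.dInv x ≤ 2 := by
  rw [dInv_apply, inv_le_comm₀ (D.d_pos x) (by norm_num)]
  linarith [D.d_ge x]

theorem dInv_pos (x : Torus) : 0 < D.dInv x := inv_pos.2 (D.d_pos x)

/-- The chain rule: the derivative of `f ∘ φ` is `(f' / d) ∘ φ`. -/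
theorem WD_comp {f g : L2} (h : WD f g) : WD (D.comp f) (D.comp (mulL (ofR D.dInv) g)) := by
  intro k
  have hb : HasTDeriv (fun y => fourier k (D.G y))
      (fun y => (D.d y : ℂ) * (Complex.I * k * fourier k (D.G y))) :=
    D.hasTDeriv_comp (hasTDeriv_fourier k)
  have hb2 := (WD.of_hasTDeriv (f := ⟨fun y => fourier k (D.G y), by fun_prop⟩)
    (f' := ⟨fun y => (D.d y : ℂ) * (Complex.I * k * fourier k (D.G y)), by fun_prop⟩) hb).inner h
  have h1 : ∀ u : L2, coeff (D.comp u) k = inner ℂ (cl (ofR D.sq * D.a k)) u := by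
    intro u
    rw [comp, ← inner_a_left, ← mulL_cl, inner_mulL_left, star_ofR]
  have h2 : mulL (ofR D.dInv) (cl (ofR D.sq * D.a k)) =
      cl ⟨fun y => fourier k (D.G y), by fun_prop⟩ := by
    rw [mulL_cl]
    congr 1
    ext y
    have h3 : (D.d y : ℂ) ≠ 0 := by exact_mod_cast (D.d_pos y).ne'
    simp only [ContinuousMap.mul_apply, ofR_apply, dInv_apply, a_apply, ContinuousMap.coe_mk]
    rw [← mul_assoc (D.sq y : ℂ), ← Complex.ofReal_mul, sq_mul_self]
    push_cast
    field_simp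
  have h4 : cl ⟨fun y => (D.d y : ℂ) * (Complex.I * k * fourier k (D.G y)), by fun_prop⟩ =
      (Complex.I * k : ℂ) • cl (ofR D.sq * D.a k) := by
    rw [← map_smul]
    congr 1
    ext y
    simp only [ContinuousMap.smul_apply, ContinuousMap.mul_apply, ofR_apply, a_apply,
      ContinuousMap.coe_mk, smul_eq_mul]
    rw [← mul_assoc (D.sq y : ℂ), ← Complex.ofReal_mul, sq_mul_self]
    ring
  have h5 : inner ℂ (cl (ofR D.sq * D.a k)) (mulL (ofR D.dInv) g) =
      inner ℂ (mulL (ofR D.dInv) (cl (ofR D.sq * D.a k))) g := by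
    rw [inner_mulL_left, star_ofR]
  rw [h1, h1, h5, h2, hb2, h4, inner_smul_left]
  simp

end Diffeo

/-! ### Off-diagonal decay of the matrix of a change of variables -/

theorem norm_conv_le_growth {N n : ℕ} (hn : n ≤ N) {p x : ℤ → ℂ} {A B : ℝ} (hA : 0 ≤ A) (hB : 0 ≤ B)
    (hp : wn N p ≤ ENNReal.ofReal A) (hx : ∀ j, ‖x j‖ ≤ B * jp j ^ n) (l : ℤ) :
    (Summable fun j => ‖p (l - j) * x j‖) ∧ ‖∑' j, p (l - j) * x j‖ ≤ A * B * jp l ^ n := by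
  have hp' : wn n p ≤ ENNReal.ofReal A := (wn_mono hn p).trans hp
  have hs := summable_of_wn (hp'.trans_lt ENNReal.ofReal_lt_top).ne
  have hs' : Summable fun j => jp (l - j) ^ n * ‖p (l - j)‖ :=
    (Equiv.subLeft l).summable_iff.2 hs
  have ht : ∑' j, jp (l - j) ^ n * ‖p (l - j)‖ = ∑' j, jp j ^ n * ‖p j‖ :=
    (Equiv.subLeft l).tsum_eq (fun j => jp j ^ n * ‖p j‖)
  have hle : ∀ j, ‖p (l - j) * x j‖ ≤ (B * jp l ^ n) * (jp (l - j) ^ n * ‖p (l - j)‖) := by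
    intro j
    rw [norm_mul]
    have h1 : jp j ≤ jp l * jp (l - j) := jp_le_mul_sub l j
    have h2 : jp j ^ n ≤ jp l ^ n * jp (l - j) ^ n := by
      rw [← mul_pow]; exact pow_le_pow_left₀ (jp_pos j).le h1 n
    calc _ ≤ ‖p (l - j)‖ * (B * jp j ^ n) := by gcongr; exact hx j
      _ ≤ ‖p (l - j)‖ * (B * (jp l ^ n * jp (l - j) ^ n)) := by gcongr
      _ = _ := by ring
  have hsum := (hs'.mul_left (B * jp l ^ n)).of_nonneg_of_le (fun j => norm_nonneg _) hle
  refine ⟨hsum, (norm_tsum_le_tsum_norm hsum).trans ?_⟩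
  refine (hsum.tsum_le_tsum hle (hs'.mul_left _)).trans ?_
  rw [tsum_mul_left, ht]
  have h3 := tsum_le_of_wn hA hp'
  have := jp_pos l
  calc _ ≤ B * jp l ^ n * A := by gcongr
    _ = _ := by ring

/-- Convolution with an element of the weighted Wiener space preserves polynomial decay. -/
theorem norm_conv_le_decay {N n : ℕ} (hn : n ≤ N) {p x : ℤ → ℂ} {A B : ℝ} (hA : 0 ≤ A) (hB : 0 ≤ B)
    (hp : wn N p ≤ ENNReal.ofReal A) (hx : ∀ j, ‖x j‖ * jp j ^ n ≤ B) (l : ℤ) :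
    ‖∑' j, p (l - j) * x j‖ * jp l ^ n ≤ A * B := by
  have hp' : wn n p ≤ ENNReal.ofReal A := (wn_mono hn p).trans hp
  have hs := summable_of_wn (hp'.trans_lt ENNReal.ofReal_lt_top).ne
  have hs' : Summable fun j => jp (l - j) ^ n * ‖p (l - j)‖ :=
    (Equiv.subLeft l).summable_iff.2 hs
  have ht : ∑' j, jp (l - j) ^ n * ‖p (l - j)‖ = ∑' j, jp j ^ n * ‖p j‖ :=
    (Equiv.subLeft l).tsum_eq (fun j => jp j ^ n * ‖p j‖)
  have hl := jp_pos l
  have hle : ∀ j, ‖p (l - j) * x j‖ ≤ (B / jp l ^ n) * (jp (l - j) ^ n * ‖p (l - j)‖) := by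
    intro j
    rw [norm_mul, div_mul_eq_mul_div, le_div_iff₀ (by positivity)]
    have h1 : jp l ≤ jp j * jp (l - j) := by
      have := jp_le_mul_sub j l
      rwa [← jp_neg (j - l), neg_sub] at this
    have h2 : jp l ^ n ≤ jp j ^ n * jp (l - j) ^ n := by
      rw [← mul_pow]; exact pow_le_pow_left₀ (jp_pos l).le h1 n
    have h4 := jp_pos (l - j)
    calc _ ≤ ‖p (l - j)‖ * ‖x j‖ * (jp j ^ n * jp (l - j) ^ n) := by gcongr
      _ = (‖x j‖ * jp j ^ n) * (jp (l - j) ^ n * ‖p (l - j)‖) := by ring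
      _ ≤ _ := by gcongr; exact hx j
  have hsum := (hs'.mul_left (B / jp l ^ n)).of_nonneg_of_le (fun j => norm_nonneg _) hle
  have h5 := (norm_tsum_le_tsum_norm hsum).trans (hsum.tsum_le_tsum hle (hs'.mul_left _))
  rw [tsum_mul_left, ht] at h5
  have h3 := tsum_le_of_wn hA hp'
  calc _ ≤ (B / jp l ^ n * A) * jp l ^ n := by
        gcongr
        exact h5.trans (by gcongr)
    _ = _ := by field_simp

/-- A change of variables whose derivative has a derivative, and is close to `1` in a weighted
Wiener space. -/
structure SDiffeo extends Diffeo where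
  /-- the second derivative of the change of variables -/
  d' : C(Torus, ℝ)
  hasTDeriv_d : HasTDeriv d d'
  wn_le : wn 8 (realCoeff (d - 1 : C(Torus, ℝ))) ≤ ENNReal.ofReal (1 / 4)

namespace SDiffeo

variable (D : SDiffeo)

theorem hasTDeriv_d_sub_one : HasTDeriv (D.d - 1 : C(Torus, ℝ)) D.d' := fun x => by
  simpa using (D.hasTDeriv_d x).sub_const 1

/-- The bounds are uniform over all `SDiffeo`s, since the smallness of `d - 1` is part of the
structure. -/
theorem exists_wn_bound : ∃ A : ℝ, 1 ≤ A ∧ ∀ D : SDiffeo,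
    wn 7 (realCoeff D.d) ≤ ENNReal.ofReal A ∧ wn 7 (realCoeff D.dInv) ≤ ENNReal.ofReal A ∧
    wn 7 (realCoeff (D.d' * D.dInv : C(Torus, ℝ))) ≤ ENNReal.ofReal A ∧
    wn 7 (realCoeff (D.d' * D.dInv * D.dInv : C(Torus, ℝ))) ≤ ENNReal.ofReal A := by
  obtain ⟨C, hC, h⟩ := wn_one_add_rpow (-1)
  have key : ∀ (f : C(Torus, ℝ)) (B : ℝ), 0 ≤ B →
      wn 7 (realCoeff (f - 1 : C(Torus, ℝ))) ≤ ENNReal.ofReal B →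
      wn 7 (realCoeff f) ≤ ENNReal.ofReal (B + 1) := by
    intro f B hB hf
    have h1 : realCoeff f = fun k => realCoeff (f - 1 : C(Torus, ℝ)) k +
        fourierCoeff (1 : C(Torus, ℂ)) k := by
      ext k
      have : ofR f = ofR (f - 1) + 1 := by ext x; simp
      rw [← fourierCoeff_ofR, this, fourierCoeff_add', fourierCoeff_ofR]
    rw [h1]
    refine (wn_add_le 7 _ _).trans ?_
    rw [wn_one, ENNReal.ofReal_add hB zero_le_one, ENNReal.ofReal_one]
    gcongr
  have hmul : ∀ (f g : C(Torus, ℝ)) (B B' : ℝ), 0 ≤ B → wn 7 (realCoeff f) ≤ ENNReal.ofReal B →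
      wn 7 (realCoeff g) ≤ ENNReal.ofReal B' →
      wn 7 (realCoeff (f * g : C(Torus, ℝ))) ≤ ENNReal.ofReal (B * B') := by
    intro f g B B' hB hf hg
    rw [← fourierCoeff_ofR, ofR_mul, ENNReal.ofReal_mul hB]
    exact (wn_mul_le 7 _ _).trans (mul_le_mul' hf hg)
  refine ⟨(1 + C) ^ 2 * 2, by nlinarith, fun D => ?_⟩
  have h7 : wn 7 (realCoeff (D.d - 1 : C(Torus, ℝ))) ≤ ENNReal.ofReal (1 / 4) :=
    (wn_mono (by norm_num) _).trans D.wn_le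
  have h1 := key D.d _ (by norm_num) h7
  have h2 : wn 7 (realCoeff (D.dInv - 1 : C(Torus, ℝ))) ≤ ENNReal.ofReal C := by
    have h3 := h 7 (D.d - 1) (D.dInv - 1)
      (h7.trans (ENNReal.ofReal_le_ofReal (by norm_num))) (fun x => by
        simp [Diffeo.dInv_apply, Real.rpow_neg_one])
    refine h3.trans ?_
    calc _ ≤ ENNReal.ofReal C * ENNReal.ofReal 1 :=
          mul_le_mul_right (h7.trans (ENNReal.ofReal_le_ofReal (by norm_num))) _
      _ = _ := by simp
  have h3 := key D.dInv C hC.le h2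
  have h4 : wn 7 (realCoeff D.d') ≤ ENNReal.ofReal 1 :=
    ((wn_deriv_le 7 D.hasTDeriv_d_sub_one).trans D.wn_le).trans
      (ENNReal.ofReal_le_ofReal (by norm_num))
  have h5 := hmul _ _ _ _ zero_le_one h4 h3
  have h6 := hmul _ _ _ _ (by linarith) h5 h3
  refine ⟨h1.trans ?_, h3.trans ?_, h5.trans ?_, h6.trans ?_⟩ <;>
    apply ENNReal.ofReal_le_ofReal <;> nlinarith

/-- A constant that bounds the coefficients of all `SDiffeo`s. -/
def bd : ℝ := Classical.choose exists_wn_bound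

theorem one_le_bd : 1 ≤ bd := (Classical.choose_spec exists_wn_bound).1

theorem wn_d : wn 7 (realCoeff D.d) ≤ ENNReal.ofReal bd :=
  ((Classical.choose_spec exists_wn_bound).2 D).1

theorem wn_dInv : wn 7 (realCoeff D.dInv) ≤ ENNReal.ofReal bd :=
  ((Classical.choose_spec exists_wn_bound).2 D).2.1

theorem wn_d'_dInv : wn 7 (realCoeff (D.d' * D.dInv : C(Torus, ℝ))) ≤ ENNReal.ofReal bd :=
  ((Classical.choose_spec exists_wn_bound).2 D).2.2.1

theorem wn_d'_dInv_dInv :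
    wn 7 (realCoeff (D.d' * D.dInv * D.dInv : C(Torus, ℝ))) ≤ ENNReal.ofReal bd :=
  ((Classical.choose_spec exists_wn_bound).2 D).2.2.2

/-- The derivative of `√d e^{ikG}`. -/
def a' (k : ℤ) : C(Torus, ℂ) :=
  (1 / 2 : ℂ) • (ofR (D.d' * D.dInv) * D.a k) + (Complex.I * k) • (ofR D.d * D.a k)

theorem hasTDeriv_sq : HasTDeriv D.sq (fun x => D.d' x * (D.dInv x / 2 * D.sq x)) := by
  have h := HasTDeriv.comp_real (F := Real.sqrt) (F' := fun r => 1 / (2 * Real.sqrt r))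
    D.hasTDeriv_d (fun x => Real.hasDerivAt_sqrt (D.d_pos x).ne')
  intro x
  refine (h x).congr_deriv ?_
  have h1 := (D.sq_pos x).ne'
  have h2 := D.sq_mul_self x
  simp only [smul_eq_mul, Diffeo.dInv_apply, ← Diffeo.sq_apply]
  rw [← h2]
  field_simp

theorem hasTDeriv_a (k : ℤ) : HasTDeriv (D.a k) (D.a' k) := by
  have h := D.hasTDeriv_sq.ofReal.mul (D.hasTDeriv_comp (hasTDeriv_fourier k))
  intro x
  refine (h x).congr_deriv ?_
  simp only [a', ContinuousMap.add_apply, ContinuousMap.smul_apply, ContinuousMap.mul_apply,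
    ofR_apply, Diffeo.a_apply, smul_eq_mul, Complex.real_smul]
  push_cast
  ring

/-- The matrix of the change of variables, in the basis of exponentials. -/
def M (k l : ℤ) : ℂ := fourierCoeff (D.a k) l

theorem norm_M_le_one (k l : ℤ) : ‖D.M k l‖ ≤ 1 := by
  rw [M, ← coeff_cl, ← Diffeo.U_eb]
  refine (norm_coeff_le _ _).trans ?_
  rw [LinearIsometryEquiv.norm_map, norm_eb]

theorem coeff_mul_a (f : C(Torus, ℝ)) (k l : ℤ) :
    fourierCoeff (ofR f * D.a k : C(Torus, ℂ)) l = ∑' j, realCoeff f (l - j) * D.M k j :=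
  (hasSum_coeff_mul (ofR f) (D.a k) l).tsum_eq.symm

/-- The derivative of `d^{1/2} e^{ikG}`, read on its Fourier coefficients. -/
theorem int_mul_M (k l : ℤ) : Complex.I * l * D.M k l =
    (1 / 2) * ∑' j, realCoeff (D.d' * D.dInv : C(Torus, ℝ)) (l - j) * D.M k j +
      Complex.I * k * ∑' j, realCoeff D.d (l - j) * D.M k j := by
  rw [M, ← fourierCoeff_deriv (D.hasTDeriv_a k), a', fourierCoeff_add', ← coeff_mul_a,
    ← coeff_mul_a]
  congr 1 <;> rw [← coeff_cl, map_smul, coeff_smul, coeff_cl]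

/-- Multiplication by `ik` of `d^{1/2} e^{ikG}`, expressed by its derivative; this gives the decay
in the index `k`. -/
theorem mul_int_M (k l : ℤ) : Complex.I * k * D.M k l =
    ∑' j, realCoeff D.dInv (l - j) * (Complex.I * j * D.M k j) -
      (1 / 2) * ∑' j, realCoeff (D.d' * D.dInv * D.dInv : C(Torus, ℝ)) (l - j) * D.M k j := by
  have h1 : (Complex.I * k) • D.a k = ofR D.dInv * D.a' k -
      (1 / 2 : ℂ) • (ofR (D.d' * D.dInv * D.dInv) * D.a k) := by
    ext x
    have : (D.d x : ℂ) ≠ 0 := by exact_mod_cast (D.d_pos x).ne'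
    simp only [a', ContinuousMap.add_apply, ContinuousMap.smul_apply, ContinuousMap.mul_apply,
      ContinuousMap.sub_apply, ofR_apply, smul_eq_mul, Diffeo.dInv_apply]
    push_cast
    field_simp
    ring
  have h2 : Complex.I * k * D.M k l = coeff (cl ((Complex.I * k) • D.a k)) l := by
    rw [map_smul, coeff_smul, coeff_cl]; rfl
  rw [h2, h1, map_sub, coeff_sub, coeff_cl, map_smul, coeff_smul, coeff_cl, ← coeff_mul_a,
    ← (hasSum_coeff_mul _ _ l).tsum_eq]
  congr 2
  ext j
  rw [fourierCoeff_deriv (D.hasTDeriv_a k)]; rfl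

/-- Decay of the matrix at output frequencies larger than the input frequency, by induction on `n`
with `int_mul_M`. -/
theorem norm_M_le_left (n : ℕ) (hn : n ≤ 7) (k l : ℤ) :
    ‖D.M k l‖ * jp l ^ n ≤ (2 * bd) ^ n * jp k ^ n := by
  induction n generalizing l with
  | zero => simpa using D.norm_M_le_one k l
  | succ n ih =>
    have hb := one_le_bd
    have hk := jp_pos k
    have hl := jp_pos l
    have ih' := fun l => ih (by omega) l
    have h1 := norm_conv_le_decay (by omega : n ≤ 7) (by linarith) (by positivity)
      D.wn_d'_dInv ih' l
    have h2 := norm_conv_le_decay (by omega : n ≤ 7) (by linarith) (by positivity)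
      D.wn_d ih' l
    have h3 : |(l : ℝ)| * ‖D.M k l‖ ≤
        (1 / 2) * ‖∑' j, realCoeff (D.d' * D.dInv : C(Torus, ℝ)) (l - j) * D.M k j‖ +
        |(k : ℝ)| * ‖∑' j, realCoeff D.d (l - j) * D.M k j‖ := by
      have h4 : |(l : ℝ)| * ‖D.M k l‖ = ‖Complex.I * l * D.M k l‖ := by simp
      rw [h4, int_mul_M]
      refine (norm_add_le _ _).trans (le_of_eq ?_)
      simp
    set X := ‖∑' j, realCoeff (D.d' * D.dInv : C(Torus, ℝ)) (l - j) * D.M k j‖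
    set Y := ‖∑' j, realCoeff D.d (l - j) * D.M k j‖
    set B := (2 * bd) ^ n * jp k ^ n
    have hB : 0 ≤ B := by positivity
    calc ‖D.M k l‖ * jp l ^ (n + 1)
        = ‖D.M k l‖ * jp l ^ n + (|(l : ℝ)| * ‖D.M k l‖) * jp l ^ n := by
          rw [pow_succ, jp]; ring
      _ ≤ B + ((1 / 2) * X + |(k : ℝ)| * Y) * jp l ^ n := by
          gcongr
          exact ih' l
      _ = B + ((1 / 2) * (X * jp l ^ n) + |(k : ℝ)| * (Y * jp l ^ n)) := by ring
      _ ≤ bd * B + ((1 / 2) * (bd * B) + |(k : ℝ)| * (bd * B)) := by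
          gcongr
          nlinarith
      _ ≤ 2 * bd * B * jp k := by
          rw [jp]
          have : 0 ≤ bd * B * |(k : ℝ)| := by positivity
          have : 0 ≤ bd * B := by positivity
          nlinarith
      _ = (2 * bd) ^ (n + 1) * jp k ^ (n + 1) := by simp only [B]; ring

/-- Decay of the matrix at output frequencies smaller than the input frequency, by induction on `n`
with `mul_int_M`. -/
theorem norm_M_le_right (n : ℕ) (hn : n ≤ 7) (k l : ℤ) :
    ‖D.M k l‖ * jp k ^ n ≤ (3 * bd) ^ n * jp l ^ n := by
  induction n generalizing l with
  | zero => simpa using D.norm_M_le_one k l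
  | succ n ih =>
    have hb := one_le_bd
    have hk := jp_pos k
    have hl := jp_pos l
    have ih' : ∀ l, ‖D.M k l‖ ≤ (3 * bd) ^ n / jp k ^ n * jp l ^ n := fun l => by
      rw [div_mul_eq_mul_div, le_div_iff₀ (by positivity)]
      exact ih (by omega) l
    have ih2 : ∀ l : ℤ, ‖Complex.I * l * D.M k l‖ ≤ (3 * bd) ^ n / jp k ^ n * jp l ^ (n + 1) := by
      intro l
      have hl := jp_pos l
      have h0 := abs_le_jp l
      have h1 := ih' l
      rw [norm_mul, norm_mul, Complex.norm_I, one_mul, Complex.norm_intCast]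
      calc _ ≤ jp l * ((3 * bd) ^ n / jp k ^ n * jp l ^ n) := by gcongr
        _ = _ := by ring
    have h1 := (norm_conv_le_growth (by omega : n + 1 ≤ 7) (by linarith) (by positivity)
      D.wn_dInv ih2 l).2
    have h2 := (norm_conv_le_growth (by omega : n ≤ 7) (by linarith) (by positivity)
      D.wn_d'_dInv_dInv ih' l).2
    have h3 : |(k : ℝ)| * ‖D.M k l‖ ≤
        ‖∑' j, realCoeff D.dInv (l - j) * (Complex.I * j * D.M k j)‖ +
        (1 / 2) * ‖∑' j, realCoeff (D.d' * D.dInv * D.dInv : C(Torus, ℝ)) (l - j) * D.M k j‖ := by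
      have h4 : |(k : ℝ)| * ‖D.M k l‖ = ‖Complex.I * k * D.M k l‖ := by simp
      rw [h4, mul_int_M]
      refine (norm_sub_le _ _).trans (le_of_eq ?_)
      simp
    set X := ‖∑' j, realCoeff D.dInv (l - j) * (Complex.I * j * D.M k j)‖
    set Y := ‖∑' j, realCoeff (D.d' * D.dInv * D.dInv : C(Torus, ℝ)) (l - j) * D.M k j‖
    set B := (3 * bd) ^ n / jp k ^ n with hBdef
    have hB : 0 ≤ B := by positivity
    have hBk : B * jp k ^ n = (3 * bd) ^ n := by rw [hBdef]; field_simp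
    have h5 := ih' l
    have h6 : jp l ^ n ≤ jp l ^ (n + 1) := pow_le_pow_right₀ (one_le_jp l) (by omega)
    have h7 : ‖D.M k l‖ * jp k ≤ 3 * bd * B * jp l ^ (n + 1) := by
      have h8 : ‖D.M k l‖ * jp k = ‖D.M k l‖ + |(k : ℝ)| * ‖D.M k l‖ := by rw [jp]; ring
      have h9 : ‖D.M k l‖ ≤ bd * B * jp l ^ (n + 1) := by
        calc _ ≤ B * jp l ^ n := h5
          _ ≤ B * jp l ^ (n + 1) := by gcongr
          _ = 1 * (B * jp l ^ (n + 1)) := (one_mul _).symm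
          _ ≤ bd * (B * jp l ^ (n + 1)) := by gcongr
          _ = _ := by ring
      have h10 : bd * B * jp l ^ n ≤ bd * B * jp l ^ (n + 1) := by gcongr
      have h11 : 0 ≤ bd * B * jp l ^ (n + 1) := by positivity
      linarith
    calc ‖D.M k l‖ * jp k ^ (n + 1) = (‖D.M k l‖ * jp k) * jp k ^ n := by ring
      _ ≤ (3 * bd * B * jp l ^ (n + 1)) * jp k ^ n := by gcongr
      _ = 3 * bd * (B * jp k ^ n) * jp l ^ (n + 1) := by ring
      _ = _ := by rw [hBk]; ring

end SDiffeo

/-! ### The symbol of the commutator -/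

/-- The symbol of `L^{1/2}`. -/
def lam (g b : ℝ) (k : ℤ) : ℝ := Real.sqrt (symbolL g b k)

/-- The symbol of the form `⟨(∂_θ + [·, X]) L^{1/2} c L^{1/2} ·, ·⟩`, where `c = (1 + θ β')^{-3/2}`
and `X` is the generator of the change of variables. -/
def symS (g b : ℝ) (n p q : ℤ) : ℝ :=
  lam g b (n + p + q) * lam g b (n + p) * (2 * n + p) -
    lam g b (n + q) * lam g b n * (2 * n + 2 * q + p) +
    lam g b (n + p + q) * lam g b n * (2 * q - 3 * p)

theorem lam_nonneg (g b : ℝ) (k : ℤ) : 0 ≤ lam g b k := Real.sqrt_nonneg _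

theorem symbolL_nonneg (g b : ℝ) (k : ℤ) : 0 ≤ symbolL g b k := Real.sqrt_nonneg _

theorem lam_mul_self (g b : ℝ) (k : ℤ) : lam g b k * lam g b k = symbolL g b k :=
  Real.mul_self_sqrt (symbolL_nonneg g b k)

theorem lam_neg (g b : ℝ) (k : ℤ) : lam g b (-k) = lam g b k := by
  simp [lam, symbolL]

theorem symS_neg (g b : ℝ) (n p q : ℤ) : symS g b (-n) (-p) (-q) = - symS g b n p q := by
  have h1 : -n + -p + -q = -(n + p + q) := by ring
  have h2 : -n + -p = -(n + p) := by ring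
  have h3 : -n + -q = -(n + q) := by ring
  rw [symS, h1, h2, h3, lam_neg, lam_neg, lam_neg, lam_neg, symS]
  push_cast
  ring

theorem symbolL_eq {g b : ℝ} (hg : 0 < g) (hb : 0 < b) (k : ℤ) :
    symbolL g b k ^ 2 = (g + (k : ℝ) ^ 2) * (|(k : ℝ)| * Real.tanh (b * |(k : ℝ)|)) := by
  rw [symbolL, Real.sq_sqrt]
  have : 0 ≤ Real.tanh (b * |(k : ℝ)|) := by
    rw [Real.tanh_eq_sinh_div_cosh]
    exact div_nonneg (Real.sinh_nonneg_iff.2 (by positivity)) (Real.cosh_pos _).le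
  positivity

theorem lam_pow_four {g b : ℝ} (hg : 0 < g) (hb : 0 < b) (k : ℤ) :
    lam g b k ^ 4 = (g + (k : ℝ) ^ 2) * (|(k : ℝ)| * Real.tanh (b * |(k : ℝ)|)) := by
  rw [← symbolL_eq hg hb, ← lam_mul_self]; ring

theorem lam_le {g b : ℝ} (hg : 0 < g) (hb : 0 < b) (k : ℤ) : lam g b k ≤ (g + 1) * jp k := by
  have hj := one_le_jp k
  refine le_of_pow_le_pow_left₀ (n := 4) (by norm_num) (by positivity) ?_
  rw [lam_pow_four hg hb]
  have h1 : Real.tanh (b * |(k : ℝ)|) ≤ 1 := (Real.tanh_lt_one _).le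
  have h2 : |(k : ℝ)| ≤ jp k := abs_le_jp k
  have h3 : (k : ℝ) ^ 2 ≤ jp k ^ 2 := by rw [← sq_abs]; gcongr
  have h4 : 1 ≤ jp k ^ 2 := one_le_pow₀ hj
  calc _ ≤ (g + jp k ^ 2) * (jp k * 1) := by
        refine mul_le_mul (by linarith) (mul_le_mul h2 h1 ?_ (jp_pos k).le) ?_ (by positivity)
        · rw [Real.tanh_eq_sinh_div_cosh]
          exact div_nonneg (Real.sinh_nonneg_iff.2 (by positivity)) (Real.cosh_pos _).le
        · refine mul_nonneg (abs_nonneg _) ?_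
          rw [Real.tanh_eq_sinh_div_cosh]
          exact div_nonneg (Real.sinh_nonneg_iff.2 (by positivity)) (Real.cosh_pos _).le
    _ ≤ (g + 1) * jp k ^ 2 * jp k := by nlinarith [mul_pos hg (jp_pos k)]
    _ = (g + 1) * jp k ^ 3 := by ring
    _ ≤ (g + 1) ^ 4 * jp k ^ 4 := by
      have : (1 : ℝ) ≤ g + 1 := by linarith
      exact mul_le_mul (le_self_pow₀ this (by norm_num)) (pow_le_pow_right₀ hj (by norm_num))
        (by positivity) (by positivity)
    _ = _ := by ring

/-- Taylor expansion of `z ↦ (1 + z)^{3/4}`, with `w = (1 + z)^{1/4}`. -/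
theorem abs_cube_sub_le {w z : ℝ} (hw : 0 ≤ w) (hwz : w ^ 4 = 1 + z) (hz : |z| ≤ 1 / 4) :
    |w ^ 3 - (1 + 3 / 4 * z - 3 / 32 * z ^ 2)| ≤ 5 * |z| ^ 3 := by
  have hz' := abs_le.1 hz
  have hw2 : w ≤ 6 / 5 := by
    refine le_of_pow_le_pow_left₀ (n := 4) (by norm_num) (by norm_num) ?_
    rw [hwz]; linarith [hz'.2, show (6 / 5 : ℝ) ^ 4 = 1296 / 625 by norm_num]
  have hz2 : z = w ^ 4 - 1 := by linarith
  have h1 : |w - 1| ≤ |z| := by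
    have : z = (w - 1) * (w ^ 3 + w ^ 2 + w + 1) := by rw [hz2]; ring
    rw [this, abs_mul]
    refine le_mul_of_one_le_right (abs_nonneg _) ?_
    rw [abs_of_nonneg (by positivity)]
    have : 0 ≤ w ^ 3 + w ^ 2 + w := by positivity
    linarith
  have h2 : w ^ 3 - (1 + 3 / 4 * z - 3 / 32 * z ^ 2) = (w - 1) ^ 3 *
      (5 / 32 + 15 / 32 * w + 15 / 16 * w ^ 2 + 9 / 16 * w ^ 3 + 9 / 32 * w ^ 4 +
        3 / 32 * w ^ 5) := by rw [hz2]; ring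
  rw [h2, abs_mul, abs_pow, mul_comm]
  gcongr
  rw [abs_of_nonneg (by positivity)]
  calc _ ≤ 5 / 32 + 15 / 32 * (6 / 5) + 15 / 16 * (6 / 5) ^ 2 + 9 / 16 * (6 / 5) ^ 3 +
        9 / 32 * (6 / 5) ^ 4 + 3 / 32 * (6 / 5 : ℝ) ^ 5 := by gcongr
    _ ≤ 5 := by norm_num

/-- The polynomial part of the cancellation, up to third order, in `abs_model_le`. -/
theorem abs_model_poly_le {x y u : ℝ} (hx : |x| ≤ u) (hy : |y| ≤ u) (hu : u ≤ 1 / 4) :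
    |3 / 8 * x ^ 3 + 21 / 64 * x ^ 2 * y - 15 / 64 * x * y ^ 2 - 63 / 512 * x ^ 4 -
      45 / 256 * x ^ 3 * y - 27 / 512 * x ^ 2 * y ^ 2 + 9 / 1024 * x ^ 5 + 9 / 512 * x ^ 4 * y +
      9 / 1024 * x ^ 3 * y ^ 2| ≤ 3 * u ^ 3 := by
  have hu0 : 0 ≤ u := (abs_nonneg x).trans hx
  have hx' := abs_le.1 (hx.trans hu)
  have hy' := abs_le.1 (hy.trans hu)
  have hxx : |x * x| ≤ 1 / 16 := by
    rw [abs_mul]; nlinarith [abs_nonneg x]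
  have hxy : |x * y| ≤ 1 / 16 := by
    rw [abs_mul]; nlinarith [abs_nonneg x, abs_nonneg y]
  have hxx' := abs_le.1 hxx
  have hxy' := abs_le.1 hxy
  have ha : |3 / 8 - 63 / 512 * x - 45 / 256 * y + 9 / 1024 * (x * x) + 9 / 512 * (x * y)| ≤ 1 := by
    rw [abs_le]; constructor <;> linarith
  have hb : |21 / 64 - 27 / 512 * y + 9 / 1024 * (x * y)| ≤ 1 := by
    rw [abs_le]; constructor <;> linarith
  have hxs : |x| ^ 2 ≤ u ^ 2 := by gcongr
  have hys : |y| ^ 2 ≤ u ^ 2 := by gcongr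
  have e : 3 / 8 * x ^ 3 + 21 / 64 * x ^ 2 * y - 15 / 64 * x * y ^ 2 - 63 / 512 * x ^ 4 -
      45 / 256 * x ^ 3 * y - 27 / 512 * x ^ 2 * y ^ 2 + 9 / 1024 * x ^ 5 + 9 / 512 * x ^ 4 * y +
      9 / 1024 * x ^ 3 * y ^ 2 =
      x ^ 2 * (x * (3 / 8 - 63 / 512 * x - 45 / 256 * y + 9 / 1024 * (x * x) + 9 / 512 * (x * y)) +
        y * (21 / 64 - 27 / 512 * y + 9 / 1024 * (x * y))) + (- (15 / 64)) * (x * y ^ 2) := by ring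
  rw [e]
  refine (abs_add_le _ _).trans ?_
  rw [abs_mul, abs_mul (-(15 / 64)), abs_mul x (y ^ 2), abs_pow, abs_pow]
  have h1 : |x * (3 / 8 - 63 / 512 * x - 45 / 256 * y + 9 / 1024 * (x * x) + 9 / 512 * (x * y)) +
        y * (21 / 64 - 27 / 512 * y + 9 / 1024 * (x * y))| ≤ u * 1 + u * 1 := by
    refine (abs_add_le _ _).trans ?_
    rw [abs_mul, abs_mul]
    gcongr
  calc _ ≤ u ^ 2 * (u * 1 + u * 1) + 1 * (u * u ^ 2) := by
        gcongr
        norm_num [abs_le]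
    _ = 3 * u ^ 3 := by ring

/-- The cancellation, up to third order, of the principal and subprincipal symbols, for the
model symbol `|k|^{3/4}`. -/
theorem abs_model_le {x y u w₁ w₂ w₃ : ℝ} (hx : |x| ≤ u) (hy : |y| ≤ u) (hu : u ≤ 1 / 8)
    (h1 : 0 ≤ w₁) (h2 : 0 ≤ w₂) (h3 : 0 ≤ w₃) (hw₁ : w₁ ^ 4 = 1 + x) (hw₂ : w₂ ^ 4 = 1 + y)
    (hw₃ : w₃ ^ 4 = 1 + (x + y)) :
    |w₃ ^ 3 * w₁ ^ 3 * (2 + x) - w₂ ^ 3 * (2 + 2 * y + x) + w₃ ^ 3 * (2 * y - 3 * x)| ≤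
      400 * u ^ 3 := by
  have hu0 : 0 ≤ u := (abs_nonneg x).trans hx
  have hxy : |x + y| ≤ 2 * u := (abs_add_le _ _).trans (by linarith)
  have r1 := abs_cube_sub_le h1 hw₁ (hx.trans (by linarith))
  have r2 := abs_cube_sub_le h2 hw₂ (hy.trans (by linarith))
  have r3 := abs_cube_sub_le h3 hw₃ (hxy.trans (by linarith))
  set e1 := w₁ ^ 3 - (1 + 3 / 4 * x - 3 / 32 * x ^ 2)
  set e2 := w₂ ^ 3 - (1 + 3 / 4 * y - 3 / 32 * y ^ 2)
  set e3 := w₃ ^ 3 - (1 + 3 / 4 * (x + y) - 3 / 32 * (x + y) ^ 2)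
  have r1' : |e1| ≤ 5 * u ^ 3 := r1.trans (by gcongr)
  have r2' : |e2| ≤ 5 * u ^ 3 := r2.trans (by gcongr)
  have r3' : |e3| ≤ 40 * u ^ 3 := r3.trans (by
    calc _ ≤ 5 * (2 * u) ^ 3 := by gcongr
      _ = _ := by ring)
  have hx' := abs_le.1 (hx.trans hu)
  have hy' := abs_le.1 (hy.trans hu)
  have hw1 : |w₁ ^ 3| ≤ 2 := by
    have : w₁ ≤ 6 / 5 := by
      refine le_of_pow_le_pow_left₀ (n := 4) (by norm_num) (by norm_num) ?_
      rw [hw₁]; linarith [hx'.2, show (6 / 5 : ℝ) ^ 4 = 1296 / 625 by norm_num]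
    rw [abs_of_nonneg (by positivity)]
    calc _ ≤ (6 / 5 : ℝ) ^ 3 := by gcongr
      _ ≤ 2 := by norm_num
  have hP3 : |1 + 3 / 4 * (x + y) - 3 / 32 * (x + y) ^ 2| ≤ 2 := by
    have : (x + y) ^ 2 ≤ 1 / 16 := by nlinarith
    rw [abs_le]; constructor <;> nlinarith [sq_nonneg (x + y)]
  have hA : |2 + x| ≤ 3 := by rw [abs_le]; constructor <;> linarith
  have hB : |2 + 2 * y + x| ≤ 3 := by rw [abs_le]; constructor <;> linarith
  have hC : |2 * y - 3 * x| ≤ 1 := by rw [abs_le]; constructor <;> linarith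
  have hQ := abs_model_poly_le hx hy (by linarith)
  have e : w₃ ^ 3 * w₁ ^ 3 * (2 + x) - w₂ ^ 3 * (2 + 2 * y + x) + w₃ ^ 3 * (2 * y - 3 * x) =
      (3 / 8 * x ^ 3 + 21 / 64 * x ^ 2 * y - 15 / 64 * x * y ^ 2 - 63 / 512 * x ^ 4 -
      45 / 256 * x ^ 3 * y - 27 / 512 * x ^ 2 * y ^ 2 + 9 / 1024 * x ^ 5 + 9 / 512 * x ^ 4 * y +
      9 / 1024 * x ^ 3 * y ^ 2) + e3 * (w₁ ^ 3) * (2 + x) +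
      (1 + 3 / 4 * (x + y) - 3 / 32 * (x + y) ^ 2) * e1 * (2 + x) + (-e2) * (2 + 2 * y + x) +
      e3 * (2 * y - 3 * x) := by
    simp only [e1, e2, e3]; ring
  rw [e]
  refine (abs_add_le _ _).trans ?_
  refine (add_le_add_left ((abs_add_le _ _).trans (add_le_add_left ((abs_add_le _ _).trans
    (add_le_add_left (abs_add_le _ _) _)) _)) _).trans ?_
  simp only [abs_mul, abs_neg]
  calc _ ≤ 3 * u ^ 3 + 40 * u ^ 3 * 2 * 3 + 2 * (5 * u ^ 3) * 3 + 5 * u ^ 3 * 3 +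
        40 * u ^ 3 * 1 := by
        gcongr
    _ ≤ _ := by nlinarith [pow_nonneg hu0 3]

theorem exists_fourth_root {x : ℝ} (hx : 0 ≤ x) : ∃ w : ℝ, 0 ≤ w ∧ w ^ 4 = x :=
  ⟨Real.sqrt (Real.sqrt x), Real.sqrt_nonneg _, by
    rw [show (4 : ℕ) = 2 * 2 by norm_num, pow_mul, Real.sq_sqrt (Real.sqrt_nonneg _),
      Real.sq_sqrt hx]⟩

/-- `tanh` approaches `1` fast. -/
theorem one_sub_tanh_le {x : ℝ} (hx : 0 < x) : 1 - Real.tanh x ≤ 12 / x ^ 3 := by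
  have h1 : Real.exp x * (1 - Real.tanh x) ≤ 2 := by
    have h2 := Real.cosh_pos x
    have h3 : 1 - Real.tanh x = Real.exp (-x) / Real.cosh x := by
      rw [Real.tanh_eq_sinh_div_cosh, ← Real.cosh_sub_sinh]; field_simp
    rw [h3, ← mul_div_assoc, ← Real.exp_add, add_neg_cancel, Real.exp_zero, div_le_iff₀ h2]
    linarith [Real.one_le_cosh x]
  have h4 : x ^ 3 / 6 ≤ Real.exp x := by
    have := Real.pow_div_factorial_le_exp x hx.le 3
    norm_num [Nat.factorial] at this
    exact this
  have h5 : 0 ≤ 1 - Real.tanh x := by linarith [Real.tanh_lt_one x]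
  rw [le_div_iff₀ (by positivity)]
  nlinarith

theorem tanh_nonneg {x : ℝ} (hx : 0 ≤ x) : 0 ≤ Real.tanh x := by
  rw [Real.tanh_eq_sinh_div_cosh]
  exact div_nonneg (Real.sinh_nonneg_iff.2 hx) (Real.cosh_pos _).le

theorem tanh_mono {x y : ℝ} (h : x ≤ y) : Real.tanh x ≤ Real.tanh y := by
  rw [Real.tanh_eq_sinh_div_cosh, Real.tanh_eq_sinh_div_cosh,
    div_le_div_iff₀ (Real.cosh_pos _) (Real.cosh_pos _)]
  have := Real.sinh_nonneg_iff.2 (sub_nonneg.2 h)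
  rw [Real.sinh_sub] at this
  linarith

/-- The factor `((1 + g / x²) tanh (b x))` by which `λ(x)⁴` differs from `x³` varies slowly. -/
theorem abs_ratio_sub_le {g b x N K : ℝ} (hg : 0 < g) (hb : 0 < b) (hN : 1 ≤ N) (hK : 0 ≤ K)
    (hKN : 8 * K ≤ N) (hx : |x - N| ≤ K) :
    |(1 + g / x ^ 2) * Real.tanh (b * x) - (1 + g / N ^ 2) * Real.tanh (b * N)| ≤
      (4 * g + 36 * (1 + g) / b ^ 3) * (1 + K) / N ^ 3 := by
  have hx' := abs_le.1 hx
  have hx1 : 7 / 8 * N ≤ x := by linarith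
  have hx2 : x ≤ 9 / 8 * N := by linarith
  have hN0 : 0 < N := by linarith
  have hx0 : 0 < x := by linarith
  have hNx : N ^ 3 ≤ 2 * x ^ 3 := by
    have : (7 / 8 * N) ^ 3 ≤ x ^ 3 := by gcongr
    nlinarith [pow_pos hN0 3]
  have h1 : |Real.tanh (b * x) - Real.tanh (b * N)| ≤ 36 / b ^ 3 / N ^ 3 := by
    have a1 := one_sub_tanh_le (mul_pos hb hx0)
    have a2 := one_sub_tanh_le (mul_pos hb hN0)
    have a3 := Real.tanh_lt_one (b * x)
    have a4 := Real.tanh_lt_one (b * N)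
    have a5 : 12 / (b * x) ^ 3 ≤ 24 / (b ^ 3 * N ^ 3) := by
      rw [mul_pow, div_le_div_iff₀ (by positivity) (by positivity)]
      nlinarith [pow_pos hb 3]
    have a6 : 24 / (b ^ 3 * N ^ 3) + 12 / (b * N) ^ 3 = 36 / b ^ 3 / N ^ 3 := by
      field_simp; ring
    rw [abs_le]; constructor <;> linarith
  have h2 : |g / x ^ 2 - g / N ^ 2| ≤ 4 * g * K / N ^ 3 := by
    have e : g / x ^ 2 - g / N ^ 2 = g * ((N - x) * (N + x)) / (x ^ 2 * N ^ 2) := by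
      field_simp; ring
    rw [e, abs_div, abs_mul, abs_mul, abs_of_pos hg, abs_of_pos (by positivity : 0 < N + x),
      abs_of_pos (by positivity : 0 < x ^ 2 * N ^ 2), div_le_div_iff₀ (by positivity) (by positivity)]
    have e1 : |N - x| ≤ K := by rwa [abs_sub_comm]
    have e2 : N ^ 3 * (N + x) ≤ 4 * (x ^ 2 * N ^ 2) := by
      have : N * (N + x) ≤ 4 * x ^ 2 := by nlinarith
      nlinarith [pow_pos hN0 2]
    calc g * (|N - x| * (N + x)) * N ^ 3 ≤ g * (K * (N + x)) * N ^ 3 := by gcongr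
      _ = g * K * (N ^ 3 * (N + x)) := by ring
      _ ≤ g * K * (4 * (x ^ 2 * N ^ 2)) := by gcongr
      _ = _ := by ring
  have e : (1 + g / x ^ 2) * Real.tanh (b * x) - (1 + g / N ^ 2) * Real.tanh (b * N) =
      (g / x ^ 2 - g / N ^ 2) * Real.tanh (b * x) +
        (1 + g / N ^ 2) * (Real.tanh (b * x) - Real.tanh (b * N)) := by ring
  have h3 : |Real.tanh (b * x)| ≤ 1 := (Real.abs_tanh_lt_one _).le
  have h4 : |1 + g / N ^ 2| ≤ 1 + g := by
    rw [abs_of_pos (by positivity)]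
    have : g / N ^ 2 ≤ g := div_le_self hg.le (one_le_pow₀ hN)
    linarith
  rw [e]
  refine (abs_add_le _ _).trans ?_
  rw [abs_mul, abs_mul]
  calc _ ≤ 4 * g * K / N ^ 3 * 1 + (1 + g) * (36 / b ^ 3 / N ^ 3) := by gcongr
    _ = (4 * g * K + 36 * (1 + g) / b ^ 3) / N ^ 3 := by field_simp
    _ ≤ _ := by
      gcongr
      have : 0 ≤ 36 * (1 + g) / b ^ 3 := by positivity
      nlinarith

theorem lam_eq {g b : ℝ} (hg : 0 < g) (hb : 0 < b) {k : ℤ} {N a w ρ : ℝ} (hN : 0 < N)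
    (hk : 0 < (k : ℝ)) (ha : 0 ≤ a) (hw : 0 ≤ w) (hρ : 0 ≤ ρ) (ha4 : a ^ 4 = N ^ 3)
    (hw4 : w ^ 4 = k / N) (hρ4 : ρ ^ 4 = (1 + g / (k : ℝ) ^ 2) * Real.tanh (b * k)) :
    lam g b k = a * w ^ 3 * ρ := by
  refine (pow_left_inj₀ (lam_nonneg _ _ _) (by positivity) (by norm_num : (4 : ℕ) ≠ 0)).1 ?_
  rw [lam_pow_four hg hb, abs_of_pos hk, mul_pow, mul_pow, ← pow_mul, mul_comm 3 4, pow_mul, ha4,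
    hw4, hρ4]
  field_simp
  ring

/-- The size of the terms of the decomposition of `symS` in which the ratios `ρᵢ` differ. -/
theorem abs_remainder_le {g N p q w1 w2 w3 ρ0 ρ1 ρ2 ρ3 η : ℝ}
    (hw1b : |w1 ^ 3| ≤ 2) (hw2b : |w2 ^ 3| ≤ 2) (hw3b : |w3 ^ 3| ≤ 2)
    (hρ0b : |ρ0| ≤ 1 + g) (hρ1b : |ρ1| ≤ 1 + g)
    (hd1' : |ρ1 - ρ0| ≤ η) (hd2' : |ρ2 - ρ0| ≤ η) (hd3' : |ρ3 - ρ0| ≤ η)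
    (c1 : |2 * N + p| ≤ 3 * N) (c2 : |2 * N + 2 * q + p| ≤ 3 * N) (c3 : |2 * q - 3 * p| ≤ N) :
    |w3 ^ 3 * w1 ^ 3 * ((ρ3 - ρ0) * ρ1 + ρ0 * (ρ1 - ρ0)) * (2 * N + p) +
        (-(w2 ^ 3 * ((ρ2 - ρ0) * ρ0) * (2 * N + 2 * q + p))) +
        w3 ^ 3 * ((ρ3 - ρ0) * ρ0) * (2 * q - 3 * p)| ≤ 32 * (1 + g) * (N * η) := by
  have mm : ∀ {x y X Y : ℝ}, |x| ≤ X → |y| ≤ Y → |x * y| ≤ X * Y := fun {x y X Y} hx hy => by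
    rw [abs_mul]
    exact mul_le_mul hx hy (abs_nonneg _) ((abs_nonneg _).trans hx)
  have t1 := mm (mm (mm hw3b hw1b) ((abs_add_le _ _).trans
    (add_le_add (mm hd3' hρ1b) (mm hρ0b hd1')))) c1
  have t2 := mm (mm hw2b (mm hd2' hρ0b)) c2
  have t3 := mm (mm hw3b (mm hd3' hρ0b)) c3
  refine (abs_add_le _ _).trans ((add_le_add ((abs_add_le _ _).trans
    (add_le_add t1 ((abs_neg _).trans_le t2))) t3).trans_eq ?_)
  ring

/-- For `k` close to `N`, the symbol `λ(k)` factors as `N^{3/4} (k / N)^{3/4} ρ`, where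
`w³ = (k / N)^{3/4}` belongs to the model symbol and `ρ` is almost independent of `k`. Fourth powers
replace fractional exponents. -/
theorem exists_decomposition {g b : ℝ} (hg : 0 < g) (hb : 0 < b) {a τ N K : ℝ} (ha : 0 ≤ a)
    (hτ : τ ^ 4 = Real.tanh b) (hN1 : 1 ≤ N) (hK0 : 0 ≤ K) (hKn : 8 * K ≤ N)
    (ha4 : a ^ 4 = N ^ 3) (k : ℤ) (hk : |(k : ℝ) - N| ≤ K) :
    ∃ w ρ : ℝ, 0 ≤ w ∧ 0 ≤ ρ ∧ w ^ 4 = k / N ∧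
      lam g b k = a * w ^ 3 * ρ ∧ |w ^ 3| ≤ 2 ∧ |ρ| ≤ 1 + g ∧ τ ≤ ρ ∧
      |ρ ^ 4 - (1 + g / N ^ 2) * Real.tanh (b * N)| ≤
        (4 * g + 36 * (1 + g) / b ^ 3) * (1 + K) / N ^ 3 := by
  have hN0 : 0 < N := by linarith
  have hk' := abs_le.1 hk
  have hk0 : 7 / 8 * N ≤ k := by linarith
  have hk2 : (k : ℝ) ≤ 9 / 8 * N := by linarith
  have hkpos : 0 < (k : ℝ) := by linarith
  have hk1 : (1 : ℝ) ≤ k := by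
    have : 0 < k := by exact_mod_cast hkpos
    exact_mod_cast this
  obtain ⟨w, hw, hw4⟩ := exists_fourth_root (div_nonneg hkpos.le hN0.le)
  have ht : 0 ≤ Real.tanh (b * k) := tanh_nonneg (by positivity)
  obtain ⟨ρ, hρ, hρ4⟩ := exists_fourth_root
    (mul_nonneg (by positivity : 0 ≤ 1 + g / (k : ℝ) ^ 2) ht)
  refine ⟨w, ρ, hw, hρ, hw4, lam_eq hg hb hN0 hkpos ha hw hρ ha4 hw4 hρ4, ?_, ?_, ?_, ?_⟩
  · have : w ≤ 6 / 5 := by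
      refine le_of_pow_le_pow_left₀ (n := 4) (by norm_num) (by norm_num) ?_
      rw [hw4, div_le_iff₀ hN0]; nlinarith [show (6 / 5 : ℝ) ^ 4 = 1296 / 625 by norm_num]
    rw [abs_of_nonneg (by positivity)]
    calc _ ≤ (6 / 5 : ℝ) ^ 3 := by gcongr
      _ ≤ 2 := by norm_num
  · rw [abs_of_nonneg hρ]
    refine le_of_pow_le_pow_left₀ (n := 4) (by norm_num) (by positivity) ?_
    rw [hρ4]
    have h1 : g / (k : ℝ) ^ 2 ≤ g := div_le_self hg.le (one_le_pow₀ hk1)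
    have h2 := (Real.tanh_lt_one (b * k)).le
    calc _ ≤ (1 + g) * 1 := by gcongr
      _ ≤ (1 + g) ^ 4 := by
        rw [mul_one]; exact le_self_pow₀ (by linarith) (by norm_num)
  · refine le_of_pow_le_pow_left₀ (n := 4) (by norm_num) hρ ?_
    rw [hρ4, hτ]
    have h1 : Real.tanh b ≤ Real.tanh (b * k) := tanh_mono (by nlinarith)
    have h2 : 0 ≤ g / (k : ℝ) ^ 2 := by positivity
    nlinarith
  · rw [hρ4]; exact abs_ratio_sub_le hg hb hN1 hK0 hKn hk

/-- At high frequencies the symbol is close to the model symbol `|k|^{3/4}`, for which the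
cancellation is `abs_model_le`. The slowly varying factors `ρ` contribute `abs_remainder_le`. -/
theorem abs_symS_le_of_large {g b : ℝ} (hg : 0 < g) (hb : 0 < b) : ∃ C : ℝ, 0 < C ∧
    ∀ n p q : ℤ, 0 < n → 8 * (|(p : ℝ)| + |(q : ℝ)|) ≤ n →
      |symS g b n p q| ≤ C * (1 + (|(p : ℝ)| + |(q : ℝ)|)) ^ 3 := by
  obtain ⟨τ, hτ0, hτ⟩ := exists_fourth_root (tanh_nonneg hb.le)
  have hτpos : 0 < τ := by
    refine hτ0.lt_of_ne fun h => ?_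
    rw [← h] at hτ
    have : 0 < Real.tanh b := by
      rw [Real.tanh_eq_sinh_div_cosh]
      exact div_pos (Real.sinh_pos_iff.2 hb) (Real.cosh_pos _)
    norm_num at hτ
    linarith
  set C0 := 4 * g + 36 * (1 + g) / b ^ 3 with hC0
  have hC0pos : 0 < C0 := by positivity
  refine ⟨400 * (1 + g) ^ 2 + 64 * (1 + g) * C0 / τ ^ 3, by positivity, fun n p q hn hKn => ?_⟩
  set K := |(p : ℝ)| + |(q : ℝ)| with hK
  have hK0 : 0 ≤ K := by positivity
  set N := (n : ℝ) with hN
  have hN1 : 1 ≤ N := by rw [hN]; exact_mod_cast hn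
  have hN0 : 0 < N := by linarith
  have hp := abs_le.1 (show |(p : ℝ)| ≤ K by rw [hK]; linarith [abs_nonneg (q : ℝ)])
  have hq := abs_le.1 (show |(q : ℝ)| ≤ K by rw [hK]; linarith [abs_nonneg (p : ℝ)])
  have hpq := abs_le.1 (show |(p : ℝ) + q| ≤ K from abs_add_le _ _)
  obtain ⟨a, ha, ha4⟩ := exists_fourth_root (pow_nonneg hN0.le 3)
  have haN : a ≤ N := by
    refine le_of_pow_le_pow_left₀ (n := 4) (by norm_num) hN0.le ?_
    rw [ha4]; exact pow_le_pow_right₀ hN1 (by norm_num)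
  -- the decomposition `λ(k) = a w³ ρ`, for `k` close to `n`
  have key : ∀ k : ℤ, |(k : ℝ) - N| ≤ K → ∃ w ρ : ℝ, 0 ≤ w ∧ 0 ≤ ρ ∧ w ^ 4 = k / N ∧
      lam g b k = a * w ^ 3 * ρ ∧ |w ^ 3| ≤ 2 ∧ |ρ| ≤ 1 + g ∧ τ ≤ ρ ∧
      |ρ ^ 4 - (1 + g / N ^ 2) * Real.tanh (b * N)| ≤ C0 * (1 + K) / N ^ 3 := by
    intro k hk
    exact exists_decomposition hg hb ha hτ hN1 hK0 hKn ha4 k hk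
  obtain ⟨w0, ρ0, hw0, hρ0, hw04, hl0, hw0b, hρ0b, hτ0', hd0⟩ := key n (by rw [← hN]; simpa)
  obtain ⟨w1, ρ1, hw1, hρ1, hw14, hl1, hw1b, hρ1b, hτ1, hd1⟩ := key (n + p) (by
    rw [abs_le]; push_cast; constructor <;> linarith)
  obtain ⟨w2, ρ2, hw2, hρ2, hw24, hl2, hw2b, hρ2b, hτ2, hd2⟩ := key (n + q) (by
    rw [abs_le]; push_cast; constructor <;> linarith)
  obtain ⟨w3, ρ3, hw3, hρ3, hw34, hl3, hw3b, hρ3b, hτ3, hd3⟩ := key (n + p + q) (by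
    rw [abs_le]; push_cast; constructor <;> linarith)
  have hw0' : w0 = 1 := by
    rw [← hN, div_self hN0.ne'] at hw04
    exact (pow_eq_one_iff_of_nonneg hw0 (by norm_num)).1 hw04
  set η := 2 * (C0 * (1 + K) / N ^ 3) / τ ^ 3 with hη
  have hη0 : 0 ≤ η := by positivity
  have hdiff : ∀ ρ : ℝ, 0 ≤ ρ →
      |ρ ^ 4 - (1 + g / N ^ 2) * Real.tanh (b * N)| ≤ C0 * (1 + K) / N ^ 3 → |ρ - ρ0| ≤ η := by
    intro ρ hρ h
    have h1 : |ρ ^ 4 - ρ0 ^ 4| ≤ 2 * (C0 * (1 + K) / N ^ 3) := by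
      have h2 := abs_le.1 h
      have h3 := abs_le.1 hd0
      rw [abs_le]; constructor <;> linarith
    have h4 : ρ ^ 4 - ρ0 ^ 4 = (ρ - ρ0) * (ρ ^ 3 + ρ ^ 2 * ρ0 + ρ * ρ0 ^ 2 + ρ0 ^ 3) := by ring
    rw [h4, abs_mul] at h1
    rw [hη, le_div_iff₀ (by positivity)]
    refine le_trans ?_ h1
    gcongr
    rw [abs_of_nonneg (by positivity)]
    have h5 : τ ^ 3 ≤ ρ0 ^ 3 := by gcongr
    have h6 : 0 ≤ ρ ^ 3 + ρ ^ 2 * ρ0 + ρ * ρ0 ^ 2 := by positivity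
    linarith
  have hd1' := hdiff ρ1 hρ1 hd1
  have hd2' := hdiff ρ2 hρ2 hd2
  have hd3' := hdiff ρ3 hρ3 hd3
  have hmodel := abs_model_le (x := p / N) (y := q / N) (u := K / N) (w₁ := w1) (w₂ := w2)
    (w₃ := w3)
    (by rw [abs_div, abs_of_pos hN0]; gcongr; rw [hK]; linarith [abs_nonneg (q : ℝ)])
    (by rw [abs_div, abs_of_pos hN0]; gcongr; rw [hK]; linarith [abs_nonneg (p : ℝ)])
    (by rw [div_le_iff₀ hN0]; linarith) hw1 hw2 hw3
    (by rw [hw14]; push_cast; rw [← hN]; field_simp) (by rw [hw24]; push_cast; rw [← hN]; field_simp)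
    (by rw [hw34]; push_cast; rw [← hN]; field_simp; ring)
  set s := w3 ^ 3 * w1 ^ 3 * (2 + p / N) - w2 ^ 3 * (2 + 2 * (q / N) + p / N) +
    w3 ^ 3 * (2 * (q / N) - 3 * (p / N)) with hs
  have e : symS g b n p q = a ^ 2 * (N * ρ0 ^ 2 * s) + a ^ 2 *
      (w3 ^ 3 * w1 ^ 3 * ((ρ3 - ρ0) * ρ1 + ρ0 * (ρ1 - ρ0)) * (2 * N + p) +
        (-(w2 ^ 3 * ((ρ2 - ρ0) * ρ0) * (2 * N + 2 * q + p))) +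
        w3 ^ 3 * ((ρ3 - ρ0) * ρ0) * (2 * q - 3 * p)) := by
    rw [symS, hl0, hl1, hl2, hl3, hw0', hs, ← hN]
    field_simp
    ring
  have ha2 : |a ^ 2| ≤ N ^ 2 := by rw [abs_of_nonneg (by positivity)]; gcongr
  have b1 : |a ^ 2 * (N * ρ0 ^ 2 * s)| ≤ 400 * (1 + g) ^ 2 * K ^ 3 := by
    rw [abs_mul, abs_mul, abs_mul, abs_of_pos hN0, abs_pow ρ0]
    calc _ ≤ N ^ 2 * (N * (1 + g) ^ 2 * (400 * (K / N) ^ 3)) := by gcongr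
      _ = _ := by field_simp
  have c1 : |2 * N + p| ≤ 3 * N := by rw [abs_le]; constructor <;> linarith
  have c2 : |2 * N + 2 * q + p| ≤ 3 * N := by rw [abs_le]; constructor <;> linarith
  have c3 : |2 * (q : ℝ) - 3 * p| ≤ N := by rw [abs_le]; constructor <;> linarith
  have b2 := abs_remainder_le hw1b hw2b hw3b hρ0b hρ1b hd1' hd2' hd3' c1 c2 c3
  have b3 := mul_le_mul ha2 b2 (abs_nonneg _) (by positivity)
  rw [← abs_mul] at b3
  rw [e]
  refine (abs_add_le _ _).trans ((add_le_add b1 b3).trans ?_)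
  have e4 : N ^ 2 * (32 * (1 + g) * (N * η)) = 64 * (1 + g) * C0 / τ ^ 3 * (1 + K) := by
    rw [hη]; field_simp; ring
  rw [e4, add_mul]
  have h1K : 1 + K ≤ (1 + K) ^ 3 := le_self_pow₀ (by linarith) (by norm_num)
  have h2K : K ^ 3 ≤ (1 + K) ^ 3 := by gcongr; linarith
  gcongr

/-- No cancellation is needed if the frequency `n` is controlled by those of the coefficients. -/
theorem abs_symS_le_of_small {g b : ℝ} (hg : 0 < g) (hb : 0 < b) {n p q : ℤ} {K : ℝ}
    (hK : K = |(p : ℝ)| + |(q : ℝ)|) (hn : |(n : ℝ)| ≤ 8 * K) :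
    |symS g b n p q| ≤ 10000 * (g + 1) ^ 2 * (1 + K) ^ 3 := by
  have hp : |(p : ℝ)| ≤ K := by rw [hK]; linarith [abs_nonneg (q : ℝ)]
  have hq : |(q : ℝ)| ≤ K := by rw [hK]; linarith [abs_nonneg (p : ℝ)]
  have hpq := abs_add_le (p : ℝ) q
  rw [← hK] at hpq
  have hK0 : 0 ≤ K := (abs_nonneg _).trans hp
  have hl : ∀ k : ℤ, |(k : ℝ)| ≤ 9 * K → |lam g b k| ≤ (g + 1) * (10 * (1 + K)) := fun k hk => by
    rw [abs_of_nonneg (lam_nonneg _ _ _)]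
    refine (lam_le hg hb k).trans (mul_le_mul_of_nonneg_left ?_ (by linarith))
    rw [jp]; linarith
  have hn' := abs_le.1 hn
  have hp' := abs_le.1 hp
  have hq' := abs_le.1 hq
  have hpq' := abs_le.1 hpq
  have l0 := hl n (by linarith)
  have l1 := hl (n + p) (by push_cast; rw [abs_le]; constructor <;> linarith)
  have l2 := hl (n + q) (by push_cast; rw [abs_le]; constructor <;> linarith)
  have l3 := hl (n + p + q) (by push_cast; rw [abs_le]; constructor <;> linarith)
  have mm : ∀ {x y X Y : ℝ}, |x| ≤ X → |y| ≤ Y → |x * y| ≤ X * Y := fun {x y X Y} hx hy => by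
    rw [abs_mul]
    exact mul_le_mul hx hy (abs_nonneg _) ((abs_nonneg _).trans hx)
  have f1 : |2 * (n : ℝ) + p| ≤ 20 * (1 + K) := by rw [abs_le]; constructor <;> linarith
  have f2 : |2 * (n : ℝ) + 2 * q + p| ≤ 20 * (1 + K) := by rw [abs_le]; constructor <;> linarith
  have f3 : |2 * (q : ℝ) - 3 * p| ≤ 20 * (1 + K) := by rw [abs_le]; constructor <;> linarith
  have t1 := mm (mm l3 l1) f1
  have t2 := mm (mm l2 l0) f2
  have t3 := mm (mm l3 l0) f3
  rw [symS]
  refine (abs_add_le _ _).trans ((add_le_add ((abs_sub _ _).trans (add_le_add t1 t2)) t3).trans ?_)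
  have : 0 ≤ (g + 1) ^ 2 * (1 + K) ^ 3 := by positivity
  nlinarith

/-- The commutator symbol is bounded uniformly in the frequency `n` of the function it acts on:
this is the cancellation which makes the conjugated operator a perturbation of order zero. -/
theorem exists_abs_symS_le {g b : ℝ} (hg : 0 < g) (hb : 0 < b) : ∃ C : ℝ, 0 < C ∧
    ∀ n p q : ℤ, |symS g b n p q| ≤ C * (jp p ^ 3 * jp q ^ 3) := by
  obtain ⟨C, hC, h⟩ := abs_symS_le_of_large hg hb
  refine ⟨C + 10000 * (g + 1) ^ 2, by positivity, fun n p q => ?_⟩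
  have hj : (1 + (|(p : ℝ)| + |(q : ℝ)|)) ^ 3 ≤ jp p ^ 3 * jp q ^ 3 := by
    rw [← mul_pow]
    refine pow_le_pow_left₀ (by positivity) ?_ 3
    rw [jp, jp]
    nlinarith [abs_nonneg (p : ℝ), abs_nonneg (q : ℝ),
      mul_nonneg (abs_nonneg (p : ℝ)) (abs_nonneg (q : ℝ))]
  refine le_trans ?_ (mul_le_mul_of_nonneg_left hj (by positivity))
  have hpos : 0 ≤ (1 + (|(p : ℝ)| + |(q : ℝ)|)) ^ 3 := by positivity
  rw [add_mul]
  by_cases hs : |(n : ℝ)| ≤ 8 * (|(p : ℝ)| + |(q : ℝ)|)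
  · have := abs_symS_le_of_small hg hb rfl hs
    have : 0 ≤ C * (1 + (|(p : ℝ)| + |(q : ℝ)|)) ^ 3 := by positivity
    linarith
  · push Not at hs
    have h2 : 0 ≤ 10000 * (g + 1) ^ 2 * (1 + (|(p : ℝ)| + |(q : ℝ)|)) ^ 3 := by positivity
    have hn0 : n ≠ 0 := by
      rintro rfl
      simp only [Int.cast_zero, abs_zero] at hs
      linarith [abs_nonneg (p : ℝ), abs_nonneg (q : ℝ)]
    -- the symbol is odd, which reduces negative `n` to positive `n`
    rcases lt_or_gt_of_ne hn0 with hn | hn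
    · have hn' : ((n : ℤ) : ℝ) < 0 := by exact_mod_cast hn
      have := h (-n) (-p) (-q) (by omega) (by
        rw [abs_of_neg hn'] at hs; push_cast; rw [abs_neg, abs_neg]; exact hs.le)
      rw [symS_neg, abs_neg] at this
      push_cast at this
      rw [abs_neg, abs_neg] at this
      linarith
    · have hn' : (0 : ℝ) < ((n : ℤ) : ℝ) := by exact_mod_cast hn
      have := h n p q hn (by rw [abs_of_pos hn'] at hs; exact hs.le)
      linarith

/-! ### The quadratic form of the principal part along a path of changes of variables -/

/-- The terms of the double series of the form `⟨L^{1/2} (c L^{1/2} f), h⟩`. -/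
def formTerm (g b : ℝ) (c f h : ℤ → ℂ) (x : ℤ × ℤ) : ℂ :=
  lam g b (x.1 + x.2) * lam g b x.1 * (c x.2 * f x.1 * conj (h (x.1 + x.2)))

/-- The index change `(l, q, p) ↦ (l, q - p, p)`. -/
def shearSnd : (ℤ × ℤ) × ℤ ≃ (ℤ × ℤ) × ℤ where
  toFun x := ((x.1.1, x.1.2 - x.2), x.2)
  invFun x := ((x.1.1, x.1.2 + x.2), x.2)
  left_inv x := by simp
  right_inv x := by simp

/-- The index change `(l, q, p) ↦ (l - p, q, p)`. -/
def shearFst : (ℤ × ℤ) × ℤ ≃ (ℤ × ℤ) × ℤ where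
  toFun x := ((x.1.1 - x.2, x.1.2), x.2)
  invFun x := ((x.1.1 + x.2, x.1.2), x.2)
  left_inv x := by simp
  right_inv x := by simp

theorem summable_triple {f c v : ℤ → ℝ} (hf : Summable f) (hc : Summable c) (hv : Summable v)
    (hf0 : ∀ i, 0 ≤ f i) (hc0 : ∀ i, 0 ≤ c i) (hv0 : ∀ i, 0 ≤ v i) :
    Summable fun x : (ℤ × ℤ) × ℤ => f x.1.1 * c x.1.2 * v x.2 :=
  (hf.mul_of_nonneg hc hf0 hc0).mul_of_nonneg hv (fun _ => mul_nonneg (hf0 _) (hc0 _)) hv0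

theorem lam_add_add_le {g b : ℝ} (hg : 0 < g) (hb : 0 < b) (n p q : ℤ) :
    lam g b (n + p + q) ≤ (g + 1) * (jp n * jp p * jp q) := by
  refine (lam_le hg hb _).trans (mul_le_mul_of_nonneg_left ?_ (by linarith))
  exact (jp_add_le _ _).trans (mul_le_mul_of_nonneg_right (jp_add_le _ _) (jp_pos _).le)

theorem lam_add_le {g b : ℝ} (hg : 0 < g) (hb : 0 < b) (n p : ℤ) :
    lam g b (n + p) ≤ (g + 1) * (jp n * jp p) :=
  (lam_le hg hb _).trans (mul_le_mul_of_nonneg_left (jp_add_le _ _) (by linarith))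

section Core

variable {g b : ℝ} {v c f h : ℤ → ℂ}

/-- The triple series which all the derivatives of the form are expressed by; its weight `w`
grows at most like the third power of each frequency. -/
theorem summable_weighted {B H : ℝ} (hv : wn 3 v ≠ ⊤) (hc : wn 3 c ≠ ⊤) (hf : wn 3 f ≠ ⊤)
    (hh : ∀ k, ‖h k‖ ≤ H) {w : (ℤ × ℤ) × ℤ → ℂ}
    (hw : ∀ x, ‖w x‖ ≤ B * (jp x.1.1 ^ 3 * jp x.1.2 ^ 3 * jp x.2 ^ 3)) :
    Summable fun x : (ℤ × ℤ) × ℤ =>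
      w x * (v x.2 * c x.1.2 * f x.1.1 * conj (h (x.1.1 + x.2 + x.1.2))) := by
  have hH : 0 ≤ H := (norm_nonneg _).trans (hh 0)
  have h1 := summable_triple (summable_of_wn hf) (summable_of_wn hc) (summable_of_wn hv)
    (fun i => by have := jp_pos i; positivity) (fun i => by have := jp_pos i; positivity)
    (fun i => by have := jp_pos i; positivity)
  refine Summable.of_norm_bounded (h1.mul_left (B * H)) fun x => ?_
  rw [norm_mul, norm_mul, norm_mul, norm_mul, RCLike.norm_conj]
  calc _ ≤ (B * (jp x.1.1 ^ 3 * jp x.1.2 ^ 3 * jp x.2 ^ 3)) *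
        (‖v x.2‖ * ‖c x.1.2‖ * ‖f x.1.1‖ * H) :=
        mul_le_mul (hw x) (mul_le_mul_of_nonneg_left (hh _) (by positivity)) (by positivity)
          ((norm_nonneg _).trans (hw x))
    _ = _ := by ring

theorem norm_lin_le {n p q : ℤ} {α β γ : ℝ} :
    ‖Complex.I * ((α : ℂ) * n + β * p + γ * q)‖ ≤ (|α| + |β| + |γ|) * (jp n * jp p * jp q) := by
  have hn := one_le_jp n
  have hp := one_le_jp p
  have hq := one_le_jp q
  have h1 : jp n ≤ jp n * jp p * jp q := by
    rw [mul_assoc]; exact le_mul_of_one_le_right (by linarith) (one_le_mul_of_one_le_of_one_le hp hq)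
  have h2 : jp p ≤ jp n * jp p * jp q := by
    rw [mul_comm (jp n), mul_assoc]
    exact le_mul_of_one_le_right (by linarith) (one_le_mul_of_one_le_of_one_le hn hq)
  have h3 : jp q ≤ jp n * jp p * jp q :=
    le_mul_of_one_le_left (by linarith) (one_le_mul_of_one_le_of_one_le hn hp)
  rw [norm_mul, Complex.norm_I, one_mul]
  refine (norm_add₃_le).trans ?_
  simp only [norm_mul, Complex.norm_real, Real.norm_eq_abs, Complex.norm_intCast]
  have e1 := (abs_le_jp n).trans h1
  have e2 := (abs_le_jp p).trans h2
  have e3 := (abs_le_jp q).trans h3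
  rw [add_mul, add_mul]
  gcongr

theorem norm_weight_le {x y X Y Z : ℝ} (hx : |x| ≤ X) (hy : |y| ≤ Y) {w : ℂ} (hz : ‖w‖ ≤ Z)
    (hX : 0 ≤ X) (hY : 0 ≤ Y) : ‖(x : ℂ) * y * w‖ ≤ X * Y * Z := by
  rw [norm_mul, norm_mul, Complex.norm_real, Complex.norm_real]
  exact mul_le_mul (mul_le_mul hx hy (abs_nonneg _) hX) hz (norm_nonneg _) (by positivity)

/-- The derivative of the form along the flow of the vector field `v`, as a series with the
commutator symbol. -/
theorem hasSum_form_deriv (hg : 0 < g) (hb : 0 < b) {c' f' h' : ℤ → ℂ} {H : ℝ}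
    (hv : wn 3 v ≠ ⊤) (hc : wn 3 c ≠ ⊤) (hf : wn 3 f ≠ ⊤) (hh : ∀ k, ‖h k‖ ≤ H)
    (hvr : ∀ p, v (-p) = conj (v p))
    (hc' : ∀ q, HasSum (fun p : ℤ => v p * (Complex.I * (q - 5 / 2 * p)) * c (q - p)) (c' q))
    (hf' : ∀ l, HasSum (fun p : ℤ => v p * (Complex.I * (l - p / 2)) * f (l - p)) (f' l))
    (hh' : ∀ l, HasSum (fun p : ℤ => v p * (Complex.I * (l - p / 2)) * h (l - p)) (h' l)) :
    (Summable fun x : (ℤ × ℤ) × ℤ => (Complex.I / 2 * symS g b x.1.1 x.2 x.1.2) *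
        (v x.2 * c x.1.2 * f x.1.1 * conj (h (x.1.1 + x.2 + x.1.2)))) ∧
    HasSum (fun y : ℤ × ℤ => formTerm g b c' f h y + formTerm g b c f' h y + formTerm g b c f h' y)
      (∑' x : (ℤ × ℤ) × ℤ, (Complex.I / 2 * symS g b x.1.1 x.2 x.1.2) *
        (v x.2 * c x.1.2 * f x.1.1 * conj (h (x.1.1 + x.2 + x.1.2)))) := by
  have hg1 : 0 < g + 1 := by linarith
  have habs : ∀ k, |lam g b k| = lam g b k := fun k => abs_of_nonneg (lam_nonneg _ _ _)
  have J : ∀ n p q : ℤ, 1 ≤ jp n ∧ 1 ≤ jp p ∧ 1 ≤ jp q := fun n p q =>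
    ⟨one_le_jp _, one_le_jp _, one_le_jp _⟩
  have fin : ∀ (n p q : ℤ) (A : ℝ), 0 ≤ A →
      (g + 1) * (jp n * jp p * jp q) * ((g + 1) * (jp n * jp p * jp q)) *
        (A * (jp n * jp p * jp q)) = (g + 1) ^ 2 * A * (jp n ^ 3 * jp q ^ 3 * jp p ^ 3) := by
    intros; ring
  have l1 : ∀ n p q : ℤ, |lam g b n| ≤ (g + 1) * (jp n * jp p * jp q) := by
    intro n p q
    have := lam_add_add_le hg hb n 0 0
    obtain ⟨j1, j2, j3⟩ := J n p q
    rw [habs]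
    refine (lam_le hg hb n).trans (mul_le_mul_of_nonneg_left ?_ hg1.le)
    rw [mul_assoc]; exact le_mul_of_one_le_right (by linarith)
      (one_le_mul_of_one_le_of_one_le j2 j3)
  have l2 : ∀ n p q : ℤ, |lam g b (n + p)| ≤ (g + 1) * (jp n * jp p * jp q) := by
    intro n p q
    obtain ⟨j1, j2, j3⟩ := J n p q
    rw [habs]
    refine (lam_add_le hg hb n p).trans (mul_le_mul_of_nonneg_left ?_ hg1.le)
    exact le_mul_of_one_le_right (by positivity) j3
  have l3 : ∀ n p q : ℤ, |lam g b (n + q)| ≤ (g + 1) * (jp n * jp p * jp q) := by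
    intro n p q
    rw [mul_right_comm]; exact l2 n q p
  have l4 : ∀ n p q : ℤ, |lam g b (n + p + q)| ≤ (g + 1) * (jp n * jp p * jp q) := by
    intro n p q
    rw [habs]; exact lam_add_add_le hg hb n p q
  have P0 : ∀ n p q : ℤ, 0 ≤ (g + 1) * (jp n * jp p * jp q) := fun n p q =>
    (abs_nonneg _).trans (l4 n p q)
  -- the three weights
  let w1 : (ℤ × ℤ) × ℤ → ℂ := fun x => lam g b (x.1.1 + x.2 + x.1.2) * lam g b x.1.1 *
    (Complex.I * (((0 : ℝ) : ℂ) * x.1.1 + ((-(3 / 2) : ℝ) : ℂ) * x.2 + ((1 : ℝ) : ℂ) * x.1.2))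
  let w2 : (ℤ × ℤ) × ℤ → ℂ := fun x => lam g b (x.1.1 + x.2 + x.1.2) * lam g b (x.1.1 + x.2) *
    (Complex.I * (((1 : ℝ) : ℂ) * x.1.1 + ((1 / 2 : ℝ) : ℂ) * x.2 + ((0 : ℝ) : ℂ) * x.1.2))
  let w3 : (ℤ × ℤ) × ℤ → ℂ := fun x => lam g b (x.1.1 + x.1.2) * lam g b x.1.1 *
    (Complex.I * (((-1 : ℝ) : ℂ) * x.1.1 + ((-(1 / 2) : ℝ) : ℂ) * x.2 + ((-1 : ℝ) : ℂ) * x.1.2))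
  have s1 := summable_weighted (w := w1) hv hc hf hh fun x =>
    (norm_weight_le (l4 x.1.1 x.2 x.1.2) (l1 x.1.1 x.2 x.1.2) norm_lin_le
      (P0 _ _ _) (P0 _ _ _)).trans_eq (fin _ _ _ _ (by positivity))
  have s2 := summable_weighted (w := w2) hv hc hf hh fun x =>
    (norm_weight_le (l4 x.1.1 x.2 x.1.2) (l2 x.1.1 x.2 x.1.2) norm_lin_le
      (P0 _ _ _) (P0 _ _ _)).trans_eq (fin _ _ _ _ (by positivity))
  have s3 := summable_weighted (w := w3) hv hc hf hh fun x =>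
    (norm_weight_le (l3 x.1.1 x.2 x.1.2) (l1 x.1.1 x.2 x.1.2) norm_lin_le
      (P0 _ _ _) (P0 _ _ _)).trans_eq (fin _ _ _ _ (by positivity))
  have t1 : HasSum (fun y => formTerm g b c' f h y) _ :=
    (shearSnd.hasSum_iff.2 s1.hasSum).prod_fiberwise fun y => by
      have := (hc' y.2).mul_left (lam g b (y.1 + y.2) * lam g b y.1 * (f y.1 * conj (h (y.1 + y.2))))
      rw [show formTerm g b c' f h y = (lam g b (y.1 + y.2) * lam g b y.1 *
        (f y.1 * conj (h (y.1 + y.2)))) * c' y.2 by rw [formTerm]; ring]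
      refine this.congr_fun fun p => ?_
      simp only [Function.comp_apply, shearSnd, Equiv.coe_fn_mk, w1]
      rw [show y.1 + p + (y.2 - p) = y.1 + y.2 by ring]
      push_cast
      ring
  have t2 : HasSum (fun y => formTerm g b c f' h y) _ :=
    (shearFst.hasSum_iff.2 s2.hasSum).prod_fiberwise fun y => by
      have := (hf' y.1).mul_left (lam g b (y.1 + y.2) * lam g b y.1 * (c y.2 * conj (h (y.1 + y.2))))
      rw [show formTerm g b c f' h y = (lam g b (y.1 + y.2) * lam g b y.1 *
        (c y.2 * conj (h (y.1 + y.2)))) * f' y.1 by rw [formTerm]; ring]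
      refine this.congr_fun fun p => ?_
      simp only [Function.comp_apply, shearFst, Equiv.coe_fn_mk, w2]
      rw [show y.1 - p + p = y.1 by ring]
      push_cast
      ring
  have t3 : HasSum (fun y => formTerm g b c f h' y) _ :=
    s3.hasSum.prod_fiberwise fun y => by
      have h1 := (Equiv.neg ℤ).hasSum_iff.2 ((hh' (y.1 + y.2)).map (starRingEnd ℂ) Complex.continuous_conj)
      have := h1.mul_left (lam g b (y.1 + y.2) * lam g b y.1 * (c y.2 * f y.1))
      rw [show formTerm g b c f h' y = (lam g b (y.1 + y.2) * lam g b y.1 *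
        (c y.2 * f y.1)) * conj (h' (y.1 + y.2)) by rw [formTerm]; ring]
      refine this.congr_fun fun p => ?_
      simp only [Function.comp_apply, Equiv.neg_apply, w3, map_mul, hvr, Complex.conj_conj,
        Complex.conj_I, map_sub, map_div₀, map_ofNat, map_intCast]
      rw [show y.1 + y.2 - -p = y.1 + p + y.2 by ring]
      push_cast
      ring
  have e : (fun x : (ℤ × ℤ) × ℤ => (Complex.I / 2 * symS g b x.1.1 x.2 x.1.2) *
        (v x.2 * c x.1.2 * f x.1.1 * conj (h (x.1.1 + x.2 + x.1.2)))) = fun x =>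
      w1 x * (v x.2 * c x.1.2 * f x.1.1 * conj (h (x.1.1 + x.2 + x.1.2))) +
      w2 x * (v x.2 * c x.1.2 * f x.1.1 * conj (h (x.1.1 + x.2 + x.1.2))) +
      w3 x * (v x.2 * c x.1.2 * f x.1.1 * conj (h (x.1.1 + x.2 + x.1.2))) := by
    ext x
    simp only [symS, w1, w2, w3]
    push_cast
    ring
  rw [e]
  refine ⟨(s1.add s2).add s3, ?_⟩
  rw [((s1.add s2).tsum_add s3), s1.tsum_add s2]
  exact (t1.add t2).add t3

/-- The bound of the derivative of the form, in terms of `L²` norms only. -/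
theorem norm_tsum_symS_le {C A A' : ℝ} (hC : 0 ≤ C)
    (hS : ∀ n p q : ℤ, |symS g b n p q| ≤ C * (jp p ^ 3 * jp q ^ 3))
    (hA : 0 ≤ A) (hA' : 0 ≤ A') (hv : wn 3 v ≤ ENNReal.ofReal A) (hc : wn 3 c ≤ ENNReal.ofReal A')
    (hf : Summable fun k => ‖f k‖ ^ 2) (hh : Summable fun k => ‖h k‖ ^ 2) :
    ‖∑' x : (ℤ × ℤ) × ℤ, (Complex.I / 2 * symS g b x.1.1 x.2 x.1.2) *
        (v x.2 * c x.1.2 * f x.1.1 * conj (h (x.1.1 + x.2 + x.1.2)))‖ ≤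
      C * (A * A') * (Real.sqrt (∑' k, ‖f k‖ ^ 2) * Real.sqrt (∑' k, ‖h k‖ ^ 2)) := by
  set R := Real.sqrt (∑' k, ‖f k‖ ^ 2) * Real.sqrt (∑' k, ‖h k‖ ^ 2) with hR
  have hR0 : 0 ≤ R := by positivity
  have sv := summable_of_wn (hv.trans_lt ENNReal.ofReal_lt_top).ne
  have sc := summable_of_wn (hc.trans_lt ENNReal.ofReal_lt_top).ne
  have bv := tsum_le_of_wn hA hv
  have bc := tsum_le_of_wn hA' hc
  have nn : ∀ (a : ℤ → ℂ) (i : ℤ), 0 ≤ jp i ^ 3 * ‖a i‖ := fun a i => by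
    have := jp_pos i; positivity
  -- for fixed `p` and `q`, the sum over `n` is a scalar product
  have hn : ∀ s : ℤ, (Summable fun n => ‖f n‖ * ‖h (n + s)‖) ∧
      ∑' n, ‖f n‖ * ‖h (n + s)‖ ≤ R := fun s => by
    have h1 : Summable fun n => ‖h (n + s)‖ ^ 2 := (Equiv.addRight s).summable_iff.2 hh
    have h2 := summable_mul_and_tsum_le (fun i => norm_nonneg (f i))
      (fun i => norm_nonneg (h (i + s))) hf h1
    refine ⟨h2.1, h2.2.trans_eq ?_⟩
    rw [hR]
    congr 2
    exact (Equiv.addRight s).tsum_eq (fun n => ‖h n‖ ^ 2)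
  let F : (ℤ × ℤ) × ℤ → ℝ := fun z =>
    C * ((jp z.1.1 ^ 3 * ‖v z.1.1‖) * (jp z.1.2 ^ 3 * ‖c z.1.2‖)) *
      (‖f z.2‖ * ‖h (z.2 + (z.1.1 + z.1.2))‖)
  have hF0 : ∀ z, 0 ≤ F z := fun z => by
    have := nn v z.1.1; have := nn c z.1.2; positivity
  have spq := sv.mul_of_nonneg sc (nn v) (nn c)
  have hfib : ∀ y : ℤ × ℤ, HasSum (fun n => F (y, n))
      (C * ((jp y.1 ^ 3 * ‖v y.1‖) * (jp y.2 ^ 3 * ‖c y.2‖)) *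
        ∑' n, ‖f n‖ * ‖h (n + (y.1 + y.2))‖) := fun y =>
    ((hn (y.1 + y.2)).1.hasSum).mul_left _
  have hle : ∀ y : ℤ × ℤ, ∑' n, F (y, n) ≤
      C * R * ((jp y.1 ^ 3 * ‖v y.1‖) * (jp y.2 ^ 3 * ‖c y.2‖)) := fun y => by
    rw [(hfib y).tsum_eq]
    have h1 := nn v y.1; have h2 := nn c y.2
    calc _ ≤ C * ((jp y.1 ^ 3 * ‖v y.1‖) * (jp y.2 ^ 3 * ‖c y.2‖)) * R :=
          mul_le_mul_of_nonneg_left (hn _).2 (by positivity)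
      _ = _ := by ring
  have hsum1 : Summable fun y => ∑' n, F (y, n) :=
    (spq.mul_left (C * R)).of_nonneg_of_le (fun y => tsum_nonneg fun n => hF0 _) hle
  have hFs : Summable F := (summable_prod_of_nonneg hF0).2 ⟨fun y => (hfib y).summable, hsum1⟩
  have hFt : ∑' z, F z ≤ C * (A * A') * R := by
    rw [hFs.tsum_prod]
    refine (hsum1.tsum_le_tsum hle (spq.mul_left _)).trans ?_
    rw [tsum_mul_left]
    have : ∑' y : ℤ × ℤ, (jp y.1 ^ 3 * ‖v y.1‖) * (jp y.2 ^ 3 * ‖c y.2‖) ≤ A * A' := by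
      rw [← sv.tsum_mul_tsum sc spq]
      exact mul_le_mul bv bc (tsum_nonneg (nn c)) hA
    calc _ ≤ C * R * (A * A') := mul_le_mul_of_nonneg_left this (by positivity)
      _ = _ := by ring
  let e : (ℤ × ℤ) × ℤ ≃ (ℤ × ℤ) × ℤ :=
    { toFun := fun x => ((x.2, x.1.2), x.1.1)
      invFun := fun x => ((x.2, x.1.2), x.1.1)
      left_inv := fun x => rfl
      right_inv := fun x => rfl }
  refine le_trans (tsum_of_norm_bounded (e.hasSum_iff.2 hFs.hasSum) fun x => ?_) hFt
  simp only [norm_mul, RCLike.norm_conj, norm_div, Complex.norm_I, Complex.norm_real,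
    Real.norm_eq_abs, Complex.norm_ofNat, Function.comp_apply, e, Equiv.coe_fn_mk, F]
  have h1 := hS x.1.1 x.2 x.1.2
  rw [show x.1.1 + x.2 + x.1.2 = x.1.1 + (x.2 + x.1.2) by ring]
  calc _ = (1 / 2 * |symS g b x.1.1 x.2 x.1.2|) * (‖v x.2‖ * ‖c x.1.2‖ *
        (‖f x.1.1‖ * ‖h (x.1.1 + (x.2 + x.1.2))‖)) := by ring
    _ ≤ (C * (jp x.2 ^ 3 * jp x.1.2 ^ 3)) * (‖v x.2‖ * ‖c x.1.2‖ *
        (‖f x.1.1‖ * ‖h (x.1.1 + (x.2 + x.1.2))‖)) := by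
      refine mul_le_mul_of_nonneg_right ?_ (by positivity)
      have := abs_nonneg (symS g b x.1.1 x.2 x.1.2)
      linarith
    _ = _ := by ring

end Core

/-! ### Differentiation of curves of functions and of series -/

theorem norm_cl_sq (f : C(Torus, ℂ)) : ‖cl f‖ ^ 2 = ∫ x, ‖f x‖ ^ 2 ∂dx := by
  have h := inner_cl_cl f f
  rw [inner_self_eq_norm_sq_to_K] at h
  have h2 : ∫ x, conj (f x) * f x ∂dx = ((∫ x, ‖f x‖ ^ 2 ∂dx : ℝ) : ℂ) := by
    rw [← integral_complex_ofReal]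
    refine integral_congr_ae (Eventually.of_forall fun x => ?_)
    simp only [← Complex.normSq_eq_conj_mul_self, Complex.normSq_eq_norm_sq]
  rw [h2] at h
  refine Complex.ofReal_injective ?_
  rw [← h]
  push_cast
  rfl

/-- Bounded pointwise convergence implies convergence in `L²`. -/
theorem tendsto_cl {ι : Type*} {l : Filter ι} [l.IsCountablyGenerated] {f : ι → C(Torus, ℂ)}
    {g : C(Torus, ℂ)} {B : ℝ} (hB : ∀ᶠ i in l, ∀ x, ‖f i x‖ ≤ B)
    (h : ∀ x, Tendsto (fun i => f i x) l (𝓝 (g x))) :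
    Tendsto (fun i => cl (f i)) l (𝓝 (cl g)) := by
  rw [tendsto_iff_norm_sub_tendsto_zero]
  have h1 : Tendsto (fun i => ∫ x, ‖(f i - g) x‖ ^ 2 ∂dx) l (𝓝 (∫ _, (0 : ℝ) ∂dx)) := by
    refine tendsto_integral_filter_of_dominated_convergence (fun _ => (B + ‖g‖) ^ 2)
      (Eventually.of_forall fun i => Continuous.aestronglyMeasurable (by fun_prop)) ?_
      (integrable_const _) (Eventually.of_forall fun x => ?_)
    · filter_upwards [hB] with i hi
      refine Eventually.of_forall fun x => ?_
      rw [norm_pow, norm_norm]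
      gcongr
      exact (norm_sub_le _ _).trans (add_le_add (hi x) (g.norm_coe_le_norm x))
    · have h2 : Tendsto (fun i => ‖f i x - g x‖) l (𝓝 0) := by
        rw [← tendsto_iff_norm_sub_tendsto_zero]; exact h x
      simpa using h2.pow 2
  have h3 : ∀ i, ‖cl (f i) - cl g‖ = Real.sqrt (∫ x, ‖(f i - g) x‖ ^ 2 ∂dx) := fun i => by
    rw [← map_sub, ← norm_cl_sq, Real.sqrt_sq (norm_nonneg _)]
  simp only [h3]
  simpa using h1.sqrt

theorem norm_slope_le {E : Type*} [NormedAddCommGroup E] [NormedSpace ℝ E] {f : ℝ → E} {s t B : ℝ}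
    (h : ‖f t - f s‖ ≤ B * |t - s|) (hts : t ≠ s) : ‖slope f s t‖ ≤ B := by
  rw [slope_def_module, norm_smul, norm_inv, Real.norm_eq_abs, inv_mul_le_iff₀ (abs_pos.2
    (sub_ne_zero.2 hts)), mul_comm]
  exact h

theorem hasDerivWithinAt_cl {F : ℝ → C(Torus, ℂ)} {F' : C(Torus, ℂ)} {I : Set ℝ} {s B : ℝ}
    (hlip : ∀ t ∈ I, ∀ x, ‖F t x - F s x‖ ≤ B * |t - s|)
    (h : ∀ x, HasDerivWithinAt (fun t => F t x) (F' x) I s) :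
    HasDerivWithinAt (fun t => cl (F t)) (cl F') I s := by
  rw [hasDerivWithinAt_iff_tendsto_slope]
  have e : slope (fun t => cl (F t)) s = fun t => cl (slope F s t) := by
    ext1 t
    rw [slope_def_module, slope_def_module, ← map_sub, ContinuousLinearMap.map_smul_of_tower]
  rw [e]
  refine tendsto_cl (B := B) ?_ fun x => ?_
  · filter_upwards [self_mem_nhdsWithin] with t ht x
    have : slope F s t x = slope (fun t => F t x) s t := by
      simp [slope_def_module]
    rw [this]
    exact norm_slope_le (hlip t ht.1 x) ht.2
  · have h1 := hasDerivWithinAt_iff_tendsto_slope.1 (h x)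
    refine h1.congr fun t => ?_
    simp [slope_def_module]

theorem _root_.HasDerivWithinAt.inner_const {f : ℝ → L2} {f' : L2} {I : Set ℝ} {s : ℝ}
    (h : HasDerivWithinAt f f' I s) (k : ℤ) :
    HasDerivWithinAt (fun t => coeff (f t) k) (coeff f' k) I s := by
  simp only [coeff_eq_inner]
  exact ((innerSL ℂ (eb k)).restrictScalars ℝ).hasFDerivAt.comp_hasDerivWithinAt s h

theorem lipschitz_of_deriv {E : Type*} [NormedAddCommGroup E] [NormedSpace ℝ E] {f f' : ℝ → E}
    {I : Set ℝ} (hI : Convex ℝ I) {B : ℝ} (hd : ∀ t ∈ I, HasDerivWithinAt f (f' t) I t)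
    (hb : ∀ t ∈ I, ‖f' t‖ ≤ B) {s t : ℝ} (hs : s ∈ I) (ht : t ∈ I) :
    ‖f t - f s‖ ≤ B * |t - s| := by
  have := hI.norm_image_sub_le_of_norm_hasDerivWithin_le hd hb hs ht
  rwa [Real.norm_eq_abs] at this

theorem hasDerivWithinAt_tsum {ι : Type*} {F F' : ι → ℝ → ℂ} {I : Set ℝ} (hI : Convex ℝ I)
    {u : ι → ℝ} (hu : Summable u) (hd : ∀ i, ∀ t ∈ I, HasDerivWithinAt (F i) (F' i t) I t)
    (hb : ∀ i, ∀ t ∈ I, ‖F' i t‖ ≤ u i) (hF : ∀ t ∈ I, Summable fun i => F i t) {s : ℝ}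
    (hs : s ∈ I) :
    HasDerivWithinAt (fun t => ∑' i, F i t) (∑' i, F' i s) I s := by
  rw [hasDerivWithinAt_iff_tendsto_slope]
  have h1 : Tendsto (fun t => ∑' i, slope (F i) s t) (𝓝[I \ {s}] s) (𝓝 (∑' i, F' i s)) := by
    refine tendsto_tsum_of_dominated_convergence hu
      (fun i => hasDerivWithinAt_iff_tendsto_slope.1 (hd i s hs)) ?_
    filter_upwards [self_mem_nhdsWithin] with t ht i
    exact norm_slope_le (lipschitz_of_deriv hI (hd i) (hb i) hs ht.1) ht.2
  refine h1.congr' ?_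
  filter_upwards [self_mem_nhdsWithin] with t ht
  simp only [slope_def_module]
  rw [Summable.tsum_const_smul _ ((hF t ht.1).sub (hF s hs)), (hF t ht.1).tsum_sub (hF s hs)]

/-! ### The path from a translation to a change of variables -/

/-- Multiplying by a power of the derivative of the change of variables. -/
def Diffeo.pow (D : Diffeo) (s : ℝ) : C(Torus, ℝ) :=
  ⟨fun x => D.d x ^ s, D.d.continuous.rpow_const fun x => Or.inl (D.d_pos x).ne'⟩

theorem Diffeo.pow_apply (D : Diffeo) (s : ℝ) (x : Torus) : D.pow s x = D.d x ^ s := rfl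

theorem wn_le_of_sub_one {N : ℕ} {f : C(Torus, ℝ)} {B : ℝ} (hB : 0 ≤ B)
    (hf : wn N (realCoeff (f - 1 : C(Torus, ℝ))) ≤ ENNReal.ofReal B) :
    wn N (realCoeff f) ≤ ENNReal.ofReal (B + 1) := by
  have h1 : realCoeff f = fun k => realCoeff (f - 1 : C(Torus, ℝ)) k +
      fourierCoeff (1 : C(Torus, ℂ)) k := by
    ext k
    have : ofR f = ofR (f - 1) + 1 := by ext x; simp
    rw [← fourierCoeff_ofR, this, fourierCoeff_add', fourierCoeff_ofR]
  rw [h1]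
  refine (wn_add_le N _ _).trans ?_
  rw [wn_one, ENNReal.ofReal_add hB zero_le_one, ENNReal.ofReal_one]
  gcongr

theorem wn_mul_real_le (N : ℕ) {f h : C(Torus, ℝ)} {A B : ℝ} (hA : 0 ≤ A)
    (hf : wn N (realCoeff f) ≤ ENNReal.ofReal A) (hh : wn N (realCoeff h) ≤ ENNReal.ofReal B) :
    wn N (realCoeff (f * h : C(Torus, ℝ))) ≤ ENNReal.ofReal (A * B) := by
  rw [← fourierCoeff_ofR, ofR_mul, ENNReal.ofReal_mul hA]
  exact (wn_mul_le N _ _).trans (mul_le_mul' hf hh)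

namespace SDiffeo

variable (D : SDiffeo)

theorem exists_wn_pow (s : ℝ) : ∃ A : ℝ, 1 ≤ A ∧ ∀ D : SDiffeo,
    wn 7 (realCoeff (D.pow s)) ≤ ENNReal.ofReal A := by
  obtain ⟨C, hC, h⟩ := wn_one_add_rpow s
  refine ⟨C + 1, by linarith, fun D => wn_le_of_sub_one hC.le ?_⟩
  have h7 : wn 7 (realCoeff (D.d - 1 : C(Torus, ℝ))) ≤ ENNReal.ofReal (1 / 2) :=
    ((wn_mono (by norm_num) _).trans D.wn_le).trans (ENNReal.ofReal_le_ofReal (by norm_num))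
  have h3 := h 7 (D.d - 1) (D.pow s - 1) h7 (fun x => by simp [Diffeo.pow_apply])
  refine h3.trans ?_
  calc _ ≤ ENNReal.ofReal C * ENNReal.ofReal 1 :=
        mul_le_mul_right (h7.trans (ENNReal.ofReal_le_ofReal (by norm_num))) _
    _ = _ := by simp

/-- A constant that bounds the power `s` of the derivative of all `SDiffeo`s. -/
def powBd (s : ℝ) : ℝ := Classical.choose (exists_wn_pow s)

theorem one_le_powBd (s : ℝ) : 1 ≤ powBd s := (Classical.choose_spec (exists_wn_pow s)).1

theorem wn_pow (s : ℝ) : wn 7 (realCoeff (D.pow s)) ≤ ENNReal.ofReal (powBd s) :=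
  (Classical.choose_spec (exists_wn_pow s)).2 D

/-- The mean of the displacement. -/
def q0 : ℝ := ∫ x, D.β x ∂dx

/-- The displacement without its mean. -/
def β0 : C(Torus, ℝ) := D.β - ContinuousMap.const _ D.q0

theorem β0_apply (x : Torus) : D.β0 x = D.β x - D.q0 := rfl

theorem hasTDeriv_β0 : HasTDeriv D.β0 (D.d - 1 : C(Torus, ℝ)) := fun x => by
  exact (D.hasTDeriv x).sub_const D.q0

theorem realCoeff_β0_zero : realCoeff D.β0 0 = 0 := by
  have h1 : realCoeff D.β0 0 = ((∫ x, D.β0 x ∂dx : ℝ) : ℂ) := by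
    rw [realCoeff, fourierCoeff, ← integral_complex_ofReal]
    simp
  rw [h1]
  simp only [β0_apply]
  rw [integral_sub (D.β.continuous.integrable_of_hasCompactSupport
    (HasCompactSupport.of_compactSpace _)) (integrable_const _)]
  simp [q0]

theorem wn_β0_le (N : ℕ) : wn N (realCoeff D.β0) ≤ wn N (realCoeff (D.d - 1 : C(Torus, ℝ))) := by
  refine wn_le_of_le fun k => ?_
  rcases eq_or_ne k 0 with rfl | hk
  · rw [realCoeff_β0_zero, norm_zero]; exact norm_nonneg _
  · rw [realCoeff_deriv D.hasTDeriv_β0, norm_mul, norm_mul, Complex.norm_I, one_mul,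
      Complex.norm_intCast]
    refine le_mul_of_one_le_left (norm_nonneg _) ?_
    exact_mod_cast Int.one_le_abs hk

/-- The parameter of the path, clamped to `[0, 1]`. -/
def clamp (θ : ℝ) : ℝ := max 0 (min θ 1)

theorem clamp_mem (θ : ℝ) : 0 ≤ clamp θ ∧ clamp θ ≤ 1 :=
  ⟨le_max_left _ _, max_le zero_le_one (min_le_right _ _)⟩

theorem clamp_of_mem {θ : ℝ} (h : θ ∈ Icc (0 : ℝ) 1) : clamp θ = θ := by
  rw [clamp, min_eq_left h.2, max_eq_right h.1]

/-- The change of variables `y ↦ y + q₀ + θ β₀(y)`, for `θ` between `0` and `1`. -/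
def path (θ : ℝ) : SDiffeo where
  β := ContinuousMap.const _ D.q0 + clamp θ • D.β0
  d := 1 + clamp θ • (D.d - 1)
  d' := clamp θ • D.d'
  hasTDeriv := fun x => by
    simpa using ((D.hasTDeriv_β0 x).const_mul (clamp θ)).const_add D.q0
  abs_sub_le := fun x => by
    have h := D.abs_sub_le x
    have h2 := clamp_mem θ
    simp only [ContinuousMap.add_apply, ContinuousMap.one_apply, ContinuousMap.smul_apply,
      ContinuousMap.sub_apply, smul_eq_mul, add_sub_cancel_left, abs_mul, abs_of_nonneg h2.1]
    calc _ ≤ 1 * |D.d x - 1| := mul_le_mul_of_nonneg_right h2.2 (abs_nonneg _)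
      _ ≤ _ := by rwa [one_mul]
  hasTDeriv_d := fun x => by
    simpa using ((D.hasTDeriv_d_sub_one x).const_mul (clamp θ)).const_add 1
  wn_le := by
    refine le_trans (wn_le_of_le fun k => ?_) D.wn_le
    have h2 := clamp_mem θ
    have : ofR (1 + clamp θ • (D.d - 1) - 1) = (clamp θ : ℂ) • ofR (D.d - 1) := by
      ext x; simp
    rw [← fourierCoeff_ofR, this, ← coeff_cl, map_smul, coeff_smul, coeff_cl, fourierCoeff_ofR,
      norm_mul, Complex.norm_real, Real.norm_eq_abs, abs_of_nonneg h2.1]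
    exact mul_le_of_le_one_left (norm_nonneg _) h2.2

theorem path_β_apply (θ : ℝ) (x : Torus) : (D.path θ).β x = D.q0 + clamp θ * D.β0 x := rfl

theorem path_d_apply (θ : ℝ) (x : Torus) : (D.path θ).d x = 1 + clamp θ * (D.d x - 1) := rfl

theorem path_one_a (k : ℤ) : (D.path 1).a k = D.a k := by
  have h : clamp 1 = 1 := clamp_of_mem ⟨zero_le_one, le_rfl⟩
  ext x
  rw [Diffeo.a_apply, Diffeo.a_apply, Diffeo.sq_apply, Diffeo.sq_apply, Diffeo.G_apply,
    Diffeo.G_apply, path_β_apply, path_d_apply, h, β0_apply]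
  simp

/-- The vector field that generates the path. -/
def vf (θ : ℝ) : C(Torus, ℝ) := D.β0 * (D.path θ).dInv

/-- The derivative of the vector field. -/
def vf' (θ : ℝ) : C(Torus, ℝ) :=
  (D.d - 1) * (D.path θ).dInv - D.β0 * (D.path θ).dInv * ((D.path θ).d' * (D.path θ).dInv)

theorem hasTDeriv_inv {f f' : Torus → ℝ} (h : HasTDeriv f f') (h0 : ∀ x, f x ≠ 0) :
    HasTDeriv (fun x => (f x)⁻¹) (fun x => f' x * -(f x ^ 2)⁻¹) :=
  HasTDeriv.comp_real (F' := fun r => -(r ^ 2)⁻¹) h fun x => hasDerivAt_inv (h0 x)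

theorem hasTDeriv_vf (θ : ℝ) : HasTDeriv (D.vf θ) (D.vf' θ) := by
  have h := D.hasTDeriv_β0.mul (hasTDeriv_inv (D.path θ).hasTDeriv_d
    fun x => ((D.path θ).d_pos x).ne')
  intro x
  refine (h x).congr_deriv ?_
  have := ((D.path θ).d_pos x).ne'
  simp only [vf', ContinuousMap.sub_apply, ContinuousMap.mul_apply, ContinuousMap.one_apply,
    Diffeo.dInv_apply]
  field_simp
  ring

theorem wn_vf_le (θ : ℝ) {A : ℝ} (hA : 0 ≤ A)
    (h : wn 7 (realCoeff (D.d - 1 : C(Torus, ℝ))) ≤ ENNReal.ofReal A) :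
    wn 7 (realCoeff (D.vf θ)) ≤ ENNReal.ofReal (A * bd) :=
  wn_mul_real_le 7 hA ((D.wn_β0_le 7).trans h) (D.path θ).wn_dInv

theorem wn_d_sub_one : wn 7 (realCoeff (D.d - 1 : C(Torus, ℝ))) ≤ ENNReal.ofReal 1 :=
  ((wn_mono (by norm_num) _).trans D.wn_le).trans (ENNReal.ofReal_le_ofReal (by norm_num))

/-! ### The derivatives along the path -/

/-- The derivative along the path of the functions `a k`. -/
def aDot (θ : ℝ) (k : ℤ) : C(Torus, ℂ) :=
  ofR (D.vf θ) * (D.path θ).a' k + (1 / 2 : ℂ) • (ofR (D.vf' θ) * (D.path θ).a k)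

/-- The derivative along the path of the power `-3/2` of the derivative. -/
def cDot (θ : ℝ) : C(Torus, ℝ) := (-(3 / 2) : ℝ) • ((D.d - 1) * (D.path θ).pow (-(5 / 2)))

theorem hasDerivWithinAt_path_d {θ : ℝ} (hθ : θ ∈ Icc (0 : ℝ) 1) (x : Torus) :
    HasDerivWithinAt (fun t => (D.path t).d x) (D.d x - 1) (Icc 0 1) θ := by
  have h : HasDerivWithinAt (fun t : ℝ => 1 + t * (D.d x - 1)) (D.d x - 1) (Icc 0 1) θ := by
    simpa using (((hasDerivWithinAt_id θ (Icc (0:ℝ) 1)).mul_const (D.d x - 1)).const_add 1)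
  refine h.congr (fun t ht => ?_) ?_
  · rw [path_d_apply, clamp_of_mem ht]
  · rw [path_d_apply, clamp_of_mem hθ]

theorem hasDerivWithinAt_path_pow (s : ℝ) {θ : ℝ} (hθ : θ ∈ Icc (0 : ℝ) 1) (x : Torus) :
    HasDerivWithinAt (fun t => (D.path t).pow s x)
      ((D.d x - 1) * s * (D.path θ).d x ^ (s - 1)) (Icc 0 1) θ :=
  (D.hasDerivWithinAt_path_d hθ x).rpow_const (Or.inl ((D.path θ).d_pos x).ne')

theorem hasDerivWithinAt_fourier (k : ℤ) (x : Torus) {f : ℝ → ℝ} {f' s : ℝ} {I : Set ℝ}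
    (h : HasDerivWithinAt f f' I s) :
    HasDerivWithinAt (fun t => (fourier k (x + (f t : Torus)) : ℂ))
      (f' • (Complex.I * k * fourier k (x + (f s : Torus)))) I s :=
  ((hasTDeriv_fourier k).hasDerivAt x (f s)).scomp_hasDerivWithinAt s h

theorem norm_fourier_apply (k : ℤ) (x : Torus) : ‖(fourier k x : ℂ)‖ = 1 := Circle.norm_coe _

theorem hasDerivWithinAt_path_a (k : ℤ) {θ : ℝ} (hθ : θ ∈ Icc (0 : ℝ) 1) (x : Torus) :
    HasDerivWithinAt (fun t => (D.path t).a k x) (D.aDot θ k x) (Icc 0 1) θ ∧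
      ‖D.aDot θ k x‖ ≤ 2 * (1 + |(k : ℝ)| * ‖D.β0‖) := by
  have hβ : HasDerivWithinAt (fun t => (D.path t).β x) (D.β0 x) (Icc 0 1) θ := by
    have h : HasDerivWithinAt (fun t : ℝ => D.q0 + t * D.β0 x) (D.β0 x) (Icc 0 1) θ := by
      simpa using (((hasDerivWithinAt_id θ (Icc (0:ℝ) 1)).mul_const (D.β0 x)).const_add D.q0)
    refine h.congr (fun t ht => ?_) ?_
    · rw [path_β_apply, clamp_of_mem ht]
    · rw [path_β_apply, clamp_of_mem hθ]
  have hs := (D.hasDerivWithinAt_path_d hθ x).sqrt ((D.path θ).d_pos x).ne'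
  have h := hs.ofReal_comp.mul (hasDerivWithinAt_fourier k x hβ)
  have hsq : 0 < Real.sqrt ((D.path θ).d x) := Real.sqrt_pos.2 ((D.path θ).d_pos x)
  have e : D.aDot θ k x = (((D.d x - 1) / (2 * Real.sqrt ((D.path θ).d x)) : ℝ) : ℂ) *
      fourier k (x + ((D.path θ).β x : Torus)) + (Real.sqrt ((D.path θ).d x) : ℂ) *
      (D.β0 x • (Complex.I * k * fourier k (x + ((D.path θ).β x : Torus)))) := by
    have hd : (Real.sqrt ((D.path θ).d x) : ℂ) ^ 2 = ((D.path θ).d x : ℂ) := by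
      rw [← Complex.ofReal_pow, Real.sq_sqrt ((D.path θ).d_pos x).le]
    have hd0 : (Real.sqrt ((D.path θ).d x) : ℂ) ≠ 0 := by exact_mod_cast hsq.ne'
    simp only [aDot, a', vf', vf, ContinuousMap.add_apply, ContinuousMap.smul_apply,
      ContinuousMap.mul_apply, ContinuousMap.sub_apply, ContinuousMap.one_apply, ofR_apply,
      smul_eq_mul, Diffeo.dInv_apply, Diffeo.a_apply, Diffeo.sq_apply, Diffeo.G_apply,
      Complex.real_smul]
    push_cast
    rw [← hd]
    field_simp
    ring
  refine ⟨?_, ?_⟩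
  · rw [e]
    refine h.congr (fun t _ => ?_) ?_ <;>
      simp only [Diffeo.a_apply, Diffeo.sq_apply, Diffeo.G_apply, Pi.mul_apply]
  · rw [e]
    have h1 : 3 / 4 ≤ Real.sqrt ((D.path θ).d x) := by
      refine Real.le_sqrt_of_sq_le ?_
      have := (D.path θ).d_ge x
      linarith
    have h2 : Real.sqrt ((D.path θ).d x) ≤ 2 := by
      rw [← Diffeo.sq_apply]; exact (D.path θ).sq_le x
    have h3 := D.abs_sub_le x
    have h4 : ‖D.β0 x‖ ≤ ‖D.β0‖ := D.β0.norm_coe_le_norm x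
    refine (norm_add_le _ _).trans ?_
    simp only [norm_mul, norm_smul, norm_fourier_apply, Complex.norm_real, Complex.norm_I,
      Complex.norm_intCast, mul_one, one_mul]
    rw [Real.norm_eq_abs, abs_div, abs_of_pos (by positivity : 0 < 2 * Real.sqrt ((D.path θ).d x)),
      Real.norm_eq_abs (Real.sqrt _), abs_of_pos hsq]
    have h5 : |D.d x - 1| / (2 * Real.sqrt ((D.path θ).d x)) ≤ 2 := by
      rw [div_le_iff₀ (by positivity)]; nlinarith
    calc _ ≤ 2 + 2 * (‖D.β0‖ * |(k : ℝ)|) := by gcongr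
      _ = _ := by ring

theorem hasDerivWithinAt_path_M (k l : ℤ) {θ : ℝ} (hθ : θ ∈ Icc (0 : ℝ) 1) :
    HasDerivWithinAt (fun t => (D.path t).M k l) (fourierCoeff (D.aDot θ k) l) (Icc 0 1) θ := by
  simp only [M, ← coeff_cl]
  refine (hasDerivWithinAt_cl (B := 2 * (1 + |(k : ℝ)| * ‖D.β0‖)) (fun t ht x => ?_)
    fun x => (D.hasDerivWithinAt_path_a k hθ x).1).inner_const l
  exact lipschitz_of_deriv (convex_Icc 0 1)
    (fun t ht => (D.hasDerivWithinAt_path_a k ht x).1)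
    (fun t ht => (D.hasDerivWithinAt_path_a k ht x).2) hθ ht

theorem hasDerivWithinAt_path_c (q : ℤ) {θ : ℝ} (hθ : θ ∈ Icc (0 : ℝ) 1) :
    HasDerivWithinAt (fun t => realCoeff ((D.path t).pow (-(3 / 2))) q) (realCoeff (D.cDot θ) q)
      (Icc 0 1) θ := by
  have hd : ∀ x, ∀ t ∈ Icc (0 : ℝ) 1, HasDerivWithinAt
      (fun t => ofR ((D.path t).pow (-(3 / 2))) x) (ofR (D.cDot t) x) (Icc 0 1) t := by
    intro x t ht
    refine ((D.hasDerivWithinAt_path_pow (-(3 / 2)) ht x).congr_deriv ?_).ofReal_comp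
    simp only [cDot, ContinuousMap.smul_apply, ContinuousMap.mul_apply, ContinuousMap.sub_apply,
      ContinuousMap.one_apply, smul_eq_mul, Diffeo.pow_apply]
    norm_num
    ring
  have hb : ∀ x, ∀ t ∈ Icc (0 : ℝ) 1, ‖ofR (D.cDot t) x‖ ≤ 3 / 2 * powBd (-(5 / 2)) := by
    intro x t _
    have h1 := norm_le_of_wn (f := ofR ((D.path t).pow (-(5 / 2)))) (N := 7)
      (by linarith [one_le_powBd (-(5 / 2))]) (by rw [fourierCoeff_ofR]; exact (D.path t).wn_pow _) x
    rw [ofR_apply, Complex.norm_real, Real.norm_eq_abs] at h1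
    have h2 := D.abs_sub_le x
    rw [ofR_apply, Complex.norm_real, Real.norm_eq_abs, cDot]
    simp only [ContinuousMap.smul_apply, ContinuousMap.mul_apply, ContinuousMap.sub_apply,
      ContinuousMap.one_apply, smul_eq_mul, abs_mul]
    rw [show |(-(3 / 2) : ℝ)| = 3 / 2 by norm_num]
    refine mul_le_mul_of_nonneg_left ?_ (by norm_num)
    calc _ ≤ 1 * powBd (-(5 / 2)) := mul_le_mul (by linarith) h1 (abs_nonneg _) zero_le_one
      _ = _ := one_mul _
  simp only [← fourierCoeff_ofR, ← coeff_cl]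
  refine (hasDerivWithinAt_cl (B := 3 / 2 * powBd (-(5 / 2))) (fun t ht x => ?_)
    fun x => hd x θ hθ).inner_const q
  exact lipschitz_of_deriv (convex_Icc 0 1) (hd x) (hb x) hθ ht

end SDiffeo

/-! ### The conjugated principal part is a bounded perturbation -/

/-- Finite linear combinations of the exponentials. -/
def trig : (ℤ →₀ ℂ) →ₗ[ℂ] L2 := Finsupp.linearCombination ℂ eb

theorem trig_apply (φ : ℤ →₀ ℂ) : trig φ = φ.sum fun n z => z • eb n :=
  Finsupp.linearCombination_apply ℂ φ

theorem denseRange_trig : DenseRange trig := by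
  intro u
  refine mem_closure_of_tendsto (hasSum_eb u) (Eventually.of_forall fun S => ?_)
  refine ⟨∑ k ∈ S, Finsupp.single k (coeff u k), ?_⟩
  rw [map_sum]
  exact Finset.sum_congr rfl fun k _ => by rw [trig, Finsupp.linearCombination_single]

theorem coeff_sum {ι : Type*} (S : Finset ι) (f : ι → L2) (k : ℤ) :
    coeff (∑ i ∈ S, f i) k = ∑ i ∈ S, coeff (f i) k := by
  simp only [coeff_eq_inner, inner_sum]

theorem norm_formTerm_le {g b : ℝ} (hg : 0 < g) (hb : 0 < b) {c f h : ℤ → ℂ} {A B H : ℝ}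
    (hA : ∀ q, ‖c q‖ * jp q ^ 3 ≤ A) (hB : ∀ l, ‖f l‖ * jp l ^ 4 ≤ B) (hH : ∀ k, ‖h k‖ ≤ H)
    (y : ℤ × ℤ) : ‖formTerm g b c f h y‖ ≤
      (g + 1) ^ 2 * A * B * H * ((jp y.1 ^ 2)⁻¹ * (jp y.2 ^ 2)⁻¹) := by
  have j1 := jp_pos y.1
  have j2 := jp_pos y.2
  have hA0 : 0 ≤ A := le_trans (by have := jp_pos 0; positivity) (hA 0)
  have hB0 : 0 ≤ B := le_trans (by have := jp_pos 0; positivity) (hB 0)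
  have h1 := hA y.2
  have h2 := hB y.1
  rw [← le_div_iff₀ (by positivity)] at h1 h2
  rw [formTerm, norm_mul, norm_mul, norm_mul, norm_mul, RCLike.norm_conj, Complex.norm_real,
    Complex.norm_real, Real.norm_eq_abs, Real.norm_eq_abs, abs_of_nonneg (lam_nonneg _ _ _),
    abs_of_nonneg (lam_nonneg _ _ _)]
  calc _ ≤ ((g + 1) * (jp y.1 * jp y.2)) * ((g + 1) * jp y.1) *
        ((A / jp y.2 ^ 3) * (B / jp y.1 ^ 4) * H) := by
        refine mul_le_mul (mul_le_mul (lam_add_le hg hb _ _) (lam_le hg hb _) (lam_nonneg _ _ _)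
          (by positivity)) (mul_le_mul (mul_le_mul h1 h2 (norm_nonneg _) (by positivity)) (hH _)
          (norm_nonneg _) (by positivity)) (by positivity) (by positivity)
    _ = _ := by field_simp

theorem summable_inv_jp_sq_prod :
    Summable fun y : ℤ × ℤ => (jp y.1 ^ 2)⁻¹ * (jp y.2 ^ 2)⁻¹ :=
  summable_jp_inv_sq.mul_of_nonneg summable_jp_inv_sq (fun i => by have := jp_pos i; positivity)
    fun i => by have := jp_pos i; positivity

theorem summable_formTerm {g b : ℝ} (hg : 0 < g) (hb : 0 < b) {c f h : ℤ → ℂ} {A B H : ℝ}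
    (hA : ∀ q, ‖c q‖ * jp q ^ 3 ≤ A) (hB : ∀ l, ‖f l‖ * jp l ^ 4 ≤ B) (hH : ∀ k, ‖h k‖ ≤ H) :
    Summable (formTerm g b c f h) :=
  Summable.of_norm_bounded (summable_inv_jp_sq_prod.mul_left _) (norm_formTerm_le hg hb hA hB hH)

theorem norm_mul_jp_pow_le_of_wn {N n : ℕ} (hn : n ≤ N) {a : ℤ → ℂ} {A : ℝ} (hA : 0 ≤ A)
    (h : wn N a ≤ ENNReal.ofReal A) (k : ℤ) : ‖a k‖ * jp k ^ n ≤ A := by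
  have h' := (wn_mono hn a).trans h
  have hs := summable_of_wn (h'.trans_lt ENNReal.ofReal_lt_top).ne
  refine le_trans ?_ (tsum_le_of_wn hA h')
  rw [mul_comm]
  exact hs.le_tsum k fun j _ => by have := jp_pos j; positivity

theorem wn_of_decay {n : ℕ} {a : ℤ → ℂ} {B : ℝ} (h : ∀ k, ‖a k‖ * jp k ^ (n + 2) ≤ B) :
    wn n a ≠ ⊤ := by
  rw [wn_eq_ofReal]
  · exact ENNReal.ofReal_ne_top
  refine (summable_jp_inv_sq.mul_left B).of_nonneg_of_le
    (fun k => by have := jp_pos k; positivity) fun k => ?_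
  have hk := jp_pos k
  rw [← div_eq_mul_inv, le_div_iff₀ (by positivity)]
  refine le_trans (le_of_eq ?_) (h k)
  ring

namespace SDiffeo

variable (D : SDiffeo)

theorem coeff_U_trig (φ : ℤ →₀ ℂ) (l : ℤ) :
    coeff (D.U (trig φ)) l = ∑ n ∈ φ.support, φ n * D.M n l := by
  rw [trig_apply, Finsupp.sum, map_sum, coeff_sum]
  refine Finset.sum_congr rfl fun n _ => ?_
  rw [map_smul, coeff_smul, Diffeo.U_eb, coeff_cl, M]

/-- The constant of the decay of the coefficients of the transformed trigonometric polynomials. -/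
def trigBd (φ : ℤ →₀ ℂ) : ℝ := ∑ n ∈ φ.support, ‖φ n‖ * ((2 * bd) ^ 7 * jp n ^ 7)

theorem norm_coeff_U_trig (φ : ℤ →₀ ℂ) (l : ℤ) :
    ‖coeff (D.U (trig φ)) l‖ * jp l ^ 7 ≤ trigBd φ := by
  rw [coeff_U_trig]
  have := jp_pos l
  calc _ ≤ (∑ n ∈ φ.support, ‖φ n‖ * ‖D.M n l‖) * jp l ^ 7 := by
        gcongr
        refine (norm_sum_le _ _).trans_eq (Finset.sum_congr rfl fun n _ => norm_mul _ _)
    _ = ∑ n ∈ φ.support, ‖φ n‖ * (‖D.M n l‖ * jp l ^ 7) := by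
        rw [Finset.sum_mul]; exact Finset.sum_congr rfl fun n _ => by ring
    _ ≤ _ := Finset.sum_le_sum fun n _ =>
        mul_le_mul_of_nonneg_left (D.norm_M_le_left 7 le_rfl n l) (norm_nonneg _)

theorem coeff_a' (k l : ℤ) : fourierCoeff (D.a' k) l = Complex.I * l * D.M k l :=
  fourierCoeff_deriv (D.hasTDeriv_a k) l

theorem realCoeff_vf' (θ : ℝ) (k : ℤ) :
    realCoeff (D.vf' θ) k = Complex.I * k * realCoeff (D.vf θ) k :=
  realCoeff_deriv (D.hasTDeriv_vf θ) k

theorem fourierCoeff_smul' (z : ℂ) (f : C(Torus, ℂ)) (k : ℤ) :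
    fourierCoeff (z • f : C(Torus, ℂ)) k = z * fourierCoeff f k := by
  rw [← coeff_cl, map_smul, coeff_smul, coeff_cl]

/-- The function `d^{1/2} e^{ikG}` moves along the path by the transport of half densities: its
derivative is `v ∂ₓ + v' / 2` applied to it. -/
theorem hasSum_aDot (θ : ℝ) (n l : ℤ) :
    HasSum (fun p : ℤ => realCoeff (D.vf θ) p * (Complex.I * (l - p / 2)) *
      (D.path θ).M n (l - p)) (fourierCoeff (D.aDot θ n) l) := by
  have h1 := hasSum_coeff_mul (ofR (D.vf θ)) ((D.path θ).a' n) l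
  have h2 := (hasSum_coeff_mul (ofR (D.vf' θ)) ((D.path θ).a n) l).mul_left (1 / 2)
  have h3 := (Equiv.subLeft l).hasSum_iff.2 (h1.add h2)
  rw [aDot, fourierCoeff_add', fourierCoeff_smul']
  refine h3.congr_fun fun p => ?_
  simp only [Function.comp_apply, Equiv.subLeft_apply, sub_sub_cancel, fourierCoeff_ofR, coeff_a',
    realCoeff_vf', M]
  push_cast
  ring

/-- The `x`-derivative of a power of the derivative. -/
theorem hasTDeriv_pow (s : ℝ) : HasTDeriv (D.pow s) ((s • (D.d' * D.pow (s - 1)) : C(Torus, ℝ))) := by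
  have h := HasTDeriv.comp_real (F := fun r => r ^ s) (F' := fun r => s * r ^ (s - 1))
    D.hasTDeriv_d (fun x => Real.hasDerivAt_rpow_const (Or.inl (D.d_pos x).ne'))
  intro x
  refine (h x).congr_deriv ?_
  simp only [ContinuousMap.smul_apply, ContinuousMap.mul_apply, smul_eq_mul, Diffeo.pow_apply]
  ring

/-- The function `d^{-3/2}` is transported as a density of weight `-3/2`: its derivative is
`v ∂ₓ - (3 / 2) v'` applied to it. -/
theorem hasSum_cDot (θ : ℝ) (q : ℤ) :
    HasSum (fun p : ℤ => realCoeff (D.vf θ) p * (Complex.I * (q - 5 / 2 * p)) *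
      realCoeff ((D.path θ).pow (-(3 / 2))) (q - p)) (realCoeff (D.cDot θ) q) := by
  set c := (D.path θ).pow (-(3 / 2)) with hc
  set c' : C(Torus, ℝ) := ((-(3 / 2) : ℝ) • ((D.path θ).d' * (D.path θ).pow (-(3 / 2) - 1)))
  have hd : HasTDeriv c c' := (D.path θ).hasTDeriv_pow (-(3 / 2))
  have h1 := hasSum_coeff_mul (ofR (D.vf θ)) (ofR c') q
  have h2 := (hasSum_coeff_mul (ofR (D.vf' θ)) (ofR c) q).mul_left (-(3 / 2))
  have h3 := (Equiv.subLeft q).hasSum_iff.2 (h1.add h2)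
  have e : ofR (D.cDot θ) = ofR (D.vf θ) * ofR c' + (-(3 / 2) : ℂ) • (ofR (D.vf' θ) * ofR c) := by
    ext x
    have hx := (D.path θ).d_pos x
    have h4 : (D.path θ).d x ^ (-(3 / 2) : ℝ) =
        (D.path θ).d x * (D.path θ).d x ^ (-(5 / 2) : ℝ) := by
      rw [← Real.rpow_one_add' hx.le (by norm_num)]; norm_num
    have h5 : (-(3 / 2) - 1 : ℝ) = -(5 / 2) := by norm_num
    have h6 := hx.ne'
    simp only [ofR_apply, ContinuousMap.add_apply, ContinuousMap.mul_apply,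
      ContinuousMap.smul_apply, smul_eq_mul, cDot, c', c, vf, vf', ContinuousMap.sub_apply,
      ContinuousMap.one_apply, Diffeo.pow_apply, Diffeo.dInv_apply, h4, h5]
    set Z := (D.path θ).d x ^ (-(5 / 2) : ℝ)
    have h6' : ((D.path θ).d x : ℂ) ≠ 0 := by exact_mod_cast h6
    push_cast
    field_simp
    ring
  rw [← fourierCoeff_ofR (D.cDot θ), e, fourierCoeff_add', fourierCoeff_smul']
  refine h3.congr_fun fun p => ?_
  simp only [Function.comp_apply, Equiv.subLeft_apply, sub_sub_cancel, fourierCoeff_ofR,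
    realCoeff_vf', realCoeff_deriv hd]
  push_cast
  ring

/-- The derivative along the path of the coefficients of the transformed polynomial. -/
def trigDot (θ : ℝ) (φ : ℤ →₀ ℂ) (l : ℤ) : ℂ :=
  ∑ n ∈ φ.support, φ n * fourierCoeff (D.aDot θ n) l

theorem hasSum_trigDot (θ : ℝ) (φ : ℤ →₀ ℂ) (l : ℤ) :
    HasSum (fun p : ℤ => realCoeff (D.vf θ) p * (Complex.I * (l - p / 2)) *
      coeff ((D.path θ).U (trig φ)) (l - p)) (D.trigDot θ φ l) := by
  have h := hasSum_sum fun n (_ : n ∈ φ.support) => (D.hasSum_aDot θ n l).mul_left (φ n)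
  refine h.congr_fun fun p => ?_
  rw [coeff_U_trig, Finset.mul_sum]
  exact Finset.sum_congr rfl fun n _ => by ring

theorem norm_trigDot_le (θ : ℝ) (φ : ℤ →₀ ℂ) (l : ℤ) :
    ‖D.trigDot θ φ l‖ * jp l ^ 6 ≤ 2 * (bd * trigBd φ) := by
  have hT : 0 ≤ trigBd φ := le_trans (by have := jp_pos 0; positivity)
    ((D.path θ).norm_coeff_U_trig φ 0)
  have hb := one_le_bd
  have hl := jp_pos l
  have hv : wn 7 (realCoeff (D.vf θ)) ≤ ENNReal.ofReal bd := by
    simpa using D.wn_vf_le θ zero_le_one D.wn_d_sub_one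
  have hv' : wn 6 (realCoeff (D.vf' θ)) ≤ ENNReal.ofReal bd :=
    (wn_deriv_le 6 (D.hasTDeriv_vf θ)).trans hv
  set f := coeff ((D.path θ).U (trig φ)) with hf
  have d7 : ∀ j, ‖f j‖ * jp j ^ 7 ≤ trigBd φ := (D.path θ).norm_coeff_U_trig φ
  have d6 : ∀ j, ‖f j‖ * jp j ^ 6 ≤ trigBd φ := fun j => by
    refine le_trans (mul_le_mul_of_nonneg_left ?_ (norm_nonneg _)) (d7 j)
    exact pow_le_pow_right₀ (one_le_jp j) (by norm_num)
  have d6' : ∀ j : ℤ, ‖Complex.I * j * f j‖ * jp j ^ 6 ≤ trigBd φ := fun j => by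
    refine le_trans ?_ (d7 j)
    have := jp_pos j
    rw [norm_mul, norm_mul, Complex.norm_I, one_mul, Complex.norm_intCast]
    calc _ ≤ (jp j * ‖f j‖) * jp j ^ 6 := by gcongr; exact abs_le_jp j
      _ = _ := by ring
  have e1 := norm_conv_le_decay (by norm_num : 6 ≤ 7) (by linarith) hT hv d6' l
  have e2 := norm_conv_le_decay le_rfl (by linarith) hT hv' d6 l
  have s1 := (norm_conv_le_growth (n := 0) (by norm_num : 0 ≤ 7) (by linarith) hT hv
    (x := fun j => Complex.I * j * f j) (fun j => by
      rw [pow_zero, mul_one]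
      refine le_trans (le_mul_of_one_le_right (norm_nonneg _) (one_le_pow₀ (one_le_jp j))) (d6' j)) l).1
  have s2 := (norm_conv_le_growth (n := 0) (by norm_num : 0 ≤ 6) (by linarith) hT hv'
    (x := f) (fun j => by
      rw [pow_zero, mul_one]
      refine le_trans (le_mul_of_one_le_right (norm_nonneg _) (one_le_pow₀ (one_le_jp j))) (d6 j)) l).1
  have e3 : D.trigDot θ φ l = ∑' j : ℤ, realCoeff (D.vf θ) (l - j) * (Complex.I * j * f j) +
      (1 / 2) * ∑' j : ℤ, realCoeff (D.vf' θ) (l - j) * f j := by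
    have h3 := (Equiv.subLeft l).hasSum_iff.2
      (s1.of_norm.hasSum.add (s2.of_norm.hasSum.mul_left (1 / 2)))
    refine (D.hasSum_trigDot θ φ l).unique (h3.congr_fun fun p => ?_)
    simp only [Function.comp_apply, Equiv.subLeft_apply, sub_sub_cancel, realCoeff_vf', ← hf]
    push_cast
    ring
  rw [e3]
  have h4 : ‖∑' j : ℤ, realCoeff (D.vf θ) (l - j) * (Complex.I * j * f j) +
      (1 / 2) * ∑' j : ℤ, realCoeff (D.vf' θ) (l - j) * f j‖ ≤
      ‖∑' j : ℤ, realCoeff (D.vf θ) (l - j) * (Complex.I * j * f j)‖ +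
      ‖∑' j : ℤ, realCoeff (D.vf' θ) (l - j) * f j‖ := by
    refine (norm_add_le _ _).trans (add_le_add le_rfl ?_)
    rw [norm_mul]
    refine mul_le_of_le_one_left (norm_nonneg _) (by norm_num)
  refine (mul_le_mul_of_nonneg_right h4 (by positivity)).trans ?_
  rw [add_mul]
  linarith

theorem hasDerivWithinAt_coeff_U_trig (φ : ℤ →₀ ℂ) (l : ℤ) {θ : ℝ} (hθ : θ ∈ Icc (0 : ℝ) 1) :
    HasDerivWithinAt (fun t => coeff ((D.path t).U (trig φ)) l) (D.trigDot θ φ l) (Icc 0 1) θ := by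
  simp only [coeff_U_trig]
  exact HasDerivWithinAt.fun_sum fun n _ => (D.hasDerivWithinAt_path_M n l hθ).const_mul (φ n)

theorem exists_wn_cDot : ∃ A : ℝ, 0 ≤ A ∧ ∀ (D : SDiffeo) (θ : ℝ),
    wn 7 (realCoeff (D.cDot θ)) ≤ ENNReal.ofReal A := by
  have h1 := one_le_powBd (-(5 / 2))
  refine ⟨3 / 2 * (1 * powBd (-(5 / 2))), by positivity, fun D θ => ?_⟩
  have e : ofR (D.cDot θ) = (-(3 / 2) : ℂ) • ofR ((D.d - 1) * (D.path θ).pow (-(5 / 2))) := by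
    ext x
    simp [cDot]
  have h2 := wn_mul_real_le 7 zero_le_one D.wn_d_sub_one ((D.path θ).wn_pow (-(5 / 2)))
  have e2 : realCoeff (D.cDot θ) = fun k => (-(3 / 2) : ℂ) *
      realCoeff ((D.d - 1) * (D.path θ).pow (-(5 / 2)) : C(Torus, ℝ)) k := by
    ext k
    rw [← fourierCoeff_ofR, e, fourierCoeff_smul', fourierCoeff_ofR]
  rw [e2, wn_smul, ENNReal.ofReal_mul (by norm_num)]
  refine mul_le_mul' ?_ h2
  rw [← ofReal_norm]
  exact ENNReal.ofReal_le_ofReal (by norm_num)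

end SDiffeo

/-! ### The difference of the forms is bounded -/

/-- The form can be differentiated term by term along curves with enough decay. -/
theorem hasDerivWithinAt_tsum_formTerm {g b : ℝ} (hg : 0 < g) (hb : 0 < b) {I : Set ℝ}
    (hI : Convex ℝ I) {c c' f f' h h' : ℝ → ℤ → ℂ} {A A' B B' H H' : ℝ}
    (hc : ∀ t ∈ I, ∀ q, HasDerivWithinAt (fun t => c t q) (c' t q) I t)
    (hf : ∀ t ∈ I, ∀ q, HasDerivWithinAt (fun t => f t q) (f' t q) I t)
    (hh : ∀ t ∈ I, ∀ q, HasDerivWithinAt (fun t => h t q) (h' t q) I t)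
    (dc : ∀ t q, ‖c t q‖ * jp q ^ 3 ≤ A) (dc' : ∀ t q, ‖c' t q‖ * jp q ^ 3 ≤ A')
    (df : ∀ t q, ‖f t q‖ * jp q ^ 4 ≤ B) (df' : ∀ t q, ‖f' t q‖ * jp q ^ 4 ≤ B')
    (dh : ∀ t q, ‖h t q‖ ≤ H) (dh' : ∀ t q, ‖h' t q‖ ≤ H') {s : ℝ} (hs : s ∈ I) :
    HasDerivWithinAt (fun t => ∑' y, formTerm g b (c t) (f t) (h t) y)
      (∑' y, (formTerm g b (c' s) (f s) (h s) y + formTerm g b (c s) (f' s) (h s) y +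
        formTerm g b (c s) (f s) (h' s) y)) I s := by
  refine hasDerivWithinAt_tsum hI
    (F' := fun y t => formTerm g b (c' t) (f t) (h t) y + formTerm g b (c t) (f' t) (h t) y +
        formTerm g b (c t) (f t) (h' t) y)
    (u := fun y => ((g + 1) ^ 2 * A' * B * H + (g + 1) ^ 2 * A * B' * H +
      (g + 1) ^ 2 * A * B * H') * ((jp y.1 ^ 2)⁻¹ * (jp y.2 ^ 2)⁻¹))
    (summable_inv_jp_sq_prod.mul_left _) (fun y t ht => ?_) (fun y t _ => ?_)
    (fun t _ => summable_formTerm hg hb (dc t) (df t) (dh t)) hs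
  · have h1 := hc t ht y.2
    have h2 := hf t ht y.1
    have h3 : HasDerivWithinAt (fun t => conj (h t (y.1 + y.2))) (conj (h' t (y.1 + y.2))) I t :=
      (hh t ht (y.1 + y.2)).star
    refine (((h1.mul h2).mul h3).const_mul (lam g b (y.1 + y.2) * lam g b y.1 : ℂ)).congr_deriv ?_
    simp only [formTerm, Pi.mul_apply]
    ring
  · refine (norm_add₃_le).trans ?_
    rw [add_mul, add_mul]
    exact add_le_add (add_le_add
      (norm_formTerm_le hg hb (dc' t) (df t) (dh t) y)
      (norm_formTerm_le hg hb (dc t) (df' t) (dh t) y))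
      (norm_formTerm_le hg hb (dc t) (df t) (dh' t) y)

namespace SDiffeo

variable (D : SDiffeo)

/-- The form of `L^{1/2} (1 + θ ∂β)^{-3/2} L^{1/2}` on the transformed polynomials. -/
def pathForm (g b : ℝ) (φ χ : ℤ →₀ ℂ) (θ : ℝ) : ℂ :=
  ∑' y, formTerm g b (realCoeff ((D.path θ).pow (-(3 / 2)))) (coeff ((D.path θ).U (trig φ)))
    (coeff ((D.path θ).U (trig χ))) y

theorem jp_pow_le {m n : ℕ} (h : m ≤ n) {f : ℤ → ℂ} {B : ℝ} (hf : ∀ l, ‖f l‖ * jp l ^ n ≤ B)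
    (l : ℤ) : ‖f l‖ * jp l ^ m ≤ B :=
  le_trans (mul_le_mul_of_nonneg_left (pow_le_pow_right₀ (one_le_jp l) h) (norm_nonneg _)) (hf l)

theorem norm_le_of_decay {n : ℕ} {f : ℤ → ℂ} {B : ℝ} (hf : ∀ l, ‖f l‖ * jp l ^ n ≤ B)
    (l : ℤ) : ‖f l‖ ≤ B := by simpa using jp_pow_le (Nat.zero_le n) hf l

theorem hasDerivWithinAt_pathForm {g b : ℝ} (hg : 0 < g) (hb : 0 < b) (φ χ : ℤ →₀ ℂ) {θ : ℝ}
    (hθ : θ ∈ Icc (0 : ℝ) 1) :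
    HasDerivWithinAt (D.pathForm g b φ χ) (∑' x : (ℤ × ℤ) × ℤ,
      (Complex.I / 2 * symS g b x.1.1 x.2 x.1.2) * (realCoeff (D.vf θ) x.2 *
        realCoeff ((D.path θ).pow (-(3 / 2))) x.1.2 * coeff ((D.path θ).U (trig φ)) x.1.1 *
        conj (coeff ((D.path θ).U (trig χ)) (x.1.1 + x.2 + x.1.2)))) (Icc 0 1) θ := by
  obtain ⟨A', hA', hcd⟩ := exists_wn_cDot
  set A := powBd (-(3 / 2)) with hA
  have hA0 : 0 ≤ A := by linarith [one_le_powBd (-(3 / 2))]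
  have dc : ∀ t q, ‖realCoeff ((D.path t).pow (-(3 / 2))) q‖ * jp q ^ 3 ≤ A := fun t q =>
    norm_mul_jp_pow_le_of_wn (by norm_num : 3 ≤ 7) hA0 ((D.path t).wn_pow _) q
  have dc' : ∀ t q, ‖realCoeff (D.cDot t) q‖ * jp q ^ 3 ≤ A' := fun t q =>
    norm_mul_jp_pow_le_of_wn (by norm_num : 3 ≤ 7) hA' (hcd D t) q
  have df : ∀ (φ : ℤ →₀ ℂ) t l, ‖coeff ((D.path t).U (trig φ)) l‖ * jp l ^ 4 ≤ trigBd φ :=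
    fun φ t l => jp_pow_le (by norm_num : 4 ≤ 7) ((D.path t).norm_coeff_U_trig φ) l
  have df' : ∀ (φ : ℤ →₀ ℂ) t l, ‖D.trigDot t φ l‖ * jp l ^ 4 ≤ 2 * (bd * trigBd φ) :=
    fun φ t l => jp_pow_le (by norm_num : 4 ≤ 6) (D.norm_trigDot_le t φ) l
  have hsum := hasDerivWithinAt_tsum_formTerm hg hb (convex_Icc (0 : ℝ) 1)
    (fun t ht q => D.hasDerivWithinAt_path_c q ht)
    (fun t ht l => D.hasDerivWithinAt_coeff_U_trig φ l ht)
    (fun t ht l => D.hasDerivWithinAt_coeff_U_trig χ l ht) dc dc' (df φ) (df' φ)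
    (fun t => norm_le_of_decay (df χ t)) (fun t => norm_le_of_decay (df' χ t)) hθ
  have hv : wn 7 (realCoeff (D.vf θ)) ≤ ENNReal.ofReal bd := by
    simpa using D.wn_vf_le θ zero_le_one D.wn_d_sub_one
  refine hsum.congr_deriv (hasSum_form_deriv hg hb
    (((wn_mono (by norm_num) _).trans hv).trans_lt ENNReal.ofReal_lt_top).ne
    (((wn_mono (by norm_num) _).trans ((D.path θ).wn_pow _)).trans_lt ENNReal.ofReal_lt_top).ne
    (wn_of_decay (jp_pow_le (by norm_num : 3 + 2 ≤ 7) ((D.path θ).norm_coeff_U_trig φ)))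
    (norm_le_of_decay (df χ θ)) (fun p => realCoeff_neg _ p) (D.hasSum_cDot θ)
    (D.hasSum_trigDot θ φ) (D.hasSum_trigDot θ χ)).2.tsum_eq

/-- The path starts at a translation, whose matrix is diagonal. -/
theorem path_zero_M (n l : ℤ) : (D.path 0).M n l =
    (fourier n (D.q0 : Torus) : ℂ) * if l = n then 1 else 0 := by
  have h0 : clamp 0 = 0 := clamp_of_mem ⟨le_rfl, zero_le_one⟩
  have e : (D.path 0).a n = (fourier n (D.q0 : Torus) : ℂ) • (fourier n : C(Torus, ℂ)) := by
    ext x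
    rw [Diffeo.a_apply, Diffeo.sq_apply, Diffeo.G_apply, path_β_apply, path_d_apply, h0]
    simp only [zero_mul, add_zero, Real.sqrt_one, Complex.ofReal_one, one_mul,
      ContinuousMap.smul_apply, smul_eq_mul, fourier_apply, smul_add, AddCircle.toCircle_add]
    rw [Circle.coe_mul, mul_comm]
  rw [M, e, fourierCoeff_smul', ← coeff_eb, eb, coeff_cl]

theorem coeff_trig (φ : ℤ →₀ ℂ) (l : ℤ) : coeff (trig φ) l = φ l := by
  rw [trig_apply, Finsupp.sum, coeff_sum]
  simp only [coeff_smul, coeff_eb, mul_ite, mul_one, mul_zero]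
  rw [Finset.sum_ite_eq]
  split_ifs with h
  · rfl
  · rw [Finsupp.notMem_support_iff.1 h]

/-- A translation commutes with `L`, and `d = 1` there. -/
theorem pathForm_zero (g b : ℝ) (φ χ : ℤ →₀ ℂ) : D.pathForm g b φ χ 0 =
    ∑' k, symbolL g b k * (coeff (trig φ) k * conj (coeff (trig χ) k)) := by
  have h0 : clamp 0 = 0 := clamp_of_mem ⟨le_rfl, zero_le_one⟩
  have hc : realCoeff ((D.path 0).pow (-(3 / 2))) = fun q => if q = 0 then 1 else 0 := by
    ext q
    have : ofR ((D.path 0).pow (-(3 / 2))) = 1 := by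
      ext x
      simp [Diffeo.pow_apply, path_d_apply, h0]
    rw [← fourierCoeff_ofR, this, fourierCoeff_one]
  have hU : ∀ (φ : ℤ →₀ ℂ) l, coeff ((D.path 0).U (trig φ)) l =
      (fourier l (D.q0 : Torus) : ℂ) * coeff (trig φ) l := by
    intro φ l
    rw [coeff_U_trig, coeff_trig]
    simp only [path_zero_M, mul_ite, mul_one, mul_zero]
    rw [Finset.sum_ite_eq]
    split_ifs with h
    · rw [mul_comm]
    · rw [Finsupp.notMem_support_iff.1 h, mul_zero]
  have hinj : Function.Injective fun l : ℤ => (l, (0 : ℤ)) := fun x y h => by simpa using h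
  rw [pathForm, hc, ← hinj.tsum_eq]
  · refine tsum_congr fun l => ?_
    simp only [formTerm, add_zero, if_true, one_mul, hU, map_mul]
    have h1 : (fourier l (D.q0 : Torus) : ℂ) * conj (fourier l (D.q0 : Torus) : ℂ) = 1 := by
      rw [Complex.mul_conj, Complex.normSq_eq_norm_sq, norm_fourier_apply]; simp
    rw [← Complex.ofReal_mul, lam_mul_self]
    linear_combination (symbolL g b l : ℂ) * coeff (trig φ) l * conj (coeff (trig χ) l) * h1
  · intro y hy
    have : y.2 = 0 := by
      by_contra hne
      exact hy (by simp [formTerm, hne])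
    exact ⟨y.1, by rw [← this]⟩

/-- The form of the conjugated principal part differs from the form of `L` by a bounded form,
whose size is controlled by the change of variables. -/
theorem exists_form_bound {g b : ℝ} (hg : 0 < g) (hb : 0 < b) : ∃ C : ℝ, 0 ≤ C ∧
    ∀ (D : SDiffeo) (A : ℝ), 0 ≤ A →
      wn 7 (realCoeff (D.d - 1 : C(Torus, ℝ))) ≤ ENNReal.ofReal A → ∀ φ χ : ℤ →₀ ℂ,
      ‖∑' y, formTerm g b (realCoeff (D.pow (-(3 / 2)))) (coeff (D.U (trig φ)))
        (coeff (D.U (trig χ))) y -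
        ∑' k, symbolL g b k * (coeff (trig φ) k * conj (coeff (trig χ) k))‖ ≤
        C * A * ‖trig φ‖ * ‖trig χ‖ := by
  obtain ⟨C, hC, hS⟩ := exists_abs_symS_le hg hb
  have hp := one_le_powBd (-(3 / 2))
  have hbd := one_le_bd
  refine ⟨C * (bd * powBd (-(3 / 2))), by positivity, fun D A hA hD φ χ => ?_⟩
  have hb' : ∀ θ ∈ Icc (0 : ℝ) 1, ‖∑' x : (ℤ × ℤ) × ℤ,
      (Complex.I / 2 * symS g b x.1.1 x.2 x.1.2) * (realCoeff (D.vf θ) x.2 *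
        realCoeff ((D.path θ).pow (-(3 / 2))) x.1.2 * coeff ((D.path θ).U (trig φ)) x.1.1 *
        conj (coeff ((D.path θ).U (trig χ)) (x.1.1 + x.2 + x.1.2)))‖ ≤
      C * (bd * powBd (-(3 / 2))) * A * ‖trig φ‖ * ‖trig χ‖ := by
    intro θ _
    have hsq : ∀ φ : ℤ →₀ ℂ, Real.sqrt (∑' k, ‖coeff ((D.path θ).U (trig φ)) k‖ ^ 2) = ‖trig φ‖ := by
      intro φ
      rw [← norm_sq_eq_tsum, LinearIsometryEquiv.norm_map, Real.sqrt_sq (norm_nonneg _)]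
    have h1 := norm_tsum_symS_le (g := g) (b := b) hC.le hS (A := A * bd)
      (A' := powBd (-(3 / 2))) (by positivity)
      (by linarith) ((wn_mono (by norm_num) _).trans (D.wn_vf_le θ hA hD))
      ((wn_mono (by norm_num) _).trans ((D.path θ).wn_pow _))
      (hasSum_norm_sq ((D.path θ).U (trig φ))).summable
      (hasSum_norm_sq ((D.path θ).U (trig χ))).summable
    rw [hsq, hsq] at h1
    exact h1.trans_eq (by ring)
  -- integrate the bound of the derivative from the translation to the change of variables
  have h2 := lipschitz_of_deriv (convex_Icc (0 : ℝ) 1)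
    (fun θ hθ => D.hasDerivWithinAt_pathForm hg hb φ χ hθ) hb'
    (left_mem_Icc.2 zero_le_one) (right_mem_Icc.2 zero_le_one)
  rw [pathForm_zero, sub_zero, abs_one, mul_one] at h2
  refine le_trans (le_of_eq ?_) h2
  have e1 : ∀ φ : ℤ →₀ ℂ, coeff ((D.path 1).U (trig φ)) = coeff (D.U (trig φ)) := fun φ => by
    ext l
    rw [coeff_U_trig, coeff_U_trig]
    refine Finset.sum_congr rfl fun n _ => ?_
    rw [M, path_one_a, M]
  have e2 : (D.path 1).pow (-(3 / 2)) = D.pow (-(3 / 2)) := by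
    ext x
    rw [Diffeo.pow_apply, Diffeo.pow_apply, path_d_apply, clamp_of_mem ⟨zero_le_one, le_rfl⟩]
    simp
  rw [pathForm, e1, e1, e2]

end SDiffeo

/-- A symmetric matrix whose form is bounded on finite sequences is the matrix of a bounded
operator. -/
theorem exists_operator {w : ℤ → L2} {B : ℝ} (hB : 0 ≤ B)
    (h : ∀ φ χ : ℤ →₀ ℂ, ‖inner ℂ (trig χ) (∑ n ∈ φ.support, φ n • w n)‖ ≤ B * ‖trig φ‖ * ‖trig χ‖)
    (hs : ∀ k n, coeff (w n) k = inner ℂ (w k) (eb n)) :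
    ∃ K : L2 →L[ℂ] L2, ‖K‖ ≤ B ∧ (∀ n, K (eb n) = w n) ∧ ∀ u k, coeff (K u) k = inner ℂ (w k) u := by
  let f : (ℤ →₀ ℂ) →ₗ[ℂ] L2 := Finsupp.linearCombination ℂ w
  have hf : ∀ φ, f φ = ∑ n ∈ φ.support, φ n • w n := fun φ => Finsupp.linearCombination_apply ℂ φ
  have hfb : ∀ φ, ‖f φ‖ ≤ B * ‖trig φ‖ := by
    intro φ
    have h1 : ∀ y : L2, ‖(inner ℂ y (f φ) : ℂ)‖ ≤ B * ‖trig φ‖ * ‖y‖ := fun y => by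
      refine denseRange_trig.induction_on y (isClosed_le (by fun_prop) (by fun_prop)) fun χ => ?_
      rw [hf]; exact h φ χ
    have h2 := h1 (f φ)
    rw [inner_self_eq_norm_sq_to_K, norm_pow, RCLike.norm_ofReal, abs_norm, sq] at h2
    rcases eq_or_lt_of_le (norm_nonneg (f φ)) with h0 | h0
    · rw [← h0]; positivity
    · exact le_of_mul_le_mul_right h2 h0
  have hK : ∀ n, f.extendOfNorm trig (eb n) = w n := by
    intro n
    have h1 : eb n = trig (Finsupp.single n 1) := by
      rw [trig, Finsupp.linearCombination_single, one_smul]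
    rw [h1, LinearMap.extendOfNorm_eq denseRange_trig ⟨B, hfb⟩]
    simp [f]
  refine ⟨f.extendOfNorm trig, LinearMap.opNorm_extendOfNorm_le denseRange_trig hB hfb, hK,
    fun u k => ?_⟩
  set K := f.extendOfNorm trig
  have h1 : HasSum (fun n => inner ℂ (eb k) (K (coeff u n • eb n))) (inner ℂ (eb k) (K u)) :=
    ((hasSum_eb u).mapL K).mapL (innerSL ℂ (eb k))
  have h2 : HasSum (fun n => inner ℂ (w k) (coeff u n • eb n)) (inner ℂ (w k) u) :=
    (hasSum_eb u).mapL (innerSL ℂ (w k))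
  rw [coeff_eq_inner]
  refine h1.unique (h2.congr_fun fun n => ?_)
  rw [map_smul, inner_smul_right, inner_smul_right, hK, ← hs, coeff_eq_inner (w n)]

/-! ### The operator of the conjugated principal part -/

/-- The form is symmetric if the coefficient is real. -/
theorem tsum_formTerm_swap {g b : ℝ} {c f h : ℤ → ℂ} (hs : Summable (formTerm g b c f h))
    (hc : ∀ q, c (-q) = conj (c q)) :
    ∑' y, formTerm g b c h f y = conj (∑' y, formTerm g b c f h y) := by
  let e : ℤ × ℤ ≃ ℤ × ℤ :=
    { toFun := fun y => (y.1 + y.2, -y.2)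
      invFun := fun y => (y.1 + y.2, -y.2)
      left_inv := fun y => by simp
      right_inv := fun y => by simp }
  have h1 := hs.hasSum.map (starRingEnd ℂ) Complex.continuous_conj
  rw [← (e.hasSum_iff.2 h1).tsum_eq]
  refine tsum_congr fun y => ?_
  simp only [Function.comp_apply, e, Equiv.coe_fn_mk, formTerm, map_mul, Complex.conj_ofReal,
    Complex.conj_conj, hc]
  rw [show y.1 + y.2 + -y.2 = y.1 by ring]
  ring

/-- The form as a scalar product in `L²`. -/
theorem tsum_formTerm_eq_inner {g b : ℝ} {c f : ℤ → ℂ} {x z : L2}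
    (hs : Summable (formTerm g b c f (coeff z)))
    (hx : ∀ j, HasSum (fun l => lam g b j * (c (j - l) * (lam g b l * f l))) (coeff x j)) :
    ∑' y, formTerm g b c f (coeff z) y = inner ℂ z x := by
  let e : ℤ × ℤ ≃ ℤ × ℤ :=
    { toFun := fun y => (y.2, y.1 - y.2)
      invFun := fun y => (y.1 + y.2, y.1)
      left_inv := fun y => by simp
      right_inv := fun y => by simp }
  have h1 := (e.hasSum_iff.2 hs.hasSum).prod_fiberwise
    (g := fun j => conj (coeff z j) * coeff x j) fun j => by
      refine ((hx j).mul_left (conj (coeff z j))).congr_fun fun l => ?_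
      simp only [Function.comp_apply, e, Equiv.coe_fn_mk, formTerm]
      rw [show l + (j - l) = j by ring]
      ring
  exact h1.unique (hasSum_inner z x)

theorem hasSum_formTerm_opL {g b : ℝ} {a : Torus → ℝ} {f h : ℤ → ℂ}
    (hs : Summable (formTerm g b (realCoeff a) f h)) :
    HasSum (fun l => conj (f l) * opLhalf g b (opMul a (opLhalf g b h)) l)
      (conj (∑' y, formTerm g b (realCoeff a) f h y)) := by
  have h1 := hs.hasSum.map (starRingEnd ℂ) Complex.continuous_conj
  refine h1.prod_fiberwise fun l => ?_
  have h2 := (h1.summable.prod_factor l).hasSum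
  have e : conj (f l) * opLhalf g b (opMul a (opLhalf g b h)) l =
      ∑' q, ((starRingEnd ℂ) ∘ formTerm g b (realCoeff a) f h) (l, q) := by
    rw [opLhalf, opMul, ← tsum_mul_left, ← tsum_mul_left, ← (Equiv.addLeft l).tsum_eq]
    refine tsum_congr fun q => ?_
    simp only [Function.comp_apply, formTerm, map_mul, Complex.conj_ofReal, Complex.conj_conj,
      Equiv.coe_addLeft, opLhalf]
    rw [show l - (l + q) = -q by ring, realCoeff_neg]
    simp only [lam]
    ring
  rw [e]
  exact h2

/-- Convergence in `L²` from the convergence of the coefficients under domination. -/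
theorem tendsto_L2_of_coeff {ι : Type*} {l : Filter ι} {u : ι → L2} {v : L2} {B : ℤ → ℝ}
    (hB : Summable fun k => B k ^ 2) (hu : ∀ i k, ‖coeff (u i) k‖ ≤ B k)
    (hv : ∀ k, ‖coeff v k‖ ≤ B k)
    (h : ∀ k, Tendsto (fun i => coeff (u i) k) l (𝓝 (coeff v k))) : Tendsto u l (𝓝 v) := by
  rw [tendsto_iff_norm_sub_tendsto_zero]
  have h1 : Tendsto (fun i => ∑' k, ‖coeff (u i - v) k‖ ^ 2) l (𝓝 (∑' _ : ℤ, (0 : ℝ))) := by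
    refine tendsto_tsum_of_dominated_convergence (bound := fun k => 4 * B k ^ 2) (hB.mul_left 4)
      (fun k => ?_) (Eventually.of_forall fun i k => ?_)
    · have h2 := ((tendsto_iff_norm_sub_tendsto_zero.1 (h k)).pow 2)
      simpa [coeff_sub] using h2
    · rw [coeff_sub, norm_pow, norm_norm]
      have h3 := (norm_sub_le (coeff (u i) k) (coeff v k)).trans (add_le_add (hu i k) (hv k))
      calc _ ≤ (B k + B k) ^ 2 := by gcongr
        _ = _ := by ring
  have h3 : ∀ i, ‖u i - v‖ = Real.sqrt (∑' k, ‖coeff (u i - v) k‖ ^ 2) := fun i => by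
    rw [← norm_sq_eq_tsum, Real.sqrt_sq (norm_nonneg _)]
  simp only [h3]
  simpa using h1.sqrt

namespace SDiffeo

variable (D : SDiffeo)

/-- The coefficients of `L^{1/2} ((1 + ∂β)^{-3/2} L^{1/2} a)`, for `a` the image of the
exponential of frequency `k`. -/
def qc (g b : ℝ) (k j : ℤ) : ℂ :=
  lam g b j * ∑' l, realCoeff (D.pow (-(3 / 2))) (j - l) * (lam g b l * D.M k l)

/-- The bound of the coefficients `qc`. -/
def qcBd (g : ℝ) (k : ℤ) : ℝ :=
  (g + 1) * (powBd (-(3 / 2)) * ((g + 1) * ((2 * bd) ^ 7 * jp k ^ 7)))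

theorem norm_lam_M_le {g b : ℝ} (hg : 0 < g) (hb : 0 < b) (k l : ℤ) :
    ‖(lam g b l : ℂ) * D.M k l‖ * jp l ^ 6 ≤ (g + 1) * ((2 * bd) ^ 7 * jp k ^ 7) := by
  have hl := jp_pos l
  rw [norm_mul, Complex.norm_real, Real.norm_eq_abs, abs_of_nonneg (lam_nonneg _ _ _)]
  calc _ ≤ ((g + 1) * jp l * ‖D.M k l‖) * jp l ^ 6 := by gcongr; exact lam_le hg hb l
    _ = (g + 1) * (‖D.M k l‖ * jp l ^ 7) := by ring
    _ ≤ _ := mul_le_mul_of_nonneg_left (D.norm_M_le_left 7 le_rfl k l) (by linarith)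

theorem norm_qc_le {g b : ℝ} (hg : 0 < g) (hb : 0 < b) (k j : ℤ) :
    ‖D.qc g b k j‖ * jp j ^ 5 ≤ qcBd g k := by
  have hk := jp_pos k
  have hj := jp_pos j
  have hp := one_le_powBd (-(3 / 2))
  have hbd := one_le_bd
  have h1 := norm_conv_le_decay (by norm_num : 6 ≤ 7) (by linarith) (by positivity)
    (D.wn_pow (-(3 / 2))) (D.norm_lam_M_le hg hb k) j
  rw [qc, norm_mul, Complex.norm_real, Real.norm_eq_abs, abs_of_nonneg (lam_nonneg _ _ _), qcBd]
  set X := ‖∑' l, realCoeff (D.pow (-(3 / 2))) (j - l) * ((lam g b l : ℂ) * D.M k l)‖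
  calc _ ≤ ((g + 1) * jp j * X) * jp j ^ 5 := by gcongr; exact lam_le hg hb j
    _ = (g + 1) * (X * jp j ^ 6) := by ring
    _ ≤ _ := mul_le_mul_of_nonneg_left h1 (by linarith)

theorem norm_qc_le' {g b : ℝ} (hg : 0 < g) (hb : 0 < b) (k j : ℤ) :
    ‖D.qc g b k j‖ ≤ qcBd g k * (jp j ^ 5)⁻¹ := by
  have hj := jp_pos j
  rw [← div_eq_mul_inv, le_div_iff₀ (by positivity)]
  exact D.norm_qc_le hg hb k j

theorem summable_qcBd (g : ℝ) (k : ℤ) : Summable fun j => (qcBd g k * (jp j ^ 5)⁻¹) ^ 2 := by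
  refine ((summable_jp_inv_pow (by norm_num : 2 ≤ 10)).mul_left (qcBd g k ^ 2)).congr fun j => ?_
  rw [mul_pow, inv_pow, ← pow_mul]

theorem summable_qc {g b : ℝ} (hg : 0 < g) (hb : 0 < b) (k : ℤ) :
    Summable fun j => ‖D.qc g b k j‖ ^ 2 :=
  (summable_qcBd g k).of_nonneg_of_le (fun j => by positivity)
    fun j => pow_le_pow_left₀ (norm_nonneg _) (D.norm_qc_le' hg hb k j) 2

/-- The function with coefficients `qc`. -/
def qa {g b : ℝ} (hg : 0 < g) (hb : 0 < b) (k : ℤ) : L2 := ofCoeff _ (D.summable_qc hg hb k)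

theorem coeff_qa {g b : ℝ} (hg : 0 < g) (hb : 0 < b) (k j : ℤ) :
    coeff (D.qa hg hb k) j = D.qc g b k j := coeff_ofCoeff _ _ _

theorem hasSum_qa {g b : ℝ} (hg : 0 < g) (hb : 0 < b) (k j : ℤ) :
    HasSum (fun l => (lam g b j : ℂ) * (realCoeff (D.pow (-(3 / 2))) (j - l) *
      (lam g b l * D.M k l))) (coeff (D.qa hg hb k) j) := by
  rw [coeff_qa, qc]
  have hk := jp_pos k
  have hp := one_le_powBd (-(3 / 2))
  have hbd := one_le_bd
  exact ((norm_conv_le_growth (n := 0) (by norm_num : 0 ≤ 7) (by linarith) (by positivity)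
    (D.wn_pow (-(3 / 2))) (x := fun l => (lam g b l : ℂ) * D.M k l)
    (B := (g + 1) * ((2 * bd) ^ 7 * jp k ^ 7)) (fun l => by
      rw [pow_zero, mul_one]
      exact norm_le_of_decay (D.norm_lam_M_le hg hb k) l) j).1.of_norm.hasSum).mul_left _

theorem norm_c_le (q : ℤ) :
    ‖realCoeff (D.pow (-(3 / 2))) q‖ * jp q ^ 3 ≤ powBd (-(3 / 2)) :=
  norm_mul_jp_pow_le_of_wn (by norm_num : 3 ≤ 7) (by linarith [one_le_powBd (-(3 / 2))])
    (D.wn_pow _) q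

theorem summable_formTerm_M {g b : ℝ} (hg : 0 < g) (hb : 0 < b) (k : ℤ) (z : L2) :
    Summable (formTerm g b (realCoeff (D.pow (-(3 / 2)))) (D.M k) (coeff z)) :=
  summable_formTerm hg hb D.norm_c_le
    (jp_pow_le (by norm_num : 4 ≤ 7) (D.norm_M_le_left 7 le_rfl k)) (norm_coeff_le z)

theorem inner_qa_right {g b : ℝ} (hg : 0 < g) (hb : 0 < b) (k : ℤ) (z : L2) :
    inner ℂ z (D.qa hg hb k) =
      ∑' y, formTerm g b (realCoeff (D.pow (-(3 / 2)))) (D.M k) (coeff z) y :=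
  (tsum_formTerm_eq_inner (D.summable_formTerm_M hg hb k z) (D.hasSum_qa hg hb k)).symm

theorem hasSum_inner_qa {g b : ℝ} (hg : 0 < g) (hb : 0 < b) (k : ℤ) (u : L2) :
    HasSum (fun l => conj (D.M k l) *
      opLhalf g b (opMul (D.pow (-(3 / 2))) (opLhalf g b (coeff u))) l)
      (inner ℂ (D.qa hg hb k) u) := by
  rw [← inner_conj_symm, D.inner_qa_right hg hb k u]
  exact hasSum_formTerm_opL (D.summable_formTerm_M hg hb k u)

/-- The columns of the conjugated principal part minus `L`. -/
def col {g b : ℝ} (hg : 0 < g) (hb : 0 < b) (k : ℤ) : L2 :=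
  D.U.symm (D.qa hg hb k) - (symbolL g b k : ℂ) • eb k

theorem coeff_U_eb (k : ℤ) : coeff (D.U (eb k)) = D.M k := by
  ext l; rw [Diffeo.U_eb, coeff_cl, M]

theorem inner_U_symm (x y : L2) : inner ℂ x (D.U.symm y) = inner ℂ (D.U x) y := by
  rw [Diffeo.inner_U_left]

theorem inner_col_right {g b : ℝ} (hg : 0 < g) (hb : 0 < b) (k : ℤ) (z : L2) :
    inner ℂ z (D.col hg hb k) =
      ∑' y, formTerm g b (realCoeff (D.pow (-(3 / 2)))) (D.M k) (coeff (D.U z)) y -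
        symbolL g b k * conj (coeff z k) := by
  rw [col, inner_sub_right, inner_smul_right, inner_U_symm, inner_qa_right, coeff_eq_inner z,
    inner_conj_symm]

theorem coeff_col {g b : ℝ} (hg : 0 < g) (hb : 0 < b) (k n : ℤ) :
    coeff (D.col hg hb n) k = inner ℂ (D.col hg hb k) (eb n) := by
  rw [← inner_conj_symm, coeff_eq_inner, inner_col_right, inner_col_right, coeff_U_eb, coeff_U_eb,
    map_sub, map_mul, Complex.conj_conj, coeff_eb, coeff_eb, Complex.conj_ofReal,
    ← tsum_formTerm_swap (by simpa only [coeff_U_eb] using D.summable_formTerm_M hg hb k (D.U (eb n)))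
      (fun q => realCoeff_neg _ q)]
  congr 1
  by_cases h : n = k
  · subst h; simp
  · simp [h, Ne.symm h]

theorem inner_sum_col {g b : ℝ} (hg : 0 < g) (hb : 0 < b) (φ : ℤ →₀ ℂ) (z : L2) :
    inner ℂ z (∑ n ∈ φ.support, φ n • D.col hg hb n) =
      ∑' y, formTerm g b (realCoeff (D.pow (-(3 / 2)))) (coeff (D.U (trig φ))) (coeff (D.U z)) y -
        ∑' k, symbolL g b k * (coeff (trig φ) k * conj (coeff z k)) := by
  rw [inner_sum]
  simp only [inner_smul_right, inner_col_right, mul_sub]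
  rw [Finset.sum_sub_distrib]
  congr 1
  · simp only [← tsum_mul_left]
    rw [← Summable.tsum_finsetSum fun n _ => (D.summable_formTerm_M hg hb n _).mul_left _]
    refine tsum_congr fun y => ?_
    simp only [formTerm, coeff_U_trig, Finset.mul_sum, Finset.sum_mul]
    exact Finset.sum_congr rfl fun n _ => by ring
  · rw [tsum_eq_sum (s := φ.support)]
    · exact Finset.sum_congr rfl fun n _ => by rw [coeff_trig]; ring
    · intro k hk
      rw [coeff_trig, Finsupp.notMem_support_iff.1 hk]; simp

/-- The conjugated principal part is the sum of `L` and of a bounded operator, whose norm is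
controlled by the change of variables. -/
theorem exists_conj_operator {g b : ℝ} (hg : 0 < g) (hb : 0 < b) : ∃ C : ℝ, 0 ≤ C ∧
    ∀ (D : SDiffeo) (A : ℝ), 0 ≤ A →
      wn 7 (realCoeff (D.d - 1 : C(Torus, ℝ))) ≤ ENNReal.ofReal A →
      ∃ K : L2 →L[ℂ] L2, ‖K‖ ≤ C * A ∧ (∀ n, K (eb n) = D.col hg hb n) ∧
        ∀ u k, coeff (K u) k = inner ℂ (D.qa hg hb k) (D.U u) - symbolL g b k * coeff u k := by
  obtain ⟨C, hC, h⟩ := exists_form_bound hg hb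
  refine ⟨C, hC, fun D A hA hD => ?_⟩
  obtain ⟨K, hK1, hK2, hK3⟩ := exists_operator (w := D.col hg hb) (mul_nonneg hC hA)
    (fun φ χ => by rw [D.inner_sum_col hg hb]; exact h D A hA hD φ χ) (D.coeff_col hg hb)
  refine ⟨K, hK1, hK2, fun u k => ?_⟩
  rw [hK3, col, inner_sub_left, inner_smul_left, ← inner_conj_symm, inner_U_symm, inner_conj_symm,
    Complex.conj_ofReal, coeff_eq_inner u]

section Continuity

variable {X : Type*} [TopologicalSpace X] {E : X → SDiffeo}

theorem continuous_qa {g b : ℝ} (hg : 0 < g) (hb : 0 < b) (k : ℤ)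
    (hM : ∀ l, Continuous fun t => (E t).M k l)
    (hc : ∀ q, Continuous fun t => realCoeff ((E t).pow (-(3 / 2))) q) :
    Continuous fun t => (E t).qa hg hb k := by
  refine continuous_iff_continuousAt.2 fun t => tendsto_L2_of_coeff (summable_qcBd g k)
    (fun i j => ?_) (fun j => ?_) fun j => ?_
  · rw [coeff_qa]; exact (E i).norm_qc_le' hg hb k j
  · rw [coeff_qa]; exact (E t).norm_qc_le' hg hb k j
  · simp only [coeff_qa, qc]
    refine Continuous.tendsto (continuous_const.mul ?_) t
    refine continuous_tsum (u := fun l => powBd (-(3 / 2)) *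
      ((g + 1) * ((2 * bd) ^ 7 * jp k ^ 7) * (jp l ^ 6)⁻¹)) (fun l => ?_) ?_ fun l i => ?_
    · exact (hc _).mul (continuous_const.mul (hM l))
    · exact ((summable_jp_inv_pow (by norm_num : 2 ≤ 6)).mul_left _).mul_left _
    · have hl := jp_pos l
      rw [norm_mul]
      refine mul_le_mul (norm_le_of_decay (E i).norm_c_le _) ?_ (norm_nonneg _)
        (by linarith [one_le_powBd (-(3 / 2))])
      rw [← div_eq_mul_inv, le_div_iff₀ (by positivity)]
      exact (E i).norm_lam_M_le hg hb k l

/-- The inverses of a strongly continuous family of unitary operators are strongly continuous. -/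
theorem continuous_symm {U : X → L2 ≃ₗᵢ[ℂ] L2} (hU : ∀ h, Continuous fun t => U t h) {f : X → L2}
    (hf : Continuous f) : Continuous fun t => (U t).symm (f t) := by
  refine continuous_iff_continuousAt.2 fun t => ?_
  rw [ContinuousAt, tendsto_iff_norm_sub_tendsto_zero]
  have h1 : ∀ s, ‖(U s).symm (f s) - (U t).symm (f t)‖ = ‖f s - U s ((U t).symm (f t))‖ := by
    intro s
    rw [← LinearIsometryEquiv.norm_map (U s), map_sub, LinearIsometryEquiv.apply_symm_apply]
  simp only [h1]
  have h2 := ((hf.sub (hU ((U t).symm (f t)))).norm).tendsto t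
  simpa using h2

/-- A bounded family of operators which is strongly continuous on the exponentials is strongly
continuous. -/
theorem continuous_of_eb {K : X → L2 →L[ℂ] L2} {B : ℝ} (hB : ∀ t, ‖K t‖ ≤ B)
    (h : ∀ n, Continuous fun t => K t (eb n)) {f : X → L2} (hf : Continuous f) :
    Continuous fun t => K t (f t) := by
  have h1 : ∀ u, Continuous fun t => K t u := by
    intro u
    have hS : ∀ S : Finset ℤ, Continuous fun t => K t (∑ k ∈ S, coeff u k • eb k) := fun S => by
      simp only [map_sum, map_smul]
      exact continuous_finsetSum _ fun n _ => (continuous_const_smul (coeff u n)).comp (h n)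
    have hu : TendstoUniformly (fun (S : Finset ℤ) t => K t (∑ k ∈ S, coeff u k • eb k))
        (fun t => K t u) atTop := by
      have h2 := (hasSum_eb u)
      rw [HasSum, SummationFilter.unconditional_filter, tendsto_iff_norm_sub_tendsto_zero] at h2
      have h3 := h2.const_mul (|B| + 1)
      rw [mul_zero] at h3
      rw [Metric.tendstoUniformly_iff]
      intro ε hε
      filter_upwards [h3.eventually (gt_mem_nhds hε)] with S hS t
      rw [dist_comm, dist_eq_norm, ← map_sub]
      refine lt_of_le_of_lt ((K t).le_opNorm _) (lt_of_le_of_lt ?_ hS)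
      gcongr
      linarith [hB t, le_abs_self B]
    exact hu.continuous (Eventually.of_forall hS).frequently
  refine continuous_iff_continuousAt.2 fun t => ?_
  rw [ContinuousAt, tendsto_iff_norm_sub_tendsto_zero]
  have h2 : Tendsto (fun s => |B| * ‖f s - f t‖ + ‖K s (f t) - K t (f t)‖) (𝓝 t) (𝓝 0) := by
    have h3 := (tendsto_iff_norm_sub_tendsto_zero.1 (hf.tendsto t)).const_mul |B|
    have h4 := tendsto_iff_norm_sub_tendsto_zero.1 ((h1 (f t)).tendsto t)
    simpa using h3.add h4
  refine squeeze_zero (fun _ => norm_nonneg _) (fun s => ?_) h2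
  have e : K s (f s) - K t (f t) = K s (f s - f t) + (K s (f t) - K t (f t)) := by
    rw [map_sub]; abel
  rw [e]
  refine (norm_add_le _ _).trans (add_le_add ?_ le_rfl)
  exact ((K s).le_opNorm _).trans
    (mul_le_mul_of_nonneg_right ((hB s).trans (le_abs_self B)) (norm_nonneg _))

end Continuity

end SDiffeo

/-! ### Evolution equations in moving orthonormal bases -/

/-- Differentiating a scalar product `⟨a, w⟩`, where `a` is differentiable in `L²` and has
rapidly decaying coefficients, and `w` is differentiable in the sense of distributions only. -/
theorem hasDerivWithinAt_inner_weak {I : Set ℝ} (hI : Convex ℝ I) {a w : ℝ → L2} {a' : L2}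
    {F : ℝ → ℤ → ℂ} {B : ℤ → ℝ} {t : ℝ} (ht : t ∈ I) (ha : HasDerivWithinAt a a' I t)
    (hw : ContinuousWithinAt w I t)
    (hF : ∀ s ∈ I, ∀ l, HasDerivWithinAt (fun s => coeff (w s) l) (F s l) I s)
    (hB : ∀ s ∈ I, ∀ l, ‖F s l‖ ≤ B l) (hs : Summable fun l => ‖coeff (a t) l‖ * B l) :
    HasDerivWithinAt (fun s => (inner ℂ (a s) (w s) : ℂ))
      (inner ℂ a' (w t) + ∑' l, conj (coeff (a t) l) * F t l) I t := by
  rw [hasDerivWithinAt_iff_tendsto_slope]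
  have h1 : Tendsto (fun s => (inner ℂ (slope a t s) (w s) : ℂ)) (𝓝[I \ {t}] t)
      (𝓝 (inner ℂ a' (w t))) :=
    (hasDerivWithinAt_iff_tendsto_slope.1 ha).inner
      (hw.mono_left (nhdsWithin_mono _ sdiff_subset))
  have h2 : Tendsto (fun s => ∑' l, conj (coeff (a t) l) * slope (fun s => coeff (w s) l) t s)
      (𝓝[I \ {t}] t) (𝓝 (∑' l, conj (coeff (a t) l) * F t l)) := by
    refine tendsto_tsum_of_dominated_convergence hs (fun l => ?_) ?_
    · exact (hasDerivWithinAt_iff_tendsto_slope.1 (hF t ht l)).const_mul _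
    · filter_upwards [self_mem_nhdsWithin] with s hs' l
      rw [norm_mul, RCLike.norm_conj]
      refine mul_le_mul_of_nonneg_left ?_ (norm_nonneg _)
      exact norm_slope_le (lipschitz_of_deriv hI (fun s hs => hF s hs l) (fun s hs => hB s hs l)
        ht hs'.1) hs'.2
  refine (h1.add h2).congr fun s => ?_
  have h3 : HasSum (fun l => conj (coeff (a t) l) * slope (fun s => coeff (w s) l) t s)
      (inner ℂ (a t) (slope w t s)) := by
    refine (hasSum_inner (a t) (slope w t s)).congr_fun fun l => ?_
    rw [slope_def_module, slope_def_module, coeff_real_smul, coeff_sub, Complex.real_smul]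
  rw [h3.tsum_eq]
  simp only [slope_def_module, Complex.real_smul]
  rw [RCLike.real_smul_eq_coe_smul (K := ℂ), RCLike.real_smul_eq_coe_smul (K := ℂ) _ (w s - w t),
    inner_smul_left, inner_smul_right, inner_sub_left, inner_sub_right, RCLike.conj_ofReal]
  simp only [Complex.coe_algebraMap]
  ring

/-- A curve of unitary operators, with the regularity of the changes of variables in the basis of
the exponentials. -/
structure UCurve (I : Set ℝ) where
  /-- the operators -/
  U : ℝ → L2 ≃ₗᵢ[ℂ] L2
  /-- the derivatives of the images of the exponentials -/
  a' : ℝ → ℤ → L2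
  /-- the bound of the derivatives -/
  C : ℝ
  /-- the constant of the off-diagonal decay -/
  R : ℝ
  continuous : ∀ h, Continuous fun t => U t h
  hasDeriv : ∀ k, ∀ t ∈ I, HasDerivWithinAt (fun t => U t (eb k)) (a' t k) I t
  norm_a' : ∀ t ∈ I, ∀ k, ‖a' t k‖ ≤ C * jp k
  decay_left : ∀ t k l, ‖coeff (U t (eb k)) l‖ * jp l ^ 4 ≤ R * jp k ^ 4
  decay_right : ∀ t k l, ‖coeff (U t (eb k)) l‖ * jp k ^ 6 ≤ R * jp l ^ 6

namespace UCurve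

variable {I : Set ℝ} (Q : UCurve I)

/-- The matrix of the curve. -/
def M (t : ℝ) (k l : ℤ) : ℂ := coeff (Q.U t (eb k)) l

theorem C_nonneg {t : ℝ} (ht : t ∈ I) : 0 ≤ Q.C := by
  have h := (norm_nonneg _).trans (Q.norm_a' t ht 0)
  exact nonneg_of_mul_nonneg_left h (jp_pos 0)

theorem R_nonneg : 0 ≤ Q.R := by
  have h := Q.decay_left 0 0 0
  have h0 := jp_pos 0
  have h1 : 0 ≤ Q.R * jp 0 ^ 4 := le_trans (by positivity) h
  exact nonneg_of_mul_nonneg_left h1 (by positivity)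

theorem norm_M_le (t : ℝ) (k l : ℤ) : ‖Q.M t k l‖ ≤ Q.R * jp k ^ 4 * (jp l ^ 4)⁻¹ := by
  have hl := jp_pos l
  rw [← div_eq_mul_inv, le_div_iff₀ (by positivity)]
  exact Q.decay_left t k l

theorem norm_M_le' (t : ℝ) (k l : ℤ) : ‖Q.M t k l‖ ≤ Q.R * jp l ^ 6 * (jp k ^ 6)⁻¹ := by
  have hl := jp_pos k
  rw [← div_eq_mul_inv, le_div_iff₀ (by positivity)]
  exact Q.decay_right t k l

theorem coeff_symm_eb (t : ℝ) (j k : ℤ) : coeff ((Q.U t).symm (eb j)) k = conj (Q.M t k j) := by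
  rw [coeff_eq_inner, M, coeff_eq_inner, inner_conj_symm,
    ← LinearIsometryEquiv.inner_map_map (Q.U t), LinearIsometryEquiv.apply_symm_apply]

theorem hasSum_M (t : ℝ) (j l : ℤ) :
    HasSum (fun k => Q.M t k j * conj (Q.M t k l)) (if j = l then 1 else 0) := by
  have h := hasSum_inner ((Q.U t).symm (eb j)) ((Q.U t).symm (eb l))
  rw [LinearIsometryEquiv.inner_map_map, inner_eb_eb] at h
  refine h.congr_fun fun k => ?_
  rw [coeff_symm_eb, coeff_symm_eb, Complex.conj_conj]

/-- The derivative of the curve applied to the preimage of an exponential. -/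
def Y (t : ℝ) (j : ℤ) : L2 := ∑' k, conj (Q.M t k j) • Q.a' t k

theorem summable_Y_bound (A : ℝ) (j : ℤ) :
    Summable fun k : ℤ => Q.R * jp j ^ 6 * (jp k ^ 6)⁻¹ * (A * jp k ^ 4) := by
  refine (summable_jp_inv_sq.mul_left (Q.R * jp j ^ 6 * A)).congr fun k => ?_
  have := jp_pos k
  field_simp

theorem hasSum_Y {t : ℝ} (ht : t ∈ I) (j : ℤ) :
    HasSum (fun k => conj (Q.M t k j) • Q.a' t k) (Q.Y t j) := by
  refine (Summable.of_norm_bounded (Q.summable_Y_bound Q.C j) fun k => ?_).hasSum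
  have hk := one_le_jp k
  have hj := one_le_jp j
  have hC := Q.C_nonneg ht
  have hR := Q.R_nonneg
  rw [norm_smul, RCLike.norm_conj]
  refine mul_le_mul (Q.norm_M_le' t k j) ((Q.norm_a' t ht k).trans ?_) (norm_nonneg _)
    (by positivity)
  exact mul_le_mul_of_nonneg_left (le_self_pow₀ hk (by norm_num)) hC

/-- The inverse images of the exponentials are differentiable. -/
theorem hasDerivWithinAt_symm_eb (hI : Convex ℝ I) (j : ℤ) {t : ℝ} (ht : t ∈ I) :
    HasDerivWithinAt (fun s => (Q.U s).symm (eb j)) (-(Q.U t).symm (Q.Y t j)) I t := by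
  rw [hasDerivWithinAt_iff_tendsto_slope]
  have hC := Q.C_nonneg ht
  have hR := Q.R_nonneg
  have h1 : Tendsto (fun s => ∑' k, conj (Q.M t k j) • slope (fun s => Q.U s (eb k)) t s)
      (𝓝[I \ {t}] t) (𝓝 (Q.Y t j)) := by
    refine tendsto_tsum_of_dominated_convergence (Q.summable_Y_bound Q.C j) (fun k => ?_) ?_
    · exact (hasDerivWithinAt_iff_tendsto_slope.1 (Q.hasDeriv k t ht)).const_smul _
    · filter_upwards [self_mem_nhdsWithin] with s hs k
      have hk := one_le_jp k
      have hj := one_le_jp j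
      rw [norm_smul, RCLike.norm_conj]
      refine mul_le_mul (Q.norm_M_le' t k j) ?_ (norm_nonneg _) (by positivity)
      refine (norm_slope_le (lipschitz_of_deriv hI (Q.hasDeriv k)
        (fun s hs => Q.norm_a' s hs k) ht hs.1) hs.2).trans ?_
      exact mul_le_mul_of_nonneg_left (le_self_pow₀ hk (by norm_num)) hC
  have h2 : ∀ s, HasSum (fun k => conj (Q.M t k j) • slope (fun s => Q.U s (eb k)) t s)
      (slope (fun s => Q.U s ((Q.U t).symm (eb j))) t s) := by
    intro s
    have h3 := hasSum_eb ((Q.U t).symm (eb j))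
    have h4 := ((h3.mapL (Q.U s).toContinuousLinearEquiv.toContinuousLinearMap).sub
      (h3.mapL (Q.U t).toContinuousLinearEquiv.toContinuousLinearMap)).const_smul ((s - t)⁻¹)
    rw [slope_def_module]
    refine h4.congr_fun fun k => ?_
    rw [slope_def_module, ← coeff_symm_eb, smul_comm, smul_sub (coeff _ _)]
    congr 2
    · exact (map_smul _ _ _).symm
    · exact (map_smul _ _ _).symm
  have h5 : Tendsto (fun s => (Q.U s).symm (∑' k, conj (Q.M t k j) •
      slope (fun s => Q.U s (eb k)) t s)) (𝓝[I \ {t}] t) (𝓝 ((Q.U t).symm (Q.Y t j))) := by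
    rw [tendsto_iff_norm_sub_tendsto_zero]
    have h6 := (h1.sub (((Q.continuous ((Q.U t).symm (Q.Y t j))).tendsto t).mono_left
      nhdsWithin_le_nhds)).norm
    rw [LinearIsometryEquiv.apply_symm_apply, sub_self, norm_zero] at h6
    refine h6.congr fun s => ?_
    rw [← LinearIsometryEquiv.norm_map (Q.U s) ((Q.U s).symm _ - _), map_sub,
      LinearIsometryEquiv.apply_symm_apply]
  refine h5.neg.congr fun s => ?_
  rw [(h2 s).tsum_eq, slope_def_module, slope_def_module, LinearIsometryEquiv.apply_symm_apply]
  have h7 : (Q.U s).symm ((s - t)⁻¹ • (Q.U s ((Q.U t).symm (eb j)) - eb j)) =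
      (s - t)⁻¹ • (Q.U s).symm (Q.U s ((Q.U t).symm (eb j)) - eb j) := by
    rw [RCLike.real_smul_eq_coe_smul (K := ℂ), map_smul, ← RCLike.real_smul_eq_coe_smul (K := ℂ)]
  rw [h7, map_sub, LinearIsometryEquiv.symm_apply_apply, ← smul_neg, neg_sub]

variable {u : ℝ → L2} {F G : ℝ → ℤ → ℂ} {A B : ℝ}

theorem summable_M_mul {t : ℝ} (hF : ∀ l, ‖F t l‖ ≤ B * jp l ^ 2) (k : ℤ) :
    (Summable fun l => ‖conj (Q.M t k l) * F t l‖) ∧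
      ‖∑' l, conj (Q.M t k l) * F t l‖ ≤ Q.R * B * (∑' l, (jp l ^ 2)⁻¹) * jp k ^ 4 := by
  have hR := Q.R_nonneg
  have hle : ∀ l, ‖conj (Q.M t k l) * F t l‖ ≤ Q.R * B * jp k ^ 4 * (jp l ^ 2)⁻¹ := by
    intro l
    have hl := jp_pos l
    have hk := jp_pos k
    rw [norm_mul, RCLike.norm_conj]
    calc _ ≤ (Q.R * jp k ^ 4 * (jp l ^ 4)⁻¹) * (B * jp l ^ 2) :=
          mul_le_mul (Q.norm_M_le t k l) (hF l) (norm_nonneg _) (by positivity)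
      _ = _ := by field_simp
  have hs := (summable_jp_inv_sq.mul_left (Q.R * B * jp k ^ 4)).of_nonneg_of_le
    (fun l => norm_nonneg _) hle
  refine ⟨hs, (norm_tsum_le_tsum_norm hs).trans ?_⟩
  refine (hs.tsum_le_tsum hle (summable_jp_inv_sq.mul_left _)).trans_eq ?_
  rw [tsum_mul_left]
  ring

/-- An evolution equation in the sense of distributions, in the basis of the exponentials, is
equivalent to an evolution equation in the moving basis. -/
theorem hasDerivWithinAt_iff (hI : Convex ℝ I) (hu : ContinuousOn u I) (hA : ∀ t ∈ I, ‖u t‖ ≤ A)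
    (hF : ∀ t ∈ I, ∀ l, ‖F t l‖ ≤ B * jp l ^ 2)
    (hG : ∀ t ∈ I, ∀ k, G t k =
      inner ℂ (Q.a' t k) (u t) + ∑' l, conj (Q.M t k l) * F t l) :
    (∀ t ∈ I, ∀ l, HasDerivWithinAt (fun s => coeff (u s) l) (F t l) I t) ↔
      ∀ t ∈ I, ∀ k, HasDerivWithinAt (fun s => coeff ((Q.U s).symm (u s)) k) (G t k) I t := by
  have hcoeff : ∀ s k, coeff ((Q.U s).symm (u s)) k = inner ℂ (Q.U s (eb k)) (u s) := by
    intro s k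
    rw [coeff_eq_inner, ← LinearIsometryEquiv.inner_map_map (Q.U s),
      LinearIsometryEquiv.apply_symm_apply]
  have hcoeff' : ∀ s j, coeff (u s) j = inner ℂ ((Q.U s).symm (eb j)) ((Q.U s).symm (u s)) := by
    intro s j
    rw [LinearIsometryEquiv.inner_map_map, coeff_eq_inner]
  constructor
  · intro h t ht k
    simp only [hcoeff]
    rw [hG t ht k]
    refine hasDerivWithinAt_inner_weak hI ht (Q.hasDeriv k t ht) (hu t ht) h hF ?_
    refine (summable_jp_inv_sq.mul_left (Q.R * B * jp k ^ 4)).of_nonneg_of_le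
      (fun l => mul_nonneg (norm_nonneg _) ((norm_nonneg _).trans (hF t ht l))) fun l => ?_
    have hl := jp_pos l
    calc _ ≤ (Q.R * jp k ^ 4 * (jp l ^ 4)⁻¹) * (B * jp l ^ 2) :=
          mul_le_mul_of_nonneg_right (Q.norm_M_le t k l) ((norm_nonneg _).trans (hF t ht l))
      _ = _ := by field_simp
  · intro h t ht j
    have hR := Q.R_nonneg
    have hC := Q.C_nonneg ht
    have hA0 := (norm_nonneg _).trans (hA t ht)
    simp only [hcoeff']
    set S₀ := ∑' l : ℤ, (jp l ^ 2)⁻¹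
    -- the size of the right hand side in the moving basis
    have hGb : ∀ s ∈ I, ∀ k, ‖G s k‖ ≤ (Q.C * A + Q.R * B * S₀) * jp k ^ 4 := by
      intro s hs k
      rw [hG s hs k, add_mul]
      refine (norm_add_le _ _).trans (add_le_add ?_ (Q.summable_M_mul (hF s hs) k).2)
      have hk := one_le_jp k
      have hCs := Q.C_nonneg hs
      calc _ ≤ ‖Q.a' s k‖ * ‖u s‖ := norm_inner_le_norm _ _
        _ ≤ (Q.C * jp k ^ 4) * A := by
          refine mul_le_mul ((Q.norm_a' s hs k).trans ?_) (hA s hs) (norm_nonneg _) (by positivity)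
          exact mul_le_mul_of_nonneg_left (le_self_pow₀ hk (by norm_num)) hCs
        _ = _ := by ring
    have hUsymm : ContinuousWithinAt (fun s => (Q.U s).symm (u s)) I t := by
      rw [ContinuousWithinAt, tendsto_iff_norm_sub_tendsto_zero]
      have h6 := ((hu t ht).tendsto.sub (((Q.continuous ((Q.U t).symm (u t))).tendsto t).mono_left
        nhdsWithin_le_nhds)).norm
      rw [LinearIsometryEquiv.apply_symm_apply, sub_self, norm_zero] at h6
      refine h6.congr fun s => ?_
      rw [← LinearIsometryEquiv.norm_map (Q.U s) ((Q.U s).symm (u s) - _), map_sub,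
        LinearIsometryEquiv.apply_symm_apply]
    have hd := hasDerivWithinAt_inner_weak hI ht (Q.hasDerivWithinAt_symm_eb hI j ht) hUsymm h hGb
      ((Q.summable_Y_bound (Q.C * A + Q.R * B * S₀) j).of_nonneg_of_le
        (fun k => mul_nonneg (norm_nonneg _) ((norm_nonneg _).trans (hGb t ht k))) fun k =>
          mul_le_mul_of_nonneg_right
            (by rw [coeff_symm_eb, RCLike.norm_conj]; exact Q.norm_M_le' t k j)
            ((norm_nonneg _).trans (hGb t ht k)))
    refine hd.congr_deriv ?_
    rw [inner_neg_left, LinearIsometryEquiv.inner_map_map]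
    -- the terms with the derivative of the basis cancel
    have h1 : HasSum (fun k => Q.M t k j * inner ℂ (Q.a' t k) (u t)) (inner ℂ (Q.Y t j) (u t)) := by
      have h2 := ((Q.hasSum_Y ht j).mapL (innerSL ℂ (u t))).map (starRingEnd ℂ)
        Complex.continuous_conj
      rw [innerSL_apply_apply, inner_conj_symm] at h2
      refine h2.congr_fun fun k => ?_
      simp only [Function.comp_apply, innerSL_apply_apply]
      rw [inner_conj_symm, inner_smul_left, Complex.conj_conj]
    have h3 : HasSum (fun k => Q.M t k j * ∑' l, conj (Q.M t k l) * F t l) (F t j) := by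
      have hs : Summable fun x : ℤ × ℤ => Q.M t x.1 j * (conj (Q.M t x.1 x.2) * F t x.2) := by
        refine Summable.of_norm_bounded (summable_inv_jp_sq_prod.mul_left
          (Q.R * jp j ^ 6 * (Q.R * B))) fun x => ?_
        have h1 := jp_pos x.1
        have h2 := jp_pos x.2
        have hj := jp_pos j
        rw [norm_mul, norm_mul, RCLike.norm_conj]
        calc _ ≤ (Q.R * jp j ^ 6 * (jp x.1 ^ 6)⁻¹) * ((Q.R * jp x.1 ^ 4 * (jp x.2 ^ 4)⁻¹) *
              (B * jp x.2 ^ 2)) := by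
              refine mul_le_mul (Q.norm_M_le' t _ _) ?_ (by positivity) (by positivity)
              exact mul_le_mul (Q.norm_M_le t _ _) (hF t ht _) (norm_nonneg _) (by positivity)
          _ = _ := by field_simp
      have e1 := hs.hasSum.prod_fiberwise fun k =>
        ((Q.summable_M_mul (hF t ht) k).1.of_norm.hasSum.mul_left (Q.M t k j))
      have e2 := ((Equiv.prodComm ℤ ℤ).hasSum_iff.2 hs.hasSum).prod_fiberwise
        (g := fun l => (if j = l then 1 else 0) * F t l) fun l => by
          refine ((Q.hasSum_M t j l).mul_right (F t l)).congr_fun fun k => ?_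
          simp only [Function.comp_apply, Equiv.prodComm_apply, Prod.swap]
          ring
      have e3 : HasSum (fun l => (if j = l then 1 else 0) * F t l) (F t j) := by
        have := hasSum_single (f := fun l => (if j = l then 1 else 0) * F t l) j (fun l hl => by
          simp [Ne.symm hl])
        simpa using this
      rw [e3.unique e2]
      exact e1
    have h4 : ∑' k, conj (coeff ((Q.U t).symm (eb j)) k) * G t k =
        inner ℂ (Q.Y t j) (u t) + F t j := by
      rw [← (h1.add h3).tsum_eq]
      refine tsum_congr fun k => ?_
      rw [coeff_symm_eb, Complex.conj_conj, hG t ht k, mul_add]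
    rw [h4]
    ring

end UCurve

/-! ### Transport terms -/

theorem herm_cl_ofR (v : C(Torus, ℝ)) : Herm (cl (ofR v)) := fun k => by
  rw [coeff_cl, coeff_cl, fourierCoeff_ofR, realCoeff_neg]

/-- The function whose scalar product with `u` is, up to the sign, the coefficient of frequency `k`
of `v ∂ₓ u`. -/
def transp (v : C(Torus, ℝ)) (v' : L2) (k : ℤ) : L2 :=
  mulL (fourier k) v' + (Complex.I * k) • mulL (fourier k) (cl (ofR v))

theorem opMul_opDx {v : C(Torus, ℝ)} {v' : L2} (hv : WD (cl (ofR v)) v') {V : Torus → ℝ}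
    (hV : ∀ k, realCoeff V k = realCoeff v k) (u : L2) (k : ℤ) :
    opMul V (opDx (coeff u)) k = - inner ℂ (transp v v' k) u := by
  have h1 := (hasSum_conv_of_herm (herm_cl_ofR v) u k).mul_left (Complex.I * k)
  have h2 := hasSum_conv_of_herm (Herm.of_WD (herm_cl_ofR v) hv) u k
  rw [transp, inner_add_left, inner_smul_left, map_mul, Complex.conj_I, map_intCast, opMul]
  rw [show -(inner ℂ (mulL (fourier k) v') u + -Complex.I * k * inner ℂ (mulL (fourier k)
    (cl (ofR v))) u) = Complex.I * k * inner ℂ (mulL (fourier k) (cl (ofR v))) u -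
    inner ℂ (mulL (fourier k) v') u by ring, ← (h1.sub h2).tsum_eq]
  refine tsum_congr fun j => ?_
  rw [hv (k - j), coeff_cl, fourierCoeff_ofR, hV, opDx]
  push_cast
  ring

theorem norm_transp_le (v : C(Torus, ℝ)) (v' : L2) (k : ℤ) :
    ‖transp v v' k‖ ≤ (‖v'‖ + ‖cl (ofR v)‖) * jp k := by
  have h1 : ∀ f : L2, ‖mulL (fourier k) f‖ ≤ ‖f‖ := fun f => by
    simpa [norm_fourier] using norm_mulL_le (fourier k) f
  have hk := one_le_jp k
  have hk' := abs_le_jp k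
  rw [transp]
  refine (norm_add_le _ _).trans ?_
  rw [norm_smul, norm_mul, Complex.norm_I, one_mul, Complex.norm_intCast, add_mul]
  refine add_le_add ((h1 v').trans (le_mul_of_one_le_right (norm_nonneg _) hk)) ?_
  rw [mul_comm]
  exact mul_le_mul (h1 _) hk' (abs_nonneg _) (norm_nonneg _)

theorem norm_principal_le {g b : ℝ} (hg : 0 < g) (hb : 0 < b) {c : Torus → ℝ} {A : ℝ} (hA : 0 ≤ A)
    (hc : wn 1 (realCoeff c) ≤ ENNReal.ofReal A) (u : L2) (l : ℤ) :
    ‖opLhalf g b (opMul c (opLhalf g b (coeff u))) l‖ ≤ (g + 1) ^ 2 * A * ‖u‖ * jp l ^ 2 := by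
  have hl := jp_pos l
  have h1 := (norm_conv_le_growth (n := 1) le_rfl hA (B := (g + 1) * ‖u‖) (by positivity) hc
    (x := opLhalf g b (coeff u)) (fun j => by
      rw [opLhalf, norm_mul, Complex.norm_real, Real.norm_eq_abs, abs_of_nonneg (Real.sqrt_nonneg _),
        pow_one]
      have h2 := lam_le hg hb j
      rw [lam] at h2
      calc _ ≤ (g + 1) * jp j * ‖u‖ :=
            mul_le_mul h2 (norm_coeff_le u j) (norm_nonneg _) (by have := jp_pos j; positivity)
        _ = _ := by ring) l).2
  rw [opLhalf, norm_mul, Complex.norm_real, Real.norm_eq_abs, abs_of_nonneg (Real.sqrt_nonneg _),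
    opMul]
  have h2 := lam_le hg hb l
  rw [lam] at h2
  calc _ ≤ ((g + 1) * jp l) * (A * ((g + 1) * ‖u‖) * jp l ^ 1) :=
        mul_le_mul h2 h1 (norm_nonneg _) (by positivity)
    _ = _ := by ring

theorem opMul_congr {f h : Torus → ℝ} {z : ℝ} (hf : ∀ k, realCoeff f k = z * realCoeff h k)
    (v : ℤ → ℂ) (k : ℤ) : opMul f v k = z * opMul h v k := by
  rw [opMul, opMul, ← tsum_mul_left]
  exact tsum_congr fun j => by rw [hf]; ring

namespace SDiffeo

variable (D : SDiffeo)

theorem hasSum_a (k : ℤ) :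
    HasSum (fun l => D.M k l • (fourier l : C(Torus, ℂ))) (D.a k) :=
  hasSum_fourier_of_wn (wn_of_decay (jp_pow_le (by norm_num : 0 + 2 ≤ 7)
    (D.norm_M_le_left 7 le_rfl k)))

theorem hasSum_a' (k : ℤ) :
    HasSum (fun l : ℤ => (Complex.I * l * D.M k l) • (fourier l : C(Torus, ℂ))) (D.a' k) := by
  refine (hasSum_fourier_of_wn (f := D.a' k) ?_).congr_fun fun l => ?_
  · refine wn_of_decay (B := (2 * bd) ^ 7 * jp k ^ 7) fun l => ?_
    have hl := one_le_jp l
    rw [coeff_a', norm_mul, norm_mul, Complex.norm_I, one_mul, Complex.norm_intCast]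
    calc _ ≤ (jp l * ‖D.M k l‖) * jp l ^ (0 + 2) := by gcongr; exact abs_le_jp l
      _ = ‖D.M k l‖ * jp l ^ 3 := by ring
      _ ≤ _ := jp_pow_le (by norm_num : 3 ≤ 7) (D.norm_M_le_left 7 le_rfl k) l
  · rw [coeff_a']

theorem hasSum_transp (v : C(Torus, ℝ)) (v' : L2) (k : ℤ) :
    HasSum (fun l => D.M k l • transp v v' l)
      (mulL (D.a k) v' + mulL (D.a' k) (cl (ofR v))) := by
  have h1 := (D.hasSum_a k).mapL (mulL.flip v')
  have h2 := (D.hasSum_a' k).mapL (mulL.flip (cl (ofR v)))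
  refine (h1.add h2).congr_fun fun l => ?_
  rw [map_smul, map_smul, ContinuousLinearMap.flip_apply, ContinuousLinearMap.flip_apply, transp,
    smul_add, smul_smul, mul_comm (D.M k l)]

theorem hasSum_opMul_opDx {v : C(Torus, ℝ)} {v' : L2} (hv : WD (cl (ofR v)) v') {V : Torus → ℝ}
    (hV : ∀ k, realCoeff V k = realCoeff v k) (u : L2) (k : ℤ) :
    HasSum (fun l => conj (D.M k l) * opMul V (opDx (coeff u)) l)
      (- inner ℂ (mulL (D.a k) v' + mulL (D.a' k) (cl (ofR v))) u) := by
  have h := (((D.hasSum_transp v v' k).mapL (innerSL ℂ u)).map (starRingEnd ℂ)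
    Complex.continuous_conj).neg
  rw [innerSL_apply_apply, inner_conj_symm] at h
  refine h.congr_fun fun l => ?_
  simp only [Function.comp_apply, innerSL_apply_apply, opMul_opDx hv hV]
  rw [inner_conj_symm, inner_smul_left]
  ring

theorem U_mulL_comp (k : ℤ) (f : L2) : D.U (mulL (fourier k) (D.comp f)) = mulL (D.a k) f := by
  rw [Diffeo.U_mulL, Diffeo.comp, LinearIsometryEquiv.apply_symm_apply, mulL_mulL]
  congr 2
  ext x
  rw [Diffeo.a_apply]
  simp [mul_comm]

theorem comp_cl (f : C(Torus, ℂ)) : D.comp (cl f) = cl (f.comp D.φ) := by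
  refine Lp.ext ?_
  have h1 : (fun x => (cl f : Torus → ℂ) (D.φ x)) =ᵐ[dx] fun x => f (D.φ x) :=
    D.wmapInv.quasiMeasurePreserving.ae_eq_comp (coeFn_cl f)
  filter_upwards [D.coeFn_comp (cl f), coeFn_cl (f.comp D.φ), h1] with x e1 e2 e3
  rw [e1, e2, e3]; rfl

end SDiffeo

/-! ### Changes of variables depending on time -/

/-- A curve of changes of variables, with its time derivative on `[0, T]`. -/
structure Flow (T : ℝ) where
  /-- the changes of variables -/
  D : ℝ → SDiffeo
  /-- the time derivative of the derivative of the change of variables -/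
  e : ℝ → C(Torus, ℝ)
  /-- the time derivative of the displacement -/
  z : ℝ → C(Torus, ℝ)
  continuous_d : Continuous fun p : ℝ × Torus => (D p.1).d p.2
  continuous_β : Continuous fun p : ℝ × Torus => (D p.1).β p.2
  continuous_e : Continuous fun p : ℝ × Torus => e p.1 p.2
  continuous_z : Continuous fun p : ℝ × Torus => z p.1 p.2
  hasDeriv_d : ∀ t ∈ Icc 0 T, ∀ x, HasDerivWithinAt (fun s => (D s).d x) (e t x) (Icc 0 T) t
  hasDeriv_β : ∀ t ∈ Icc 0 T, ∀ x, HasDerivWithinAt (fun s => (D s).β x) (z t x) (Icc 0 T) t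
  hasTDeriv_z : ∀ t, HasTDeriv (z t) (e t)

/-- Joint continuity and continuity of curves in the space of continuous functions. -/
theorem continuous_curve {E : Type*} [TopologicalSpace E] {F : ℝ → C(Torus, E)}
    (h : Continuous fun p : ℝ × Torus => F p.1 p.2) : Continuous F :=
  ContinuousMap.continuous_of_continuous_uncurry F h

namespace Flow

variable {T : ℝ} (Q : Flow T)

theorem exists_bound {F : ℝ → C(Torus, ℝ)} (h : Continuous fun p : ℝ × Torus => F p.1 p.2) :
    ∃ B : ℝ, 0 ≤ B ∧ ∀ t ∈ Icc 0 T, ∀ x, |F t x| ≤ B := by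
  obtain ⟨B, hB⟩ := (isCompact_Icc.prod isCompact_univ).exists_bound_of_continuousOn
    (s := Icc 0 T ×ˢ (univ : Set Torus)) h.continuousOn
  exact ⟨max B 0, le_max_right _ _, fun t ht x => (hB (t, x) ⟨ht, mem_univ _⟩).trans (le_max_left _ _)⟩

/-- The time derivative of `a k`. -/
def aT (t : ℝ) (k : ℤ) : C(Torus, ℂ) :=
  (1 / 2 : ℂ) • (ofR (Q.e t * (Q.D t).dInv) * (Q.D t).a k) +
    (Complex.I * k) • (ofR (Q.z t) * (Q.D t).a k)

theorem hasDerivWithinAt_a (k : ℤ) {t : ℝ} (ht : t ∈ Icc 0 T) (x : Torus) :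
    HasDerivWithinAt (fun s => (Q.D s).a k x) (Q.aT t k x) (Icc 0 T) t := by
  have hsq : 0 < Real.sqrt ((Q.D t).d x) := Real.sqrt_pos.2 ((Q.D t).d_pos x)
  have hs := (Q.hasDeriv_d t ht x).sqrt ((Q.D t).d_pos x).ne'
  have h := hs.ofReal_comp.mul (SDiffeo.hasDerivWithinAt_fourier k x (Q.hasDeriv_β t ht x))
  have e : Q.aT t k x = ((Q.e t x / (2 * Real.sqrt ((Q.D t).d x)) : ℝ) : ℂ) *
      fourier k (x + ((Q.D t).β x : Torus)) + (Real.sqrt ((Q.D t).d x) : ℂ) *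
      (Q.z t x • (Complex.I * k * fourier k (x + ((Q.D t).β x : Torus)))) := by
    have hd : (Real.sqrt ((Q.D t).d x) : ℂ) ^ 2 = ((Q.D t).d x : ℂ) := by
      rw [← Complex.ofReal_pow, Real.sq_sqrt ((Q.D t).d_pos x).le]
    have hd0 : (Real.sqrt ((Q.D t).d x) : ℂ) ≠ 0 := by exact_mod_cast hsq.ne'
    simp only [aT, ContinuousMap.add_apply, ContinuousMap.smul_apply,
      ContinuousMap.mul_apply, ofR_apply, smul_eq_mul, Diffeo.dInv_apply, Diffeo.a_apply,
      Diffeo.sq_apply, Diffeo.G_apply, Complex.real_smul]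
    push_cast
    rw [← hd]
    field_simp
  rw [e]
  refine h.congr (fun t _ => ?_) ?_ <;>
    simp only [Diffeo.a_apply, Diffeo.sq_apply, Diffeo.G_apply, Pi.mul_apply]

theorem norm_aT_le {B : ℝ} (hB : 0 ≤ B) {t : ℝ} {x : Torus} (he : |Q.e t x| ≤ B) (hz : |Q.z t x| ≤ B) (k : ℤ) :
    ‖Q.aT t k x‖ ≤ 2 * B * jp k := by
  have h1 := (Q.D t).norm_a_le k x
  have h2 := (Q.D t).dInv_le x
  have h3 := (Q.D t).dInv_pos x
  simp only [aT, ContinuousMap.add_apply, ContinuousMap.smul_apply, ContinuousMap.mul_apply,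
    ofR_apply, smul_eq_mul]
  refine (norm_add_le _ _).trans ?_
  simp only [norm_mul, Complex.norm_real, Complex.norm_I, Complex.norm_intCast, one_mul,
    Real.norm_eq_abs, abs_of_pos h3]
  have h4 : ‖(1 / 2 : ℂ)‖ = 1 / 2 := by norm_num
  rw [h4, jp]
  calc _ ≤ 1 / 2 * (B * 2 * 2) + |(k : ℝ)| * (B * 2) := by gcongr
    _ = _ := by ring

theorem continuous_a (k : ℤ) : Continuous fun t => (Q.D t).a k := by
  refine continuous_curve ?_
  simp only [Diffeo.a_apply, Diffeo.sq_apply, Diffeo.G_apply]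
  have h1 : Continuous fun p : ℝ × Torus => (((Q.D p.1).β p.2 : ℝ) : Torus) :=
    (AddCircle.continuous_mk' _).comp Q.continuous_β
  have h2 := Q.continuous_d
  exact (Complex.continuous_ofReal.comp h2.sqrt).mul
    ((fourier k : C(Torus, ℂ)).continuous.comp (continuous_snd.add h1))

theorem continuous_M (k l : ℤ) : Continuous fun t => (Q.D t).M k l := by
  simp only [SDiffeo.M, ← coeff_cl, coeff_eq_inner]
  exact continuous_const.inner (cl.continuous.comp (Q.continuous_a k))

theorem continuous_pow (s : ℝ) : Continuous fun t => (Q.D t).pow s := by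
  refine continuous_curve ?_
  simp only [Diffeo.pow_apply]
  exact Q.continuous_d.rpow_const fun p => Or.inl ((Q.D p.1).d_pos p.2).ne'

theorem continuous_ofR {F : ℝ → C(Torus, ℝ)} (h : Continuous F) : Continuous fun t => ofR (F t) := by
  refine continuous_curve ?_
  simp only [ofR_apply]
  exact Complex.continuous_ofReal.comp
    (continuous_eval.comp ((h.comp continuous_fst).prodMk continuous_snd))

theorem continuous_coeff {f : ℝ → L2} (h : Continuous f) (k : ℤ) :
    Continuous fun t => coeff (f t) k := by
  simp only [coeff_eq_inner]
  exact continuous_const.inner h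

theorem continuous_pow_coeff (s : ℝ) (q : ℤ) :
    Continuous fun t => realCoeff ((Q.D t).pow s) q := by
  simp only [← fourierCoeff_ofR, ← coeff_cl]
  exact continuous_coeff (cl.continuous.comp (continuous_ofR (Q.continuous_pow s))) q

theorem continuous_U {f : ℝ → L2} (hf : Continuous f) : Continuous fun t => (Q.D t).U (f t) := by
  refine SDiffeo.continuous_of_eb (B := 1)
    (K := fun t => (Q.D t).U.toContinuousLinearEquiv.toContinuousLinearMap) (fun t => ?_)
    (fun n => ?_) hf
  · exact ContinuousLinearMap.opNorm_le_bound _ zero_le_one fun x => by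
      rw [one_mul]; exact ((Q.D t).U.norm_map x).le
  · have := cl.continuous.comp (Q.continuous_a n)
    refine this.congr fun t => ?_
    exact ((Q.D t).U_eb n).symm

theorem continuous_U_symm {f : ℝ → L2} (hf : Continuous f) :
    Continuous fun t => (Q.D t).U.symm (f t) :=
  SDiffeo.continuous_symm (fun _ => Q.continuous_U continuous_const) hf

/-- The curve of unitary operators of a curve of changes of variables. -/
def toUCurve : UCurve (Icc 0 T) where
  U t := (Q.D t).U
  a' t k := cl (Q.aT t k)
  C := 2 * max (Classical.choose (exists_bound (T := T) Q.continuous_e))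
    (Classical.choose (exists_bound (T := T) Q.continuous_z))
  R := (3 * SDiffeo.bd) ^ 6
  continuous := fun h => Q.continuous_U continuous_const
  hasDeriv := fun k t ht => by
    obtain ⟨he0, he⟩ := Classical.choose_spec (exists_bound (T := T) Q.continuous_e)
    obtain ⟨hz0, hz⟩ := Classical.choose_spec (exists_bound (T := T) Q.continuous_z)
    simp only [Diffeo.U_eb]
    refine hasDerivWithinAt_cl (B := 2 * max (Classical.choose (exists_bound (T := T)
      Q.continuous_e)) (Classical.choose (exists_bound (T := T) Q.continuous_z)) * jp k)
      (fun s hs x => ?_) fun x => Q.hasDerivWithinAt_a k ht x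
    exact lipschitz_of_deriv (convex_Icc 0 T) (fun s hs => Q.hasDerivWithinAt_a k hs x)
      (fun s hs => Q.norm_aT_le (le_max_of_le_left he0) ((he s hs x).trans (le_max_left _ _))
        ((hz s hs x).trans (le_max_right _ _)) k) ht hs
  norm_a' := fun t ht k => by
    obtain ⟨he0, he⟩ := Classical.choose_spec (exists_bound (T := T) Q.continuous_e)
    obtain ⟨hz0, hz⟩ := Classical.choose_spec (exists_bound (T := T) Q.continuous_z)
    have hj := jp_pos k
    have hm : 0 ≤ max (Classical.choose (exists_bound (T := T) Q.continuous_e))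
      (Classical.choose (exists_bound (T := T) Q.continuous_z)) := le_max_of_le_left he0
    refine (norm_cl_le _).trans ((ContinuousMap.norm_le _ (by positivity)).2 fun x => ?_)
    exact Q.norm_aT_le hm ((he t ht x).trans (le_max_left _ _))
        ((hz t ht x).trans (le_max_right _ _)) k
  decay_left := fun t k l => by
    rw [SDiffeo.coeff_U_eb]
    have hb := SDiffeo.one_le_bd
    have hj := jp_pos k
    refine ((Q.D t).norm_M_le_left 4 (by norm_num) k l).trans ?_
    refine mul_le_mul_of_nonneg_right ?_ (by positivity)
    calc (2 * SDiffeo.bd) ^ 4 ≤ (3 * SDiffeo.bd) ^ 4 := by gcongr; norm_num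
      _ ≤ _ := pow_le_pow_right₀ (by linarith) (by norm_num)
  decay_right := fun t k l => by
    rw [SDiffeo.coeff_U_eb]
    exact (Q.D t).norm_M_le_right 6 (by norm_num) k l

theorem toUCurve_M (t : ℝ) (k l : ℤ) : Q.toUCurve.M t k l = (Q.D t).M k l := by
  rw [UCurve.M]; exact congrFun ((Q.D t).coeff_U_eb k) l

/-! ### The transport field and the term of order zero -/

variable (v : C(Torus, ℝ)) (v' : L2) (t : ℝ)

/-- The transport field `V d + ∂_t β`, in the original variables. -/
def Z : C(Torus, ℝ) := v * (Q.D t).d + Q.z t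

/-- The weak derivative of the transport field. -/
def Z' : L2 := mulL (ofR (Q.D t).d) v' + cl (ofR (v * (Q.D t).d' + Q.e t))

/-- The term of order zero `(∂_t d / d + V d' / d) / 2`. -/
def ρ : C(Torus, ℝ) := (1 / 2 : ℝ) • ((Q.e t + v * (Q.D t).d') * (Q.D t).dInv)

variable {v v'}

theorem cl_ofR_add (f h : C(Torus, ℝ)) : cl (ofR (f + h)) = cl (ofR f) + cl (ofR h) := by
  rw [ofR_add, map_add]

theorem WD_Z (hv : WD (cl (ofR v)) v') : WD (cl (ofR (Q.Z v t))) (Q.Z' v v' t) := by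
  have hd : HasTDeriv (ofR (Q.D t).d) (ofR (Q.D t).d') := (Q.D t).hasTDeriv_d.ofReal
  have hz : HasTDeriv (ofR (Q.z t)) (ofR (Q.e t)) := (Q.hasTDeriv_z t).ofReal
  have h := (WD.mulL hd hv).add (WD.of_hasTDeriv hz)
  rw [Z, Z', cl_ofR_add, cl_ofR_add, mul_comm v, mul_comm v, ofR_mul, ofR_mul, ← mulL_cl, ← mulL_cl]
  convert h using 1
  abel

/-- The identity between the first order terms in the original and in the new variables. -/
theorem transport_identity (k : ℤ) :
    mulL ((Q.D t).a k) (mulL (ofR (Q.D t).dInv) (Q.Z' v v' t)) +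
      (Complex.I * k) • mulL ((Q.D t).a k) (cl (ofR (Q.Z v t))) -
      mulL (ofR (Q.ρ v t)) (cl ((Q.D t).a k)) =
    cl (Q.aT t k) + (mulL ((Q.D t).a k) v' + mulL ((Q.D t).a' k) (cl (ofR v))) := by
  have h1 : mulL (ofR (Q.D t).dInv) (mulL (ofR (Q.D t).d) v') = v' := by
    rw [mulL_mulL, ← ofR_mul]
    have : (Q.D t).dInv * (Q.D t).d = 1 := by
      ext x
      have := ((Q.D t).d_pos x).ne'
      simp [Diffeo.dInv_apply, this]
    rw [this]
    have : ofR 1 = 1 := by ext x; simp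
    rw [this, mulL_one]
  rw [Z', map_add, h1, map_add]
  have h2 : mulL ((Q.D t).a k) (mulL (ofR (Q.D t).dInv) (cl (ofR (v * (Q.D t).d' + Q.e t)))) +
      (Complex.I * k) • mulL ((Q.D t).a k) (cl (ofR (Q.Z v t))) -
      mulL (ofR (Q.ρ v t)) (cl ((Q.D t).a k)) =
      cl (Q.aT t k) + mulL ((Q.D t).a' k) (cl (ofR v)) := by
    simp only [mulL_cl, ← map_smul, ← map_add, ← map_sub]
    congr 1
    ext x
    have hx : ((Q.D t).d x : ℂ) ≠ 0 := by exact_mod_cast ((Q.D t).d_pos x).ne'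
    simp only [aT, SDiffeo.a', Z, ρ, ContinuousMap.add_apply, ContinuousMap.sub_apply,
      ContinuousMap.smul_apply, ContinuousMap.mul_apply, ofR_apply, smul_eq_mul, Diffeo.dInv_apply]
    push_cast
    field_simp
    ring
  rw [← sub_eq_zero] at h2 ⊢
  rw [← h2]
  abel

end Flow

/-! ### The equation in the new variables, in the original time -/

/-- The remainders of the conjugation of the principal part along a curve of changes of
variables. -/
theorem exists_conj_curve {g b : ℝ} (hg : 0 < g) (hb : 0 < b) : ∃ C : ℝ, 0 ≤ C ∧
    ∀ (T : ℝ) (Q : Flow T) (A : ℝ), 0 ≤ A →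
      (∀ t, wn 7 (realCoeff ((Q.D t).d - 1 : C(Torus, ℝ))) ≤ ENNReal.ofReal A) →
      ∃ K : ℝ → L2 →L[ℂ] L2, (∀ t, ‖K t‖ ≤ C * A) ∧
        (∀ f : ℝ → L2, Continuous f → Continuous fun t => K t (f t)) ∧
        ∀ t u k, coeff (K t u) k =
          inner ℂ ((Q.D t).qa hg hb k) ((Q.D t).U u) - symbolL g b k * coeff u k := by
  obtain ⟨C, hC, h⟩ := SDiffeo.exists_conj_operator hg hb
  refine ⟨C, hC, fun T Q A hA hQ => ?_⟩
  choose K hK1 hK2 hK3 using fun t => h (Q.D t) A hA (hQ t)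
  refine ⟨K, hK1, fun f hf => SDiffeo.continuous_of_eb hK1 (fun n => ?_) hf, hK3⟩
  simp only [hK2, SDiffeo.col]
  refine (Q.continuous_U_symm ?_).sub continuous_const
  exact SDiffeo.continuous_qa hg hb n (fun l => Q.continuous_M n l)
    (fun q => Q.continuous_pow_coeff _ q)

/-- A unitary operator as a bounded real linear operator. -/
def realOp (U : L2 ≃ₗᵢ[ℂ] L2) : L2 →L[ℝ] L2 :=
  U.toContinuousLinearEquiv.toContinuousLinearMap.restrictScalars ℝ

@[simp] theorem realOp_apply (U : L2 ≃ₗᵢ[ℂ] L2) (h : L2) : realOp U h = U h := rfl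

namespace Flow

variable {T : ℝ} (Q : Flow T)

/-- The remainder of order zero in the new variables. -/
def R3 (m : ℝ) (v : C(Torus, ℝ)) (R : L2 →L[ℝ] L2) (K : L2 →L[ℂ] L2) (t : ℝ) : L2 →L[ℝ] L2 :=
  m⁻¹ • ((realOp (Q.D t).U.symm).comp
    ((R + (mulL (ofR (Q.ρ v t))).restrictScalars ℝ).comp (realOp (Q.D t).U))) +
    (Complex.I • K).restrictScalars ℝ

theorem R3_apply (m : ℝ) (v : C(Torus, ℝ)) (R : L2 →L[ℝ] L2) (K : L2 →L[ℂ] L2) (t : ℝ) (h : L2) :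
    Q.R3 m v R K t h = m⁻¹ • (Q.D t).U.symm (R ((Q.D t).U h) +
      mulL (ofR (Q.ρ v t)) ((Q.D t).U h)) + Complex.I • K h := rfl

variable {g b : ℝ} {hg : 0 < g} {hb : 0 < b}

theorem hasSum_M_mul (t : ℝ) (k : ℤ) (f : L2) :
    HasSum (fun l => conj ((Q.D t).M k l) * coeff f l) (coeff ((Q.D t).U.symm f) k) := by
  rw [← Diffeo.inner_a_left]
  refine (hasSum_inner (cl ((Q.D t).a k)) f).congr_fun fun l => ?_
  rw [coeff_cl, SDiffeo.M]

/-- The evolution operators in the original variables, paired with the moving basis, give the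
evolution operators in the new variables. -/
theorem pairing_identity {t m : ℝ} (hm : 0 < m) {v : C(Torus, ℝ)} {v' : L2}
    (hv : WD (cl (ofR v)) v') {c V W : Torus → ℝ} (hV : ∀ k, realCoeff V k = realCoeff v k)
    (hc : ∀ k, realCoeff c k = m * realCoeff ((Q.D t).pow (-(3 / 2))) k)
    (hW : ∀ k, realCoeff W k = (m⁻¹ : ℝ) * realCoeff ((Q.Z v t).comp (Q.D t).φ) k)
    {K : L2 →L[ℂ] L2} (hK : ∀ u k, coeff (K u) k =
      inner ℂ ((Q.D t).qa hg hb k) ((Q.D t).U u) - symbolL g b k * coeff u k)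
    (R : L2 →L[ℝ] L2) (u f h₁ : L2) (hf : f = m • (Q.D t).U h₁) (k : ℤ) :
    (m : ℂ) * (coeff h₁ k - (opMul W (opDx (coeff ((Q.D t).U.symm u))) k +
        Complex.I * opL g b (coeff ((Q.D t).U.symm u)) k +
        coeff (Q.R3 m v R K t ((Q.D t).U.symm u)) k)) =
      inner ℂ (cl (Q.aT t k)) u + ∑' l, conj ((Q.D t).M k l) * (coeff f l -
        (opMul V (opDx (coeff u)) l +
          Complex.I * opLhalf g b (opMul c (opLhalf g b (coeff u))) l + coeff (R u) l)) := by
  have hm' : (m : ℂ) ≠ 0 := by exact_mod_cast hm.ne'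
  set h := (Q.D t).U.symm u with hh
  have hu : (Q.D t).U h = u := LinearIsometryEquiv.apply_symm_apply _ _
  -- the sums over the frequencies of the terms in the original variables
  have s1 := Q.hasSum_M_mul t k f
  have s2 := (Q.D t).hasSum_opMul_opDx hv hV u k
  have s3 : HasSum (fun l => conj ((Q.D t).M k l) * (Complex.I * opLhalf g b (opMul c
      (opLhalf g b (coeff u))) l)) (Complex.I * m * inner ℂ ((Q.D t).qa hg hb k) u) := by
    refine (((Q.D t).hasSum_inner_qa hg hb k u).mul_left (Complex.I * m)).congr_fun fun l => ?_
    rw [opLhalf, opMul_congr hc, opLhalf]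
    ring
  have s4 := Q.hasSum_M_mul t k (R u)
  have s := s1.sub ((s2.add s3).add s4)
  have e : ∑' l, conj ((Q.D t).M k l) * (coeff f l - (opMul V (opDx (coeff u)) l +
      Complex.I * opLhalf g b (opMul c (opLhalf g b (coeff u))) l + coeff (R u) l)) = _ :=
    (s.congr_fun fun l => by ring).tsum_eq
  rw [e]
  -- the terms in the new variables
  have hZ : WD (cl (ofR ((Q.Z v t).comp (Q.D t).φ)))
      ((Q.D t).comp (mulL (ofR (Q.D t).dInv) (Q.Z' v v' t))) := by
    have := (Q.D t).WD_comp (Q.WD_Z t hv)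
    rw [SDiffeo.comp_cl] at this
    exact this
  have hUt : (Q.D t).U (transp ((Q.Z v t).comp (Q.D t).φ)
      ((Q.D t).comp (mulL (ofR (Q.D t).dInv) (Q.Z' v v' t))) k) =
      mulL ((Q.D t).a k) (mulL (ofR (Q.D t).dInv) (Q.Z' v v' t)) +
      (Complex.I * k) • mulL ((Q.D t).a k) (cl (ofR (Q.Z v t))) := by
    rw [transp, map_add, map_smul, SDiffeo.U_mulL_comp]
    have : cl (ofR ((Q.Z v t).comp (Q.D t).φ)) = (Q.D t).comp (cl (ofR (Q.Z v t))) := by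
      rw [SDiffeo.comp_cl]; rfl
    rw [this, SDiffeo.U_mulL_comp]
  have hW' : opMul W (opDx (coeff h)) k = -((m : ℂ)⁻¹ *
      inner ℂ (mulL ((Q.D t).a k) (mulL (ofR (Q.D t).dInv) (Q.Z' v v' t)) +
      (Complex.I * k) • mulL ((Q.D t).a k) (cl (ofR (Q.Z v t)))) u) := by
    rw [opMul_congr hW, opMul_opDx hZ (fun k => rfl), ← hUt, Diffeo.inner_U_left, ← hh]
    push_cast
    ring
  have hρ : coeff ((Q.D t).U.symm (mulL (ofR (Q.ρ v t)) u)) k =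
      inner ℂ (mulL (ofR (Q.ρ v t)) (cl ((Q.D t).a k))) u := by
    rw [← Diffeo.inner_a_left, inner_mulL_left, star_ofR]
  have hf' : coeff ((Q.D t).U.symm f) k = m * coeff h₁ k := by
    rw [hf, RCLike.real_smul_eq_coe_smul (K := ℂ), map_smul, LinearIsometryEquiv.symm_apply_apply,
      coeff_smul]
    rfl
  have hid := congrArg (fun x => (inner ℂ x u : ℂ)) (Q.transport_identity (v := v) (v' := v') t k)
  simp only [inner_sub_left, inner_add_left (cl (Q.aT t k))] at hid
  rw [hW', opL, R3_apply, hu, coeff_add, coeff_real_smul, map_add, coeff_add, coeff_smul, hK, hu,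
    hρ, hf']
  push_cast
  field_simp
  linear_combination hid

/-- The right hand side loses at most two derivatives. -/
theorem norm_rhs_le {c V : Torus → ℝ} {v : C(Torus, ℝ)} {v' : L2} (hv : WD (cl (ofR v)) v')
    (hV : ∀ k, realCoeff V k = realCoeff v k) {A : ℝ} (hA : 0 ≤ A) (hg : 0 < g) (hb : 0 < b)
    (hc : wn 1 (realCoeff c) ≤ ENNReal.ofReal A) {u f x : L2} (hu : ‖u‖ ≤ A) (hf : ‖f‖ ≤ A)
    (hx : ‖x‖ ≤ A) (hv1 : ‖v'‖ + ‖cl (ofR v)‖ ≤ A) (l : ℤ) :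
    ‖coeff f l - (opMul V (opDx (coeff u)) l +
      Complex.I * opLhalf g b (opMul c (opLhalf g b (coeff u))) l + coeff x l)‖ ≤
      (2 * A + A * A + (g + 1) ^ 2 * A * A) * jp l ^ 2 := by
  have hj := one_le_jp l
  have hj2 : 1 ≤ jp l ^ 2 := one_le_pow₀ hj
  have h1 : ‖opMul V (opDx (coeff u)) l‖ ≤ A * A * jp l ^ 2 := by
    rw [opMul_opDx hv hV, norm_neg]
    calc _ ≤ ‖transp v v' l‖ * ‖u‖ := norm_inner_le_norm _ _
      _ ≤ (A * jp l ^ 2) * A := by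
        refine mul_le_mul ((norm_transp_le v v' l).trans ?_) hu (norm_nonneg _) (by positivity)
        exact mul_le_mul hv1 (le_self_pow₀ hj (by norm_num)) (by linarith) hA
      _ = _ := by ring
  have h2 := norm_principal_le hg hb hA hc u l
  have h3 : (g + 1) ^ 2 * A * ‖u‖ * jp l ^ 2 ≤ (g + 1) ^ 2 * A * A * jp l ^ 2 := by gcongr
  have h4 : A ≤ A * jp l ^ 2 := le_mul_of_one_le_right hA hj2
  have h5 := (norm_coeff_le f l).trans hf
  have h6 := (norm_coeff_le x l).trans hx
  refine (norm_sub_le _ _).trans ((add_le_add le_rfl (norm_add₃_le)).trans ?_)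
  rw [norm_mul, Complex.norm_I, one_mul]
  linarith

/-- The equation in the original variables is equivalent to the equation in the new variables,
still with the original time. -/
theorem equation_iff {c V W : ℝ → Torus → ℝ} {v : ℝ → C(Torus, ℝ)} {v' : ℝ → L2} {m : ℝ → ℝ}
    (hm : ∀ t ∈ Icc 0 T, 0 < m t)
    (hv : ∀ t, WD (cl (ofR (v t))) (v' t)) (hV : ∀ t ∈ Icc 0 T, ∀ k, realCoeff (V t) k = realCoeff (v t) k)
    (hc : ∀ t ∈ Icc 0 T, ∀ k, realCoeff (c t) k = m t * realCoeff ((Q.D t).pow (-(3 / 2))) k)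
    (hW : ∀ t ∈ Icc 0 T, ∀ k, realCoeff (W t) k =
      ((m t)⁻¹ : ℝ) * realCoeff ((Q.Z (v t) t).comp (Q.D t).φ) k)
    {K : ℝ → L2 →L[ℂ] L2} (hK : ∀ t u k, coeff (K t u) k =
      inner ℂ ((Q.D t).qa hg hb k) ((Q.D t).U u) - symbolL g b k * coeff u k)
    {R : ℝ → L2 →L[ℝ] L2} {u f h₁ : ℝ → L2} (hf : ∀ t ∈ Icc 0 T, f t = m t • (Q.D t).U (h₁ t))
    {A : ℝ} (hA : 0 ≤ A) (hcA : ∀ t ∈ Icc 0 T, wn 1 (realCoeff (c t)) ≤ ENNReal.ofReal A)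
    (huc : ContinuousOn u (Icc 0 T))
    (hu : ∀ t ∈ Icc 0 T, ‖u t‖ ≤ A) (hfA : ∀ t ∈ Icc 0 T, ‖f t‖ ≤ A)
    (hR : ∀ t ∈ Icc 0 T, ‖R t (u t)‖ ≤ A)
    (hvA : ∀ t ∈ Icc 0 T, ‖v' t‖ + ‖cl (ofR (v t))‖ ≤ A) :
    (∀ t ∈ Icc 0 T, ∀ l, HasDerivWithinAt (fun s => coeff (u s) l) (coeff (f t) l -
      (opMul (V t) (opDx (coeff (u t))) l +
        Complex.I * opLhalf g b (opMul (c t) (opLhalf g b (coeff (u t)))) l +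
        coeff (R t (u t)) l)) (Icc 0 T) t) ↔
    ∀ t ∈ Icc 0 T, ∀ k, HasDerivWithinAt (fun s => coeff ((Q.D s).U.symm (u s)) k)
      ((m t : ℂ) * (coeff (h₁ t) k - (opMul (W t) (opDx (coeff ((Q.D t).U.symm (u t)))) k +
        Complex.I * opL g b (coeff ((Q.D t).U.symm (u t))) k +
        coeff (Q.R3 (m t) (v t) (R t) (K t) t ((Q.D t).U.symm (u t))) k))) (Icc 0 T) t := by
  refine Q.toUCurve.hasDerivWithinAt_iff
    (F := fun t l => coeff (f t) l - (opMul (V t) (opDx (coeff (u t))) l +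
        Complex.I * opLhalf g b (opMul (c t) (opLhalf g b (coeff (u t)))) l +
        coeff (R t (u t)) l))
    (G := fun t k => (m t : ℂ) * (coeff (h₁ t) k -
      (opMul (W t) (opDx (coeff ((Q.D t).U.symm (u t)))) k +
        Complex.I * opL g b (coeff ((Q.D t).U.symm (u t))) k +
        coeff (Q.R3 (m t) (v t) (R t) (K t) t ((Q.D t).U.symm (u t))) k)))
    (convex_Icc 0 T) huc hu
    (fun t ht l => norm_rhs_le (hv t) (hV t ht) hA hg hb (hcA t ht) (hu t ht) (hfA t ht) (hR t ht)
      (hvA t ht) l) fun t ht k => ?_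
  simp only [toUCurve_M]
  exact Q.pairing_identity (hm t ht) (hv t) (hV t ht) (hc t ht) (hW t ht) (hK t) (R t) (u t) (f t)
    (h₁ t) (hf t ht) k

end Flow

section

/-! ### Curves in Sobolev spaces -/

/-- Time clamped to `[0, T]`. -/
def clampT (T t : ℝ) : ℝ := max 0 (min t T)

theorem clampT_mem {T : ℝ} (hT : 0 < T) (t : ℝ) : clampT T t ∈ Icc 0 T :=
  ⟨le_max_left _ _, max_le hT.le (min_le_right _ _)⟩

theorem clampT_of_mem {T t : ℝ} (h : t ∈ Icc 0 T) : clampT T t = t := by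
  rw [clampT, min_eq_left h.2, max_eq_right h.1]

theorem continuous_clampT (T : ℝ) : Continuous (clampT T) := by
  unfold clampT; fun_prop

theorem tendsto_clampT {T : ℝ} (hT : 0 < T) (t : ℝ) :
    Tendsto (clampT T) (𝓝 t) (𝓝[Icc 0 T] (clampT T t)) :=
  tendsto_nhdsWithin_iff.2
    ⟨(continuous_clampT T).tendsto t, Eventually.of_forall fun s => clampT_mem hT s⟩

theorem fourierCoeff_star (F : C(Torus, ℂ)) (k : ℤ) :
    fourierCoeff (star F : C(Torus, ℂ)) k = conj (fourierCoeff F (-k)) := by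
  simp only [fourierCoeff, ← integral_conj]
  congr 1; ext x
  simp only [ContinuousMap.star_apply, smul_eq_mul, map_mul, ← fourier_neg, RCLike.star_def, neg_neg]

/-- The real part of a continuous function. -/
def reC (F : C(Torus, ℂ)) : C(Torus, ℝ) := ⟨fun x => (F x).re, by fun_prop⟩

theorem ofR_reC {F : C(Torus, ℂ)} (h : ∀ k, fourierCoeff F (-k) = conj (fourierCoeff F k)) :
    ofR (reC F) = F := by
  have hreal : star F = F := continuousMap_ext_coeff fun k => by
    rw [fourierCoeff_star, h, Complex.conj_conj]
  ext x
  exact Complex.conj_eq_iff_re.1 (DFunLike.congr_fun hreal x)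

theorem continuous_reC {G : ℝ → C(Torus, ℂ)} (h : Continuous G) : Continuous fun t => reC (G t) := by
  refine continuous_curve ?_
  exact Complex.continuous_re.comp
    (continuous_eval.comp ((h.comp continuous_fst).prodMk continuous_snd))

theorem continuous_uncurry {E : Type*} [TopologicalSpace E] {F : ℝ → C(Torus, E)}
    (h : Continuous F) : Continuous fun p : ℝ × Torus => F p.1 p.2 :=
  continuous_eval.comp ((h.comp continuous_fst).prodMk continuous_snd)

variable {T : ℝ} {f : ℝ → Torus → ℝ}

theorem tendsto_of_sobolev {s : ℝ} (hT : 0 < T) (hf : ContH T s f) {E : Type*}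
    [NormedAddCommGroup E] {u : ℝ → E} {C : ℝ≥0∞} (hC : C ≠ ⊤)
    (h : ∀ t τ, ‖u τ - u t‖ₑ ≤
      C * sobolevNorm s (fun x => f (clampT T τ) x - f (clampT T t) x)) : Continuous u := by
  refine continuous_iff_continuousAt.2 fun t => ?_
  rw [ContinuousAt, tendsto_iff_edist_tendsto_0]
  have h1 := (hf.2 _ (clampT_mem hT t)).comp (tendsto_clampT hT t)
  have h2 := ENNReal.Tendsto.const_mul (a := C) h1 (Or.inr hC)
  rw [mul_zero] at h2
  refine tendsto_of_tendsto_of_tendsto_of_le_of_le tendsto_const_nhds h2 (fun _ => zero_le)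
    fun τ => ?_
  rw [edist_eq_enorm_sub]
  exact h t τ

/-- A curve in `H¹`, as a curve of continuous functions with weak derivatives in `L²`. -/
theorem exists_curve_one (hT : 0 < T) (hf : ContH T 1 f) :
    ∃ (F : ℝ → C(Torus, ℝ)) (F' : ℝ → L2), Continuous F ∧ Continuous F' ∧
      (∀ t, WD (cl (ofR (F t))) (F' t)) ∧
      (∀ t k, realCoeff (F t) k = realCoeff (f (clampT T t)) k) ∧
      (∀ t ∈ Icc 0 T, f t =ᵐ[dx] F t) := by
  choose u u' hu hw using fun t => exists_WD_one (hf.1 _ (clampT_mem hT t)).2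
  have hsub : ∀ t τ k, coeff (u τ - u t) k =
      realCoeff (fun x => f (clampT T τ) x - f (clampT T t) x) k := fun t τ k => by
    rw [coeff_sub, hu, hu, realCoeff_sub_of_memLp (hf.1 _ (clampT_mem hT τ)).1
      (hf.1 _ (clampT_mem hT t)).1]
  have cu : Continuous u := tendsto_of_sobolev hT hf ENNReal.one_ne_top fun t τ => by
    rw [one_mul, ← ofReal_norm]
    exact (le_sobolevNorm_one (hsub t τ) ((hw τ).sub (hw t))).1
  have cu' : Continuous u' := tendsto_of_sobolev hT hf ENNReal.one_ne_top fun t τ => by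
    rw [one_mul, ← ofReal_norm]
    exact (le_sobolevNorm_one (hsub t τ) ((hw τ).sub (hw t))).2
  let G : ℝ → C(Torus, ℂ) := fun t => coeff (u t) 0 • 1 + antideriv (u' t)
  have hG : ∀ t, u t = cl (G t) := fun t => (hw t).eq_cl
  have cG : Continuous G :=
    ((Flow.continuous_coeff cu 0).smul continuous_const).add (antideriv.continuous.comp cu')
  have hR : ∀ t, ofR (reC (G t)) = G t := fun t => ofR_reC fun k => by
    rw [← coeff_cl, ← coeff_cl, ← hG, hu, hu, realCoeff_neg]
  have hk : ∀ t k, realCoeff (reC (G t)) k = realCoeff (f (clampT T t)) k := fun t k => by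
    rw [← fourierCoeff_ofR, hR, ← coeff_cl, ← hG, hu]
  refine ⟨fun t => reC (G t), u', continuous_reC cG, cu', fun t => ?_, hk, fun t ht => ?_⟩
  · rw [hR, ← hG]; exact hw t
  · have := hk t
    rw [clampT_of_mem ht] at this
    exact ae_eq_of_realCoeff (hf.1 t ht).1 fun k => (this k).symm

theorem exists_curve_two (hT : 0 < T) (hf : ContH T 2 f) {F : ℝ → C(Torus, ℝ)} {F' : ℝ → L2}
    (hF : ∀ t, WD (cl (ofR (F t))) (F' t))
    (hk : ∀ t k, realCoeff (F t) k = realCoeff (f (clampT T t)) k) :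
    ∃ F'' : ℝ → L2, Continuous F'' ∧ ∀ t, WD (F' t) (F'' t) := by
  have hu : ∀ t k, coeff (cl (ofR (F t))) k = realCoeff (f (clampT T t)) k := fun t k => by
    rw [coeff_cl, fourierCoeff_ofR, hk]
  choose u'' hw using fun t => exists_WD_two (hf.1 _ (clampT_mem hT t)).2 (hu t) (hF t)
  refine ⟨u'', tendsto_of_sobolev hT hf ENNReal.one_ne_top fun t τ => ?_, hw⟩
  rw [one_mul, ← ofReal_norm]
  refine le_sobolevNorm_two (u := cl (ofR (F τ)) - cl (ofR (F t))) (fun k => ?_)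
    ((hF τ).sub (hF t)) ((hw τ).sub (hw t))
  rw [coeff_sub, hu, hu, realCoeff_sub_of_memLp (hf.1 _ (clampT_mem hT τ)).1
    (hf.1 _ (clampT_mem hT t)).1]

theorem realCoeff_sub (f h : C(Torus, ℝ)) (k : ℤ) :
    realCoeff (f - h : C(Torus, ℝ)) k = realCoeff f k - realCoeff h k := by
  have : ofR (f - h) = ofR f - ofR h := by ext x; simp
  rw [← fourierCoeff_ofR, this, ← coeff_cl, map_sub, coeff_sub, coeff_cl, coeff_cl,
    fourierCoeff_ofR, fourierCoeff_ofR]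

/-- The derivatives of a curve which is continuous in a weighted Wiener space. -/
theorem exists_curve_deriv (N : ℕ) {G : ℝ → C(Torus, ℝ)}
    (hG : ∀ t, wn (N + 1) (realCoeff (G t)) ≠ ⊤)
    (hc : ∀ t, Tendsto (fun s => wn (N + 1) (realCoeff (G s - G t : C(Torus, ℝ)))) (𝓝 t) (𝓝 0)) :
    ∃ G' : ℝ → C(Torus, ℝ), (∀ t, HasTDeriv (G t) (G' t)) ∧
      (∀ t, wn N (realCoeff (G' t)) ≠ ⊤) ∧
      (∀ t, Tendsto (fun s => wn N (realCoeff (G' s - G' t : C(Torus, ℝ)))) (𝓝 t) (𝓝 0)) ∧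
      Continuous G' := by
  choose G' hG' using fun t => exists_hasTDeriv_real
    (((wn_mono (Nat.le_add_left 1 N) _).trans_lt (hG t).lt_top).ne)
  have hd : ∀ s t, HasTDeriv (G s - G t : C(Torus, ℝ)) (G' s - G' t : C(Torus, ℝ)) :=
    fun s t x => (hG' s x).sub (hG' t x)
  have ht : ∀ t, Tendsto (fun s => wn N (realCoeff (G' s - G' t : C(Torus, ℝ)))) (𝓝 t) (𝓝 0) :=
    fun t => tendsto_of_tendsto_of_tendsto_of_le_of_le tendsto_const_nhds (hc t)
      (fun _ => zero_le) fun s => wn_deriv_le N (hd s t)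
  refine ⟨G', hG', fun t => ((wn_deriv_le N (hG' t)).trans_lt (hG t).lt_top).ne, ht, ?_⟩
  refine continuous_iff_continuousAt.2 fun t => ?_
  rw [ContinuousAt, tendsto_iff_edist_tendsto_0]
  refine tendsto_of_tendsto_of_tendsto_of_le_of_le tendsto_const_nhds (ht t)
    (fun _ => zero_le) fun s => ?_
  rw [edist_eq_enorm_sub]
  rcases eq_or_ne (wn N (realCoeff (G' s - G' t : C(Torus, ℝ)))) ⊤ with h | h
  · show _ ≤ wn N (realCoeff (G' s - G' t : C(Torus, ℝ)))
    rw [h]; exact le_top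
  · show _ ≤ wn N (realCoeff (G' s - G' t : C(Torus, ℝ)))
    rw [← ENNReal.ofReal_toReal h, ← ofReal_norm]
    refine ENNReal.ofReal_le_ofReal ((ContinuousMap.norm_le _ ENNReal.toReal_nonneg).2 fun x => ?_)
    have := norm_le_of_wn (f := ofR (G' s - G' t)) (N := N) ENNReal.toReal_nonneg
      (by rw [ENNReal.ofReal_toReal h]; exact le_rfl) x
    rwa [ofR_apply, Complex.norm_real] at this

/-- The classical derivatives of a curve in `H³`. -/
theorem exists_curve_deriv_two (hT : 0 < T) (hf : ContH T 3 f) {F : ℝ → C(Torus, ℝ)}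
    (hk : ∀ t k, realCoeff (F t) k = realCoeff (f (clampT T t)) k) :
    ∃ F₁ F₂ : ℝ → C(Torus, ℝ), (∀ t, HasTDeriv (F t) (F₁ t)) ∧ (∀ t, HasTDeriv (F₁ t) (F₂ t)) ∧
      Continuous F₁ ∧ Continuous F₂ := by
  have h3 : ((2 + 1 : ℕ) : ℝ) ≤ 3 := by norm_num
  have hF : ∀ t, wn 2 (realCoeff (F t)) ≠ ⊤ := fun t => by
    have := wn_le_sobolevNorm 2 h3 (hf.1 _ (clampT_mem hT t)).2
    rw [show realCoeff (F t) = realCoeff (f (clampT T t)) from funext (hk t)]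
    exact (this.trans_lt (ENNReal.mul_lt_top ENNReal.ofReal_lt_top
      (hf.1 _ (clampT_mem hT t)).2)).ne
  have hc : ∀ t, Tendsto (fun s => wn 2 (realCoeff (F s - F t : C(Torus, ℝ)))) (𝓝 t) (𝓝 0) := by
    intro t
    have h1 := (hf.2 _ (clampT_mem hT t)).comp (tendsto_clampT hT t)
    have h2 := ENNReal.Tendsto.const_mul (a := ENNReal.ofReal (wienerC 2)) h1
      (Or.inr ENNReal.ofReal_ne_top)
    rw [mul_zero] at h2
    refine tendsto_of_tendsto_of_tendsto_of_le_of_le' tendsto_const_nhds h2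
      (Eventually.of_forall fun _ => zero_le) ?_
    filter_upwards [h1.eventually (gt_mem_nhds ENNReal.zero_lt_top)] with s hs
    have e : realCoeff (F s - F t : C(Torus, ℝ)) =
        realCoeff (fun x => f (clampT T s) x - f (clampT T t) x) := by
      ext k
      rw [realCoeff_sub, hk, hk, realCoeff_sub_of_memLp (hf.1 _ (clampT_mem hT s)).1
        (hf.1 _ (clampT_mem hT t)).1]
    rw [e]
    exact wn_le_sobolevNorm 2 h3 hs
  obtain ⟨F₁, h1, w1, t1, c1⟩ := exists_curve_deriv 1 hF hc
  obtain ⟨F₂, h2, -, -, c2⟩ := exists_curve_deriv 0 w1 t1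
  exact ⟨F₁, F₂, h1, h2, c1, c2⟩

/-- A curve whose Fourier coefficients have the derivatives of a continuous curve is
differentiable. -/
theorem hasDerivWithinAt_of_coeff {T : ℝ} {F G : ℝ → C(Torus, ℂ)} (hG : Continuous G)
    (h : ∀ t ∈ Icc 0 T, ∀ k, HasDerivWithinAt (fun s => fourierCoeff (F s) k)
      (fourierCoeff (G t) k) (Icc 0 T) t) {t : ℝ} (ht : t ∈ Icc 0 T) :
    HasDerivWithinAt F (G t) (Icc 0 T) t := by
  have h0 : (0 : ℝ) ∈ Icc 0 T := ⟨le_rfl, ht.1.trans ht.2⟩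
  let P : ℝ → C(Torus, ℂ) := fun s => F 0 + ∫ r in (0 : ℝ)..s, G r
  have hP : ∀ s, HasDerivAt P (G s) s := fun s =>
    (intervalIntegral.integral_hasDerivAt_right (hG.intervalIntegrable _ _)
      hG.stronglyMeasurable.stronglyMeasurableAtFilter hG.continuousAt).const_add (F 0)
  let Λ : ℤ → C(Torus, ℂ) →L[ℝ] ℂ := fun k =>
    ((innerSL ℂ (eb k)).comp cl).restrictScalars ℝ
  have hΛ : ∀ k f, Λ k f = fourierCoeff f k := fun k f => by
    rw [← coeff_cl, coeff_eq_inner]; rfl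
  have hFP : ∀ s ∈ Icc 0 T, F s = P s := by
    intro s hs
    refine continuousMap_ext_coeff fun k => ?_
    have hd : ∀ r ∈ Icc 0 T, HasDerivWithinAt
        (fun r => fourierCoeff (F r) k - fourierCoeff (P r) k) 0 (Icc 0 T) r := by
      intro r hr
      have h1 := ((Λ k).hasFDerivAt.comp_hasDerivAt r (hP r)).hasDerivWithinAt (s := Icc 0 T)
      have h2 : HasDerivWithinAt (fun r => fourierCoeff (P r) k) (fourierCoeff (G r) k)
          (Icc 0 T) r := by
        simp only [← hΛ]; exact h1
      exact ((h r hr k).sub h2).congr_deriv (sub_self _)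
    have h3 := lipschitz_of_deriv (convex_Icc 0 T) (B := 0) hd (fun r _ => by simp) h0 hs
    have h4 : P 0 = F 0 := by simp [P]
    rw [h4, sub_self, sub_zero, zero_mul] at h3
    exact sub_eq_zero.1 (norm_le_zero_iff.1 h3)
  exact (hP t).hasDerivWithinAt.congr hFP (hFP t ht)

theorem hasDerivWithinAt_of_realCoeff {T : ℝ} {F G : ℝ → C(Torus, ℝ)} (hG : Continuous G)
    (h : ∀ t ∈ Icc 0 T, ∀ k, HasDerivWithinAt (fun s => realCoeff (F s) k)
      (realCoeff (G t) k) (Icc 0 T) t) {t : ℝ} (ht : t ∈ Icc 0 T) (x : Torus) :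
    HasDerivWithinAt (fun s => F s x) (G t x) (Icc 0 T) t := by
  have h1 := hasDerivWithinAt_of_coeff (F := fun t => ofR (F t)) (G := fun t => ofR (G t))
    (Flow.continuous_ofR hG) h ht
  let Λ : C(Torus, ℂ) →L[ℝ] ℝ :=
    Complex.reCLM.comp ((ContinuousMap.evalCLM ℂ x).restrictScalars ℝ)
  exact Λ.hasFDerivAt.comp_hasDerivWithinAt t h1

end

section

/-! ### Means and time derivatives -/

/-- The mean of a function on the torus. -/
def mean (f : C(Torus, ℝ)) : ℝ := ∫ x, f x ∂dx

theorem realCoeff_zero_eq (f : Torus → ℝ) : realCoeff f 0 = ((∫ x, f x ∂dx : ℝ) : ℂ) := by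
  rw [realCoeff, fourierCoeff, ← integral_complex_ofReal]
  simp

theorem ofReal_mean (f : C(Torus, ℝ)) : (mean f : ℂ) = coeff (cl (ofR f)) 0 := by
  rw [coeff_cl, fourierCoeff_ofR, realCoeff_zero_eq]; rfl

theorem integrable_continuous (f : C(Torus, ℝ)) : Integrable f dx :=
  f.continuous.integrable_of_hasCompactSupport (HasCompactSupport.of_compactSpace _)

theorem mean_add (f h : C(Torus, ℝ)) : mean (f + h) = mean f + mean h :=
  integral_add (integrable_continuous f) (integrable_continuous h)

theorem mean_smul (r : ℝ) (f : C(Torus, ℝ)) : mean (r • f) = r * mean f :=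
  integral_const_mul r _

theorem mean_const (r : ℝ) : mean (ContinuousMap.const _ r) = r := by
  simp [mean]

theorem abs_mean_le {f : C(Torus, ℝ)} {B : ℝ} (h : ∀ x, |f x| ≤ B) : |mean f| ≤ B := by
  have := norm_integral_le_of_norm_le_const (μ := dx) (f := f) (Eventually.of_forall h)
  simpa [mean] using this

theorem continuous_mean {F : ℝ → C(Torus, ℝ)} (h : Continuous F) :
    Continuous fun t => mean (F t) := by
  have h1 := Complex.continuous_re.comp
    (Flow.continuous_coeff (cl.continuous.comp (Flow.continuous_ofR h)) 0)
  refine h1.congr fun t => ?_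
  simp only [Function.comp_apply, ← ofReal_mean, Complex.ofReal_re]

variable {T : ℝ} {F F' : ℝ → C(Torus, ℝ)}

theorem hasDerivWithinAt_cl_ofR (hF' : Continuous F')
    (h : ∀ t ∈ Icc 0 T, ∀ x, HasDerivWithinAt (fun s => F s x) (F' t x) (Icc 0 T) t) {t : ℝ}
    (ht : t ∈ Icc 0 T) :
    HasDerivWithinAt (fun s => cl (ofR (F s))) (cl (ofR (F' t))) (Icc 0 T) t := by
  obtain ⟨B, -, hB⟩ := Flow.exists_bound (T := T) (continuous_uncurry hF')
  have h' : ∀ t ∈ Icc 0 T, ∀ x,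
      HasDerivWithinAt (fun s => ofR (F s) x) (ofR (F' t) x) (Icc 0 T) t :=
    fun t ht x => (h t ht x).ofReal_comp
  refine hasDerivWithinAt_cl (B := B) (fun s hs x => ?_) fun x => h' t ht x
  refine lipschitz_of_deriv (convex_Icc 0 T) (fun r hr => h' r hr x) (fun r hr => ?_) ht hs
  rw [ofR_apply, Complex.norm_real]
  exact hB r hr x

theorem hasDerivWithinAt_mean (hF' : Continuous F')
    (h : ∀ t ∈ Icc 0 T, ∀ x, HasDerivWithinAt (fun s => F s x) (F' t x) (Icc 0 T) t) {t : ℝ}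
    (ht : t ∈ Icc 0 T) :
    HasDerivWithinAt (fun s => mean (F s)) (mean (F' t)) (Icc 0 T) t := by
  have h1 := (hasDerivWithinAt_cl_ofR hF' h ht).inner_const 0
  simp only [← ofReal_mean] at h1
  exact Complex.reCLM.hasFDerivAt.comp_hasDerivWithinAt t h1

/-- The embedding of `H¹` into the continuous functions. -/
theorem norm_le_of_WD {f : C(Torus, ℂ)} {f' : L2} (h : WD (cl f) f') :
    ‖f‖ ≤ (1 + 2 * embC) * (‖cl f‖ + ‖f'‖) := by
  have h1 := cl_injective h.eq_cl
  have h2 : ‖coeff (cl f) 0 • (1 : C(Torus, ℂ))‖ ≤ ‖cl f‖ := by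
    rw [norm_smul, norm_one, mul_one]
    exact norm_coeff_le _ _
  have h3 := norm_antideriv_le f'
  have h4 : ‖f‖ ≤ ‖coeff (cl f) 0 • (1 : C(Torus, ℂ))‖ + ‖antideriv f'‖ := by
    conv_lhs => rw [h1]
    exact norm_add_le _ _
  nlinarith [embC_nonneg, norm_nonneg (cl f), norm_nonneg f', mul_nonneg embC_nonneg
    (norm_nonneg (cl f))]

theorem norm_ofR_apply_le (f : C(Torus, ℝ)) (x : Torus) : |f x| ≤ ‖ofR f‖ := by
  have := (ofR f).norm_coe_le_norm x
  rwa [ofR_apply, Complex.norm_real] at this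

theorem norm_ofR_le {f : C(Torus, ℝ)} {B : ℝ} (h : ∀ x, |f x| ≤ B) : ‖ofR f‖ ≤ B := by
  refine (ContinuousMap.norm_le _ ((abs_nonneg _).trans (h 0))).2 fun x => ?_
  rw [ofR_apply, Complex.norm_real]; exact h x

theorem norm_cl_ofR_le {f : C(Torus, ℝ)} {B : ℝ} (h : ∀ x, |f x| ≤ B) : ‖cl (ofR f)‖ ≤ B :=
  (norm_cl_le _).trans (norm_ofR_le h)

/-! ### The coefficients of the equation -/

/-- The constant in the bound of the power `-2/3`. -/
def rpowC : ℝ := Classical.choose (wn_one_add_rpow (-(2 / 3)))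

theorem rpowC_pos : 0 < rpowC := (Classical.choose_spec (wn_one_add_rpow (-(2 / 3)))).1

/-- The size of `c - 1` for which the change of variables is defined. -/
def smallC : ℝ := (16 * (rpowC + 1))⁻¹

theorem smallC_pos : 0 < smallC := by
  have := rpowC_pos
  unfold smallC; positivity

theorem rpowC_mul_smallC_le : rpowC * smallC ≤ 1 / 16 := by
  have := rpowC_pos
  rw [smallC, ← div_eq_mul_inv, div_le_iff₀ (by positivity)]
  linarith

theorem smallC_le : smallC ≤ 1 / 16 := by
  have := rpowC_pos
  rw [smallC, inv_le_comm₀ (by positivity) (by norm_num)]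
  linarith

/-- The coefficients `c = 1 + γ` and `V = v` of the equation, as curves of continuous functions
defined for all times, with the derivatives that the change of variables involves. -/
structure Coefs (T : ℝ) where
  /-- the coefficient `c - 1` -/
  γ : ℝ → C(Torus, ℝ)
  /-- the derivative `∂ₓ c` -/
  γ₁ : ℝ → C(Torus, ℝ)
  /-- the second derivative `∂ₓ² c` -/
  γ₂ : ℝ → C(Torus, ℝ)
  /-- the time derivative `∂_t c` -/
  γt : ℝ → C(Torus, ℝ)
  /-- the derivative `∂ₓ ∂_t c` -/
  γt' : ℝ → L2
  /-- the transport coefficient -/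
  v : ℝ → C(Torus, ℝ)
  /-- the derivative `∂ₓ V` -/
  v' : ℝ → L2
  continuous_γ : Continuous γ
  continuous_γ₁ : Continuous γ₁
  continuous_γ₂ : Continuous γ₂
  continuous_γt : Continuous γt
  continuous_γt' : Continuous γt'
  continuous_v : Continuous v
  continuous_v' : Continuous v'
  hasTDeriv_γ : ∀ t, HasTDeriv (γ t) (γ₁ t)
  hasTDeriv_γ₁ : ∀ t, HasTDeriv (γ₁ t) (γ₂ t)
  WD_γt : ∀ t, WD (cl (ofR (γt t))) (γt' t)
  WD_v : ∀ t, WD (cl (ofR (v t))) (v' t)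
  hasDeriv_γ : ∀ t ∈ Icc 0 T, ∀ x, HasDerivWithinAt (fun s => γ s x) (γt t x) (Icc 0 T) t
  wn_le : ∀ t, wn 8 (realCoeff (γ t)) ≤ ENNReal.ofReal smallC

namespace Coefs

variable (Q : Coefs T) (t : ℝ)

theorem abs_γ_le (x : Torus) : |Q.γ t x| ≤ 1 / 16 := by
  have := norm_le_of_wn (f := ofR (Q.γ t)) (by norm_num)
    ((Q.wn_le t).trans (ENNReal.ofReal_le_ofReal smallC_le)) x
  rwa [ofR_apply, Complex.norm_real] at this

theorem abs_γ₁_le (x : Torus) : |Q.γ₁ t x| ≤ 1 / 16 := by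
  have := norm_le_of_wn (f := ofR (Q.γ₁ t)) (N := 7) (by norm_num)
    (((wn_deriv_le 7 (Q.hasTDeriv_γ t)).trans (Q.wn_le t)).trans
      (ENNReal.ofReal_le_ofReal smallC_le)) x
  rwa [ofR_apply, Complex.norm_real] at this

theorem one_add_γ_ge (x : Torus) : 1 / 2 ≤ 1 + Q.γ t x := by
  linarith [(abs_le.1 (Q.abs_γ_le t x)).1]

theorem one_add_γ_pos (x : Torus) : 0 < 1 + Q.γ t x := by linarith [Q.one_add_γ_ge t x]

/-- The power `c^s`. -/
def pw (s : ℝ) : C(Torus, ℝ) :=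
  ⟨fun x => (1 + Q.γ t x) ^ s, by
    have := (Q.γ t).continuous
    exact (continuous_const.add this).rpow_const fun x => Or.inl (Q.one_add_γ_pos t x).ne'⟩

theorem pw_apply (s : ℝ) (x : Torus) : Q.pw t s x = (1 + Q.γ t x) ^ s := rfl

theorem pw_pos (s : ℝ) (x : Torus) : 0 < Q.pw t s x := Real.rpow_pos_of_pos (Q.one_add_γ_pos t x) s

theorem pw_le {s : ℝ} {n : ℕ} (hs : -n ≤ s) (hs0 : s ≤ 0) (x : Torus) : Q.pw t s x ≤ 2 ^ n := by
  rw [pw_apply]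
  calc (1 + Q.γ t x) ^ s ≤ (1 / 2 : ℝ) ^ s :=
        Real.rpow_le_rpow_of_nonpos (by norm_num) (Q.one_add_γ_ge t x) hs0
    _ ≤ (1 / 2 : ℝ) ^ (-n : ℝ) := Real.rpow_le_rpow_of_exponent_ge (by norm_num) (by norm_num) hs
    _ = 2 ^ n := by rw [Real.rpow_neg (by norm_num), Real.rpow_natCast, one_div, inv_pow, inv_inv]

theorem continuous_pw (s : ℝ) : Continuous fun t => Q.pw t s := by
  refine continuous_curve ?_
  simp only [pw_apply]
  exact (continuous_const.add (continuous_uncurry Q.continuous_γ)).rpow_const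
    fun p => Or.inl (Q.one_add_γ_pos _ _).ne'

theorem hasTDeriv_pw (s : ℝ) : HasTDeriv (Q.pw t s) (s • (Q.pw t (s - 1) * Q.γ₁ t) : C(Torus, ℝ)) := by
  intro x
  have h := ((Q.hasTDeriv_γ t x).const_add 1).rpow_const (p := s)
    (Or.inl (by simpa using (Q.one_add_γ_pos t x).ne'))
  refine h.congr_deriv ?_
  simp [pw_apply]; ring

theorem hasDeriv_pw (s : ℝ) (ht : t ∈ Icc 0 T) (x : Torus) :
    HasDerivWithinAt (fun r => Q.pw r s x) ((s • (Q.pw t (s - 1) * Q.γt t) : C(Torus, ℝ)) x)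
      (Icc 0 T) t := by
  have h := ((Q.hasDeriv_γ t ht x).const_add 1).rpow_const (p := s)
    (Or.inl (Q.one_add_γ_pos t x).ne')
  refine h.congr_deriv ?_
  simp [pw_apply]; ring

/-- The mean of `c^{-2/3}`. -/
def σ : ℝ := mean (Q.pw t (-(2 / 3)))

theorem wn_pw_sub_one (N : ℕ) (hN : N ≤ 8) : wn N (realCoeff (Q.pw t (-(2 / 3)) - 1 : C(Torus, ℝ))) ≤
    ENNReal.ofReal rpowC * wn N (realCoeff (Q.γ t)) := by
  refine (Classical.choose_spec (wn_one_add_rpow (-(2 / 3)))).2 N (Q.γ t) _ ?_ fun x => rfl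
  exact ((wn_mono hN _).trans (Q.wn_le t)).trans
    (ENNReal.ofReal_le_ofReal (smallC_le.trans (by norm_num)))

theorem σ_sub_one : Q.σ t - 1 = mean (Q.pw t (-(2 / 3)) - 1) := by
  have : Q.pw t (-(2 / 3)) = (Q.pw t (-(2 / 3)) - 1) + ContinuousMap.const _ 1 := by ext x; simp
  rw [σ, this, mean_add, mean_const, ← this]; ring

theorem enorm_σ_sub_one_le (N : ℕ) : ‖Q.σ t - 1‖ₑ ≤
    wn N (realCoeff (Q.pw t (-(2 / 3)) - 1 : C(Torus, ℝ))) := by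
  rw [σ_sub_one]
  refine le_trans (le_of_eq ?_) (ENNReal.le_tsum 0)
  have h : realCoeff (Q.pw t (-(2 / 3)) - 1 : C(Torus, ℝ)) 0 =
    (mean (Q.pw t (-(2 / 3)) - 1) : ℂ) := realCoeff_zero_eq _
  rw [h, ← ofReal_norm (mean _ : ℂ), Complex.norm_real, ofReal_norm]
  simp [jp]

theorem wn_eight : wn 8 (realCoeff (Q.pw t (-(2 / 3)) - 1 : C(Torus, ℝ))) ≤
    ENNReal.ofReal (1 / 16) := by
  refine (Q.wn_pw_sub_one t 8 le_rfl).trans ?_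
  calc _ ≤ ENNReal.ofReal rpowC * ENNReal.ofReal smallC := by gcongr; exact Q.wn_le t
    _ = ENNReal.ofReal (rpowC * smallC) := (ENNReal.ofReal_mul rpowC_pos.le).symm
    _ ≤ _ := ENNReal.ofReal_le_ofReal rpowC_mul_smallC_le

theorem abs_σ_sub_one_le : |Q.σ t - 1| ≤ 1 / 16 := by
  have := (Q.enorm_σ_sub_one_le t 8).trans (Q.wn_eight t)
  rwa [← ofReal_norm, ENNReal.ofReal_le_ofReal_iff (by norm_num)] at this

theorem σ_ge : 1 / 2 ≤ Q.σ t := by linarith [(abs_le.1 (Q.abs_σ_sub_one_le t)).1]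

theorem σ_pos : 0 < Q.σ t := by linarith [Q.σ_ge t]

theorem inv_σ_le : (Q.σ t)⁻¹ ≤ 2 := by
  rw [inv_le_comm₀ (Q.σ_pos t) (by norm_num)]; linarith [Q.σ_ge t]

theorem continuous_σ : Continuous Q.σ := continuous_mean (Q.continuous_pw _)

theorem continuous_inv_σ : Continuous fun t => (Q.σ t)⁻¹ :=
  Q.continuous_σ.inv₀ fun t => (Q.σ_pos t).ne'

/-- The derivative `c^{-2/3} / ∫ c^{-2/3}` of the change of variables. -/
def d : C(Torus, ℝ) := (Q.σ t)⁻¹ • Q.pw t (-(2 / 3))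

theorem d_apply (x : Torus) : Q.d t x = (Q.σ t)⁻¹ * Q.pw t (-(2 / 3)) x := rfl

theorem mean_d : mean (Q.d t) = 1 := by
  rw [d, mean_smul]; exact inv_mul_cancel₀ (Q.σ_pos t).ne'

theorem wn_d_sub_one_le (N : ℕ) : wn N (realCoeff (Q.d t - 1 : C(Torus, ℝ))) ≤
    ENNReal.ofReal 4 * wn N (realCoeff (Q.pw t (-(2 / 3)) - 1 : C(Torus, ℝ))) := by
  have hσ := (Q.σ_pos t).ne'
  have h1 : realCoeff (Q.d t - 1 : C(Torus, ℝ)) = fun k => ((Q.σ t)⁻¹ : ℂ) *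
      (realCoeff (Q.pw t (-(2 / 3)) - 1 : C(Torus, ℝ)) k +
        (((1 - Q.σ t : ℝ) : ℂ) * fourierCoeff (1 : C(Torus, ℂ)) k)) := by
    ext k
    have h2 : ofR (Q.d t - 1) = ((Q.σ t)⁻¹ : ℂ) • (ofR (Q.pw t (-(2 / 3)) - 1) +
        ((1 - Q.σ t : ℝ) : ℂ) • 1) := by
      ext x
      have : (Q.σ t : ℂ) ≠ 0 := by exact_mod_cast hσ
      simp [d_apply]
      field_simp
      ring
    rw [← fourierCoeff_ofR, ← fourierCoeff_ofR, h2, ← coeff_cl, map_smul, coeff_smul, map_add,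
      coeff_add, map_smul, coeff_smul, coeff_cl, coeff_cl]
  rw [h1, wn_smul]
  have h3 : ‖((Q.σ t)⁻¹ : ℂ)‖ₑ ≤ ENNReal.ofReal 2 := by
    rw [← ofReal_norm, norm_inv, Complex.norm_real, Real.norm_of_nonneg (Q.σ_pos t).le]
    exact ENNReal.ofReal_le_ofReal (Q.inv_σ_le t)
  have h4 : ‖((1 - Q.σ t : ℝ) : ℂ)‖ₑ = ‖Q.σ t - 1‖ₑ := by
    rw [← ofReal_norm, Complex.norm_real, norm_sub_rev, ofReal_norm]
  calc _ ≤ ENNReal.ofReal 2 * (wn N (realCoeff (Q.pw t (-(2 / 3)) - 1 : C(Torus, ℝ))) +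
          wn N (realCoeff (Q.pw t (-(2 / 3)) - 1 : C(Torus, ℝ)))) := by
        refine mul_le_mul' h3 ((wn_add_le N _ _).trans (add_le_add le_rfl ?_))
        rw [wn_smul, wn_one, mul_one, h4]
        exact Q.enorm_σ_sub_one_le t N
    _ = _ := by
      rw [← two_mul, ← mul_assoc]
      congr 1
      rw [show (4 : ℝ) = 2 * 2 by norm_num, ENNReal.ofReal_mul (by norm_num)]
      norm_num

theorem wn_d_sub_one : wn 8 (realCoeff (Q.d t - 1 : C(Torus, ℝ))) ≤ ENNReal.ofReal (1 / 4) := by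
  refine (Q.wn_d_sub_one_le t 8).trans ?_
  calc _ ≤ ENNReal.ofReal 4 * ENNReal.ofReal (1 / 16) := by gcongr; exact Q.wn_eight t
    _ = _ := by rw [← ENNReal.ofReal_mul (by norm_num)]; norm_num

theorem abs_d_sub_one_le (x : Torus) : |Q.d t x - 1| ≤ 1 / 4 := by
  have := norm_le_of_wn (f := ofR (Q.d t - 1)) (by norm_num) (Q.wn_d_sub_one t) x
  rwa [ofR_apply, Complex.norm_real] at this

theorem continuous_d : Continuous fun t => Q.d t := Q.continuous_inv_σ.smul (Q.continuous_pw _)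

/-- The derivative of `d`. -/
def d₁ : C(Torus, ℝ) := (Q.σ t)⁻¹ • ((-(2 / 3) : ℝ) • (Q.pw t (-(2 / 3) - 1) * Q.γ₁ t))

theorem hasTDeriv_d : HasTDeriv (Q.d t) (Q.d₁ t) := fun x =>
  (Q.hasTDeriv_pw t _ x).const_mul _

/-- The second derivative of `d`. -/
def d₂ : C(Torus, ℝ) := (Q.σ t)⁻¹ • ((-(2 / 3) : ℝ) •
  (((-(2 / 3) - 1 : ℝ) • (Q.pw t (-(2 / 3) - 1 - 1) * Q.γ₁ t)) * Q.γ₁ t +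
    Q.pw t (-(2 / 3) - 1) * Q.γ₂ t))

theorem hasTDeriv_d₁ : HasTDeriv (Q.d₁ t) (Q.d₂ t) := fun x =>
  ((((Q.hasTDeriv_pw t _).mul (Q.hasTDeriv_γ₁ t)) x).const_mul _).const_mul _

theorem continuous_d₁ : Continuous fun t => Q.d₁ t := by
  have h0 := Q.continuous_inv_σ
  have h1 := Q.continuous_pw (-(2 / 3) - 1)
  have h2 := Q.continuous_γ₁
  unfold d₁
  fun_prop

theorem continuous_d₂ : Continuous fun t => Q.d₂ t := by
  have h0 := Q.continuous_inv_σ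
  have h1 := Q.continuous_pw (-(2 / 3) - 1 - 1)
  have h2 := Q.continuous_pw (-(2 / 3) - 1)
  have h3 := Q.continuous_γ₁
  have h4 := Q.continuous_γ₂
  unfold d₂
  fun_prop

/-- The time derivative of `c^{-2/3}`. -/
def κt : C(Torus, ℝ) := (-(2 / 3) : ℝ) • (Q.pw t (-(2 / 3) - 1) * Q.γt t)

theorem continuous_κt : Continuous fun t => Q.κt t := by
  have h1 := Q.continuous_pw (-(2 / 3) - 1)
  have h2 := Q.continuous_γt
  unfold κt
  fun_prop

theorem hasDeriv_σ (ht : t ∈ Icc 0 T) : HasDerivWithinAt Q.σ (mean (Q.κt t)) (Icc 0 T) t :=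
  hasDerivWithinAt_mean Q.continuous_κt (fun t ht x => Q.hasDeriv_pw t _ ht x) ht

/-- The time derivative of `d`. -/
def e : C(Torus, ℝ) := (Q.σ t)⁻¹ • (Q.κt t - mean (Q.κt t) • Q.d t)

theorem continuous_e : Continuous fun t => Q.e t :=
  Q.continuous_inv_σ.smul
    (Q.continuous_κt.sub ((continuous_mean Q.continuous_κt).smul Q.continuous_d))

theorem hasDeriv_d (ht : t ∈ Icc 0 T) (x : Torus) :
    HasDerivWithinAt (fun s => Q.d s x) (Q.e t x) (Icc 0 T) t := by
  have h := ((Q.hasDeriv_σ t ht).inv (Q.σ_pos t).ne').mul (Q.hasDeriv_pw t (-(2 / 3)) ht x)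
  refine h.congr_deriv ?_
  have := (Q.σ_pos t).ne'
  change _ = (Q.σ t)⁻¹ * (Q.κt t x - mean (Q.κt t) * ((Q.σ t)⁻¹ * Q.pw t (-(2 / 3)) x))
  change -mean (Q.κt t) / Q.σ t ^ 2 * Q.pw t (-(2 / 3)) x + (Q.σ t)⁻¹ * Q.κt t x = _
  field_simp
  ring

theorem mean_e : mean (Q.e t) = 0 := by
  have : Q.κt t - mean (Q.κt t) • Q.d t = Q.κt t + (-mean (Q.κt t)) • Q.d t := by
    rw [neg_smul, sub_eq_add_neg]
  rw [e, mean_smul, this, mean_add, mean_smul, mean_d]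
  ring

/-- The part of the derivative of `e` that does not involve the derivative of `∂_t c`. -/
def e₁ : C(Torus, ℝ) :=
  (-(2 / 3) : ℝ) • ((-(2 / 3) - 1 : ℝ) • (Q.pw t (-(2 / 3) - 1 - 1) * Q.γ₁ t)) * Q.γt t -
    mean (Q.κt t) • Q.d₁ t

/-- The derivative of `e`. -/
def e' : L2 := ((Q.σ t)⁻¹ : ℝ) • (mulL (ofR ((-(2 / 3) : ℝ) • Q.pw t (-(2 / 3) - 1))) (Q.γt' t) +
  cl (ofR (Q.e₁ t)))

theorem WD_e : WD (cl (ofR (Q.e t))) (Q.e' t) := by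
  have h1 : HasTDeriv (ofR ((-(2 / 3) : ℝ) • Q.pw t (-(2 / 3) - 1)))
      (ofR ((-(2 / 3) : ℝ) • ((-(2 / 3) - 1 : ℝ) • (Q.pw t (-(2 / 3) - 1 - 1) * Q.γ₁ t)))) := by
    have h : HasTDeriv ((-(2 / 3) : ℝ) • Q.pw t (-(2 / 3) - 1) : C(Torus, ℝ)) ((-(2 / 3) : ℝ) •
      ((-(2 / 3) - 1 : ℝ) • (Q.pw t (-(2 / 3) - 1 - 1) * Q.γ₁ t)) : C(Torus, ℝ)) := fun x =>
        (Q.hasTDeriv_pw t _ x).const_mul _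
    exact h.ofReal
  have h2 : HasTDeriv (ofR (mean (Q.κt t) • Q.d t)) (ofR (mean (Q.κt t) • Q.d₁ t)) := by
    have h : HasTDeriv (mean (Q.κt t) • Q.d t : C(Torus, ℝ)) (mean (Q.κt t) • Q.d₁ t : C(Torus, ℝ)) :=
      fun x => (Q.hasTDeriv_d t x).const_mul _
    exact h.ofReal
  have h3 := ((WD.mulL h1 (Q.WD_γt t)).sub (WD.of_hasTDeriv h2)).smul ((Q.σ t)⁻¹ : ℂ)
  have e1 : cl (ofR (Q.e t)) = ((Q.σ t)⁻¹ : ℂ) •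
      (mulL (ofR ((-(2 / 3) : ℝ) • Q.pw t (-(2 / 3) - 1))) (cl (ofR (Q.γt t))) -
        cl (ofR (mean (Q.κt t) • Q.d t))) := by
    rw [mulL_cl, ← map_sub, ← map_smul]
    congr 1
    ext x
    simp only [e, κt, ofR_apply, ContinuousMap.smul_apply, ContinuousMap.sub_apply,
      ContinuousMap.mul_apply, smul_eq_mul]
    push_cast
    ring
  have e2 : Q.e' t = ((Q.σ t)⁻¹ : ℂ) • (mulL (ofR ((-(2 / 3) : ℝ) •
      ((-(2 / 3) - 1 : ℝ) • (Q.pw t (-(2 / 3) - 1 - 1) * Q.γ₁ t)))) (cl (ofR (Q.γt t))) +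
      mulL (ofR ((-(2 / 3) : ℝ) • Q.pw t (-(2 / 3) - 1))) (Q.γt' t) -
        cl (ofR (mean (Q.κt t) • Q.d₁ t))) := by
    have : ∀ f h : C(Torus, ℝ), cl (ofR (f - h)) = cl (ofR f) - cl (ofR h) := fun f h => by
      rw [← map_sub]; congr 1; ext x; simp
    rw [e', RCLike.real_smul_eq_coe_smul (K := ℂ), e₁, mulL_cl, this, ← ofR_mul]
    simp only [RCLike.ofReal_inv, Complex.coe_algebraMap]
    congr 1
    abel
  rw [e1, e2]
  exact h3

theorem continuous_mulL {F : ℝ → C(Torus, ℝ)} {f : ℝ → L2} (hF : Continuous F) (hf : Continuous f) :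
    Continuous fun t => mulL (ofR (F t)) (f t) :=
  (mulL.continuous.comp (Flow.continuous_ofR hF)).clm_apply hf

theorem continuous_e₁ : Continuous fun t => Q.e₁ t := by
  have h1 := Q.continuous_pw (-(2 / 3) - 1 - 1)
  have h3 := Q.continuous_γ₁
  have hm := continuous_mean Q.continuous_κt
  have h4 := Q.continuous_γt
  have h5 := Q.continuous_d₁
  unfold e₁
  fun_prop

theorem continuous_e' : Continuous fun t => Q.e' t := by
  have h1 : Continuous fun t => (-(2 / 3) : ℝ) • Q.pw t (-(2 / 3) - 1) :=
    by have := Q.continuous_pw (-(2 / 3) - 1); fun_prop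
  have h2 := continuous_mulL h1 Q.continuous_γt'
  have h3 : Continuous fun t => cl (ofR (Q.e₁ t)) :=
    cl.continuous.comp (Flow.continuous_ofR Q.continuous_e₁)
  have h4 := Q.continuous_inv_σ
  unfold e'
  exact h4.smul (h2.add h3)

end Coefs

end

/-! ### The change of variables of the equation -/

/-- The primitive of zero mean of a function of zero mean. -/
def prim (f : C(Torus, ℝ)) : C(Torus, ℝ) := reC (antideriv (cl (ofR f)))

theorem hasTDeriv_prim {f : C(Torus, ℝ)} (h : wn 0 (realCoeff f) ≠ ⊤) (h0 : mean f = 0) :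
    HasTDeriv (prim f) f := by
  obtain ⟨β, hβ, hβ'⟩ := exists_antideriv_real h (by
    rw [realCoeff_zero_eq]; exact_mod_cast h0)
  have : prim f = β := by
    rw [prim, ← hβ']
    ext x; simp [reC]
  rwa [this]

theorem abs_prim_le (f : C(Torus, ℝ)) (x : Torus) : |prim f x| ≤ 2 * embC * ‖cl (ofR f)‖ :=
  (Complex.abs_re_le_norm _).trans
    (((antideriv (cl (ofR f))).norm_coe_le_norm x).trans (norm_antideriv_le _))

theorem continuous_prim {F : ℝ → C(Torus, ℝ)} (h : Continuous F) :
    Continuous fun t => prim (F t) :=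
  continuous_reC (antideriv.continuous.comp (cl.continuous.comp (Flow.continuous_ofR h)))

theorem hasDerivWithinAt_prim {T : ℝ} {F F' : ℝ → C(Torus, ℝ)} (hF' : Continuous F')
    (h : ∀ t ∈ Icc 0 T, ∀ x, HasDerivWithinAt (fun s => F s x) (F' t x) (Icc 0 T) t) {t : ℝ}
    (ht : t ∈ Icc 0 T) (x : Torus) :
    HasDerivWithinAt (fun s => prim (F s) x) (prim (F' t) x) (Icc 0 T) t := by
  let Λ : L2 →L[ℝ] ℝ := Complex.reCLM.comp
    (((ContinuousMap.evalCLM ℂ x).comp antideriv).restrictScalars ℝ)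
  exact Λ.hasFDerivAt.comp_hasDerivWithinAt t (hasDerivWithinAt_cl_ofR hF' h ht)

theorem wn_zero_ne_top_of_WD {f : C(Torus, ℝ)} {f' : L2} (h : WD (cl (ofR f)) f') :
    wn 0 (realCoeff f) ≠ ⊤ := by
  have h1 : sobolevNorm 1 f < ⊤ :=
    (sobolevNorm_one_le (fun k => by rw [coeff_cl, fourierCoeff_ofR]) h).trans_lt
      ENNReal.ofReal_lt_top
  exact ((wn_le_sobolevNorm 0 (by norm_num) h1).trans_lt
    (ENNReal.mul_lt_top ENNReal.ofReal_lt_top h1)).ne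

namespace Coefs

variable {T : ℝ} (Q : Coefs T) (t : ℝ)

/-- The velocity of the translation that makes the mean of the transport coefficient vanish. -/
def qt : ℝ := -mean (Q.d t * (Q.v t * Q.d t + prim (Q.e t)))

theorem continuous_qt : Continuous fun t => Q.qt t := by
  have h1 := Q.continuous_d
  have h2 := Q.continuous_v
  have h3 := continuous_prim Q.continuous_e
  have h4 : Continuous fun t => Q.d t * (Q.v t * Q.d t + prim (Q.e t)) := by fun_prop
  exact (continuous_mean h4).neg

/-- The translation that makes the mean of the transport coefficient vanish. -/
def q : ℝ := ∫ s in (0 : ℝ)..t, Q.qt s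

theorem hasDerivAt_q : HasDerivAt Q.q (Q.qt t) t :=
  intervalIntegral.integral_hasDerivAt_right (Q.continuous_qt.intervalIntegrable _ _)
    Q.continuous_qt.stronglyMeasurable.stronglyMeasurableAtFilter Q.continuous_qt.continuousAt

theorem continuous_q : Continuous Q.q :=
  continuous_iff_continuousAt.2 fun t => (Q.hasDerivAt_q t).continuousAt

/-- The displacement of the change of variables. -/
def β : C(Torus, ℝ) := prim (Q.d t - 1) + ContinuousMap.const _ (Q.q t)

theorem hasTDeriv_β : HasTDeriv (Q.β t) (fun x => Q.d t x - 1) := by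
  have h := hasTDeriv_prim (f := Q.d t - 1)
    (((wn_mono (Nat.zero_le 8) _).trans_lt ((Q.wn_d_sub_one t).trans_lt
      ENNReal.ofReal_lt_top)).ne) (by
        have : Q.d t = (Q.d t - 1) + ContinuousMap.const _ 1 := by ext x; simp
        have h1 := Q.mean_d t
        rw [this, mean_add, mean_const] at h1
        linarith)
  exact fun x => (h x).add_const _

/-- The time derivative of the displacement. -/
def z : C(Torus, ℝ) := prim (Q.e t) + ContinuousMap.const _ (Q.qt t)

theorem hasTDeriv_z : HasTDeriv (Q.z t) (Q.e t) := fun x =>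
  (hasTDeriv_prim (wn_zero_ne_top_of_WD (Q.WD_e t)) (Q.mean_e t) x).add_const _

theorem continuous_β : Continuous fun t => Q.β t := by
  have h1 : Continuous fun t => Q.d t - 1 := Q.continuous_d.sub continuous_const
  exact (continuous_prim h1).add
    (continuous_curve (Q.continuous_q.comp continuous_fst))

theorem continuous_z : Continuous fun t => Q.z t :=
  (continuous_prim Q.continuous_e).add (continuous_curve (Q.continuous_qt.comp continuous_fst))

theorem hasDeriv_β (ht : t ∈ Icc 0 T) (x : Torus) :
    HasDerivWithinAt (fun s => Q.β s x) (Q.z t x) (Icc 0 T) t :=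
  (hasDerivWithinAt_prim (F := fun s => Q.d s - 1) Q.continuous_e
    (fun t ht x => (Q.hasDeriv_d t ht x).sub_const 1) ht x).add (Q.hasDerivAt_q t).hasDerivWithinAt

/-- The change of variables that makes the coefficient of the principal part constant in `x`. -/
def toFlow : Flow T where
  D t := { β := Q.β t, d := Q.d t, hasTDeriv := Q.hasTDeriv_β t, abs_sub_le := Q.abs_d_sub_one_le t,
           d' := Q.d₁ t, hasTDeriv_d := Q.hasTDeriv_d t, wn_le := Q.wn_d_sub_one t }
  e t := Q.e t
  z t := Q.z t
  continuous_d := continuous_uncurry Q.continuous_d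
  continuous_β := continuous_uncurry Q.continuous_β
  continuous_e := continuous_uncurry Q.continuous_e
  continuous_z := continuous_uncurry Q.continuous_z
  hasDeriv_d := Q.hasDeriv_d
  hasDeriv_β := Q.hasDeriv_β
  hasTDeriv_z := Q.hasTDeriv_z

theorem toFlow_d : (Q.toFlow.D t).d = Q.d t := rfl

/-- The coefficient of the principal part in the new variables. -/
def m : ℝ := Q.σ t ^ (-(3 / 2) : ℝ)

theorem m_pos : 0 < Q.m t := Real.rpow_pos_of_pos (Q.σ_pos t) _

theorem continuous_m : Continuous Q.m :=
  Q.continuous_σ.rpow_const fun t => Or.inl (Q.σ_pos t).ne'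

theorem inv_m_le : (Q.m t)⁻¹ ≤ 2 := by
  have h := (abs_le.1 (Q.abs_σ_sub_one_le t)).2
  rw [m, Real.rpow_neg (Q.σ_pos t).le, inv_inv]
  calc Q.σ t ^ (3 / 2 : ℝ) ≤ (17 / 16 : ℝ) ^ (3 / 2 : ℝ) :=
        Real.rpow_le_rpow (Q.σ_pos t).le (by linarith) (by norm_num)
    _ ≤ (17 / 16 : ℝ) ^ (2 : ℝ) := Real.rpow_le_rpow_of_exponent_le (by norm_num) (by norm_num)
    _ ≤ 2 := by norm_num

/-- The choice of `d` makes the coefficient of the principal part constant: `c = m d^{-3/2}`. -/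
theorem one_add_γ_eq (x : Torus) :
    1 + Q.γ t x = Q.m t * (Q.toFlow.D t).pow (-(3 / 2)) x := by
  have h1 := Q.one_add_γ_pos t x
  have h2 := Q.σ_pos t
  rw [Diffeo.pow_apply, toFlow_d, d_apply, pw_apply, m,
    Real.mul_rpow (inv_nonneg.2 h2.le) (Real.rpow_nonneg h1.le _), ← Real.rpow_mul h1.le,
    Real.inv_rpow h2.le, ← mul_assoc, mul_inv_cancel₀ (Real.rpow_pos_of_pos h2 _).ne']
  norm_num

/-- The maps `r ↦ r^{-2/3}` and `r ↦ r^{-3/2}` are decreasing and inverse to each other, so the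
bounds of `c` pass to `m` without loss. -/
theorem abs_m_sub_one_le {δ : ℝ} (hδ : δ < 1) (h : ∀ x, |Q.γ t x| ≤ δ) : |Q.m t - 1| ≤ δ := by
  have hδ0 : 0 ≤ δ := (abs_nonneg _).trans (h 0)
  have hpow : ∀ r : ℝ, 0 < r → (r ^ (-(2 / 3) : ℝ)) ^ (-(3 / 2) : ℝ) = r := fun r hr => by
    rw [← Real.rpow_mul hr.le]; norm_num
  have hc : ∀ r : ℝ, mean (ContinuousMap.const _ r) = r := mean_const
  have h1 : (1 + δ) ^ (-(2 / 3) : ℝ) ≤ Q.σ t := by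
    rw [← hc ((1 + δ) ^ (-(2 / 3) : ℝ))]
    refine integral_mono (integrable_continuous _) (integrable_continuous _) fun x => ?_
    exact Real.rpow_le_rpow_of_nonpos (Q.one_add_γ_pos t x)
      (by linarith [(abs_le.1 (h x)).2]) (by norm_num)
  have h2 : Q.σ t ≤ (1 - δ) ^ (-(2 / 3) : ℝ) := by
    rw [← hc ((1 - δ) ^ (-(2 / 3) : ℝ))]
    refine integral_mono (integrable_continuous _) (integrable_continuous _) fun x => ?_
    exact Real.rpow_le_rpow_of_nonpos (by linarith)
      (by linarith [(abs_le.1 (h x)).1]) (by norm_num)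
  have h3 : Q.m t ≤ 1 + δ := by
    rw [← hpow (1 + δ) (by linarith)]
    exact Real.rpow_le_rpow_of_nonpos (Real.rpow_pos_of_pos (by linarith) _) h1 (by norm_num)
  have h4 : 1 - δ ≤ Q.m t := by
    rw [← hpow (1 - δ) (by linarith)]
    exact Real.rpow_le_rpow_of_nonpos (Q.σ_pos t) h2 (by norm_num)
  rw [abs_le]; constructor <;> linarith

/-! ### Bounds -/

/-- The constant of the embedding of `H¹` into the continuous functions. -/
def embE : ℝ := 1 + 2 * embC

theorem one_le_embE : 1 ≤ embE := by have := embC_nonneg; unfold embE; linarith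

/-- The size of `∂_t c` and of `V` in `H¹`. -/
def size : ℝ := (‖cl (ofR (Q.γt t))‖ + ‖Q.γt' t‖) + (‖cl (ofR (Q.v t))‖ + ‖Q.v' t‖)

theorem size_nonneg : 0 ≤ Q.size t := by unfold size; positivity

theorem embE_mul_size_nonneg : 0 ≤ embE * Q.size t :=
  mul_nonneg (zero_le_one.trans one_le_embE) (Q.size_nonneg t)

theorem size_le_embE_mul : Q.size t ≤ embE * Q.size t :=
  le_mul_of_one_le_left (Q.size_nonneg t) one_le_embE

theorem abs_γt_le (x : Torus) : |Q.γt t x| ≤ embE * Q.size t := by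
  refine (norm_ofR_apply_le _ x).trans ((norm_le_of_WD (Q.WD_γt t)).trans ?_)
  refine mul_le_mul_of_nonneg_left ?_ (zero_le_one.trans one_le_embE)
  have : 0 ≤ ‖cl (ofR (Q.v t))‖ + ‖Q.v' t‖ := by positivity
  unfold size; linarith

theorem abs_v_le (x : Torus) : |Q.v t x| ≤ embE * Q.size t := by
  refine (norm_ofR_apply_le _ x).trans ((norm_le_of_WD (Q.WD_v t)).trans ?_)
  refine mul_le_mul_of_nonneg_left ?_ (zero_le_one.trans one_le_embE)
  have : 0 ≤ ‖cl (ofR (Q.γt t))‖ + ‖Q.γt' t‖ := by positivity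
  unfold size; linarith

theorem norm_γt'_le : ‖Q.γt' t‖ ≤ embE * Q.size t := by
  refine le_trans ?_ (Q.size_le_embE_mul t)
  have : 0 ≤ ‖cl (ofR (Q.γt t))‖ := by positivity
  have : 0 ≤ ‖cl (ofR (Q.v t))‖ + ‖Q.v' t‖ := by positivity
  unfold size; linarith

theorem norm_v'_le : ‖Q.v' t‖ ≤ embE * Q.size t := by
  refine le_trans ?_ (Q.size_le_embE_mul t)
  have : 0 ≤ ‖cl (ofR (Q.v t))‖ := by positivity
  have : 0 ≤ ‖cl (ofR (Q.γt t))‖ + ‖Q.γt' t‖ := by positivity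
  unfold size; linarith

theorem abs_κt_le (x : Torus) : |Q.κt t x| ≤ 3 * (embE * Q.size t) := by
  have h1 := Q.pw_le t (s := -(2 / 3) - 1) (n := 2) (by norm_num) (by norm_num) x
  have h2 := Q.pw_pos t (-(2 / 3) - 1) x
  have h3 := Q.abs_γt_le t x
  have h4 := Q.embE_mul_size_nonneg t
  change |-(2 / 3) * (Q.pw t (-(2 / 3) - 1) x * Q.γt t x)| ≤ _
  rw [abs_mul, abs_mul, abs_of_pos h2, abs_neg, abs_of_pos (by norm_num : (0 : ℝ) < 2 / 3)]
  calc _ ≤ 2 / 3 * (2 ^ 2 * (embE * Q.size t)) := by gcongr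
    _ ≤ _ := by linarith

theorem abs_d_le (x : Torus) : |Q.d t x| ≤ 5 / 4 := by
  have := abs_le.1 (Q.abs_d_sub_one_le t x)
  rw [abs_le]; constructor <;> linarith

theorem abs_d₁_le (x : Torus) : |Q.d₁ t x| ≤ 1 / 4 := by
  have := norm_le_of_wn (f := ofR (Q.d₁ t)) (N := 7) (by norm_num)
    ((wn_deriv_le 7 (Q.toFlow.D t).hasTDeriv_d_sub_one).trans (Q.wn_d_sub_one t)) x
  rwa [ofR_apply, Complex.norm_real] at this

theorem abs_d₂_le (x : Torus) : |Q.d₂ t x| ≤ 1 / 4 := by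
  have := norm_le_of_wn (f := ofR (Q.d₂ t)) (N := 6) (by norm_num)
    ((wn_deriv_le 6 (Q.hasTDeriv_d₁ t)).trans
      ((wn_deriv_le 7 (Q.toFlow.D t).hasTDeriv_d_sub_one).trans (Q.wn_d_sub_one t))) x
  rwa [ofR_apply, Complex.norm_real] at this

theorem abs_mean_κt_le : |mean (Q.κt t)| ≤ 3 * (embE * Q.size t) := abs_mean_le (Q.abs_κt_le t)

theorem abs_e_le (x : Torus) : |Q.e t x| ≤ 14 * (embE * Q.size t) := by
  have h1 := Q.abs_κt_le t x
  have h2 := Q.abs_mean_κt_le t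
  have h3 := Q.abs_d_le t x
  have h4 := Q.inv_σ_le t
  have h5 := inv_pos.2 (Q.σ_pos t)
  have h6 := Q.embE_mul_size_nonneg t
  change |(Q.σ t)⁻¹ * (Q.κt t x - mean (Q.κt t) * Q.d t x)| ≤ _
  rw [abs_mul, abs_of_pos h5]
  calc _ ≤ 2 * (3 * (embE * Q.size t) + 3 * (embE * Q.size t) * (5 / 4)) := by
        gcongr
        refine (abs_sub _ _).trans ?_
        rw [abs_mul]
        gcongr
    _ ≤ _ := by linarith

theorem abs_e₁_le (x : Torus) : |Q.e₁ t x| ≤ 2 * (embE * Q.size t) := by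
  have h1 := Q.pw_le t (s := -(2 / 3) - 1 - 1) (n := 3) (by norm_num) (by norm_num) x
  have h2 := Q.pw_pos t (-(2 / 3) - 1 - 1) x
  have h3 := Q.abs_γt_le t x
  have h4 := Q.embE_mul_size_nonneg t
  have h5 := Q.abs_γ₁_le t x
  have h6 := Q.abs_mean_κt_le t
  have h7 := Q.abs_d₁_le t x
  change |(-(2 / 3) * ((-(2 / 3) - 1) * (Q.pw t (-(2 / 3) - 1 - 1) x * Q.γ₁ t x))) * Q.γt t x -
    mean (Q.κt t) * Q.d₁ t x| ≤ _
  have e : (-(2 / 3) * ((-(2 / 3) - 1) * (Q.pw t (-(2 / 3) - 1 - 1) x * Q.γ₁ t x))) * Q.γt t x =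
    (10 / 9) * (Q.pw t (-(2 / 3) - 1 - 1) x * Q.γ₁ t x * Q.γt t x) := by ring
  rw [e]
  refine (abs_sub _ _).trans ?_
  rw [abs_mul, abs_mul, abs_mul, abs_mul, abs_of_pos h2, abs_of_pos (by norm_num : (0 : ℝ) < 10 / 9)]
  calc _ ≤ 10 / 9 * (2 ^ 3 * (1 / 16) * (embE * Q.size t)) +
        3 * (embE * Q.size t) * (1 / 4) := by gcongr
    _ ≤ _ := by linarith

theorem norm_e'_le : ‖Q.e' t‖ ≤ 10 * (embE * Q.size t) := by
  have h4 := Q.inv_σ_le t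
  have h5 := inv_pos.2 (Q.σ_pos t)
  have h6 := Q.embE_mul_size_nonneg t
  have h7 := Q.norm_γt'_le t
  have h1 : ‖mulL (ofR ((-(2 / 3) : ℝ) • Q.pw t (-(2 / 3) - 1))) (Q.γt' t)‖ ≤
      3 * (embE * Q.size t) := by
    refine (norm_mulL_le_of_le (A := 3) (fun x => ?_) _).trans (by gcongr)
    have h1 := Q.pw_le t (s := -(2 / 3) - 1) (n := 2) (by norm_num) (by norm_num) x
    have h2 := Q.pw_pos t (-(2 / 3) - 1) x
    rw [ofR_apply, Complex.norm_real, ContinuousMap.smul_apply, smul_eq_mul, norm_mul,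
      Real.norm_of_nonneg h2.le, norm_neg, Real.norm_of_nonneg (by norm_num)]
    linarith
  have h2 := norm_cl_ofR_le (Q.abs_e₁_le t)
  rw [e', norm_smul, Real.norm_of_nonneg h5.le]
  calc _ ≤ 2 * (3 * (embE * Q.size t) + 2 * (embE * Q.size t)) := by
        gcongr
        exact (norm_add_le _ _).trans (add_le_add h1 h2)
    _ = _ := by ring

theorem abs_prim_e_le (x : Torus) : |prim (Q.e t) x| ≤ 14 * (embE * (embE * Q.size t)) := by
  have h1 := norm_cl_ofR_le (Q.abs_e_le t)
  have h2 := embC_nonneg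
  have h6 := Q.embE_mul_size_nonneg t
  calc _ ≤ 2 * embC * (14 * (embE * Q.size t)) := (abs_prim_le _ x).trans (by gcongr)
    _ ≤ embE * (14 * (embE * Q.size t)) := by
      gcongr
      unfold embE; linarith
    _ = _ := by ring

theorem embE_mul_le : embE * Q.size t ≤ embE * (embE * Q.size t) :=
  le_mul_of_one_le_left (Q.embE_mul_size_nonneg t) one_le_embE

theorem abs_qt_le : |Q.qt t| ≤ 20 * (embE * (embE * Q.size t)) := by
  rw [qt, abs_neg]
  refine abs_mean_le fun x => ?_
  have h1 := Q.abs_d_le t x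
  have h2 := Q.abs_v_le t x
  have h3 := Q.abs_prim_e_le t x
  have h4 := Q.embE_mul_le t
  have h5 := Q.embE_mul_size_nonneg t
  change |Q.d t x * (Q.v t x * Q.d t x + prim (Q.e t) x)| ≤ _
  rw [abs_mul]
  calc _ ≤ 5 / 4 * ((embE * Q.size t) * (5 / 4) + 14 * (embE * (embE * Q.size t))) := by
        gcongr
        refine (abs_add_le _ _).trans (add_le_add ?_ h3)
        rw [abs_mul]
        gcongr
    _ ≤ _ := by linarith

theorem abs_Z_le (x : Torus) : |Q.toFlow.Z (Q.v t) t x| ≤ 36 * (embE * (embE * Q.size t)) := by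
  have h1 := Q.abs_d_le t x
  have h2 := Q.abs_v_le t x
  have h3 := Q.abs_prim_e_le t x
  have h4 := Q.embE_mul_le t
  have h5 := Q.embE_mul_size_nonneg t
  have h6 := Q.abs_qt_le t
  change |Q.v t x * Q.d t x + (prim (Q.e t) x + Q.qt t)| ≤ _
  refine (abs_add_le _ _).trans ((add_le_add le_rfl (abs_add_le _ _)).trans ?_)
  rw [abs_mul]
  calc _ ≤ (embE * Q.size t) * (5 / 4) + (14 * (embE * (embE * Q.size t)) +
        20 * (embE * (embE * Q.size t))) := by gcongr
    _ ≤ _ := by linarith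

theorem norm_mulL_ofR_le {f : C(Torus, ℝ)} {B : ℝ} (h : ∀ x, |f x| ≤ B) (u : L2) :
    ‖mulL (ofR f) u‖ ≤ B * ‖u‖ :=
  norm_mulL_le_of_le (fun x => by rw [ofR_apply, Complex.norm_real]; exact h x) u

theorem norm_Z'_le : ‖Q.toFlow.Z' (Q.v t) (Q.v' t) t‖ ≤ 16 * (embE * (embE * Q.size t)) := by
  have h1 := norm_mulL_ofR_le (Q.abs_d_le t) (Q.v' t)
  have h2 := Q.norm_v'_le t
  have h4 := Q.embE_mul_le t
  have h5 := Q.embE_mul_size_nonneg t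
  have h3 : ‖cl (ofR (Q.v t * Q.d₁ t + Q.e t))‖ ≤ 1 / 4 * (embE * Q.size t) +
      14 * (embE * Q.size t) := norm_cl_ofR_le fun x => by
    refine (abs_add_le _ _).trans (add_le_add ?_ (Q.abs_e_le t x))
    rw [ContinuousMap.mul_apply, abs_mul, mul_comm]
    have := Q.abs_v_le t x
    have := Q.abs_d₁_le t x
    gcongr
  refine (norm_add_le _ _).trans ((add_le_add h1 h3).trans ?_)
  linarith

theorem abs_ρ_le (x : Torus) : |Q.toFlow.ρ (Q.v t) t x| ≤ 15 * (embE * Q.size t) := by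
  have h1 := Q.abs_e_le t x
  have h2 := Q.abs_v_le t x
  have h3 := Q.abs_d₁_le t x
  have h4 := (Q.toFlow.D t).dInv_le x
  have h5 := (Q.toFlow.D t).dInv_pos x
  have h6 := Q.embE_mul_size_nonneg t
  change |(1 / 2 : ℝ) * ((Q.e t x + Q.v t x * Q.d₁ t x) * (Q.toFlow.D t).dInv x)| ≤ _
  rw [abs_mul, abs_mul, abs_of_pos h5, abs_of_pos (by norm_num : (0 : ℝ) < 1 / 2)]
  calc _ ≤ 1 / 2 * ((14 * (embE * Q.size t) + (embE * Q.size t) * (1 / 4)) * 2) := by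
        gcongr
        refine (abs_add_le _ _).trans (add_le_add h1 ?_)
        rw [abs_mul]
        gcongr
    _ ≤ _ := by linarith

/-! ### The transport coefficient in the new variables -/

/-- The transport coefficient in the new variables. -/
def W : C(Torus, ℝ) := (Q.m t)⁻¹ • (Q.toFlow.Z (Q.v t) t).comp (Q.toFlow.D t).φ

/-- The mean of `W` is that of `m⁻¹ d Z`, and `d` has mean one, so that `qt` cancels the rest. -/
theorem mean_W : mean (Q.W t) = 0 := by
  rw [W, mean_smul]
  have h := (Q.toFlow.D t).integral_G (ofR ((Q.toFlow.Z (Q.v t) t).comp (Q.toFlow.D t).φ))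
  simp only [ofR_apply, ContinuousMap.comp_apply, Diffeo.φ_G] at h
  have h1 : mean ((Q.toFlow.Z (Q.v t) t).comp (Q.toFlow.D t).φ) =
      mean (Q.d t * Q.toFlow.Z (Q.v t) t) := by
    apply Complex.ofReal_injective
    rw [mean, mean, ← integral_complex_ofReal, ← integral_complex_ofReal]
    simp only [ContinuousMap.comp_apply, ContinuousMap.mul_apply, Complex.ofReal_mul]
    exact h.symm
  have h2 : Q.d t * Q.toFlow.Z (Q.v t) t =
      Q.d t * (Q.v t * Q.d t + prim (Q.e t)) + Q.qt t • Q.d t := by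
    ext x
    change Q.d t x * (Q.v t x * Q.d t x + (prim (Q.e t) x + Q.qt t)) =
      Q.d t x * (Q.v t x * Q.d t x + prim (Q.e t) x) + Q.qt t * Q.d t x
    ring
  rw [h1, h2, mean_add, mean_smul, mean_d, qt]
  ring

theorem cl_W : cl (ofR (Q.W t)) =
    ((Q.m t)⁻¹ : ℂ) • (Q.toFlow.D t).comp (cl (ofR (Q.toFlow.Z (Q.v t) t))) := by
  rw [SDiffeo.comp_cl, ← map_smul]
  congr 1
  ext x
  simp [W]

/-- The derivative of the transport coefficient. -/
def W' : L2 := ((Q.m t)⁻¹ : ℂ) • (Q.toFlow.D t).comp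
  (mulL (ofR (Q.toFlow.D t).dInv) (Q.toFlow.Z' (Q.v t) (Q.v' t) t))

theorem WD_W : WD (cl (ofR (Q.W t))) (Q.W' t) := by
  rw [cl_W]
  exact ((Q.toFlow.D t).WD_comp (Q.toFlow.WD_Z t (Q.WD_v t))).smul _

theorem continuous_dInv : Continuous fun t => (Q.toFlow.D t).dInv := by
  refine continuous_curve ?_
  exact (continuous_uncurry Q.continuous_d).inv₀ fun p => ((Q.toFlow.D p.1).d_pos p.2).ne'

theorem continuous_comp {f : ℝ → L2} (hf : Continuous f) :
    Continuous fun t => (Q.toFlow.D t).comp (f t) := by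
  refine Q.toFlow.continuous_U_symm (continuous_mulL ?_ hf)
  refine continuous_curve ?_
  exact (continuous_uncurry Q.continuous_d).sqrt

theorem continuous_inv_m : Continuous fun t => ((Q.m t)⁻¹ : ℂ) := by
  have := Q.continuous_m.inv₀ fun t => (Q.m_pos t).ne'
  refine (Complex.continuous_ofReal.comp this).congr fun t => ?_
  simp

theorem continuous_cl_W : Continuous fun t => cl (ofR (Q.W t)) := by
  simp only [cl_W]
  have h1 := Q.continuous_v
  have h2 := Q.continuous_d
  have h3 := Q.continuous_z
  have h4 : Continuous fun t => Q.toFlow.Z (Q.v t) t := (h1.mul h2).add h3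
  exact Q.continuous_inv_m.smul
    (Q.continuous_comp (cl.continuous.comp (Flow.continuous_ofR h4)))

theorem continuous_Z' : Continuous fun t => Q.toFlow.Z' (Q.v t) (Q.v' t) t := by
  have h4 : Continuous fun t => Q.v t * Q.d₁ t + Q.e t :=
    (Q.continuous_v.mul Q.continuous_d₁).add Q.continuous_e
  exact (continuous_mulL Q.continuous_d Q.continuous_v').add
    (cl.continuous.comp (Flow.continuous_ofR h4))

theorem continuous_W' : Continuous fun t => Q.W' t :=
  Q.continuous_inv_m.smul (Q.continuous_comp (continuous_mulL Q.continuous_dInv Q.continuous_Z'))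

theorem norm_inv_m_le : ‖((Q.m t)⁻¹ : ℂ)‖ ≤ 2 := by
  rw [norm_inv, Complex.norm_real, Real.norm_of_nonneg (Q.m_pos t).le]
  exact Q.inv_m_le t

theorem norm_cl_W_le : ‖cl (ofR (Q.W t))‖ ≤ 200 * (embE * (embE * Q.size t)) := by
  rw [cl_W, norm_smul]
  have h1 := Q.norm_inv_m_le t
  have h2 := (Q.toFlow.D t).norm_comp_le (cl (ofR (Q.toFlow.Z (Q.v t) t)))
  have h3 := norm_cl_ofR_le (Q.abs_Z_le t)
  have h4 := Q.embE_mul_le t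
  have h5 := Q.embE_mul_size_nonneg t
  calc _ ≤ 2 * (2 * (36 * (embE * (embE * Q.size t)))) := by
        gcongr
        exact h2.trans (by gcongr)
    _ ≤ _ := by linarith

theorem norm_dInv_mul_le (u : L2) : ‖mulL (ofR (Q.toFlow.D t).dInv) u‖ ≤ 2 * ‖u‖ :=
  norm_mulL_ofR_le (fun x => by
    rw [abs_of_pos ((Q.toFlow.D t).dInv_pos x)]; exact (Q.toFlow.D t).dInv_le x) u

theorem norm_W'_le : ‖Q.W' t‖ ≤ 200 * (embE * (embE * Q.size t)) := by
  rw [W', norm_smul]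
  have h1 := Q.norm_inv_m_le t
  have h2 := (Q.toFlow.D t).norm_comp_le
    (mulL (ofR (Q.toFlow.D t).dInv) (Q.toFlow.Z' (Q.v t) (Q.v' t) t))
  have h3 := Q.norm_Z'_le t
  have h6 := Q.norm_dInv_mul_le t (Q.toFlow.Z' (Q.v t) (Q.v' t) t)
  have h4 := Q.embE_mul_le t
  have h5 := Q.embE_mul_size_nonneg t
  calc _ ≤ 2 * (2 * (2 * (16 * (embE * (embE * Q.size t))))) := by
        gcongr
        exact h2.trans (by gcongr; exact h6.trans (by gcongr))
    _ ≤ _ := by linarith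

variable (v'' : L2)

/-- The second derivative of the transport field, in the original variables. -/
def Z'' : L2 := (mulL (ofR (Q.d₁ t)) (Q.v' t) + mulL (ofR (Q.d t)) v'') +
  ((mulL (ofR (Q.d₂ t)) (cl (ofR (Q.v t))) + mulL (ofR (Q.d₁ t)) (Q.v' t)) + Q.e' t)

variable {v''}

theorem WD_Z' (h : WD (Q.v' t) v'') : WD (Q.toFlow.Z' (Q.v t) (Q.v' t) t) (Q.Z'' t v'') := by
  have h1 : HasTDeriv (ofR (Q.d t)) (ofR (Q.d₁ t)) := (Q.hasTDeriv_d t).ofReal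
  have h2 : HasTDeriv (ofR (Q.d₁ t)) (ofR (Q.d₂ t)) := (Q.hasTDeriv_d₁ t).ofReal
  have h3 := (WD.mulL h1 h).add ((WD.mulL h2 (Q.WD_v t)).add (Q.WD_e t))
  have e : Q.toFlow.Z' (Q.v t) (Q.v' t) t = mulL (ofR (Q.d t)) (Q.v' t) +
      (mulL (ofR (Q.d₁ t)) (cl (ofR (Q.v t))) + cl (ofR (Q.e t))) := by
    rw [mulL_cl, ← ofR_mul, mul_comm (Q.d₁ t), ← Flow.cl_ofR_add]
    rfl
  rw [e]
  exact h3

/-- The derivative of `1 / d`. -/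
def dInv' : C(Torus, ℝ) := -(Q.d₁ t * (Q.toFlow.D t).dInv * (Q.toFlow.D t).dInv)

theorem hasTDeriv_dInv : HasTDeriv (Q.toFlow.D t).dInv (Q.dInv' t) := fun x => by
  have hx : Q.d t x ≠ 0 := ((Q.toFlow.D t).d_pos x).ne'
  have h := (Q.hasTDeriv_d t x).inv (by simpa using hx)
  refine h.congr_deriv ?_
  change _ = -(Q.d₁ t x * (Q.d t x)⁻¹ * (Q.d t x)⁻¹)
  simp
  field_simp

theorem abs_dInv'_le (x : Torus) : |Q.dInv' t x| ≤ 1 := by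
  have h1 := Q.abs_d₁_le t x
  have h4 := (Q.toFlow.D t).dInv_le x
  have h5 := (Q.toFlow.D t).dInv_pos x
  change |-(Q.d₁ t x * (Q.toFlow.D t).dInv x * (Q.toFlow.D t).dInv x)| ≤ 1
  rw [abs_neg, abs_mul, abs_mul, abs_of_pos h5]
  calc _ ≤ 1 / 4 * 2 * (2 : ℝ) := by gcongr
    _ = 1 := by norm_num

/-- The second derivative of the transport coefficient. -/
def W'' (v'' : L2) : L2 := ((Q.m t)⁻¹ : ℂ) • (Q.toFlow.D t).comp
  (mulL (ofR (Q.toFlow.D t).dInv) (mulL (ofR (Q.dInv' t)) (Q.toFlow.Z' (Q.v t) (Q.v' t) t) +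
    mulL (ofR (Q.toFlow.D t).dInv) (Q.Z'' t v'')))

theorem WD_W' (h : WD (Q.v' t) v'') : WD (Q.W' t) (Q.W'' t v'') := by
  have h1 : HasTDeriv (ofR (Q.toFlow.D t).dInv) (ofR (Q.dInv' t)) := (Q.hasTDeriv_dInv t).ofReal
  exact ((Q.toFlow.D t).WD_comp (WD.mulL h1 (Q.WD_Z' t h))).smul _

theorem continuous_W'' {v'' : ℝ → L2} (h : Continuous v'') :
    Continuous fun t => Q.W'' t (v'' t) := by
  have h1 : Continuous fun t => Q.Z'' t (v'' t) :=
    ((continuous_mulL Q.continuous_d₁ Q.continuous_v').add (continuous_mulL Q.continuous_d h)).add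
      (((continuous_mulL Q.continuous_d₂
        (cl.continuous.comp (Flow.continuous_ofR Q.continuous_v))).add
        (continuous_mulL Q.continuous_d₁ Q.continuous_v')).add Q.continuous_e')
  have h2 := Q.continuous_dInv
  have h3 : Continuous fun t => Q.dInv' t := ((Q.continuous_d₁.mul h2).mul h2).neg
  exact Q.continuous_inv_m.smul (Q.continuous_comp (continuous_mulL h2
    ((continuous_mulL h3 Q.continuous_Z').add (continuous_mulL h2 h1))))

theorem norm_Z''_le : ‖Q.Z'' t v''‖ ≤ 11 * (embE * (embE * Q.size t)) + 5 / 4 * ‖v''‖ := by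
  have h1 := norm_mulL_ofR_le (Q.abs_d₁_le t) (Q.v' t)
  have h2 := norm_mulL_ofR_le (Q.abs_d_le t) v''
  have h3 := norm_mulL_ofR_le (Q.abs_d₂_le t) (cl (ofR (Q.v t)))
  have h4 := Q.norm_e'_le t
  have h5 := Q.norm_v'_le t
  have h6 := norm_cl_ofR_le (Q.abs_v_le t)
  have h7 := Q.embE_mul_le t
  have h8 := Q.embE_mul_size_nonneg t
  refine (norm_add_le _ _).trans ((add_le_add (norm_add_le _ _) (norm_add₃_le)).trans ?_)
  linarith

theorem norm_W''_le : ‖Q.W'' t v''‖ ≤ 400 * (embE * (embE * Q.size t) + ‖v''‖) := by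
  rw [W'', norm_smul]
  set X := mulL (ofR (Q.dInv' t)) (Q.toFlow.Z' (Q.v t) (Q.v' t) t) +
    mulL (ofR (Q.toFlow.D t).dInv) (Q.Z'' t v'')
  have h1 := Q.norm_inv_m_le t
  have h2 := (Q.toFlow.D t).norm_comp_le (mulL (ofR (Q.toFlow.D t).dInv) X)
  have h3 := Q.norm_dInv_mul_le t X
  have h4 := Q.norm_dInv_mul_le t (Q.Z'' t v'')
  have h5 := norm_mulL_ofR_le (Q.abs_dInv'_le t) (Q.toFlow.Z' (Q.v t) (Q.v' t) t)
  have h6 : ‖X‖ ≤ _ := norm_add_le _ _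
  have h7 := Q.norm_Z'_le t
  have h8 := Q.norm_Z''_le t (v'' := v'')
  have h9 := Q.embE_mul_le t
  have h10 := Q.embE_mul_size_nonneg t
  have h11 := norm_nonneg v''
  calc _ ≤ 2 * (2 * (2 * ‖X‖)) := by
        gcongr
        exact h2.trans (by gcongr)
    _ ≤ _ := by linarith

end Coefs

section

/-! ### From the hypotheses to curves of continuous functions -/

variable {T : ℝ} {f : ℝ → Torus → ℝ}

theorem ContH.mono {r s : ℝ} (h : ContH T r f) (hs : s ≤ r) : ContH T s f :=
  ⟨fun t ht => ⟨(h.1 t ht).1, (sobolevNorm_mono hs _).trans_lt (h.1 t ht).2⟩, fun t ht =>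
    tendsto_of_tendsto_of_tendsto_of_le_of_le tendsto_const_nhds (h.2 t ht) (fun _ => zero_le)
      fun _ => sobolevNorm_mono hs _⟩

theorem sobolevNorm_le_normH (s : ℝ) {t : ℝ} (ht : t ∈ Icc 0 T) :
    sobolevNorm s (f t) ≤ normH T s f := le_iSup₂ (f := fun t _ => sobolevNorm s (f t)) t ht

theorem abs_le_of_ae {F : C(Torus, ℝ)} {B : ℝ} (h : ∀ᵐ x ∂dx, |F x| ≤ B) (x : Torus) :
    |F x| ≤ B := by
  have ho : IsOpen {x | B < |F x|} := isOpen_lt continuous_const (by fun_prop)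
  have h0 : dx {x | B < |F x|} = 0 := by
    rw [ae_iff] at h
    simpa using h
  have he := (ho.measure_eq_zero_iff dx).1 h0
  by_contra hx
  have : x ∈ {x | B < |F x|} := not_le.1 hx
  rw [he] at this
  exact this

theorem ofReal_le_eLpNorm_top {g : Torus → ℝ} {F : C(Torus, ℝ)} (h : g =ᵐ[dx] F) (x : Torus) :
    ENNReal.ofReal |F x| ≤ eLpNorm g ⊤ dx := by
  rcases eq_or_ne (eLpNorm g ⊤ dx) ⊤ with ht | ht
  · rw [ht]; exact le_top
  rw [eLpNorm_congr_ae h, eLpNorm_exponent_top] at ht ⊢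
  rw [← ENNReal.ofReal_toReal ht]
  refine ENNReal.ofReal_le_ofReal (abs_le_of_ae ?_ x)
  filter_upwards [ae_le_eLpNormEssSup (f := (F : Torus → ℝ)) (μ := dx)] with y hy
  rw [← Real.norm_eq_abs, ← toReal_enorm]
  exact ENNReal.toReal_mono ht hy

theorem tsum_realCoeff_sq_le {F : C(Torus, ℝ)} {B : ℝ} (h : ∀ x, |F x| ≤ B) :
    ∑' k, ‖realCoeff F k‖ ^ 2 ≤ B ^ 2 := by
  have h1 := norm_cl_ofR_le h
  have h2 := norm_sq_eq_tsum (cl (ofR F))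
  simp only [coeff_cl, fourierCoeff_ofR] at h2
  rw [← h2]
  gcongr

/-- The smallness of `c - 1` that the theorem requires. -/
def delta0 : ℝ := min (1 / 2) ((smallC / (wienerC 8 + 1)) ^ 2)

theorem wienerC_nonneg (N : ℕ) : 0 ≤ wienerC N := mul_nonneg embC_nonneg (by positivity)

theorem delta0_pos : 0 < delta0 := by
  have h1 := smallC_pos
  have h2 := wienerC_nonneg 8
  exact lt_min (by norm_num) (by positivity)

theorem delta0_lt_one : delta0 < 1 := (min_le_left _ _).trans_lt (by norm_num)

theorem wienerC_mul_sqrt_le : wienerC 8 * Real.sqrt delta0 ≤ smallC := by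
  have h1 := smallC_pos
  have h2 := wienerC_nonneg 8
  have h3 : Real.sqrt delta0 ≤ smallC / (wienerC 8 + 1) := by
    rw [Real.sqrt_le_left (by positivity)]
    exact min_le_right _ _
  calc _ ≤ wienerC 8 * (smallC / (wienerC 8 + 1)) := by gcongr
    _ ≤ smallC := by
      rw [← mul_div_assoc, div_le_iff₀ (by positivity)]
      nlinarith

/-- The curves of continuous functions given by the coefficients of the equation. -/
theorem exists_coefs (hT : 0 < T) {c ct V : ℝ → Torus → ℝ}
    (hc : ContH T 18 fun t x => c t x - 1) (hct : IsTimeDeriv T c ct) (hct1 : ContH T 1 ct)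
    (hV : ContH T 1 V) (hδ : normLinfty T (fun t x => c t x - 1) < ENNReal.ofReal delta0)
    (hN : normH T 18 (fun t x => c t x - 1) ≤ 1) :
    ∃ Q : Coefs T,
      (∀ t k, realCoeff (Q.γ t) k = realCoeff (fun x => c (clampT T t) x - 1) k) ∧
      (∀ t ∈ Icc 0 T, (fun x => c t x - 1) =ᵐ[dx] Q.γ t) ∧
      (∀ t k, realCoeff (Q.γt t) k = realCoeff (ct (clampT T t)) k) ∧
      (∀ t k, realCoeff (Q.v t) k = realCoeff (V (clampT T t)) k) := by
  obtain ⟨γ, -, cγ, -, -, kγ, aγ⟩ := exists_curve_one hT (hc.mono (by norm_num))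
  obtain ⟨γ₁, γ₂, h1, h2, c1, c2⟩ := exists_curve_deriv_two hT (hc.mono (by norm_num)) kγ
  obtain ⟨γt, γt', cγt, cγt', wγt, kγt, -⟩ := exists_curve_one hT hct1
  obtain ⟨v, v', cv, cv', wv, kv, -⟩ := exists_curve_one hT hV
  have hd : ∀ t ∈ Icc 0 T, ∀ k, HasDerivWithinAt (fun s => realCoeff (γ s) k)
      (realCoeff (γt t) k) (Icc 0 T) t := by
    intro t ht k
    have e : ∀ s ∈ Icc 0 T, realCoeff (γ s) k = realCoeff (c s) k - realCoeff (fun _ => 1) k := by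
      intro s hs
      rw [kγ, clampT_of_mem hs]
      have h := realCoeff_sub_of_memLp (hc.1 s hs).1 (memLp_const (-1 : ℝ)) k
      have h' := realCoeff_sub_of_memLp (memLp_const (0 : ℝ)) (memLp_const (1 : ℝ)) k
      simp only [sub_neg_eq_add, sub_add_cancel, zero_sub] at h h'
      have h0 : realCoeff (fun _ => 0) k = 0 := by simp [realCoeff, fourierCoeff]
      rw [h, h', h0]; ring
    have h3 := (hct t ht k).sub_const (realCoeff (fun _ => 1) k)
    rw [kγt, clampT_of_mem ht]
    exact h3.congr e (e t ht)
  have hsmall : ∀ t ∈ Icc 0 T, ∀ x, |γ t x| ≤ delta0 := by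
    intro t ht x
    have h3 := (ofReal_le_eLpNorm_top (aγ t ht) x).trans
      (le_iSup₂ (f := fun t (_ : t ∈ Icc 0 T) => eLpNorm (fun x => c t x - 1) ⊤ dx) t ht)
    exact (ENNReal.ofReal_le_ofReal_iff delta0_pos.le).1 (h3.trans hδ.le)
  refine ⟨{ γ := γ, γ₁ := γ₁, γ₂ := γ₂, γt := γt, γt' := γt', v := v, v' := v'
            continuous_γ := cγ, continuous_γ₁ := c1, continuous_γ₂ := c2, continuous_γt := cγt
            continuous_γt' := cγt', continuous_v := cv, continuous_v' := cv'
            hasTDeriv_γ := h1, hasTDeriv_γ₁ := h2, WD_γt := wγt, WD_v := wv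
            hasDeriv_γ := fun t ht x => hasDerivWithinAt_of_realCoeff cγt hd ht x
            wn_le := fun t => ?_ }, kγ, aγ, kγt, kv⟩
  have hm := clampT_mem hT t
  have e : realCoeff (γ t) = realCoeff (γ (clampT T t)) := by
    ext k
    rw [kγ, kγ, clampT_of_mem hm]
  rw [e]
  refine (wn_le_of_interpolation 8 delta0_pos.le ?_ (tsum_realCoeff_sq_le (hsmall _ hm))).trans
    (ENNReal.ofReal_le_ofReal wienerC_mul_sqrt_le)
  have e2 : sobolevNorm (2 * (8 + 1) : ℕ) (γ (clampT T t)) =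
      sobolevNorm 18 (fun x => c (clampT T t) x - 1) := by
    simp only [sobolevNorm, kγ, clampT_of_mem hm]
    norm_num
  rw [e2]
  exact (sobolevNorm_le_normH (f := fun t x => c t x - 1) 18 hm).trans hN

namespace Coefs

variable {c ct V : ℝ → Torus → ℝ} (Q : Coefs T)

theorem ofReal_size_le (hT : 0 < T) (h1 : ∀ t k, realCoeff (Q.γt t) k = realCoeff (ct (clampT T t)) k)
    (h2 : ∀ t k, realCoeff (Q.v t) k = realCoeff (V (clampT T t)) k) (t : ℝ) :
    ENNReal.ofReal (Q.size t) ≤ ENNReal.ofReal 2 * (normH T 1 V + normH T 1 ct) := by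
  have a1 := le_sobolevNorm_one (f := ct (clampT T t)) (u := cl (ofR (Q.γt t)))
    (fun k => by rw [coeff_cl, fourierCoeff_ofR, h1]) (Q.WD_γt t)
  have a2 := le_sobolevNorm_one (f := V (clampT T t)) (u := cl (ofR (Q.v t)))
    (fun k => by rw [coeff_cl, fourierCoeff_ofR, h2]) (Q.WD_v t)
  have b1 := sobolevNorm_le_normH (f := ct) 1 (clampT_mem hT t)
  have b2 := sobolevNorm_le_normH (f := V) 1 (clampT_mem hT t)
  rw [size, ENNReal.ofReal_add (by positivity) (by positivity),
    ENNReal.ofReal_add (by positivity) (by positivity),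
    ENNReal.ofReal_add (by positivity) (by positivity)]
  calc _ ≤ (normH T 1 ct + normH T 1 ct) + (normH T 1 V + normH T 1 V) :=
        add_le_add (add_le_add (a1.1.trans b1) (a1.2.trans b1))
          (add_le_add (a2.1.trans b2) (a2.2.trans b2))
    _ = _ := by
      rw [← two_mul, ← two_mul, ← mul_add, add_comm]
      norm_num

theorem realCoeff_c (hc : ∀ t ∈ Icc 0 T, (fun x => c t x - 1) =ᵐ[dx] Q.γ t) {t : ℝ}
    (ht : t ∈ Icc 0 T) (k : ℤ) :
    realCoeff (c t) k = Q.m t * realCoeff ((Q.toFlow.D t).pow (-(3 / 2))) k := by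
  have h : (fun x => (c t x : ℂ)) =ᵐ[dx]
      fun x => ((Q.m t : ℂ) • ofR ((Q.toFlow.D t).pow (-(3 / 2)))) x := by
    filter_upwards [hc t ht] with x hx
    have h1 := Q.one_add_γ_eq t x
    rw [← hx, add_sub_cancel] at h1
    rw [h1]
    simp
  rw [realCoeff, congrFun (fourierCoeff_congr_ae h) k, ← coeff_cl, map_smul, coeff_smul, coeff_cl,
    fourierCoeff_ofR]

theorem wn_c_ne_top (hc : ∀ t ∈ Icc 0 T, (fun x => c t x - 1) =ᵐ[dx] Q.γ t) {t : ℝ}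
    (ht : t ∈ Icc 0 T) : wn 1 (realCoeff (c t)) ≤ ENNReal.ofReal (1 / 16 + 1) := by
  have h : realCoeff (c t) = realCoeff (1 + Q.γ t : C(Torus, ℝ)) := by
    have : (fun x => (c t x : ℂ)) =ᵐ[dx] fun x => (((1 + Q.γ t : C(Torus, ℝ)) x : ℝ) : ℂ) := by
      filter_upwards [hc t ht] with x hx
      simp [← hx]
    exact fourierCoeff_congr_ae this
  rw [h]
  refine wn_le_of_sub_one (by norm_num) ?_
  rw [add_sub_cancel_left]
  exact ((wn_mono (by norm_num) _).trans (Q.wn_le t)).trans (ENNReal.ofReal_le_ofReal smallC_le)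

end Coefs

end

section

/-! ### The change of time -/

/-- A continuous function that is bounded below by `1 / 2`, the speed of a change of time. -/
structure Speed where
  /-- the speed -/
  m : ℝ → ℝ
  continuous_m : Continuous m
  half_le : ∀ t, 1 / 2 ≤ m t

namespace Speed

variable (S : Speed)

/-- The change of time. -/
def ψ (t : ℝ) : ℝ := ∫ s in (0 : ℝ)..t, S.m s

theorem hasDerivAt_ψ (t : ℝ) : HasDerivAt S.ψ (S.m t) t :=
  intervalIntegral.integral_hasDerivAt_right (S.continuous_m.intervalIntegrable _ _)
    S.continuous_m.stronglyMeasurable.stronglyMeasurableAtFilter S.continuous_m.continuousAt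

theorem m_pos (t : ℝ) : 0 < S.m t := by linarith [S.half_le t]

theorem strictMono_ψ : StrictMono S.ψ := strictMono_of_hasDerivAt_pos S.hasDerivAt_ψ S.m_pos

theorem ψ_zero : S.ψ 0 = 0 := by simp [ψ]

theorem continuous_ψ : Continuous S.ψ :=
  continuous_iff_continuousAt.2 fun t => (S.hasDerivAt_ψ t).continuousAt

theorem monotone_ψ_sub : Monotone fun t => S.ψ t - 1 / 2 * t :=
  monotone_of_hasDerivAt_nonneg (f' := fun t => S.m t - 1 / 2)
    (fun t => ((S.hasDerivAt_ψ t).sub ((hasDerivAt_id t).const_mul (1 / 2))).congr_deriv (by simp))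
    fun t => sub_nonneg.2 (S.half_le t)

theorem surjective_ψ : Function.Surjective S.ψ := by
  have h0 := S.ψ_zero
  refine S.continuous_ψ.surjective ?_ ?_
  · refine tendsto_atTop_mono' (f₁ := fun t : ℝ => 1 / 2 * t) _ ?_
      (tendsto_id.const_mul_atTop (one_half_pos (α := ℝ)))
    filter_upwards [eventually_ge_atTop 0] with t ht
    have := S.monotone_ψ_sub ht
    simp only [h0] at this
    linarith
  · refine tendsto_atBot_mono' (f₁ := fun t : ℝ => 1 / 2 * t) _ ?_
      (tendsto_id.const_mul_atBot (one_half_pos (α := ℝ)))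
    filter_upwards [eventually_le_atBot 0] with t ht
    have := S.monotone_ψ_sub ht
    simp only [h0] at this
    linarith

/-- The change of time as an order isomorphism. -/
def iso : ℝ ≃o ℝ := S.strictMono_ψ.orderIsoOfSurjective _ S.surjective_ψ

/-- The inverse change of time. -/
def ψinv (t : ℝ) : ℝ := S.iso.symm t

theorem ψ_ψinv (t : ℝ) : S.ψ (S.ψinv t) = t := S.iso.apply_symm_apply t

theorem ψinv_ψ (t : ℝ) : S.ψinv (S.ψ t) = t := S.iso.symm_apply_apply t

theorem continuous_ψinv : Continuous S.ψinv := S.iso.symm.continuous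

theorem hasDerivAt_ψinv (t : ℝ) : HasDerivAt S.ψinv (S.m (S.ψinv t))⁻¹ t :=
  HasDerivAt.of_local_left_inverse S.continuous_ψinv.continuousAt (S.hasDerivAt_ψ _)
    (S.m_pos _).ne' (Eventually.of_forall S.ψ_ψinv)

theorem mapsTo_ψ (T : ℝ) : MapsTo S.ψ (Icc 0 T) (Icc 0 (S.ψ T)) := fun t ht =>
  ⟨by rw [← S.ψ_zero]; exact S.strictMono_ψ.monotone ht.1, S.strictMono_ψ.monotone ht.2⟩

theorem mapsTo_ψinv (T : ℝ) : MapsTo S.ψinv (Icc 0 (S.ψ T)) (Icc 0 T) := fun t ht => by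
  have h := S.ψ_ψinv t
  exact ⟨S.strictMono_ψ.le_iff_le.1 (by rw [h, S.ψ_zero]; exact ht.1),
    S.strictMono_ψ.le_iff_le.1 (by rw [h]; exact ht.2)⟩

theorem isTimeDiffeo (T : ℝ) : IsTimeDiffeo T (S.ψ T) S.ψ S.ψinv S.m :=
  ⟨S.ψ_zero, rfl, S.mapsTo_ψ T, S.mapsTo_ψinv T,
    ⟨fun t _ => S.ψinv_ψ t, fun t _ => S.ψ_ψinv t⟩, S.continuous_m.continuousOn,
    fun t _ => ⟨S.m_pos t, (S.hasDerivAt_ψ t).hasDerivWithinAt⟩⟩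

theorem ψ_pos {T : ℝ} (hT : 0 < T) : 0 < S.ψ T := by
  rw [← S.ψ_zero]; exact S.strictMono_ψ hT

/-- The chain rule for the change of time. -/
theorem hasDerivWithinAt_iff (T : ℝ) {F X : ℝ → ℂ} :
    (∀ t ∈ Icc 0 T, HasDerivWithinAt F ((S.m t : ℂ) * X t) (Icc 0 T) t) ↔
      ∀ t ∈ Icc 0 (S.ψ T), HasDerivWithinAt (fun s => F (S.ψinv s)) (X (S.ψinv t))
        (Icc 0 (S.ψ T)) t := by
  constructor
  · intro h t ht
    have h1 := HasDerivWithinAt.scomp t (h _ (S.mapsTo_ψinv T ht))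
      (S.hasDerivAt_ψinv t).hasDerivWithinAt (S.mapsTo_ψinv T)
    refine h1.congr_deriv ?_
    have : (S.m (S.ψinv t) : ℂ) ≠ 0 := by exact_mod_cast (S.m_pos _).ne'
    rw [Complex.real_smul, Complex.ofReal_inv, inv_mul_cancel_left₀ this]
  · intro h t ht
    have h1 := HasDerivWithinAt.scomp t (h _ (S.mapsTo_ψ T ht))
      (S.hasDerivAt_ψ t).hasDerivWithinAt (S.mapsTo_ψ T)
    refine (h1.congr_deriv ?_).congr (fun s _ => ?_) ?_
    · rw [Complex.real_smul, S.ψinv_ψ]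
    · simp only [Function.comp_apply, S.ψinv_ψ]
    · simp only [Function.comp_apply, S.ψinv_ψ]

theorem abs_ψ_div_sub_one_le {T : ℝ} (hT : 0 < T) {δ : ℝ} (h : ∀ t ∈ Icc 0 T, |S.m t - 1| ≤ δ) :
    |S.ψ T / T - 1| ≤ δ := by
  have h1 := lipschitz_of_deriv (f := fun t => S.ψ t - t) (f' := fun t => S.m t - 1)
    (convex_Icc 0 T)
    (fun t _ => ((S.hasDerivAt_ψ t).sub (hasDerivAt_id t)).hasDerivWithinAt) h
    (left_mem_Icc.2 hT.le) (right_mem_Icc.2 hT.le)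
  simp only [S.ψ_zero, sub_zero, Real.norm_eq_abs] at h1
  have h2 : S.ψ T / T - 1 = (S.ψ T - T) / T := by field_simp
  rw [h2, abs_div, div_le_iff₀ (abs_pos.2 hT.ne')]
  exact h1

end Speed

/-! ### Curves in `L²` -/

variable {T : ℝ}

theorem atTime_of_mem (u : C0L2 T) {t : ℝ} (ht : t ∈ Icc 0 T) : atTime u t = u ⟨t, ht⟩ :=
  dif_pos ht

theorem continuousOn_atTime (u : C0L2 T) : ContinuousOn (atTime u) (Icc 0 T) := by
  rw [continuousOn_iff_continuous_domRestrict]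
  refine u.continuous.congr fun t => ?_
  rw [domRestrict_apply, atTime_of_mem u t.2]

/-- A curve extended by constants outside `[0, T]`. -/
theorem exists_extend (hT : 0 < T) {f : ℝ → L2} (hf : ContinuousOn f (Icc 0 T)) :
    ∃ F : ℝ → L2, Continuous F ∧ EqOn F f (Icc 0 T) :=
  ⟨fun t => f (clampT T t), hf.comp_continuous (continuous_clampT T) (clampT_mem hT),
    fun t ht => by simp only [clampT_of_mem ht]⟩

theorem continuousOn_of_continuous (hT : 0 < T) {A : ℝ → L2 → L2}
    (hA : ∀ f : ℝ → L2, Continuous f → Continuous fun t => A t (f t)) {f : ℝ → L2}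
    (hf : ContinuousOn f (Icc 0 T)) : ContinuousOn (fun t => A t (f t)) (Icc 0 T) := by
  obtain ⟨F, hF, hFf⟩ := exists_extend hT hf
  exact (hA F hF).continuousOn.congr fun t ht => by simp only [hFf ht]

theorem exists_norm_le {f : ℝ → L2} (hf : ContinuousOn f (Icc 0 T)) :
    ∃ B : ℝ, 0 ≤ B ∧ ∀ t ∈ Icc 0 T, ‖f t‖ ≤ B := by
  obtain ⟨B, hB⟩ := isCompact_Icc.exists_bound_of_continuousOn hf
  exact ⟨max B 0, le_max_right _ _, fun t ht => (hB t ht).trans (le_max_left _ _)⟩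

theorem tendsto_sobolev {s : ℝ} {f : ℝ → Torus → ℝ} {t : ℝ} {p : ℝ → ℝ}
    (h0 : Tendsto p (𝓝[Icc 0 T] t) (𝓝 0))
    (h : ∀ τ ∈ Icc 0 T, sobolevNorm s (fun x => f τ x - f t x) ≤ ENNReal.ofReal (p τ)) :
    Tendsto (fun τ => sobolevNorm s (fun x => f τ x - f t x)) (𝓝[Icc 0 T] t) (𝓝 0) := by
  have h1 := ENNReal.tendsto_ofReal h0
  rw [ENNReal.ofReal_zero] at h1
  refine tendsto_of_tendsto_of_tendsto_of_le_of_le' tendsto_const_nhds h1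
    (Eventually.of_forall fun _ => zero_le) ?_
  filter_upwards [self_mem_nhdsWithin] with τ hτ using h τ hτ

theorem memLp_continuous (F : C(Torus, ℝ)) : MemLp F 2 dx := by
  refine MemLp.of_bound F.continuous.aestronglyMeasurable ‖F‖ (Eventually.of_forall fun x => ?_)
  exact F.norm_coe_le_norm x

theorem coeff_cl_ofR_sub (F G : C(Torus, ℝ)) (k : ℤ) :
    coeff (cl (ofR F) - cl (ofR G)) k = realCoeff (fun x => F x - G x) k := by
  rw [coeff_sub, coeff_cl, coeff_cl, fourierCoeff_ofR, fourierCoeff_ofR]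
  exact (realCoeff_sub F G k).symm

theorem contH_one_of_curve {F : ℝ → C(Torus, ℝ)} {F' : ℝ → L2}
    (h0 : Continuous fun t => cl (ofR (F t))) (h1 : Continuous F')
    (hw : ∀ t, WD (cl (ofR (F t))) (F' t)) : ContH T 1 fun t => F t := by
  refine ⟨fun t _ => ⟨memLp_continuous _, (sobolevNorm_one_le (fun k => by
    rw [coeff_cl, fourierCoeff_ofR]) (hw t)).trans_lt ENNReal.ofReal_lt_top⟩, fun t _ => ?_⟩
  have hp : Tendsto (fun τ => ‖cl (ofR (F τ)) - cl (ofR (F t))‖ + ‖F' τ - F' t‖) (𝓝 t) (𝓝 0) := by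
    have : Continuous fun τ => ‖cl (ofR (F τ)) - cl (ofR (F t))‖ + ‖F' τ - F' t‖ := by fun_prop
    simpa using this.tendsto t
  exact tendsto_sobolev (hp.mono_left nhdsWithin_le_nhds) fun τ _ =>
    sobolevNorm_one_le (coeff_cl_ofR_sub _ _) ((hw τ).sub (hw t))

theorem contH_two_of_curve {F : ℝ → C(Torus, ℝ)} {F' F'' : ℝ → L2}
    (h0 : Continuous fun t => cl (ofR (F t))) (h1 : Continuous F') (h2 : Continuous F'')
    (hw : ∀ t, WD (cl (ofR (F t))) (F' t)) (hw' : ∀ t, WD (F' t) (F'' t)) :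
    ContH T 2 fun t => F t := by
  refine ⟨fun t _ => ⟨memLp_continuous _, (sobolevNorm_two_le (fun k => by
    rw [coeff_cl, fourierCoeff_ofR]) (hw t) (hw' t)).trans_lt ENNReal.ofReal_lt_top⟩, fun t _ => ?_⟩
  have hp : Tendsto (fun τ => 2 * (‖cl (ofR (F τ)) - cl (ofR (F t))‖ + ‖F' τ - F' t‖ +
      ‖F'' τ - F'' t‖)) (𝓝 t) (𝓝 0) := by
    have : Continuous fun τ => 2 * (‖cl (ofR (F τ)) - cl (ofR (F t))‖ + ‖F' τ - F' t‖ +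
      ‖F'' τ - F'' t‖) := by fun_prop
    simpa using this.tendsto t
  exact tendsto_sobolev (hp.mono_left nhdsWithin_le_nhds) fun τ _ =>
    sobolevNorm_two_le (coeff_cl_ofR_sub _ _) ((hw τ).sub (hw t)) ((hw' τ).sub (hw' t))

/-! ### The change of variables of the plane -/

namespace Flow

variable (Q : Flow T)

/-- The inverse changes of variables depend continuously on time. -/
theorem continuousOn_φ :
    ContinuousOn (fun q : ℝ × Torus => (Q.D q.1).φ q.2) (Icc 0 T ×ˢ univ) := by
  let f : Icc (0 : ℝ) T × Torus → Icc (0 : ℝ) T × Torus := fun q => (q.1, (Q.D q.1).G q.2)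
  let e : Icc (0 : ℝ) T × Torus ≃ Icc (0 : ℝ) T × Torus :=
    { toFun := f
      invFun := fun q => (q.1, (Q.D q.1).φ q.2)
      left_inv := fun q => by simp [f, Diffeo.φ_G]
      right_inv := fun q => by simp [f, Diffeo.G_φ] }
  have hf : Continuous e := by
    have h1 : Continuous fun q : Icc (0 : ℝ) T × Torus => ((q.1 : ℝ), q.2) := by fun_prop
    have h2 : Continuous fun q : Icc (0 : ℝ) T × Torus => (((Q.D q.1).β q.2 : ℝ) : Torus) :=
      (AddCircle.continuous_mk' _).comp (Q.continuous_β.comp h1)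
    exact continuous_fst.prodMk (continuous_snd.add h2)
  have h := hf.homeoOfEquivCompactToT2.symm.continuous
  rw [continuousOn_iff_continuous_domRestrict]
  have h3 : Continuous fun q : (Icc 0 T ×ˢ univ : Set (ℝ × Torus)) =>
      ((⟨q.1.1, q.2.1⟩, q.1.2) : Icc (0 : ℝ) T × Torus) := by fun_prop
  exact continuous_snd.comp (h.comp h3)

theorem isSpaceDiffeo : IsSpaceDiffeo T fun t => (Q.D t).βinv := by
  have hφ := Q.continuousOn_φ
  have h1 : ContinuousOn (fun q : ℝ × Torus => (q.1, (Q.D q.1).φ q.2)) (Icc 0 T ×ˢ univ) :=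
    continuousOn_fst.prodMk hφ
  refine ⟨(Q.continuous_β.comp_continuousOn h1).neg, ?_, fun t _ x => ⟨?_, ?_⟩⟩
  · simp only [(Diffeo.hasTDeriv_βinv _).dX_eq]
    exact ((Q.continuous_d.comp_continuousOn h1).inv₀
      fun q _ => ((Q.D q.1).d_pos _).ne').sub continuousOn_const
  · exact ((Q.D t).hasTDeriv_βinv x).differentiableAt
  · simp only [(Diffeo.hasTDeriv_βinv _).dX_eq]
    have h2 := (Q.D t).d_ge ((Q.D t).φ x)
    have h3 := (Q.D t).d_le ((Q.D t).φ x)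
    have h4 : ((Q.D t).d ((Q.D t).φ x))⁻¹ ≤ 3 / 2 := by
      rw [inv_le_comm₀ (by linarith) (by norm_num)]; linarith
    have h5 : 1 / 2 ≤ ((Q.D t).d ((Q.D t).φ x))⁻¹ := by
      rw [le_inv_comm₀ (by norm_num) (by linarith)]; linarith
    rw [abs_le]; constructor <;> linarith

/-- The unitary operators, followed by a change of time. -/
def Φ (hT : 0 < T) (S : Speed) : C0L2 T ≃L[ℂ] C0L2 (S.ψ T) :=
  LinearEquiv.toContinuousLinearEquivOfBounds
    { toFun := fun u =>
        { toFun := fun t => (Q.D (S.ψinv t)).U.symm (u ⟨S.ψinv t, S.mapsTo_ψinv T t.2⟩)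
          continuous_toFun := by
            obtain ⟨F, hF, hFu⟩ := exists_extend hT (continuousOn_atTime u)
            have h := (Q.continuous_U_symm hF).comp (S.continuous_ψinv.comp
              (continuous_subtype_val (p := fun t => t ∈ Icc 0 (S.ψ T))))
            refine h.congr fun t => ?_
            have ht := S.mapsTo_ψinv T t.2
            simp only [Function.comp_apply, hFu ht, atTime_of_mem u ht] }
      map_add' := fun u v => by ext1 t; exact map_add (Q.D (S.ψinv t)).U.symm _ _
      map_smul' := fun a u => by ext1 t; exact map_smul (Q.D (S.ψinv t)).U.symm a _
      invFun := fun u =>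
        { toFun := fun t => (Q.D t).U (u ⟨S.ψ t, S.mapsTo_ψ T t.2⟩)
          continuous_toFun := by
            obtain ⟨F, hF, hFu⟩ := exists_extend (S.ψ_pos hT) (continuousOn_atTime u)
            have h := (Q.continuous_U (hF.comp S.continuous_ψ)).comp
              (continuous_subtype_val (p := fun t => t ∈ Icc 0 T))
            refine h.congr fun t => ?_
            have ht := S.mapsTo_ψ T t.2
            simp only [Function.comp_apply, hFu ht, atTime_of_mem u ht] }
      left_inv := fun u => by ext1 t; simp [S.ψinv_ψ]
      right_inv := fun u => by ext1 t; simp [S.ψ_ψinv] } 1 1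
    (fun u => (ContinuousMap.norm_le _ (by positivity)).2 fun t => by
      rw [one_mul]
      exact ((Q.D (S.ψinv t)).U.symm.norm_map _).le.trans (u.norm_coe_le_norm _))
    (fun u => (ContinuousMap.norm_le _ (by positivity)).2 fun t => by
      rw [one_mul]
      exact ((Q.D t).U.norm_map _).le.trans (u.norm_coe_le_norm _))

variable (hT : 0 < T) (S : Speed)

theorem atTime_Φ (u : C0L2 T) {t : ℝ} (ht : t ∈ Icc 0 (S.ψ T)) :
    atTime (Q.Φ hT S u) t = (Q.D (S.ψinv t)).U.symm (atTime u (S.ψinv t)) := by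
  rw [atTime_of_mem _ ht, atTime_of_mem _ (S.mapsTo_ψinv T ht)]; rfl

theorem atTime_Φ_symm (u : C0L2 (S.ψ T)) {t : ℝ} (ht : t ∈ Icc 0 T) :
    atTime ((Q.Φ hT S).symm u) t = (Q.D t).U (atTime u (S.ψ t)) := by
  rw [atTime_of_mem _ ht, atTime_of_mem _ (S.mapsTo_ψ T ht)]; rfl

theorem Φ_ae_eq (u : C0L2 T) {t : ℝ} (ht : t ∈ Icc 0 (S.ψ T)) :
    (atTime (Q.Φ hT S u) t : Torus → ℂ) =ᵐ[dx] translation (fun _ => 0) (timeChange S.ψinv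
      (spaceChange (fun t => (Q.D t).βinv) (fun s x => atTime u s x))) t := by
  rw [atTime_Φ Q hT S u ht, Diffeo.U_symm_apply]
  refine (WMap.coeFn_iso _ _).trans (Eventually.of_forall fun x => ?_)
  simp only [translation, timeChange, spaceChange, (Diffeo.hasTDeriv_βinv _).dX_eq,
    AddCircle.coe_zero, sub_zero, add_sub_cancel, ← Diffeo.φ_eq]
  rfl

theorem inner_Φ (u v : C0L2 T) {t : ℝ} (ht : t ∈ Icc 0 (S.ψ T)) :
    inner ℂ (atTime (Q.Φ hT S u) t) (atTime (Q.Φ hT S v) t) =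
      inner ℂ (atTime u (S.ψinv t)) (atTime v (S.ψinv t)) := by
  rw [atTime_Φ Q hT S u ht, atTime_Φ Q hT S v ht, LinearIsometryEquiv.inner_map_map]

end Flow

end

/-! ### The conjugation of the equation -/

namespace Coefs

variable {T : ℝ} (Q : Coefs T) (R : ℝ → L2 →L[ℝ] L2) (K : ℝ → L2 →L[ℂ] L2)

/-- The coefficient of the principal part, as the speed of a change of time. -/
def speed : Speed := ⟨Q.m, Q.continuous_m, fun t => by
  rw [one_div, inv_le_comm₀ (by norm_num) (Q.m_pos t)]; exact Q.inv_m_le t⟩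

/-- The remainder of order zero in the new variables, with the original time. -/
def R3 (t : ℝ) : L2 →L[ℝ] L2 := Q.toFlow.R3 (Q.m t) (Q.v t) (R t) (K t) t

theorem norm_R3_le (t : ℝ) : ‖Q.R3 R K t‖ ≤ 2 * (‖R t‖ + 15 * (embE * Q.size t)) + ‖K t‖ := by
  have h6 := Q.embE_mul_size_nonneg t
  refine ContinuousLinearMap.opNorm_le_bound _ (by positivity) fun h => ?_
  rw [R3, Flow.R3_apply]
  have h1 : ‖(Q.m t)⁻¹‖ ≤ 2 := by
    rw [norm_inv, Real.norm_of_nonneg (Q.m_pos t).le]; exact Q.inv_m_le t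
  have h2 := (R t).le_opNorm ((Q.toFlow.D t).U h)
  have h3 := norm_mulL_ofR_le (Q.abs_ρ_le t) ((Q.toFlow.D t).U h)
  rw [LinearIsometryEquiv.norm_map] at h2 h3
  refine (norm_add_le _ _).trans ?_
  rw [norm_smul, norm_smul, Complex.norm_I, one_mul, LinearIsometryEquiv.norm_map]
  calc _ ≤ 2 * (‖R t‖ * ‖h‖ + 15 * (embE * Q.size t) * ‖h‖) + ‖K t‖ * ‖h‖ := by
        gcongr
        · exact (norm_add_le _ _).trans (add_le_add h2 h3)
        · exact (K t).le_opNorm h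
    _ = _ := by ring

theorem R3_complexLinear {t : ℝ} (h : ∀ u, R t (Complex.I • u) = Complex.I • R t u) (u : L2) :
    Q.R3 R K t (Complex.I • u) = Complex.I • Q.R3 R K t u := by
  simp only [R3, Flow.R3_apply, map_smul, h, smul_add, map_add, smul_comm (Q.m t)⁻¹ Complex.I]

variable {R K}

theorem mapsC0L2_R3 (hT : 0 < T) (hR : MapsC0L2 T R)
    (hK : ∀ f : ℝ → L2, Continuous f → Continuous fun t => K t (f t)) :
    MapsC0L2 T (Q.R3 R K) := by
  intro u hu
  have hU := continuousOn_of_continuous hT (A := fun t => (Q.toFlow.D t).U)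
    (fun f hf => Q.toFlow.continuous_U hf) hu
  have h1 := hR _ hU
  have hd := Q.continuous_d
  have he := Q.continuous_e
  have hv := Q.continuous_v
  have hd₁ := Q.continuous_d₁
  have hdi := Q.continuous_dInv
  have hρ : Continuous fun t => Q.toFlow.ρ (Q.v t) t :=
    ((he.add (hv.mul hd₁)).mul hdi).const_smul (1 / 2 : ℝ)
  have h2 := continuousOn_of_continuous hT (A := fun t u => mulL (ofR (Q.toFlow.ρ (Q.v t) t)) u)
    (fun f hf => continuous_mulL hρ hf) hU
  have h3 := continuousOn_of_continuous hT (A := fun t => (Q.toFlow.D t).U.symm)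
    (fun f hf => Q.toFlow.continuous_U_symm hf) (h1.add h2)
  have h4 := continuousOn_of_continuous hT (A := fun t u => K t u) hK hu
  have h5 : Continuous fun t => (Q.m t)⁻¹ := Q.continuous_m.inv₀ fun t => (Q.m_pos t).ne'
  exact (h5.continuousOn.smul h3).add (h4.const_smul Complex.I)

/-- The equation in the original variables is equivalent to the equation in the new variables. -/
theorem eqP_iff {g b : ℝ} (hg : 0 < g) (hb : 0 < b) (hT : 0 < T) {c V : ℝ → Torus → ℝ}
    (hc : ∀ t ∈ Icc 0 T, (fun x => c t x - 1) =ᵐ[dx] Q.γ t)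
    (hV : ∀ t k, realCoeff (Q.v t) k = realCoeff (V (clampT T t)) k) (hR : MapsC0L2 T R)
    (hK : ∀ t u k, coeff (K t u) k = inner ℂ ((Q.toFlow.D t).qa hg hb k) ((Q.toFlow.D t).U u) -
      symbolL g b k * coeff u k)
    (u f : C0L2 T) (h : C0L2 (Q.speed.ψ T))
    (hf : ∀ t ∈ Icc 0 T, atTime f t = Q.m t • atTime ((Q.toFlow.Φ hT Q.speed).symm h) t) :
    EqP g b c V R u f ↔ EqP3 g b (fun t => Q.W (Q.speed.ψinv t))
      (fun t => Q.R3 R K (Q.speed.ψinv t)) (Q.toFlow.Φ hT Q.speed u) h := by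
  obtain ⟨B₁, hB₁, h1⟩ := exists_norm_le (continuousOn_atTime u)
  obtain ⟨B₂, hB₂, h2⟩ := exists_norm_le (continuousOn_atTime f)
  obtain ⟨B₃, hB₃, h3⟩ := exists_norm_le (hR _ (continuousOn_atTime u))
  obtain ⟨B₄, hB₄, h4⟩ := exists_norm_le (T := T) Q.continuous_v'.continuousOn
  obtain ⟨B₅, hB₅, h5⟩ := exists_norm_le (T := T)
    (cl.continuous.comp (Flow.continuous_ofR Q.continuous_v)).continuousOn
  have key := Q.toFlow.equation_iff (hg := hg) (hb := hb) (c := c) (V := V)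
    (W := fun t => Q.W t) (v := Q.v) (v' := Q.v') (m := Q.m) (fun t _ => Q.m_pos t) Q.WD_v
    (fun t ht k => by rw [hV, clampT_of_mem ht]) (fun t ht k => Q.realCoeff_c hc ht k)
    (fun t _ k => by
      have : ofR (Q.W t) = ((Q.m t)⁻¹ : ℝ) • ofR ((Q.toFlow.Z (Q.v t) t).comp (Q.toFlow.D t).φ) := by
        ext x; simp [W]
      rw [← fourierCoeff_ofR, this, ← coeff_cl, RCLike.real_smul_eq_coe_smul (K := ℂ), map_smul,
        coeff_smul, coeff_cl, fourierCoeff_ofR]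
      rfl) hK (R := R) (u := atTime u) (f := atTime f)
    (h₁ := fun t => atTime h (Q.speed.ψ t))
    (fun t ht => by rw [hf t ht, Flow.atTime_Φ_symm _ _ _ _ ht])
    (A := (1 / 16 + 1) + B₁ + B₂ + B₃ + B₄ + B₅) (by positivity)
    (fun t ht => (Q.wn_c_ne_top hc ht).trans (ENNReal.ofReal_le_ofReal (by linarith)))
    (continuousOn_atTime u) (fun t ht => (h1 t ht).trans (by linarith))
    (fun t ht => (h2 t ht).trans (by linarith)) (fun t ht => (h3 t ht).trans (by linarith))
    (fun t ht => (add_le_add (h4 t ht) (h5 t ht)).trans (by linarith))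
  rw [EqP, TimeEq, key, EqP3, TimeEq]
  have time : ∀ k, _ ↔ _ := fun k => Q.speed.hasDerivWithinAt_iff T
    (F := fun s => coeff ((Q.toFlow.D s).U.symm (atTime u s)) k)
    (X := fun t => coeff (atTime h (Q.speed.ψ t)) k -
      (opMul (Q.W t) (opDx (coeff ((Q.toFlow.D t).U.symm (atTime u t)))) k +
        Complex.I * opL g b (coeff ((Q.toFlow.D t).U.symm (atTime u t))) k +
        coeff (Q.R3 R K t ((Q.toFlow.D t).U.symm (atTime u t))) k))
  have congr : ∀ t ∈ Icc 0 (Q.speed.ψ T), ∀ k, ∀ X : ℂ,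
      HasDerivWithinAt (fun s => coeff ((Q.toFlow.D (Q.speed.ψinv s)).U.symm
        (atTime u (Q.speed.ψinv s))) k) X (Icc 0 (Q.speed.ψ T)) t ↔
      HasDerivWithinAt (fun s => coeff (atTime (Q.toFlow.Φ hT Q.speed u) s) k) X
        (Icc 0 (Q.speed.ψ T)) t := fun t ht k X =>
    ⟨fun h => h.congr (fun s hs => by rw [Flow.atTime_Φ _ _ _ _ hs])
      (by rw [Flow.atTime_Φ _ _ _ _ ht]),
    fun h => h.congr (fun s hs => by rw [Flow.atTime_Φ _ _ _ _ hs])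
      (by rw [Flow.atTime_Φ _ _ _ _ ht])⟩
  constructor
  · intro H t ht k
    have := (time k).1 (fun t ht => H t ht k) t ht
    rw [← congr t ht k, Flow.atTime_Φ _ _ _ _ ht]
    simp only [Speed.ψ_ψinv] at this
    exact this
  · intro H t ht k
    refine (time k).2 (fun t ht => ?_) t ht
    have := H t ht k
    rw [← congr t ht k, Flow.atTime_Φ _ _ _ _ ht] at this
    simp only [Speed.ψ_ψinv]
    exact this

end Coefs

/-! ### Estimates in the new variables -/

namespace Coefs

variable {T : ℝ} (Q : Coefs T) {c ct V : ℝ → Torus → ℝ}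

/-- The size of the change of variables is linear in the norm of `c - 1`, which makes the norm of the
remainder of order zero linear too. -/
theorem wn_seven_le (hT : 0 < T)
    (hγ : ∀ t k, realCoeff (Q.γ t) k = realCoeff (fun x => c (clampT T t) x - 1) k)
    (hc : ContH T 18 fun t x => c t x - 1) (t : ℝ) :
    wn 7 (realCoeff ((Q.toFlow.D t).d - 1 : C(Torus, ℝ))) ≤
      ENNReal.ofReal (4 * rpowC * wienerC 7) * normH T 18 fun t x => c t x - 1 := by
  have hr := rpowC_pos
  have hm := clampT_mem hT t
  have h1 : wn 7 (realCoeff (Q.γ t)) ≤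
      ENNReal.ofReal (wienerC 7) * normH T 18 fun t x => c t x - 1 := by
    rw [show realCoeff (Q.γ t) = realCoeff (fun x => c (clampT T t) x - 1) from funext (hγ t)]
    refine (wn_le_sobolevNorm 7 (s := 18) (by norm_num) (hc.1 _ hm).2).trans ?_
    gcongr
    exact sobolevNorm_le_normH (f := fun t x => c t x - 1) 18 hm
  refine (Q.wn_d_sub_one_le t 7).trans ?_
  calc _ ≤ ENNReal.ofReal 4 * (ENNReal.ofReal rpowC *
        (ENNReal.ofReal (wienerC 7) * normH T 18 fun t x => c t x - 1)) := by
        gcongr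
        exact (Q.wn_pw_sub_one t 7 (by norm_num)).trans (by gcongr)
    _ = _ := by
      rw [ENNReal.ofReal_mul (by positivity), ENNReal.ofReal_mul (by positivity)]
      ring

/-- The bound is trivial unless `V` has finite norm in `H²`. -/
theorem normH_W_le (hT : 0 < T)
    (hγt : ∀ t k, realCoeff (Q.γt t) k = realCoeff (ct (clampT T t)) k)
    (hv : ∀ t k, realCoeff (Q.v t) k = realCoeff (V (clampT T t)) k) {T₁ : ℝ} {ψinv : ℝ → ℝ}
    (hψ : MapsTo ψinv (Icc 0 T₁) (Icc 0 T)) :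
    normH T₁ 2 (fun t => Q.W (ψinv t)) ≤
      ENNReal.ofReal (4800 * embE ^ 2) * (normH T 2 V + normH T 1 ct) := by
  have hE := one_le_embE
  have hE2 : 1 ≤ embE ^ 2 := one_le_pow₀ hE
  refine iSup₂_le fun t ht => ?_
  set s := ψinv t
  have hs : s ∈ Icc 0 T := hψ ht
  -- `V` is not assumed to be in `H²`; if it is not, the right hand side is infinite
  rcases eq_or_ne (sobolevNorm 2 (V s)) ⊤ with htop | htop
  · have : normH T 2 V = ⊤ := top_le_iff.1 (htop ▸ sobolevNorm_le_normH 2 hs)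
    rw [this, top_add, ENNReal.mul_top (ENNReal.ofReal_pos.2 (by positivity)).ne']
    exact le_top
  have hk : ∀ k, coeff (cl (ofR (Q.v s))) k = realCoeff (V s) k := fun k => by
    rw [coeff_cl, fourierCoeff_ofR, hv, clampT_of_mem hs]
  obtain ⟨v'', hv''⟩ := exists_WD_two htop.lt_top hk (Q.WD_v s)
  have h1 := le_sobolevNorm_two hk (Q.WD_v s) hv''
  have h2 := Q.norm_cl_W_le s
  have h3 := Q.norm_W'_le s
  have h4 := Q.norm_W''_le s (v'' := v'')
  have h5 := Q.ofReal_size_le hT hγt hv s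
  have h6 := Q.size_nonneg s
  have h7 : normH T 1 V ≤ normH T 2 V :=
    iSup₂_mono fun t _ => sobolevNorm_mono (by norm_num) _
  have h8 : embE * (embE * Q.size s) = embE ^ 2 * Q.size s := by ring
  have h9 : ‖v''‖ ≤ embE ^ 2 * ‖v''‖ := le_mul_of_one_le_left (norm_nonneg _) hE2
  have h10 : 0 ≤ embE ^ 2 * Q.size s := by positivity
  calc sobolevNorm 2 (Q.W s)
      ≤ ENNReal.ofReal (2 * (‖cl (ofR (Q.W s))‖ + ‖Q.W' s‖ + ‖Q.W'' s v''‖)) :=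
        sobolevNorm_two_le (fun k => by rw [coeff_cl, fourierCoeff_ofR]) (Q.WD_W s)
          (Q.WD_W' s hv'')
    _ ≤ ENNReal.ofReal (1600 * embE ^ 2 * (Q.size s + ‖v''‖)) := by
        refine ENNReal.ofReal_le_ofReal ?_
        rw [h8] at h2 h3 h4
        linarith [norm_nonneg v'']
    _ = ENNReal.ofReal (1600 * embE ^ 2) * (ENNReal.ofReal (Q.size s) + ENNReal.ofReal ‖v''‖) := by
        rw [ENNReal.ofReal_mul (by positivity), ENNReal.ofReal_add h6 (norm_nonneg _)]
    _ ≤ ENNReal.ofReal (1600 * embE ^ 2) * (ENNReal.ofReal 2 * (normH T 2 V + normH T 1 ct) +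
          (normH T 2 V + normH T 1 ct)) := by
        gcongr
        · exact h5.trans (by gcongr)
        · exact (h1.trans (sobolevNorm_le_normH 2 hs)).trans le_self_add
    _ = _ := by
        have : (4800 : ℝ) * embE ^ 2 = 1600 * embE ^ 2 * (2 + 1) := by ring
        rw [this, ENNReal.ofReal_mul (p := 1600 * embE ^ 2) (by positivity),
          ENNReal.ofReal_add (by norm_num) (by norm_num),
          ENNReal.ofReal_one, mul_assoc, add_mul, one_mul]

theorem normOp_R3_le (hT : 0 < T)
    (hγt : ∀ t k, realCoeff (Q.γt t) k = realCoeff (ct (clampT T t)) k)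
    (hv : ∀ t k, realCoeff (Q.v t) k = realCoeff (V (clampT T t)) k)
    {R : ℝ → L2 →L[ℝ] L2} {K : ℝ → L2 →L[ℂ] L2} {M : ℝ≥0∞} (hK : ∀ t, ‖K t‖ₑ ≤ M)
    {T₁ : ℝ} {ψinv : ℝ → ℝ} (hψ : MapsTo ψinv (Icc 0 T₁) (Icc 0 T)) :
    normOp T₁ (fun t => Q.R3 R K (ψinv t)) ≤
      ENNReal.ofReal (60 * embE) * (normH T 1 V + normH T 1 ct + normOp T R) + M := by
  have hE := one_le_embE
  refine iSup₂_le fun t ht => ?_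
  set s := ψinv t
  have hs : s ∈ Icc 0 T := hψ ht
  have h0 : ‖R s‖ₑ ≤ normOp T R := le_iSup₂ (f := fun t (_ : t ∈ Icc 0 T) => ‖R t‖ₑ) s hs
  have h1 := Q.norm_R3_le R K s
  have h5 := Q.ofReal_size_le hT hγt hv s
  have h6 := Q.size_nonneg s
  calc ‖Q.R3 R K s‖ₑ ≤ ENNReal.ofReal (2 * (‖R s‖ + 15 * (embE * Q.size s)) + ‖K s‖) := by
        rw [← ofReal_norm]; exact ENNReal.ofReal_le_ofReal h1
    _ = ENNReal.ofReal 2 * ‖R s‖ₑ + ENNReal.ofReal (30 * embE) * ENNReal.ofReal (Q.size s) +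
        ‖K s‖ₑ := by
        rw [← ofReal_norm (R s), ← ofReal_norm (K s), ← ENNReal.ofReal_mul (by positivity),
          ← ENNReal.ofReal_mul (by positivity), ← ENNReal.ofReal_add (by positivity) (by positivity),
          ← ENNReal.ofReal_add (by positivity) (by positivity)]
        congr 1; ring
    _ ≤ ENNReal.ofReal (60 * embE) * normOp T R +
        ENNReal.ofReal (30 * embE) * (ENNReal.ofReal 2 * (normH T 1 V + normH T 1 ct)) + M := by
        gcongr
        · linarith
        · exact hK s
    _ = _ := by
        rw [← mul_assoc, ← ENNReal.ofReal_mul (by positivity),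
          show 30 * embE * 2 = 60 * embE by ring, ← mul_add, add_comm (normOp T R)]

end Coefs

end WaterWave

end

theorem proposition5p1 (g b : ℝ) (hg : 0 < g) (hb : 0 < b) :
    ∃ δ₀ r C : ℝ, 0 < δ₀ ∧ δ₀ < 1 ∧ 2 ≤ r ∧ 0 < C ∧
    ∀ (T : ℝ), 0 < T →
    ∀ (c ct V : ℝ → Torus → ℝ) (R₂ : ℝ → L2 →L[ℝ] L2),
      ContH T r (fun t x => c t x - 1) → IsTimeDeriv T c ct → ContH T 1 ct → ContH T 1 V →
      MapsC0L2 T R₂ →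
      normLinfty T (fun t x => c t x - 1) < ENNReal.ofReal δ₀ →
      sizeN0 T r c ct V R₂ ≤ 1 →
    ∃ (T₁ : ℝ) (Φ : C0L2 T ≃L[ℂ] C0L2 T₁) (m : ℝ → ℝ) (W : ℝ → Torus → ℝ)
      (R₃ : ℝ → L2 →L[ℝ] L2) (β : ℝ → Torus → ℝ) (ψ ψinv p : ℝ → ℝ),
      0 < T₁ ∧
      -- the conjugation `P̃ u = m Φ⁻¹ (P̃₃ (Φ u))`
      (∀ (u f : C0L2 T) (g₁ : C0L2 T₁),
        (∀ t ∈ Set.Icc 0 T, atTime f t = m t • atTime (Φ.symm g₁) t) →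
        (EqP g b c V R₂ u f ↔ EqP3 g b W R₃ (Φ u) g₁)) ∧
      -- the function `W`
      ContH T₁ 1 W ∧
      (∀ t ∈ Set.Icc 0 T₁, ∫ x, W t x ∂dx = 0) ∧
      (ContH T 2 V → ContH T₁ 2 W) ∧
      normH T₁ 2 W ≤ ENNReal.ofReal C *
        (normH T 2 (fun t x => c t x - 1) + normH T 2 V + normH T 1 ct) ∧
      -- the operator `R₃`
      MapsC0L2 T₁ R₃ ∧
      normOp T₁ R₃ ≤ ENNReal.ofReal C * sizeN0 T r c ct V R₂ ∧
      (IsComplexLinear T R₂ → IsComplexLinear T₁ R₃) ∧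
      -- the time `T₁` and the function `m`
      ENNReal.ofReal |T₁ / T - 1| + normC0 T (fun t => m t - 1)
        ≤ ENNReal.ofReal C * normLinfty T (fun t x => c t x - 1) ∧
      -- the three local transformations, `Φ = φ_*⁻¹ ψ_*⁻¹ Ψ₁`, which preserve the scalar product
      IsSpaceDiffeo T β ∧
      IsTimeDiffeo T T₁ ψ ψinv m ∧
      ContDiffOn ℝ 1 p (Set.Icc 0 T₁) ∧
      (∀ u : C0L2 T, ∀ t ∈ Set.Icc 0 T₁,
        (atTime (Φ u) t : Torus → ℂ) =ᵐ[dx]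
          translation p (timeChange ψinv (spaceChange β (fun s x => atTime u s x))) t) ∧
      (∀ u v : C0L2 T, ∀ t ∈ Set.Icc 0 T₁,
        inner ℂ (atTime (Φ u) t) (atTime (Φ v) t)
          = inner ℂ (atTime u (ψinv t)) (atTime v (ψinv t))) := by
  obtain ⟨CK, hCK, conj⟩ := exists_conj_curve hg hb
  have hE := Coefs.one_le_embE
  have hr := rpowC_pos
  have hw := wienerC_nonneg 7
  set C₀ : ℝ := CK * (4 * rpowC * wienerC 7) with hC₀
  have hC₀0 : 0 ≤ C₀ := by positivity
  set C : ℝ := 2 + 4800 * Coefs.embE ^ 2 + 60 * Coefs.embE + C₀ with hC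
  have hE2 : 0 ≤ Coefs.embE ^ 2 := sq_nonneg _
  -- `18 = 2 (8 + 1)` is the order at which `wn_le_of_interpolation` controls the norm `wn 8`
  refine ⟨delta0, 18, C, delta0_pos, delta0_lt_one, by norm_num, by positivity, ?_⟩
  intro T hT c ct V R₂ hc hct hct1 hV hR hδ hN
  have hN1 : normH T 18 (fun t x => c t x - 1) ≤ 1 := by
    refine le_trans ?_ hN
    rw [sizeN0, add_assoc, add_assoc]
    exact le_self_add
  obtain ⟨Q, kγ, aγ, kγt, kv⟩ := exists_coefs hT hc hct hct1 hV hδ hN1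
  -- the remainder of the conjugation of the principal part
  set x : ℝ≥0∞ := normH T 18 (fun t x => c t x - 1) with hx
  have hxt : x ≠ ⊤ := (hN1.trans_lt ENNReal.one_lt_top).ne
  obtain ⟨K, hK1, hK2, hK3⟩ := conj T Q.toFlow (4 * rpowC * wienerC 7 * x.toReal)
    (by positivity) (fun t => (Q.wn_seven_le hT kγ hc t).trans (le_of_eq (by
      rw [ENNReal.ofReal_mul (p := 4 * rpowC * wienerC 7) (by positivity),
        ENNReal.ofReal_toReal hxt])))
  have hKx : ∀ t, ‖K t‖ₑ ≤ ENNReal.ofReal C₀ * x := fun t => by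
    rw [← ENNReal.ofReal_toReal hxt, ← ENNReal.ofReal_mul hC₀0, ← ofReal_norm]
    exact ENNReal.ofReal_le_ofReal ((hK1 t).trans (le_of_eq (by rw [hC₀]; ring)))
  have hψ := Q.speed.mapsTo_ψinv T
  have hψc := Q.speed.continuous_ψinv
  -- the translation is part of the displacement, hence `p = 0`
  refine ⟨Q.speed.ψ T, Q.toFlow.Φ hT Q.speed, Q.m, fun t => Q.W (Q.speed.ψinv t),
    fun t => Q.R3 R₂ K (Q.speed.ψinv t), fun t => (Q.toFlow.D t).βinv, Q.speed.ψ, Q.speed.ψinv,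
    fun _ => 0, Q.speed.ψ_pos hT, fun u f h hf => Q.eqP_iff hg hb hT aγ kv hR hK3 u f h hf,
    contH_one_of_curve (Q.continuous_cl_W.comp hψc) (Q.continuous_W'.comp hψc)
      (fun t => Q.WD_W _), fun t _ => Q.mean_W _, fun hV2 => ?_, ?_, ?_, ?_, ?_, ?_,
    Q.toFlow.isSpaceDiffeo, Q.speed.isTimeDiffeo T, contDiffOn_const,
    fun u t ht => Q.toFlow.Φ_ae_eq hT Q.speed u ht,
    fun u v t ht => Q.toFlow.inner_Φ hT Q.speed u v ht⟩
  · obtain ⟨v'', cv'', wv''⟩ := exists_curve_two hT hV2 Q.WD_v kv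
    exact contH_two_of_curve (Q.continuous_cl_W.comp hψc) (Q.continuous_W'.comp hψc)
      ((Q.continuous_W'' cv'').comp hψc) (fun t => Q.WD_W _) fun t => Q.WD_W' _ (wv'' _)
  · refine (Q.normH_W_le hT kγt kv hψ).trans ?_
    gcongr
    · rw [hC]; linarith
    · exact le_add_self
  · intro u hu
    have h1 := Q.mapsC0L2_R3 hT hR hK2 (fun s => u (Q.speed.ψ s))
      (hu.comp Q.speed.continuous_ψ.continuousOn (Q.speed.mapsTo_ψ T))
    have h2 := h1.comp hψc.continuousOn hψ
    refine h2.congr fun t _ => ?_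
    simp only [Function.comp_apply, Speed.ψ_ψinv]
  · refine (Q.normOp_R3_le hT kγt kv hKx hψ).trans ?_
    rw [sizeN0, ← hx]
    calc _ ≤ ENNReal.ofReal C * (normH T 1 V + normH T 1 ct + normOp T R₂) +
          ENNReal.ofReal C * x := by
          gcongr
          · rw [hC]; linarith
          · rw [hC]; linarith
      _ = _ := by ring
  · intro h t ht v
    exact Q.R3_complexLinear R₂ K (h _ (hψ ht)) v
  · set y : ℝ≥0∞ := normLinfty T (fun t x => c t x - 1) with hy
    have hyt : y ≠ ⊤ := (hδ.trans ENNReal.ofReal_lt_top).ne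
    have hy1 : y.toReal < 1 := by
      refine lt_trans ?_ delta0_lt_one
      exact (ENNReal.lt_ofReal_iff_toReal_lt hyt).1 hδ
    have hm : ∀ t ∈ Set.Icc 0 T, |Q.m t - 1| ≤ y.toReal := fun t ht =>
      Q.abs_m_sub_one_le t hy1 fun z => by
        refine (ENNReal.ofReal_le_ofReal_iff ENNReal.toReal_nonneg).1 ?_
        rw [ENNReal.ofReal_toReal hyt]
        exact (ofReal_le_eLpNorm_top (aγ t ht) z).trans
          (le_iSup₂ (f := fun t (_ : t ∈ Set.Icc 0 T) => eLpNorm (fun x => c t x - 1) ⊤ dx) t ht)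
    have h1 : ENNReal.ofReal |Q.speed.ψ T / T - 1| ≤ y := by
      rw [← ENNReal.ofReal_toReal hyt]
      exact ENNReal.ofReal_le_ofReal (Q.speed.abs_ψ_div_sub_one_le hT hm)
    have h2 : normC0 T (fun t => Q.m t - 1) ≤ y := iSup₂_le fun t ht => by
      rw [← ofReal_norm, ← ENNReal.ofReal_toReal hyt]
      exact ENNReal.ofReal_le_ofReal (hm t ht)
    calc _ ≤ y + y := add_le_add h1 h2
      _ = ENNReal.ofReal 2 * y := by rw [← two_mul]; norm_num
      _ ≤ _ := by
        gcongr
        rw [hC]; linarith
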